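/- For a real number $\alpha$ and an integer $Q\ge 1$, arrange the $Q$ fractional parts $\{n\alpha\}$, $0\le n<Q$, in increasing order on $[0,1]$ with $0$ and $1$ identified, so that they determine $Q$ consecutive gaps in cyclic order. For $\lambda_1,\lambda_2\ge 0$, $\beta\in\mathbb{R}$ and $\eta>0$ let $$g_2^{\beta,\eta}(\lambda_1,\lambda_2;Q)=\frac1\eta\int_\beta^{\beta+\eta}\frac{\#\{(\gamma_1,\gamma_2)\ \text{cyclically consecutive gaps}:\ \gamma_1\ge\lambda_1/Q,\ \gamma_2\ge\lambda_2/Q\}}{Q}\,d\alpha ,$$ where the pairs of cyclically consecutive gaps are counted with multiplicity ($Q$ pairs in all). Let $\operatorname{Li}_2(z)=\sum_{n\ge1}z^n/n^2$ for $|z|\le 1$. **Theorem.** For all $\lambda_1,\lambda_2\ge0$ the limit $g_2(\lambda_1,\lambda_2)=\lim_{Q\to\infty}g_2^{\beta,\eta}(\lambda_1,\lambda_2;Q)$ exists and does not depend on $\beta\in\mathbb{R}$ and $\eta>0$; it satisfies $g_2(\lambda_1,\lambda_2)=g_2(\lambda_2,\lambda_1)$; and it is given for $\lambda_1\ge\lambda_2$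 by the following formulas, where $a=\lambda_1$, $b=\lambda_2$. (A) If $0\le b\le a$ and $a+b\le 1$: $\frac{\pi^2}{6}g_2=\frac{\pi^2}{6}-a-\frac b2$. (B) If $b\le a<1$ and $a+b\ge 1$: $$\begin{aligned}\tfrac{\pi^2}{6}g_2={}&\tfrac{\pi^2}{6}-2+a+\tfrac{3b}{2}-2\operatorname{Li}_2(a)+2\operatorname{Li}_2(1-b)+\left(\tfrac1b+\tfrac1a\right)\log(a+b)\\&+\left(\tfrac1a-a\right)\log\tfrac{1-a}{b}+\log\tfrac{1-b}{a}\left(-b+\tfrac1b+2\log b\right).\end{aligned}$$ (C) If $b>0$, $a>1$ and $a+b\le 2$: $$\begin{aligned}\tfrac{\pi^2}{6}g_2={}&\tfrac{3b}{2}-\tfrac{\pi^2}{3}-1+\log^2 2+\left(\tfrac2a-2a\right)\log(a-1)+\left(\tfrac a2-\tfrac2a\right)\log(2-a)+\left(\tfrac a2-\tfrac2b\right)\log a\\&+\left(\tfrac1b+\tfrac1a\right)\log(a+b)+\left(a-b+\tfrac1b-\tfrac1a\right)\log(a-b)+\log^2 a+(b-2\log(2b))\log a\\&+(2\log(a-b)-2\log(1-b))\log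 b+2\operatorname{Li}_2\left(\tfrac1a\right)+2\operatorname{Li}_2\left(\tfrac a2\right)-2\operatorname{Li}_2(b)\\&+2\operatorname{Li}_2\left(\tfrac{b-1}{b-a}\right)-2\operatorname{Li}_2\left(\tfrac{a(b-1)}{b-a}\right).\end{aligned}$$ (D) If $a<2$, $b<1$ and $a+b\ge 2$: $$\begin{aligned}\tfrac{\pi^2}{6}g_2={}&-\tfrac{5\pi^2}{6}-\tfrac a2+b+\left(-a+b+\tfrac2a\right)\log2+\left(\tfrac3a-3a\right)\log(a-1)+\left(\tfrac2a-\tfrac a2-2\log2\right)\log b\\&+\left(a-\tfrac4a\right)\log(2-a)+2\left(a-b+\tfrac1b-\tfrac1a\right)\log(a-b)+\left(\tfrac a2+b-\tfrac2b\right)\log a+\left(b-\tfrac1b\right)\log(1-b)\\&+\log^2a-2\log(2-a+b)\log a+2\log(a-b)\log b+2\log2\log(2-a+b)\\&+4\operatorname{Li}_2\left(\tfrac1a\right)+2\operatorname{Li}_2\left(\tfrac a2\right)+2\operatorname{Li}_2(1-b)+2\operatorname{Li}_2(b)-2\operatorname{Li}_2\left(\tfrac{2b}{a(2-a+b)}\right)\\&+2\operatorname{Li}_2\left(\tfrac{b-1}{b-a}\right)+2\operatorname{Li}_2\left(\tfrac{b}{2-a+b}\right)-2\operatorname{Li}_2\left(\tfrac{2-a+b}{2}\right)-2\operatorname{Li}_2\left(\tfrac{a-ab}{a-b}\right).\end{aligned}$$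 (E) If $1<b\le a<2$: $$\begin{aligned}\tfrac{\pi^2}{6}g_2={}&\tfrac16(-3a-2\pi^2+6)+\left(-a+b+\tfrac2a\right)\log2-\log^22+\log^2a\\&+\left(\tfrac a2-b+\tfrac1b-\tfrac2a+2\log2\right)\log(2b-a)+\left(\tfrac1a-a\right)\log(a-1)+\left(\tfrac a2-\tfrac2a\right)\log(2-a)\\&+\left(\tfrac a2-\tfrac1b\right)\log a+\left(b-\tfrac1b\right)\log(b-1)+2\log2\,(\log(2-a+b)-\log(1-a+b))\\&+\log b\left(-\tfrac a2+\tfrac2a-2\log2\right)+(2\log b+2\log(1-a+b))\log a-(2\log(2-a+b)+2\log(2b-a))\log a\\&+2\operatorname{Li}_2\left(\tfrac1a\right)+2\operatorname{Li}_2\left(\tfrac a2\right)-2\operatorname{Li}_2\left(\tfrac{a-2b}{2(a-b-1)}\right)+2\operatorname{Li}_2\left(\tfrac{a-2b}{a(a-b-1)}\right)\\&-2\operatorname{Li}_2\left(\tfrac{a-b-1}{a-2b}\right)-2\operatorname{Li}_2\left(-\tfrac{2b}{a(a-b-2)}\right)+2\operatorname{Li}_2\left(\tfrac{(a-b-1)b}{a-2b}\right)\\&+2\operatorname{Li}_2\left(\tfrac{b}{2-a+b}\right)-2\operatorname{Li}_2\left(\tfrac{2-a+b}{2}\right).\end{aligned}$$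 (F) If $0<b<1$ and $a>2$: $$\begin{aligned}\tfrac{\pi^2}{6}g_2={}&b-\tfrac{\pi^2}{2}-1+\log^22+2\log2\log(a-b-1)+\left(\tfrac2a-2a\right)\log(a-1)+\left(\tfrac a2-\tfrac2a\right)\log(a-2)\\&+2\left(a-b+\tfrac1b-\tfrac1a\right)\log(a-b)+\left(b-\tfrac1b\right)\log a\\&+\log(a-2b)\left(-\tfrac a2+b-\tfrac1b+\tfrac2a-2\log2\right)\\&+2\log a\,(\log(a-2b)-\log(a-b-1)-\log b)+2\log(a-b)\log b\\&+2\operatorname{Li}_2\left(\tfrac1a\right)+2\operatorname{Li}_2(1-b)+2\operatorname{Li}_2\left(\tfrac{a-2b}{2(a-b-1)}\right)-2\operatorname{Li}_2\left(\tfrac{a-2b}{a(a-b-1)}\right)\\&+2\operatorname{Li}_2\left(\tfrac{a-b-1}{a-2b}\right)+2\operatorname{Li}_2(b)-2\operatorname{Li}_2\left(\tfrac{(a-b-1)b}{a-2b}\right)\\&+2\operatorname{Li}_2\left(\tfrac{b-1}{b-a}\right)-2\operatorname{Li}_2\left(\tfrac{a-ab}{a-b}\right).\end{aligned}$$ (G)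 If $1\le b\le a$ and $a\ge 2$: $g_2=0$. In particular, for $\lambda_1,\lambda_2\ge0$ with $\lambda_1+\lambda_2<1$, in either order, $g_2(\lambda_1,\lambda_2)=1-\frac{6}{\pi^2}\max(\lambda_1,\lambda_2)-\frac{3}{\pi^2}\min(\lambda_1,\lambda_2)$. For $\lambda_1<\lambda_2$ the values on the remaining regions follow from the symmetry. -/

import Mathlib

open Filter Topology

noncomputable section

namespace GapDistribution

/-- The permutation `σ` of `{0, …, Q - 1}` for which `{σ₀ α} ≤ {σ₁ α} ≤ … ≤ {σ_{Q-1} α}`. -/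
def sigma (Q : ℕ) (α : ℝ) : Equiv.Perm (Fin Q) :=
  Tuple.sort fun n : Fin Q => Int.fract (((n : ℕ) : ℝ) * α)

/-- The `i`-th element `{σ_i α}` of the fractional parts `{n α}`, `0 ≤ n < Q`, taken in
increasing order. -/
def point (Q : ℕ) (α : ℝ) (i : Fin Q) : ℝ :=
  Int.fract (((sigma Q α i : ℕ) : ℝ) * α)

/-- The `i`-th gap. As `0` and `1` are identified and `{σ₀ α} = 0`, the gap to the right of
the last point is the one that ends at `1`, so that there are exactly `Q` gaps. -/
def gap (Q : ℕ) (α : ℝ) (i : Fin Q) : ℝ :=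
  if h : (i : ℕ) + 1 < Q then point Q α ⟨(i : ℕ) + 1, h⟩ - point Q α i
  else 1 - point Q α i

/-- The number of pairs of consecutive gaps `(γ₁, γ₂)` (wrapping around `0`, so that there are
`Q` pairs in all) with `γ₁ ≥ l₁ / Q` and `γ₂ ≥ l₂ / Q`. -/
def pairCount (Q : ℕ) (l₁ l₂ α : ℝ) : ℕ :=
  (Finset.univ.filter fun i : Fin Q =>
    l₁ / (Q : ℝ) ≤ gap Q α i ∧ l₂ / (Q : ℝ) ≤ gap Q α (finRotate Q i)).card

/-- The average over `α ∈ [β, β + η]` of the proportion of pairs of consecutive gaps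
`(γ₁, γ₂)` with `γ₁ ≥ l₁ / Q` and `γ₂ ≥ l₂ / Q`. -/
def pairAverage (β η l₁ l₂ : ℝ) (Q : ℕ) : ℝ :=
  1 / η * ∫ α in β..(β + η), (pairCount Q l₁ l₂ α : ℝ) / (Q : ℝ)

/-- The dilogarithm `Li₂(z) = ∑_{n ≥ 1} zⁿ / n²`, for `|z| ≤ 1`. -/
def Li₂ (z : ℝ) : ℝ := ∑' n : ℕ, z ^ (n + 1) / ((n : ℝ) + 1) ^ 2

open Real in
/-- The value of `(π² / 6) g₂` on region `A`. -/
def formulaA (l₁ l₂ : ℝ) : ℝ := π ^ 2 / 6 - l₁ - l₂ / 2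

open Real in
/-- The value of `(π² / 6) g₂` on region `B`. -/
def formulaB (l₁ l₂ : ℝ) : ℝ :=
  π ^ 2 / 6 - 2 + l₁ + 3 * l₂ / 2 - 2 * Li₂ l₁ + 2 * Li₂ (1 - l₂)
    + (1 / l₂ + 1 / l₁) * log (l₁ + l₂)
    + (1 / l₁ - l₁) * log ((1 - l₁) / l₂)
    + log ((1 - l₂) / l₁) * (-l₂ + 1 / l₂ + 2 * log l₂)

open Real in
/-- The value of `(π² / 6) g₂` on region `C`. -/
def formulaC (l₁ l₂ : ℝ) : ℝ :=
  3 * l₂ / 2 - π ^ 2 / 3 - 1 + log 2 ^ 2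
    + (2 / l₁ - 2 * l₁) * log (l₁ - 1)
    + (l₁ / 2 - 2 / l₁) * log (2 - l₁)
    + (l₁ / 2 - 2 / l₂) * log l₁
    + (1 / l₂ + 1 / l₁) * log (l₁ + l₂)
    + (l₁ - l₂ + 1 / l₂ - 1 / l₁) * log (l₁ - l₂)
    + log l₁ ^ 2
    + (l₂ - 2 * log (2 * l₂)) * log l₁
    + (2 * log (l₁ - l₂) - 2 * log (1 - l₂)) * log l₂
    + 2 * Li₂ (1 / l₁)
    + 2 * Li₂ (l₁ / 2)
    - 2 * Li₂ l₂
    + 2 * Li₂ ((l₂ - 1) / (l₂ - l₁))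
    - 2 * Li₂ (l₁ * (l₂ - 1) / (l₂ - l₁))

open Real in
/-- The value of `(π² / 6) g₂` on region `D`. -/
def formulaD (l₁ l₂ : ℝ) : ℝ :=
  -(5 * π ^ 2 / 6) - l₁ / 2 + l₂
    + (-l₁ + l₂ + 2 / l₁) * log 2
    + (3 / l₁ - 3 * l₁) * log (l₁ - 1)
    + (2 / l₁ - l₁ / 2 - 2 * log 2) * log l₂
    + (l₁ - 4 / l₁) * log (2 - l₁)
    + 2 * (l₁ - l₂ + 1 / l₂ - 1 / l₁) * log (l₁ - l₂)
    + (l₁ / 2 + l₂ - 2 / l₂) * log l₁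
    + (l₂ - 1 / l₂) * log (1 - l₂)
    + log l₁ ^ 2
    - 2 * log (-l₁ + l₂ + 2) * log l₁
    + 2 * log (l₁ - l₂) * log l₂
    + 2 * log 2 * log (2 - l₁ + l₂)
    + 4 * Li₂ (1 / l₁)
    + 2 * Li₂ (l₁ / 2)
    + 2 * Li₂ (1 - l₂)
    + 2 * Li₂ l₂
    - 2 * Li₂ (2 * l₂ / (l₁ * (2 - l₁ + l₂)))
    + 2 * Li₂ ((l₂ - 1) / (l₂ - l₁))
    + 2 * Li₂ (l₂ / (2 - l₁ + l₂))
    - 2 * Li₂ ((2 - l₁ + l₂) / 2)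
    - 2 * Li₂ ((l₁ - l₁ * l₂) / (l₁ - l₂))

open Real in
/-- The value of `(π² / 6) g₂` on region `E`. -/
def formulaE (l₁ l₂ : ℝ) : ℝ :=
  1 / 6 * (-3 * l₁ - 2 * π ^ 2 + 6)
    + (-l₁ + l₂ + 2 / l₁) * log 2
    - log 2 ^ 2
    + log l₁ ^ 2
    + (l₁ / 2 - l₂ + 1 / l₂ - 2 / l₁ + 2 * log 2) * log (2 * l₂ - l₁)
    + (1 / l₁ - l₁) * log (l₁ - 1)
    + (l₁ / 2 - 2 / l₁) * log (2 - l₁)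
    + (l₁ / 2 - 1 / l₂) * log l₁
    + (l₂ - 1 / l₂) * log (l₂ - 1)
    + 2 * log 2 * (log (2 - l₁ + l₂) - log (-l₁ + l₂ + 1))
    + log l₂ * (-(l₁ / 2) + 2 / l₁ - 2 * log 2)
    + (2 * log l₂ + 2 * log (-l₁ + l₂ + 1)) * log l₁
    - (2 * log (-l₁ + l₂ + 2) + 2 * log (2 * l₂ - l₁)) * log l₁
    + 2 * Li₂ (1 / l₁)
    + 2 * Li₂ (l₁ / 2)
    - 2 * Li₂ ((l₁ - 2 * l₂) / (2 * (l₁ - l₂ - 1)))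
    + 2 * Li₂ ((l₁ - 2 * l₂) / (l₁ * (l₁ - l₂ - 1)))
    - 2 * Li₂ ((l₁ - l₂ - 1) / (l₁ - 2 * l₂))
    - 2 * Li₂ (-(2 * l₂ / (l₁ * (l₁ - l₂ - 2))))
    + 2 * Li₂ ((l₁ - l₂ - 1) * l₂ / (l₁ - 2 * l₂))
    + 2 * Li₂ (l₂ / (-l₁ + l₂ + 2))
    - 2 * Li₂ (1 / 2 * (-l₁ + l₂ + 2))

open Real in
/-- The value of `(π² / 6) g₂` on region `F`. -/
def formulaF (l₁ l₂ : ℝ) : ℝ :=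
  l₂ - π ^ 2 / 2 - 1 + log 2 ^ 2
    + 2 * log 2 * log (l₁ - l₂ - 1)
    + (2 / l₁ - 2 * l₁) * log (l₁ - 1)
    + (l₁ / 2 - 2 / l₁) * log (l₁ - 2)
    + 2 * (l₁ - l₂ + 1 / l₂ - 1 / l₁) * log (l₁ - l₂)
    + (l₂ - 1 / l₂) * log l₁
    + log (l₁ - 2 * l₂) * (-(l₁ / 2) + l₂ - 1 / l₂ + 2 / l₁ - 2 * log 2)
    + 2 * log l₁ * (log (l₁ - 2 * l₂) - log (l₁ - l₂ - 1) - log l₂)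
    + 2 * log (l₁ - l₂) * log l₂
    + 2 * Li₂ (1 / l₁)
    + 2 * Li₂ (1 - l₂)
    + 2 * Li₂ ((l₁ - 2 * l₂) / (2 * (l₁ - l₂ - 1)))
    - 2 * Li₂ ((l₁ - 2 * l₂) / (l₁ * (l₁ - l₂ - 1)))
    + 2 * Li₂ ((l₁ - l₂ - 1) / (l₁ - 2 * l₂))
    + 2 * Li₂ l₂
    - 2 * Li₂ ((l₁ - l₂ - 1) * l₂ / (l₁ - 2 * l₂))
    + 2 * Li₂ ((l₂ - 1) / (l₂ - l₁))
    - 2 * Li₂ ((l₁ - l₁ * l₂) / (l₁ - l₂))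

end GapDistribution

end

/-! Combinatorics. Let `a / q < α < a' / q'` be the neighbours of `α` among the fractions with
denominator at most `Q`, and put `A = q α - a`, `B = a' - q' α`. Adding `q` to an index moves a
point by `A` modulo 1, subtracting `q'` moves it by `B`, and doing both moves it by `A + B`. One of
these three moves leads from each point to its successor (three gap theorem). Hence the proportion
of consecutive pairs of gaps of each ordered pair of types is a piecewise linear function of `x = q
/ Q`, `y = q' / Q` (`sum_pairs`), while in the coordinate `t ∈ (0, 1)` along the arc the scaled gaps
are `t / y` and `(1 - t) / x`.

Limit. The arcs have length `1 / (q q')` and are indexed by the coprime pairs with `q, q' ≤ Q < q +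
q'`. The integral of the pair count against a weight `χ` is therefore close to a Riemann sum over
the Farey triangle `x, y ≤ 1 < x + y`, with weights `χ (a / q)` on coprime pairs. Independence of
the interval of integration needs the equidistribution of `a / q` jointly with `(x, y)`. As `a ≡ -1
/ q'` modulo `q`, this is a bound for short Kloosterman sums. Only a saving on average over `q` is
required, so shifting and an elementary second moment suffice for moduli with a large simple prime
factor (`norm_sum_arcPhase_le`), and the other moduli are rare (`card_fullBeyond_le`). With the
weights `1`, `1 + cos` and `1 + sin`, Weyl's criterion yields the limit `6 / π²` times
`limitIntegral` on every interval (`tendsto_pairAverage`). At thresholds `(0, 0)` all averages are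
1, so the total mass `π² / 6` need not be computed from the integral.

Evaluation. Let `b ≤ a`. A pair whose first gap is at least `a` and whose second is below `b` has a
second gap of type `A` or `B` preceded by a different type, and the two cases are mirror images.
Disintegrating over both lengths gives a joint density, namely `2 / b` times the integral of the
piecewise linear function `tent` along the line `a x + b h = 1`; it is a rational function in each
region. Its integral over the first length is a marginal containing logarithms, and integrating the
marginal over the second length gives dilogarithms. The closed formulas are verified by
differentiation (`limitValue_sub_eq_of_hasDerivAt`), the constants being matched on common
boundaries: A and B on `a + b = 1`, B and C on `a = 1`, C and D on `a + b = 2`, D and E on `b = 1`,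
F and G on `b = 1`. Region C is reached by moving the first threshold up from 1 instead, which
brings in the density of a single gap (`limitValue_sub_eq_of_hasDerivAt_left`). In region G the pair
frequency vanishes identically. The symmetry of `g₂` is the symmetry of the integrand. -/

namespace GapDistribution

/-! ### The three gap theorem on a Farey arc. -/

/-- `α` lies strictly between the neighbouring fractions `a / q < a' / q'`, whose denominators
are at most `Q` and add up to more than `Q`. -/
structure IsFareyArc (Q q q' : ℕ) (a a' : ℤ) (α : ℝ) : Prop where
  pos_left : 0 < q
  pos_right : 0 < q'
  le_left : q ≤ Q
  le_right : q' ≤ Q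
  lt_add : Q < q + q'
  det : a' * q - a * q' = 1
  lt_left : (a : ℝ) < q * α
  lt_right : q' * α < a'

/-- The index of the point following `{n α}`. -/
def nextIndex (Q q q' n : ℕ) : ℕ :=
  if n < Q - q then n + q else if n < q' then n + q - q' else n - q'

/-- The length of the gap following `{n α}`. -/
noncomputable def gapLength (Q q q' : ℕ) (A B : ℝ) (n : ℕ) : ℝ :=
  if n < Q - q then A else if n < q' then A + B else B

/-- The length `A` enters for the `q'` indices `n < q'`, and the length `B` for the `q` indices `n ≥
Q - q`. -/
lemma sum_gapLength {Q q q' : ℕ} (h1 : q ≤ Q) (h2 : q' ≤ Q) (h : Q < q + q') (A B : ℝ) :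
    ∑ n ∈ Finset.range Q, gapLength Q q q' A B n = q' * A + q * B := by
  have e : ∀ n, gapLength Q q q' A B n
      = (if n < q' then A else 0) + (if n < Q - q then 0 else B) := by
    intro n
    unfold gapLength
    split_ifs <;> first | (exfalso; omega) | ring
  simp only [e, Finset.sum_add_distrib]
  have f1 : (Finset.range Q).filter (fun n => n < q') = Finset.range q' := by
    ext n; simp only [Finset.mem_filter, Finset.mem_range]; omega
  have f2 : (Finset.range Q).filter (fun n => ¬ n < Q - q) = Finset.Ico (Q - q) Q := by
    ext n; simp only [Finset.mem_filter, Finset.mem_range, Finset.mem_Ico]; omega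
  rw [← Finset.sum_filter, f1]
  have : ∀ n, (if n < Q - q then (0:ℝ) else B) = if ¬ n < Q - q then B else 0 := by
    intro n; split_ifs <;> rfl
  simp only [this]
  rw [← Finset.sum_filter, f2]
  simp only [Finset.sum_const, Finset.card_range, Nat.card_Ico, nsmul_eq_mul]
  congr 2
  congr 1
  omega

namespace IsFareyArc

variable {Q q q' : ℕ} {a a' : ℤ} {α : ℝ}

lemma nextIndex_lt (h : IsFareyArc Q q q' a a' α) {n : ℕ} (hn : n < Q) :
    nextIndex Q q q' n < Q := by
  have := h.pos_left; have := h.pos_right; have := h.le_left; have := h.le_right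
  have := h.lt_add
  unfold nextIndex
  split_ifs <;> omega

lemma nextIndex_mul (h : IsFareyArc Q q q' a a' α) (n : ℕ) :
    ∃ k : ℤ, (nextIndex Q q q' n : ℝ) * α
      = n * α + gapLength Q q q' (q * α - a) (a' - q' * α) n + k := by
  unfold nextIndex gapLength
  have := h.le_left; have := h.le_right; have := h.lt_add
  split_ifs with h1 h2
  · exact ⟨a, by push_cast; ring⟩
  · refine ⟨a - a', ?_⟩
    rw [Nat.cast_sub (by omega)]
    push_cast; ring
  · refine ⟨-a', ?_⟩
    rw [Nat.cast_sub (by omega)]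
    push_cast; ring

lemma gapLength_pos (h : IsFareyArc Q q q' a a' α) (n : ℕ) :
    0 < gapLength Q q q' (q * α - a) (a' - q' * α) n := by
  have := h.lt_left; have := h.lt_right
  unfold gapLength
  split_ifs <;> linarith

/-- The total `q' A + q B` is the determinant `a' q - a q' = 1`. -/
lemma sum_eq_one (h : IsFareyArc Q q q' a a' α) :
    ∑ n ∈ Finset.range Q, gapLength Q q q' (q * α - a) (a' - q' * α) n = 1 := by
  rw [sum_gapLength h.le_left h.le_right h.lt_add]
  have := h.det
  have : ((a' * q - a * q' : ℤ) : ℝ) = 1 := by rw [this]; simp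
  push_cast at this
  linarith

end IsFareyArc

lemma point_nonneg (Q : ℕ) (α : ℝ) (i : Fin Q) : 0 ≤ point Q α i := Int.fract_nonneg _

lemma point_lt_one (Q : ℕ) (α : ℝ) (i : Fin Q) : point Q α i < 1 := Int.fract_lt_one _

lemma point_mono (Q : ℕ) (α : ℝ) : Monotone (point Q α) :=
  Tuple.monotone_sort fun n : Fin Q => Int.fract (((n : ℕ) : ℝ) * α)

/-- The index 0 contributes the point 0, and the sorted list starts with its least element. This
makes the sum of the gaps telescope to 1. -/
lemma point_zero (m : ℕ) (α : ℝ) : point (m + 1) α 0 = 0 := by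
  refine le_antisymm ?_ (point_nonneg _ _ _)
  have h : point (m + 1) α ((sigma (m + 1) α).symm 0) = 0 := by simp [point]
  rw [← h]
  exact point_mono _ _ (Fin.zero_le _)

lemma sum_gap (m : ℕ) (α : ℝ) : ∑ i, gap (m + 1) α i = 1 := by
  rw [Fin.sum_univ_castSucc]
  have h1 : gap (m + 1) α (Fin.last m) = 1 - point (m + 1) α (Fin.last m) := by
    simp [gap]
  have h2 : ∀ i : Fin m, gap (m + 1) α i.castSucc
      = point (m + 1) α i.succ - point (m + 1) α i.castSucc := by
    intro i
    simp only [gap, Fin.val_castSucc]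
    rw [dif_pos (by omega)]
    rfl
  simp only [h1, h2, Finset.sum_sub_distrib]
  have h3 := Fin.sum_univ_succ (point (m + 1) α)
  have h4 := Fin.sum_univ_castSucc (point (m + 1) α)
  rw [point_zero] at h3
  linarith

namespace IsFareyArc

variable {Q q q' : ℕ} {a a' : ℤ} {α : ℝ}

/-- The index of the point following the `i`-th one is the `j`-th one, up to an integer. -/
lemma exists_point (h : IsFareyArc Q q q' a a' α) (i : Fin Q) :
    ∃ j : Fin Q, (sigma Q α j : ℕ) = nextIndex Q q q' (sigma Q α i) ∧ ∃ k : ℤ,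
      gapLength Q q q' (q * α - a) (a' - q' * α) (sigma Q α i)
        = point Q α j - point Q α i + k := by
  refine ⟨(sigma Q α).symm ⟨_, h.nextIndex_lt (sigma Q α i).isLt⟩, by simp, ?_⟩
  obtain ⟨k, hk⟩ := h.nextIndex_mul (sigma Q α i)
  simp only [point, Equiv.apply_symm_apply]
  refine ⟨⌊(nextIndex Q q q' (sigma Q α i) : ℝ) * α⌋ - ⌊((sigma Q α i : ℕ) : ℝ) * α⌋ - k, ?_⟩
  simp only [Int.fract]
  push_cast
  linarith

/-- Some point lies ahead of the `i`-th one at distance `gapLength` on the circle, and the gap ends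
at the first point ahead. The integer `k` records whether the step crosses 0. -/
lemma gap_le (h : IsFareyArc Q q q' a a' α) (i : Fin Q) :
    gap Q α i ≤ gapLength Q q q' (q * α - a) (a' - q' * α) (sigma Q α i) := by
  obtain ⟨j, -, k, hk⟩ := h.exists_point i
  have hpos := h.gapLength_pos (sigma Q α i)
  rw [hk] at hpos ⊢
  have b1 := point_nonneg Q α i; have b2 := point_nonneg Q α j
  have b3 := point_lt_one Q α i; have b4 := point_lt_one Q α j
  have key : gap Q α i ≤ 1 - point Q α i := by
    unfold gap
    split_ifs with hi
    · have := point_lt_one Q α ⟨i + 1, hi⟩; linarith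
    · exact le_rfl
  rcases lt_or_ge i j with hij | hij
  · have hk0 : 0 ≤ k := by
      have : (-1 : ℝ) < k := by linarith
      have : (-1 : ℤ) < k := by exact_mod_cast this
      omega
    have hk0' : (0 : ℝ) ≤ k := by exact_mod_cast hk0
    have hi : (i : ℕ) + 1 < Q := by
      have := j.isLt; have : (i : ℕ) < j := hij; omega
    have : gap Q α i = point Q α ⟨i + 1, hi⟩ - point Q α i := by simp [gap, hi]
    have h2 : point Q α ⟨i + 1, hi⟩ ≤ point Q α j := point_mono _ _ (by
      rw [Fin.le_def]; exact hij)
    linarith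
  -- The step has wrapped around 0, so it covers at least the remaining length `1 - point i`.
  · have h2 := point_mono Q α hij
    have hk0 : 1 ≤ k := by
      have : (0 : ℝ) < k := by linarith
      have : (0 : ℤ) < k := by exact_mod_cast this
      omega
    have hk0' : (1 : ℝ) ≤ k := by exact_mod_cast hk0
    linarith

/-- The three gap theorem. -/
lemma gap_eq (h : IsFareyArc Q q q' a a' α) (i : Fin Q) :
    gap Q α i = gapLength Q q q' (q * α - a) (a' - q' * α) (sigma Q α i) := by
  have hQ : 0 < Q := lt_of_lt_of_le h.pos_left h.le_left
  have s1 : ∑ i, gap Q α i = 1 := by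
    obtain ⟨m, rfl⟩ : ∃ m, Q = m + 1 := ⟨Q - 1, by omega⟩
    exact sum_gap m α
  have s2 : ∑ i, gapLength Q q q' (q * α - a) (a' - q' * α) (sigma Q α i) = 1 := by
    rw [Equiv.sum_comp (sigma Q α)
      (fun n : Fin Q => gapLength Q q q' (q * α - a) (a' - q' * α) (n : ℕ)),
      Fin.sum_univ_eq_sum_range (gapLength Q q q' (q * α - a) (a' - q' * α)) Q]
    exact h.sum_eq_one
  -- Termwise inequality together with equal sums forces termwise equality.
  exact (Finset.sum_eq_sum_iff_of_le fun i _ => h.gap_le i).1 (s1.trans s2.symm) i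
    (Finset.mem_univ i)

/-- All gaps are positive, so the points are distinct. The next point in the order and the predicted
successor agree modulo 1 and both lie in `[0, 1)`, hence they coincide. -/
lemma sigma_finRotate (h : IsFareyArc Q q q' a a' α) (i : Fin Q) :
    (sigma Q α (finRotate Q i) : ℕ) = nextIndex Q q q' (sigma Q α i) := by
  obtain ⟨j, hj, k, hk⟩ := h.exists_point i
  rw [← h.gap_eq] at hk
  rw [← hj]
  suffices finRotate Q i = j by rw [this]
  have hQ : 0 < Q := lt_of_lt_of_le h.pos_left h.le_left
  obtain ⟨m, rfl⟩ : ∃ m, Q = m + 1 := ⟨Q - 1, by omega⟩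
  have hstrict : StrictMono (point (m + 1) α) := by
    rw [Fin.strictMono_iff_lt_succ]
    intro l
    have := h.gapLength_pos (sigma (m + 1) α l.castSucc)
    rw [← h.gap_eq] at this
    have e : gap (m + 1) α l.castSucc
        = point (m + 1) α l.succ - point (m + 1) α l.castSucc := by
      simp only [gap, Fin.val_castSucc]
      rw [dif_pos (by omega)]
      rfl
    linarith
  have key : ∃ l : ℤ, point (m + 1) α (finRotate (m + 1) i) = point (m + 1) α j + l := by
    rcases Fin.eq_castSucc_or_eq_last i with ⟨l, rfl⟩ | rfl
    · refine ⟨k, ?_⟩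
      have : finRotate (m + 1) l.castSucc = l.succ := by
        rw [finRotate_of_lt (by simp)]; rfl
      rw [this]
      have e : gap (m + 1) α l.castSucc
          = point (m + 1) α l.succ - point (m + 1) α l.castSucc := by
        simp only [gap, Fin.val_castSucc]
        rw [dif_pos (by omega)]
        rfl
      linarith
    · refine ⟨k - 1, ?_⟩
      rw [finRotate_last, point_zero]
      have e : gap (m + 1) α (Fin.last m) = 1 - point (m + 1) α (Fin.last m) := by
        simp [gap]
      push_cast
      linarith
  obtain ⟨l, hl⟩ := key
  have b1 := point_nonneg (m + 1) α (finRotate (m + 1) i)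
  have b2 := point_nonneg (m + 1) α j
  have b3 := point_lt_one (m + 1) α (finRotate (m + 1) i)
  have b4 := point_lt_one (m + 1) α j
  have l0 : l = 0 := by
    have h1 : (-1 : ℝ) < l := by linarith
    have h2 : (l : ℝ) < 1 := by linarith
    have h1 : (-1 : ℤ) < l := by exact_mod_cast h1
    have h2 : l < 1 := by exact_mod_cast h2
    omega
  refine hstrict.injective ?_
  rw [hl, l0]; simp

/-- Reindexing by `sigma` removes the sorted order: only an index and its successor matter. -/
lemma pairCount_eq (h : IsFareyArc Q q q' a a' α) (l₁ l₂ : ℝ) :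
    pairCount Q l₁ l₂ α = ((Finset.range Q).filter fun n =>
      l₁ / Q ≤ gapLength Q q q' (q * α - a) (a' - q' * α) n ∧
      l₂ / Q ≤ gapLength Q q q' (q * α - a) (a' - q' * α) (nextIndex Q q q' n)).card := by
  unfold pairCount
  simp only [h.gap_eq, h.sigma_finRotate]
  rw [Finset.card_filter, Finset.card_filter,
    Equiv.sum_comp (sigma Q α) (fun n : Fin Q => if
      l₁ / Q ≤ gapLength Q q q' (q * α - a) (a' - q' * α) n ∧
      l₂ / Q ≤ gapLength Q q q' (q * α - a) (a' - q' * α) (nextIndex Q q q' n) then 1 else 0),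
    Fin.sum_univ_eq_sum_range (fun n => if
      l₁ / Q ≤ gapLength Q q q' (q * α - a) (a' - q' * α) n ∧
      l₂ / Q ≤ gapLength Q q q' (q * α - a) (a' - q' * α) (nextIndex Q q q' n) then 1 else 0) Q]

end IsFareyArc

end GapDistribution

/-! ### Frequencies of the types of consecutive gaps. -/

namespace GapDistribution

/-- The proportion of pairs of consecutive gaps both equal to the gap `A`. -/
noncomputable def freqSame (x : ℝ) : ℝ := max 0 (1 - 2 * x)

/-- The proportion of pairs of consecutive gaps `(A, B)`. -/
noncomputable def freqMixed (x y : ℝ) : ℝ := min (1 - x) (1 - y)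

/-- The proportion of pairs of consecutive gaps `(A, A + B)`. -/
noncomputable def freqSum (x y : ℝ) : ℝ := max 0 (y - max x (1 - x))

/-- The proportion of pairs of consecutive gaps both equal to `A + B`. -/
noncomputable def freqSumSum (x y : ℝ) : ℝ := max 0 (2 * min x y - 1)

open Classical in
/-- The indicator of `a ≤ u` and `b ≤ v`. -/
noncomputable def bothLE (a b u v : ℝ) : ℝ := if a ≤ u ∧ b ≤ v then 1 else 0

/-- The proportion of pairs of consecutive gaps at least `(a, b)`, in terms of the scaled
denominators `x, y` and the scaled basic gaps `A, B`. -/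
noncomputable def pairFreq (a b x y A B : ℝ) : ℝ :=
  freqSame x * bothLE a b A A + freqSame y * bothLE a b B B
    + freqMixed x y * (bothLE a b A B + bothLE a b B A)
    + freqSum x y * (bothLE a b A (A + B) + bothLE a b (A + B) A)
    + freqSum y x * (bothLE a b B (A + B) + bothLE a b (A + B) B)
    + freqSumSum x y * bothLE a b (A + B) (A + B)

/-- Truncated subtraction keeps the formula valid when a threshold falls outside the interval, which
is what happens when some type of pair is absent. -/
lemma sum_Ico_ite (lo hi s r : ℕ) (h1 : lo ≤ hi) (h : s ≤ r) (u v w : ℝ) :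
    ∑ n ∈ Finset.Ico lo hi, (if n < s then u else if n < r then v else w)
      = ((min hi s - lo : ℕ) : ℝ) * u + ((min hi r - max lo s : ℕ) : ℝ) * v
        + ((hi - max lo r : ℕ) : ℝ) * w := by
  have e : ∀ n ∈ Finset.Ico lo hi, (if n < s then u else if n < r then v else w)
      = (if n ∈ Finset.Ico lo (min hi s) then u else 0)
        + (if n ∈ Finset.Ico (max lo s) (min hi r) then v else 0)
        + (if n ∈ Finset.Ico (max lo r) hi then w else 0) := by
    intro n hn
    simp only [Finset.mem_Ico] at hn ⊢
    split_ifs <;> first | (exfalso; omega) | ring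
  rw [Finset.sum_congr rfl e, Finset.sum_add_distrib, Finset.sum_add_distrib]
  have f : ∀ l k : ℕ, lo ≤ l → k ≤ hi → ∀ z : ℝ,
      ∑ n ∈ Finset.Ico lo hi, (if n ∈ Finset.Ico l k then z else 0) = ((k - l : ℕ) : ℝ) * z := by
    intro l k hl hk z
    rw [← Finset.sum_filter]
    have : (Finset.Ico lo hi).filter (fun n => n ∈ Finset.Ico l k) = Finset.Ico l k := by
      ext n; simp only [Finset.mem_filter, Finset.mem_Ico]; omega
    rw [this, Finset.sum_const, Nat.card_Ico, nsmul_eq_mul]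
  rw [f _ _ le_rfl (min_le_left _ _), f _ _ (le_max_left _ _) (min_le_left _ _),
    f _ _ (le_max_left _ _) le_rfl]

/-- Here and in the lemmas on `freqSum` and `freqSumSum`, truncated subtraction of naturals becomes
a positive part, the form in which the count extends to real arguments. -/
lemma cast_mul_freqSame {Q : ℕ} (hQ : 0 < Q) (q : ℕ) :
    (Q : ℝ) * freqSame (q / Q) = ((Q - 2 * q : ℕ) : ℝ) := by
  have hQ' : (0 : ℝ) < Q := by exact_mod_cast hQ
  have : ((Q - 2 * q : ℕ) : ℤ) = max 0 ((Q : ℤ) - 2 * q) := by omega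
  have h2 : ((Q - 2 * q : ℕ) : ℝ) = max 0 ((Q : ℝ) - 2 * q) := by
    have := congrArg (Int.cast : ℤ → ℝ) this
    push_cast at this
    exact this
  rw [h2, freqSame, mul_max_of_nonneg _ _ hQ'.le]
  congr 1
  · ring
  · field_simp

lemma cast_mul_freqMixed {Q q q' : ℕ} (hQ : 0 < Q) (h1 : q ≤ Q) (h2 : q' ≤ Q) :
    (Q : ℝ) * freqMixed (q / Q) (q' / Q) = ((min (Q - q) (Q - q') : ℕ) : ℝ) := by
  have hQ' : (0 : ℝ) < Q := by exact_mod_cast hQ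
  rw [freqMixed, mul_min_of_nonneg _ _ hQ'.le, Nat.cast_min, Nat.cast_sub h1, Nat.cast_sub h2]
  congr 1 <;> field_simp

lemma cast_mul_freqSum {Q q q' : ℕ} (hQ : 0 < Q) (h1 : q ≤ Q) :
    (Q : ℝ) * freqSum (q / Q) (q' / Q) = ((q' - max q (Q - q) : ℕ) : ℝ) := by
  have hQ' : (0 : ℝ) < Q := by exact_mod_cast hQ
  have : ((q' - max q (Q - q) : ℕ) : ℤ) = max 0 ((q' : ℤ) - max (q : ℤ) (Q - q)) := by omega
  have h2 : ((q' - max q (Q - q) : ℕ) : ℝ) = max 0 ((q' : ℝ) - max (q : ℝ) (Q - q)) := by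
    have := congrArg (Int.cast : ℤ → ℝ) this
    push_cast at this
    exact this
  rw [h2, freqSum, mul_max_of_nonneg _ _ hQ'.le, mul_sub, mul_max_of_nonneg _ _ hQ'.le]
  congr 1
  · ring
  · congr 1
    · field_simp
    · congr 1 <;> field_simp

lemma cast_mul_freqSumSum {Q : ℕ} (q q' : ℕ) (hQ : 0 < Q) :
    (Q : ℝ) * freqSumSum (q / Q) (q' / Q) = ((2 * min q q' - Q : ℕ) : ℝ) := by
  have hQ' : (0 : ℝ) < Q := by exact_mod_cast hQ
  have : ((2 * min q q' - Q : ℕ) : ℤ) = max 0 (2 * min (q : ℤ) q' - Q) := by omega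
  have h2 : ((2 * min q q' - Q : ℕ) : ℝ) = max 0 (2 * min (q : ℝ) q' - Q) := by
    have := congrArg (Int.cast : ℤ → ℝ) this
    push_cast at this
    exact this
  rw [h2, freqSumSum, mul_max_of_nonneg _ _ hQ'.le, mul_sub, mul_left_comm,
    mul_min_of_nonneg _ _ hQ'.le]
  congr 1
  · ring
  · congr 1
    · congr 2 <;> field_simp
    · ring

/-- The type of a gap changes at the indices `Q - q` and `q'`. On each of the three resulting blocks
the type of the following gap changes at two further thresholds, found by pulling these cuts back
along `nextIndex`. The nine intervals so obtained have the six frequencies as relative lengths, a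
pair of different types and its reversal having the same one. -/
lemma sum_pairs {Q q q' : ℕ} (p1 : 0 < q) (p2 : 0 < q') (h1 : q ≤ Q) (h2 : q' ≤ Q)
    (h : Q < q + q') (A B : ℝ) (f : ℝ → ℝ → ℝ) :
    ∑ n ∈ Finset.range Q, f (gapLength Q q q' A B n)
        (gapLength Q q q' A B (nextIndex Q q q' n))
      = Q * (freqSame (q / Q) * f A A + freqSame (q' / Q) * f B B
        + freqMixed (q / Q) (q' / Q) * (f A B + f B A)
        + freqSum (q / Q) (q' / Q) * (f A (A + B) + f (A + B) A)
        + freqSum (q' / Q) (q / Q) * (f B (A + B) + f (A + B) B)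
        + freqSumSum (q / Q) (q' / Q) * f (A + B) (A + B)) := by
  have hQ : 0 < Q := by omega
  have e1 : ∑ n ∈ Finset.Ico 0 (Q - q), f (gapLength Q q q' A B n)
        (gapLength Q q q' A B (nextIndex Q q q' n))
      = ∑ n ∈ Finset.Ico 0 (Q - q), (if n < Q - 2 * q then f A A
          else if n < q' - q then f A (A + B) else f A B) := by
    refine Finset.sum_congr rfl fun n hn => ?_
    rw [Finset.mem_Ico] at hn
    unfold gapLength nextIndex
    split_ifs <;> first | rfl | (exfalso; omega)
  have e2 : ∑ n ∈ Finset.Ico (Q - q) q', f (gapLength Q q q' A B n)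
        (gapLength Q q q' A B (nextIndex Q q q' n))
      = ∑ n ∈ Finset.Ico (Q - q) q', (if n < Q + q' - 2 * q then f (A + B) A
          else if n < 2 * q' - q then f (A + B) (A + B) else f (A + B) B) := by
    refine Finset.sum_congr rfl fun n hn => ?_
    rw [Finset.mem_Ico] at hn
    unfold gapLength nextIndex
    split_ifs <;> first | rfl | (exfalso; omega)
  have e3 : ∑ n ∈ Finset.Ico q' Q, f (gapLength Q q q' A B n)
        (gapLength Q q q' A B (nextIndex Q q q' n))
      = ∑ n ∈ Finset.Ico q' Q, (if n < Q - q + q' then f B A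
          else if n < 2 * q' then f B (A + B) else f B B) := by
    refine Finset.sum_congr rfl fun n hn => ?_
    rw [Finset.mem_Ico] at hn
    unfold gapLength nextIndex
    split_ifs <;> first | rfl | (exfalso; omega)
  rw [Finset.range_eq_Ico, ← Finset.sum_Ico_consecutive _ (Nat.zero_le (Q - q)) (Nat.sub_le Q q),
    ← Finset.sum_Ico_consecutive _ (show Q - q ≤ q' by omega) h2, e1, e2, e3,
    sum_Ico_ite _ _ _ _ (by omega) (by omega), sum_Ico_ite _ _ _ _ (by omega) (by omega),
    sum_Ico_ite _ _ _ _ (by omega) (by omega)]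
  have c : ∀ z1 z2 z3 z4 z5 z6 w1 w2 w3 : ℝ, (Q : ℝ) * (z1 * f A A + z2 * f B B
      + z3 * (f A B + f B A) + z4 * (f A (A + B) + f (A + B) A)
      + z5 * (f B (A + B) + f (A + B) B) + z6 * f (A + B) (A + B))
      = (Q * z1) * f A A + (Q * z2) * f B B
      + (Q * z3) * (f A B + f B A) + (Q * z4) * (f A (A + B) + f (A + B) A)
      + (Q * z5) * (f B (A + B) + f (A + B) B) + (Q * z6) * f (A + B) (A + B) := by
    intros; ring
  rw [c _ _ _ _ _ _ 0 0 0, cast_mul_freqSame hQ, cast_mul_freqSame hQ, cast_mul_freqMixed hQ h1 h2,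
    cast_mul_freqSum hQ h1, cast_mul_freqSum hQ h2, cast_mul_freqSumSum _ _ hQ]
  -- The nine interval lengths, simplified by means of `q, q' ≤ Q < q + q'`.
  rw [show min (Q - q) (Q - 2 * q) - 0 = Q - 2 * q by omega,
    show min (Q - q) (q' - q) - max 0 (Q - 2 * q) = q' - max q (Q - q) by omega,
    show Q - q - max 0 (q' - q) = min (Q - q) (Q - q') by omega,
    show min q' (Q + q' - 2 * q) - (Q - q) = q' - max q (Q - q) by omega,
    show min q' (2 * q' - q) - max (Q - q) (Q + q' - 2 * q) = 2 * min q q' - Q by omega,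
    show q' - max (Q - q) (2 * q' - q) = q - max q' (Q - q') by omega,
    show min Q (Q - q + q') - q' = min (Q - q) (Q - q') by omega,
    show min Q (2 * q') - max q' (Q - q + q') = q - max q' (Q - q') by omega,
    show Q - max q' (2 * q') = Q - 2 * q' by omega]
  ring

lemma IsFareyArc.pairCount_div {Q q q' : ℕ} {a a' : ℤ} {α : ℝ} (h : IsFareyArc Q q q' a a' α)
    (l₁ l₂ : ℝ) :
    (pairCount Q l₁ l₂ α : ℝ) / Q
      = pairFreq l₁ l₂ (q / Q) (q' / Q) (Q * (q * α - a)) (Q * (a' - q' * α)) := by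
  have hQ : 0 < Q := lt_of_lt_of_le h.pos_left h.le_left
  have hQ' : (0 : ℝ) < Q := by exact_mod_cast hQ
  classical
  rw [h.pairCount_eq, Finset.card_filter]
  push_cast
  have := sum_pairs h.pos_left h.pos_right h.le_left h.le_right h.lt_add
    (q * α - a) (a' - q' * α) (fun u v => if l₁ / Q ≤ u ∧ l₂ / Q ≤ v then (1 : ℝ) else 0)
  rw [this, mul_div_cancel_left₀ _ hQ'.ne']
  have hb : ∀ u v : ℝ, (if l₁ / Q ≤ u ∧ l₂ / Q ≤ v then (1 : ℝ) else 0)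
      = bothLE l₁ l₂ (Q * u) (Q * v) := by
    intro u v
    simp only [bothLE, div_le_iff₀' hQ']
  simp only [hb, pairFreq, mul_add]

end GapDistribution

/-! ### Existence and uniqueness of the Farey arc around an irrational number. -/

namespace GapDistribution

open MeasureTheory

/-- Induction by inserting mediants. When `q + q' = Q + 1` the mediant enters the new Farey sequence
and replaces the neighbour on its side of `α`; irrationality excludes that it equals `α`. -/
lemma exists_isFareyArc {α : ℝ} (hα : Irrational α) {Q : ℕ} (hQ : 1 ≤ Q) :
    ∃ q q' : ℕ, ∃ a a' : ℤ, IsFareyArc Q q q' a a' α := by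
  induction Q, hQ using Nat.le_induction with
  | base =>
    refine ⟨1, 1, ⌊α⌋, ⌊α⌋ + 1, by norm_num, by norm_num, le_rfl, le_rfl, by norm_num, by ring, ?_, ?_⟩
    · have h1 := Int.floor_le α
      have h2 : (⌊α⌋ : ℝ) ≠ α := fun h => hα ⟨⌊α⌋, by exact_mod_cast h⟩
      simpa using lt_of_le_of_ne h1 h2
    · simp
  | succ Q hQ ih =>
    obtain ⟨q, q', a, a', h⟩ := ih
    obtain ⟨p1, p2, l1, l2, hlt, det, hl, hr⟩ := h
    by_cases hs : Q + 1 < q + q'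
    · exact ⟨q, q', a, a', p1, p2, by omega, by omega, hs, det, hl, hr⟩
    have hs' : q + q' = Q + 1 := by omega
    rcases lt_trichotomy (((q + q' : ℕ) : ℝ) * α) ((a + a' : ℤ) : ℝ) with hc | hc | hc
    · exact ⟨q, q + q', a, a + a', p1, by omega, by omega, by omega, by omega,
        by push_cast; linarith, hl, hc⟩
    · exfalso
      have hpos : ((q + q' : ℕ) : ℝ) ≠ 0 := by positivity
      refine hα ⟨((a + a' : ℤ) : ℚ) / ((q + q' : ℕ) : ℚ), ?_⟩
      push_cast at hc hpos ⊢
      rw [← hc]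
      field_simp
    · exact ⟨q + q', q', a + a', a', by omega, p2, by omega, by omega, by omega,
        by push_cast; linarith, hc, hr⟩

namespace IsFareyArc

variable {Q q q' r r' : ℕ} {a a' b b' : ℤ} {α : ℝ}

/-- The coefficients of one arc in terms of another one containing the same number. -/
lemma exists_coeff (h : IsFareyArc Q q q' a a' α) (h' : IsFareyArc Q r r' b b' α) :
    ∃ u v u' v' : ℤ, (r : ℤ) = u * q + v * q' ∧ b = u * a + v * a' ∧
      (r' : ℤ) = u' * q + v' * q' ∧ b' = u' * a + v' * a' ∧ 1 ≤ u ∧ v ≤ 0 ∧ u' ≤ 0 ∧ 1 ≤ v' := by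
  -- Cramer's rule: the determinant is 1, so the coefficients are integers.
  have key : ∀ (s : ℕ) (c : ℤ), (s : ℤ) = (a' * s - c * q') * q + (c * q - a * s) * q' ∧
      c = (a' * s - c * q') * a + (c * q - a * s) * a' := by
    intro s c
    have := h.det
    constructor
    · linear_combination (-(s : ℤ)) * this
    · linear_combination (-c) * this
  have val : ∀ (s : ℕ) (u v c : ℤ), (s : ℤ) = u * q + v * q' → c = u * a + v * a' →
      (s : ℝ) * α - c = u * (q * α - a) - v * (a' - q' * α) := by
    intro s u v c h1 h2
    have h1' : (s : ℝ) = u * q + v * q' := by exact_mod_cast h1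
    have h2' : (c : ℝ) = u * a + v * a' := by exact_mod_cast h2
    rw [h1', h2']; ring
  have hA : 0 < (q : ℝ) * α - a := by have := h.lt_left; linarith
  have hB : 0 < (a' : ℝ) - q' * α := by have := h.lt_right; linarith
  -- Since `0 < s ≤ Q < q + q'`, the two coefficients are neither both positive nor both
  -- nonpositive. The side of `α` on which the fraction lies then decides between the two
  -- alternatives.
  have signs : ∀ (s : ℕ) (u v : ℤ), 0 < s → s ≤ Q → (s : ℤ) = u * q + v * q' →
      (1 ≤ u ∧ v ≤ 0) ∨ (u ≤ 0 ∧ 1 ≤ v) := by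
    intro s u v hs hsQ e
    have p1 : (0 : ℤ) < q := by exact_mod_cast h.pos_left
    have p2 : (0 : ℤ) < q' := by exact_mod_cast h.pos_right
    have hlt : (s : ℤ) < q + q' := by have := h.lt_add; omega
    have hs' : (0 : ℤ) < s := by exact_mod_cast hs
    by_contra hcon
    push Not at hcon
    rcases le_or_gt u 0 with hu | hu
    · have hv := hcon.2 hu
      nlinarith
    · have hv := hcon.1 hu
      nlinarith
  have hA' : 0 < (r : ℝ) * α - b := by have := h'.lt_left; linarith
  have hB' : (r' : ℝ) * α - b' < 0 := by have := h'.lt_right; linarith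
  obtain ⟨k1, k2⟩ := key r b
  obtain ⟨k3, k4⟩ := key r' b'
  refine ⟨_, _, _, _, k1, k2, k3, k4, ?_⟩
  have s1 := signs r _ _ h'.pos_left h'.le_left k1
  have s2 := signs r' _ _ h'.pos_right h'.le_right k3
  rw [val r _ _ b k1 k2] at hA'
  rw [val r' _ _ b' k3 k4] at hB'
  generalize a' * (r : ℤ) - b * q' = u at *
  generalize b * (q : ℤ) - a * r = v at *
  generalize a' * (r' : ℤ) - b' * q' = u' at *
  generalize b' * (q : ℤ) - a * r' = v' at *
  have t1 : 1 ≤ u ∧ v ≤ 0 := by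
    rcases s1 with s | ⟨s, s'⟩
    · exact s
    · exfalso
      have e1 : (u : ℝ) ≤ 0 := by exact_mod_cast s
      have e2 : (1 : ℝ) ≤ v := by exact_mod_cast s'
      nlinarith
  have t2 : u' ≤ 0 ∧ 1 ≤ v' := by
    rcases s2 with ⟨s, s'⟩ | s
    · exfalso
      have e1 : (1 : ℝ) ≤ u' := by exact_mod_cast s
      have e2 : (v' : ℝ) ≤ 0 := by exact_mod_cast s'
      nlinarith
    · exact s
  exact ⟨t1.1, t1.2, t2.1, t2.2⟩

/-- The change of basis has determinant 1 with diagonal entries at least 1 and off-diagonal entries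
at most 0. Its inverse writes `q` and `q'` as nonnegative combinations of `r` and `r'`, and a
nonzero off-diagonal entry would make one of them at least `r + r' > Q`. -/
lemma unique (h : IsFareyArc Q q q' a a' α) (h' : IsFareyArc Q r r' b b' α) :
    q = r ∧ q' = r' ∧ a = b := by
  obtain ⟨u, v, u', v', e1, e2, e3, e4, hu, hv, hu', hv'⟩ := h.exists_coeff h'
  have d := h.det
  have d' := h'.det
  have det1 : u * v' - u' * v = 1 := by
    rw [e1, e2, e3, e4] at d'
    linear_combination d' - (u * v' - u' * v) * d
  have p1 : (0 : ℤ) < q := by exact_mod_cast h.pos_left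
  have p2 : (0 : ℤ) < q' := by exact_mod_cast h.pos_right
  have p1' : (0 : ℤ) < r := by exact_mod_cast h'.pos_left
  have p2' : (0 : ℤ) < r' := by exact_mod_cast h'.pos_right
  have l1 : (q : ℤ) ≤ Q := by exact_mod_cast h.le_left
  have l2 : (q' : ℤ) ≤ Q := by exact_mod_cast h.le_right
  have hs : (Q : ℤ) < r + r' := by exact_mod_cast h'.lt_add
  have inv1 : (q : ℤ) = v' * r - v * r' := by
    linear_combination -v' * e1 + v * e3 - (q : ℤ) * det1
  have inv2 : (q' : ℤ) = u * r' - u' * r := by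
    linear_combination -u * e3 + u' * e1 - (q' : ℤ) * det1
  have hv0 : v = 0 := by
    by_contra hne
    have : v ≤ -1 := by omega
    nlinarith
  have hu0 : u' = 0 := by
    by_contra hne
    have : u' ≤ -1 := by omega
    nlinarith
  subst hv0 hu0
  have huv : u * v' = 1 := by linarith
  have hu1 : u = 1 := by nlinarith
  have hv1 : v' = 1 := by nlinarith
  subst hu1 hv1
  refine ⟨by omega, by omega, by linarith⟩

end IsFareyArc

end GapDistribution

/-! ### Arcs in the unit interval indexed by coprime pairs of denominators. -/

namespace GapDistribution

open MeasureTheory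

/-- The numerator of the fraction with denominator `q` whose right neighbour has
denominator `q'`. -/
def leftNum (q q' : ℕ) : ℤ := ((-(q' : ZMod q)⁻¹).val : ℤ)

/-- The numerator of the right neighbour of `leftNum q q' / q`. -/
def rightNum (q q' : ℕ) : ℤ := (leftNum q q' * q' + 1) / q

lemma leftNum_nonneg (q q' : ℕ) : 0 ≤ leftNum q q' := Int.natCast_nonneg _

lemma leftNum_lt {q : ℕ} (hq : 0 < q) (q' : ℕ) : leftNum q q' < q := by
  have : NeZero q := ⟨hq.ne'⟩
  unfold leftNum
  exact_mod_cast ZMod.val_lt (-(q' : ZMod q)⁻¹)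

lemma cast_leftNum {q : ℕ} (hq : 0 < q) (q' : ℕ) :
    ((leftNum q q' : ℤ) : ZMod q) = -(q' : ZMod q)⁻¹ := by
  have : NeZero q := ⟨hq.ne'⟩
  simp [leftNum]

lemma dvd_leftNum_mul {q q' : ℕ} (hq : 0 < q) (h : Nat.Coprime q q') :
    (q : ℤ) ∣ leftNum q q' * q' + 1 := by
  rw [← ZMod.intCast_zmod_eq_zero_iff_dvd]
  push_cast
  rw [cast_leftNum hq, neg_mul, mul_comm, ZMod.coe_mul_inv_eq_one q' h.symm]
  ring

lemma rightNum_mul {q q' : ℕ} (hq : 0 < q) (h : Nat.Coprime q q') :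
    rightNum q q' * q - leftNum q q' * q' = 1 := by
  rw [rightNum, Int.ediv_mul_cancel (dvd_leftNum_mul hq h)]
  ring

/-- The pairs of neighbouring denominators at level `Q`. -/
def fareyPairs (Q : ℕ) : Finset (ℕ × ℕ) :=
  (Finset.Icc 1 Q ×ˢ Finset.Icc 1 Q).filter fun p => Q < p.1 + p.2 ∧ Nat.Coprime p.1 p.2

lemma mem_fareyPairs {Q : ℕ} {p : ℕ × ℕ} : p ∈ fareyPairs Q ↔
    (1 ≤ p.1 ∧ p.1 ≤ Q) ∧ (1 ≤ p.2 ∧ p.2 ≤ Q) ∧ Q < p.1 + p.2 ∧ Nat.Coprime p.1 p.2 := by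
  simp [fareyPairs, and_assoc]

/-- The open arc between two neighbouring fractions. -/
def fareyArc (p : ℕ × ℕ) : Set ℝ :=
  Set.Ioo ((leftNum p.1 p.2 : ℝ) / p.1) ((rightNum p.1 p.2 : ℝ) / p.2)

lemma isFareyArc_of_mem {Q : ℕ} {p : ℕ × ℕ} (hp : p ∈ fareyPairs Q) {α : ℝ}
    (hα : α ∈ fareyArc p) :
    IsFareyArc Q p.1 p.2 (leftNum p.1 p.2) (rightNum p.1 p.2) α := by
  obtain ⟨⟨h1, h2⟩, ⟨h3, h4⟩, h5, h6⟩ := mem_fareyPairs.1 hp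
  have p1 : (0 : ℝ) < p.1 := by exact_mod_cast h1
  have p2 : (0 : ℝ) < p.2 := by exact_mod_cast h3
  refine ⟨h1, h3, h2, h4, h5, rightNum_mul h1 h6, ?_, ?_⟩
  · have := (div_lt_iff₀' p1).1 hα.1; exact this
  · have := (lt_div_iff₀' p2).1 hα.2; exact this

lemma right_sub_left {Q : ℕ} {p : ℕ × ℕ} (hp : p ∈ fareyPairs Q) :
    (rightNum p.1 p.2 : ℝ) / p.2 = (leftNum p.1 p.2 : ℝ) / p.1 + 1 / (p.1 * p.2) := by
  obtain ⟨⟨h1, h2⟩, ⟨h3, h4⟩, h5, h6⟩ := mem_fareyPairs.1 hp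
  have p1 : (0 : ℝ) < p.1 := by exact_mod_cast h1
  have p2 : (0 : ℝ) < p.2 := by exact_mod_cast h3
  have : ((rightNum p.1 p.2 * p.1 - leftNum p.1 p.2 * p.2 : ℤ) : ℝ) = 1 := by
    rw [rightNum_mul h1 h6]; simp
  push_cast at this
  field_simp
  linarith

lemma fareyArc_subset {Q : ℕ} {p : ℕ × ℕ} (hp : p ∈ fareyPairs Q) :
    fareyArc p ⊆ Set.Ioo 0 1 := by
  obtain ⟨⟨h1, h2⟩, ⟨h3, h4⟩, h5, h6⟩ := mem_fareyPairs.1 hp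
  have p1 : (0 : ℝ) < p.1 := by exact_mod_cast h1
  have p2 : (0 : ℝ) < p.2 := by exact_mod_cast h3
  refine Set.Ioo_subset_Ioo ?_ ?_
  · exact div_nonneg (by exact_mod_cast leftNum_nonneg _ _) p1.le
  · rw [div_le_one p2]
    have e := rightNum_mul h1 h6
    have hl := leftNum_lt h1 p.2
    have h1' : (1 : ℤ) ≤ p.1 := by exact_mod_cast h1
    have h3' : (1 : ℤ) ≤ p.2 := by exact_mod_cast h3
    have : rightNum p.1 p.2 ≤ p.2 := by
      -- Otherwise the determinant would be at least `(q' + 1) q - (q - 1) q' = q + q' > 1`.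
      by_contra hcon
      push Not at hcon
      nlinarith
    exact_mod_cast this

/-- For `α` in `(0, 1)` the left numerator satisfies `0 ≤ a < q`, and the determinant relation fixes
its class modulo `q`, so it is the representative chosen in `leftNum`. -/
lemma mem_fareyArc_of_isFareyArc {Q q q' : ℕ} {a a' : ℤ} {α : ℝ}
    (h : IsFareyArc Q q q' a a' α) (hα : α ∈ Set.Ioo (0 : ℝ) 1) :
    (q, q') ∈ fareyPairs Q ∧ α ∈ fareyArc (q, q') := by
  have hc : Nat.Coprime q q' := by
    rw [← Nat.isCoprime_iff_coprime]
    exact ⟨a', -a, by have := h.det; linarith⟩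
  have hp : (q, q') ∈ fareyPairs Q :=
    mem_fareyPairs.2 ⟨⟨h.pos_left, h.le_left⟩, ⟨h.pos_right, h.le_right⟩, h.lt_add, hc⟩
  have p1 : (0 : ℝ) < q := by exact_mod_cast h.pos_left
  have p2 : (0 : ℝ) < q' := by exact_mod_cast h.pos_right
  have p1' : (0 : ℤ) < q := by exact_mod_cast h.pos_left
  have p2' : (0 : ℤ) < q' := by exact_mod_cast h.pos_right
  have ha1 : a < q := by
    have : (a : ℝ) < q := by have := h.lt_left; nlinarith [hα.2]
    exact_mod_cast this
  have ha0 : 0 ≤ a := by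
    have : (0 : ℝ) < a' := by have := h.lt_right; nlinarith [hα.1]
    have : 0 < a' := by exact_mod_cast this
    have := h.det
    by_contra hcon
    push Not at hcon
    nlinarith
  have ea : a = leftNum q q' := by
    have d1 : (q : ℤ) ∣ (a - leftNum q q') * q' := by
      have e : (a - leftNum q q') * q' = (a * q' + 1) - (leftNum q q' * q' + 1) := by ring
      rw [e]
      refine dvd_sub ⟨a', ?_⟩ (dvd_leftNum_mul h.pos_left hc)
      have := h.det; linarith
    have d2 : (q : ℤ) ∣ a - leftNum q q' :=
      (Nat.isCoprime_iff_coprime.2 hc).dvd_of_dvd_mul_right d1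
    have b1 := leftNum_nonneg q q'
    have b2 := leftNum_lt h.pos_left q'
    have := Int.eq_zero_of_abs_lt_dvd d2 (by rw [abs_lt]; constructor <;> linarith)
    linarith
  have ea' : a' = rightNum q q' := by
    have e1 := h.det
    have e2 := rightNum_mul h.pos_left hc
    rw [← ea] at e2
    have : (a' - rightNum q q') * q = 0 := by linear_combination e1 - e2
    rcases mul_eq_zero.1 this with h0 | h0
    · linarith
    · omega
  refine ⟨hp, ?_, ?_⟩
  · rw [div_lt_iff₀' p1]; rw [← ea]; exact h.lt_left
  · rw [lt_div_iff₀' p2]; rw [← ea']; exact h.lt_right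

lemma pairwiseDisjoint_fareyArc (Q : ℕ) :
    (fareyPairs Q : Set (ℕ × ℕ)).Pairwise (Function.onFun Disjoint fareyArc) := by
  intro p hp r hr hne
  rw [Function.onFun, Set.disjoint_left]
  intro α h1 h2
  obtain ⟨e1, e2, -⟩ := (isFareyArc_of_mem hp h1).unique (isFareyArc_of_mem hr h2)
  exact hne (Prod.ext e1 e2)

/-- Every irrational number of `(0, 1)` lies in some arc, and the rationals form a null set. -/
lemma ae_mem_iUnion_fareyArc {Q : ℕ} (hQ : 1 ≤ Q) :
    (Set.Ioo (0 : ℝ) 1) =ᵐ[volume] ⋃ p ∈ fareyPairs Q, fareyArc p := by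
  have hirr : ∀ᵐ α : ℝ, Irrational α := by
    have := (Set.countable_range ((↑) : ℚ → ℝ)).ae_notMem volume
    filter_upwards [this] with α hα using hα
  filter_upwards [hirr] with α hα
  apply propext
  constructor
  · intro h
    obtain ⟨q, q', a, a', hF⟩ := exists_isFareyArc hα hQ
    obtain ⟨h1, h2⟩ := mem_fareyArc_of_isFareyArc hF h
    exact Set.mem_biUnion (x := (q, q')) h1 h2
  · intro h
    obtain ⟨p, hp, hα⟩ := Set.mem_iUnion₂.1 h
    exact fareyArc_subset hp hα

lemma integral_eq_sum_fareyArc {Q : ℕ} (hQ : 1 ≤ Q) (h : ℝ → ℝ)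
    (hint : ∀ p ∈ fareyPairs Q, IntegrableOn h (fareyArc p)) :
    IntervalIntegrable h volume 0 1 ∧
    ∫ α in (0 : ℝ)..1, h α = ∑ p ∈ fareyPairs Q, ∫ α in fareyArc p, h α := by
  have hae := ae_mem_iUnion_fareyArc hQ
  constructor
  · rw [intervalIntegrable_iff_integrableOn_Ioo_of_le zero_le_one,
      integrableOn_congr_set_ae hae]
    exact (integrableOn_finset_iUnion (s := fareyPairs Q)).2 hint
  · rw [intervalIntegral.integral_of_le zero_le_one, integral_Ioc_eq_integral_Ioo,
      setIntegral_congr_set hae]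
    exact integral_biUnion_finset _ (fun p _ => measurableSet_Ioo)
      (pairwiseDisjoint_fareyArc Q) hint

lemma measurable_bothLE {X : Type*} [MeasurableSpace X] {u v : X → ℝ} (a b : ℝ)
    (hu : Measurable u) (hv : Measurable v) : Measurable fun x => bothLE a b (u x) (v x) := by
  unfold bothLE
  exact Measurable.ite ((measurableSet_le measurable_const hu).inter
    (measurableSet_le measurable_const hv)) measurable_const measurable_const

lemma measurable_pairFreq {X : Type*} [MeasurableSpace X] {x y A B : X → ℝ} (a b : ℝ)
    (hx : Measurable x) (hy : Measurable y) (hA : Measurable A) (hB : Measurable B) :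
    Measurable fun z => pairFreq a b (x z) (y z) (A z) (B z) := by
  have hAB := hA.add hB
  have m1 := measurable_bothLE a b hA hA
  have m2 := measurable_bothLE a b hA hB
  have m3 := measurable_bothLE a b hB hA
  have m4 := measurable_bothLE a b hB hB
  have m5 := measurable_bothLE a b hA hAB
  have m6 := measurable_bothLE a b hB hAB
  have m7 := measurable_bothLE a b hAB hA
  have m8 := measurable_bothLE a b hAB hB
  have m9 := measurable_bothLE a b hAB hAB
  simp only [Pi.add_apply] at *
  unfold pairFreq freqSame freqMixed freqSum freqSumSum
  fun_prop

lemma bothLE_nonneg (a b u v : ℝ) : 0 ≤ bothLE a b u v := by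
  unfold bothLE; split_ifs <;> norm_num

lemma bothLE_le_one (a b u v : ℝ) : bothLE a b u v ≤ 1 := by
  unfold bothLE; split_ifs <;> norm_num

lemma freqSame_nonneg (x : ℝ) : 0 ≤ freqSame x := le_max_left _ _
lemma freqSum_nonneg (x y : ℝ) : 0 ≤ freqSum x y := le_max_left _ _
lemma freqSumSum_nonneg (x y : ℝ) : 0 ≤ freqSumSum x y := le_max_left _ _
lemma freqMixed_nonneg {x y : ℝ} (hx : x ≤ 1) (hy : y ≤ 1) : 0 ≤ freqMixed x y :=
  le_min (by linarith) (by linarith)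
lemma freqSame_le_one {x : ℝ} (hx : 0 ≤ x) : freqSame x ≤ 1 :=
  max_le (by norm_num) (by linarith)
lemma freqMixed_le_one {x y : ℝ} (hx : 0 ≤ x) : freqMixed x y ≤ 1 :=
  (min_le_left _ _).trans (by linarith)
lemma freqSum_le_one {x y : ℝ} (hx : 0 ≤ x) (hy : y ≤ 1) : freqSum x y ≤ 1 :=
  max_le (by norm_num) (by have := le_max_left x (1 - x); linarith)
lemma freqSumSum_le_one {x y : ℝ} (hx : x ≤ 1) : freqSumSum x y ≤ 1 :=
  max_le (by norm_num) (by have := min_le_left x y; linarith)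

lemma pairFreq_nonneg (a b : ℝ) {x y : ℝ} (hx : x ≤ 1) (hy : y ≤ 1) (A B : ℝ) :
    0 ≤ pairFreq a b x y A B := by
  have := freqMixed_nonneg hx hy
  have h := bothLE_nonneg a b
  have := freqSame_nonneg x; have := freqSame_nonneg y
  have := freqSum_nonneg x y; have := freqSum_nonneg y x; have := freqSumSum_nonneg x y
  unfold pairFreq
  have := h A A; have := h A B; have := h B A; have := h B B; have := h A (A + B)
  have := h (A + B) A; have := h B (A + B); have := h (A + B) B; have := h (A + B) (A + B)
  positivity

/-- The sum of nine products of numbers in `[0, 1]`. The crude constant is enough, because the bound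
only serves for domination and error terms. -/
lemma pairFreq_le (a b : ℝ) {x y : ℝ} (hx0 : 0 ≤ x) (hy0 : 0 ≤ y) (hx : x ≤ 1) (hy : y ≤ 1)
    (A B : ℝ) : pairFreq a b x y A B ≤ 9 := by
  have h0 := bothLE_nonneg a b
  have h1 := bothLE_le_one a b
  have key : ∀ u v : ℝ, 0 ≤ u → u ≤ 1 → 0 ≤ v → v ≤ 1 → u * v ≤ 1 :=
    fun u v a1 a2 a3 a4 => mul_le_one₀ a2 a3 a4
  have i1 := key _ _ (freqSame_nonneg x) (freqSame_le_one hx0) (h0 A A) (h1 A A)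
  have i2 := key _ _ (freqSame_nonneg y) (freqSame_le_one hy0) (h0 B B) (h1 B B)
  have i3 := key _ _ (freqMixed_nonneg hx hy) (freqMixed_le_one (y := y) hx0) (h0 A B) (h1 A B)
  have i4 := key _ _ (freqMixed_nonneg hx hy) (freqMixed_le_one (y := y) hx0) (h0 B A) (h1 B A)
  have i5 := key _ _ (freqSum_nonneg x y) (freqSum_le_one hx0 hy) (h0 A (A + B)) (h1 A (A + B))
  have i6 := key _ _ (freqSum_nonneg x y) (freqSum_le_one hx0 hy) (h0 (A + B) A) (h1 (A + B) A)
  have i7 := key _ _ (freqSum_nonneg y x) (freqSum_le_one hy0 hx) (h0 B (A + B)) (h1 B (A + B))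
  have i8 := key _ _ (freqSum_nonneg y x) (freqSum_le_one hy0 hx) (h0 (A + B) B) (h1 (A + B) B)
  have i9 := key _ _ (freqSumSum_nonneg x y) (freqSumSum_le_one (y := y) hx)
    (h0 (A + B) (A + B)) (h1 (A + B) (A + B))
  unfold pairFreq
  linarith

lemma abs_pairFreq_le (a b : ℝ) {x y : ℝ} (hx0 : 0 ≤ x) (hy0 : 0 ≤ y) (hx : x ≤ 1) (hy : y ≤ 1)
    (A B : ℝ) : |pairFreq a b x y A B| ≤ 9 := by
  rw [abs_of_nonneg (pairFreq_nonneg a b hx hy A B)]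
  exact pairFreq_le a b hx0 hy0 hx hy A B

/-- The integral of the weighted pair frequency over one arc, scaled to length `1`. -/
noncomputable def arcIntegral (a b : ℝ) (χ : ℝ → ℝ) (Q : ℕ) (p : ℕ × ℕ) : ℝ :=
  ∫ t in (0 : ℝ)..1, pairFreq a b (p.1 / Q) (p.2 / Q) (t / (p.2 / Q)) ((1 - t) / (p.1 / Q))
    * χ ((leftNum p.1 p.2 : ℝ) / p.1 + t / (p.1 * p.2))

lemma integrableOn_fareyArc {Q : ℕ} {p : ℕ × ℕ} (hp : p ∈ fareyPairs Q) (a b : ℝ)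
    {χ : ℝ → ℝ} (hχ : Continuous χ) :
    IntegrableOn (fun α => (pairCount Q a b α : ℝ) / Q * χ α) (fareyArc p) := by
  obtain ⟨⟨h1, h2⟩, ⟨h3, h4⟩, h5, h6⟩ := mem_fareyPairs.1 hp
  have hQ : (0 : ℝ) < Q := by exact_mod_cast lt_of_lt_of_le h1 h2
  have x1 : (p.1 : ℝ) / Q ≤ 1 := by rw [div_le_one hQ]; exact_mod_cast h2
  have x2 : (p.2 : ℝ) / Q ≤ 1 := by rw [div_le_one hQ]; exact_mod_cast h4
  have e : Set.EqOn (fun α => (pairCount Q a b α : ℝ) / Q * χ α)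
      (fun α => pairFreq a b (p.1 / Q) (p.2 / Q) (Q * (p.1 * α - leftNum p.1 p.2))
        (Q * (rightNum p.1 p.2 - p.2 * α)) * χ α) (fareyArc p) := by
    intro α hα
    simp only
    rw [(isFareyArc_of_mem hp hα).pairCount_div]
  rw [integrableOn_congr_fun e measurableSet_Ioo]
  have hχi : IntegrableOn χ (fareyArc p) :=
    ((hχ.continuousOn (s := Set.Icc _ _)).integrableOn_Icc).mono_set Set.Ioo_subset_Icc_self
  refine Integrable.bdd_mul (c := 9) hχi ?_ ?_
  · exact (measurable_pairFreq a b measurable_const measurable_const (by fun_prop)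
      (by fun_prop)).aestronglyMeasurable
  · refine Eventually.of_forall fun α => ?_
    exact abs_pairFreq_le a b (by positivity) (by positivity) x1 x2 _ _

/-- The substitution `α = a / q + t / (q q')` has Jacobian `1 / (q q')` and turns the scaled gaps `Q
A`, `Q B` into `t / (q' / Q)` and `(1 - t) / (q / Q)`. -/
lemma setIntegral_fareyArc {Q : ℕ} {p : ℕ × ℕ} (hp : p ∈ fareyPairs Q) (a b : ℝ)
    (χ : ℝ → ℝ) :
    ∫ α in fareyArc p, (pairCount Q a b α : ℝ) / Q * χ α
      = 1 / (p.1 * p.2) * arcIntegral a b χ Q p := by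
  obtain ⟨⟨h1, h2⟩, ⟨h3, h4⟩, h5, h6⟩ := mem_fareyPairs.1 hp
  have hQ : (0 : ℝ) < Q := by exact_mod_cast lt_of_lt_of_le h1 h2
  have p1 : (0 : ℝ) < p.1 := by exact_mod_cast h1
  have p2 : (0 : ℝ) < p.2 := by exact_mod_cast h3
  have hlen := right_sub_left hp
  have hle : (leftNum p.1 p.2 : ℝ) / p.1 ≤ (rightNum p.1 p.2 : ℝ) / p.2 := by
    rw [hlen]; have : 0 < 1 / ((p.1 : ℝ) * p.2) := by positivity
    linarith
  have e : ∫ α in fareyArc p, (pairCount Q a b α : ℝ) / Q * χ α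
      = ∫ α in fareyArc p, pairFreq a b (p.1 / Q) (p.2 / Q) (Q * (p.1 * α - leftNum p.1 p.2))
        (Q * (rightNum p.1 p.2 - p.2 * α)) * χ α := by
    refine setIntegral_congr_fun measurableSet_Ioo fun α hα => ?_
    rw [(isFareyArc_of_mem hp hα).pairCount_div]
  have key := intervalIntegral.integral_comp_mul_add (a := 0) (b := 1)
    (fun α => pairFreq a b (p.1 / Q) (p.2 / Q) (Q * (p.1 * α - leftNum p.1 p.2))
        (Q * (rightNum p.1 p.2 - p.2 * α)) * χ α)
    (c := 1 / ((p.1 : ℝ) * p.2)) (by positivity) ((leftNum p.1 p.2 : ℝ) / p.1)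
  rw [e, fareyArc, ← integral_Ioc_eq_integral_Ioo, ← intervalIntegral.integral_of_le hle]
  rw [mul_zero, zero_add, mul_one, add_comm _ ((leftNum p.1 p.2 : ℝ) / p.1), ← hlen,
    smul_eq_mul] at key
  have hr : (rightNum p.1 p.2 : ℝ) = p.2 * ((leftNum p.1 p.2 : ℝ) / p.1 + 1 / (p.1 * p.2)) := by
    rw [← hlen]; field_simp
  have e2 : arcIntegral a b χ Q p = ∫ x in (0 : ℝ)..1, (fun α => pairFreq a b (p.1 / Q) (p.2 / Q)
      (Q * (p.1 * α - leftNum p.1 p.2)) (Q * (rightNum p.1 p.2 - p.2 * α)) * χ α)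
      (1 / ((p.1 : ℝ) * p.2) * x + (leftNum p.1 p.2 : ℝ) / p.1) := by
    refine intervalIntegral.integral_congr fun t _ => ?_
    simp only
    congr 2
    · field_simp
      ring
    · rw [hr]; field_simp; ring
    · ring
  rw [e2, key]
  field_simp

lemma integral_pairCount {Q : ℕ} (hQ : 1 ≤ Q) (a b : ℝ) {χ : ℝ → ℝ} (hχ : Continuous χ) :
    IntervalIntegrable (fun α => (pairCount Q a b α : ℝ) / Q * χ α) volume 0 1 ∧
    ∫ α in (0 : ℝ)..1, (pairCount Q a b α : ℝ) / Q * χ α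
      = ∑ p ∈ fareyPairs Q, 1 / ((p.1 : ℝ) * p.2) * arcIntegral a b χ Q p := by
  obtain ⟨h1, h2⟩ := integral_eq_sum_fareyArc hQ
    (fun α => (pairCount Q a b α : ℝ) / Q * χ α) fun p hp => integrableOn_fareyArc hp a b hχ
  exact ⟨h1, h2.trans (Finset.sum_congr rfl fun p hp => setIntegral_fareyArc hp a b χ)⟩

end GapDistribution

/-! ### Riemann sums against equidistributed weights. -/

namespace GapDistribution

open MeasureTheory

/-- The half-open unit square. -/
def unitSquare : Set (ℝ × ℝ) := Set.Ioc 0 1 ×ˢ Set.Ioc 0 1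

/-- The cells of the `K × K` grid on the unit square. -/
def gridCell (K : ℕ) (i : ℕ × ℕ) : Set (ℝ × ℝ) :=
  Set.Ioc ((i.1 : ℝ) / K) ((i.1 + 1) / K) ×ˢ Set.Ioc ((i.2 : ℝ) / K) ((i.2 + 1) / K)

/-- Weights on pairs of natural numbers whose scaled sums over rectangles converge to `c` times
the area. -/
def Equidistributed (w : ℕ → ℕ → ℝ) (c : ℝ) : Prop :=
  ∀ u₁ u₂ v₁ v₂ : ℝ, 0 ≤ u₁ → u₁ ≤ u₂ → 0 ≤ v₁ → v₁ ≤ v₂ →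
    Tendsto (fun Q : ℕ => (∑ q ∈ Finset.Ioc ⌊u₁ * Q⌋₊ ⌊u₂ * Q⌋₊,
      ∑ q' ∈ Finset.Ioc ⌊v₁ * Q⌋₊ ⌊v₂ * Q⌋₊, w q q') / (Q : ℝ) ^ 2) atTop
      (𝓝 (c * ((u₂ - u₁) * (v₂ - v₁))))

/-- The scaled weighted sum of a function over the integer points of a square. -/
noncomputable def gridSum (w : ℕ → ℕ → ℝ) (Φ : ℝ × ℝ → ℝ) (Q : ℕ) : ℝ :=
  (∑ p ∈ Finset.Icc 1 Q ×ˢ Finset.Icc 1 Q, w p.1 p.2 * Φ ((p.1 : ℝ) / Q, (p.2 : ℝ) / Q))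
    / (Q : ℝ) ^ 2

lemma exists_gridCell_index {K : ℕ} (hK : 0 < K) {x : ℝ} (hx : x ∈ Set.Ioc (0 : ℝ) 1) :
    ∃ i < K, x ∈ Set.Ioc ((i : ℝ) / K) ((i + 1) / K) := by
  have hK' : (0 : ℝ) < K := by exact_mod_cast hK
  have h0 : 0 < ⌈x * K⌉₊ := Nat.ceil_pos.2 (mul_pos hx.1 hK')
  -- The cells are open on the left, so the index is a ceiling minus one and not a floor.
  refine ⟨⌈x * K⌉₊ - 1, ?_, ?_, ?_⟩
  · have : ⌈x * K⌉₊ ≤ K := Nat.ceil_le.2 (by nlinarith [hx.2])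
    omega
  · rw [div_lt_iff₀ hK']
    have := Nat.ceil_lt_add_one (mul_nonneg hx.1.le hK'.le)
    rw [Nat.cast_sub (by omega)]; push_cast; linarith
  · rw [le_div_iff₀ hK', Nat.cast_sub (by omega)]
    have := Nat.le_ceil (x * K)
    push_cast; linarith

lemma gridCell_index_unique {K : ℕ} {x : ℝ} {i j : ℕ}
    (hi : x ∈ Set.Ioc ((i : ℝ) / K) ((i + 1) / K)) (hj : x ∈ Set.Ioc ((j : ℝ) / K) ((j + 1) / K)) :
    i = j := by
  rcases Nat.eq_zero_or_pos K with rfl | hK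
  · simp at hi
  have hK' : (0 : ℝ) < K := by exact_mod_cast hK
  have h1 := hi.1.trans_le hj.2
  have h2 := hj.1.trans_le hi.2
  rw [div_lt_div_iff_of_pos_right hK'] at h1 h2
  have h1 : i < j + 1 := by exact_mod_cast h1
  have h2 : j < i + 1 := by exact_mod_cast h2
  omega

lemma gridCell_subset {K : ℕ} {i : ℕ × ℕ}
    (hi : i ∈ Finset.range K ×ˢ Finset.range K) : gridCell K i ⊆ unitSquare := by
  obtain ⟨h1, h2⟩ := Finset.mem_product.1 hi
  rw [Finset.mem_range] at h1 h2
  have hK' : (0 : ℝ) < K := by exact_mod_cast (by omega : 0 < K)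
  refine Set.prod_mono (Set.Ioc_subset_Ioc (by positivity) ?_)
    (Set.Ioc_subset_Ioc (by positivity) ?_)
  · rw [div_le_one hK']; exact_mod_cast h1
  · rw [div_le_one hK']; exact_mod_cast h2

/-- The upper step function of `Φ` on the `K × K` grid. -/
noncomputable def upperStep (Φ : ℝ × ℝ → ℝ) (K : ℕ) (z : ℝ × ℝ) : ℝ :=
  ∑ i ∈ Finset.range K ×ˢ Finset.range K,
    (gridCell K i).indicator (fun _ => sSup (Φ '' gridCell K i)) z

lemma upperStep_eq {Φ : ℝ × ℝ → ℝ} {K : ℕ} {i : ℕ × ℕ}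
    (hi : i ∈ Finset.range K ×ˢ Finset.range K) {z : ℝ × ℝ} (hz : z ∈ gridCell K i) :
    upperStep Φ K z = sSup (Φ '' gridCell K i) := by
  rw [upperStep, Finset.sum_eq_single_of_mem i hi, Set.indicator_of_mem hz]
  intro j hj hne
  refine Set.indicator_of_notMem (fun hzj => hne ?_) _
  exact Prod.ext (gridCell_index_unique hzj.1 hz.1) (gridCell_index_unique hzj.2 hz.2)

lemma exists_gridCell {K : ℕ} (hK : 0 < K) {z : ℝ × ℝ} (hz : z ∈ unitSquare) :
    ∃ i ∈ Finset.range K ×ˢ Finset.range K, z ∈ gridCell K i := by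
  obtain ⟨i, hi, h1⟩ := exists_gridCell_index hK hz.1
  obtain ⟨j, hj, h2⟩ := exists_gridCell_index hK hz.2
  exact ⟨(i, j), by simp [hi, hj], h1, h2⟩

lemma volume_unitSquare : volume unitSquare = 1 := by
  rw [unitSquare, Measure.volume_eq_prod, Measure.prod_prod, Real.volume_Ioc]
  simp

lemma volume_gridCell (K : ℕ) (i : ℕ × ℕ) :
    volume.real (gridCell K i) = (((i.1 : ℝ) + 1) / K - i.1 / K) * ((i.2 + 1) / K - i.2 / K) := by
  rw [gridCell, Measure.volume_eq_prod, measureReal_prod_prod, Real.volume_real_Ioc_of_le,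
    Real.volume_real_Ioc_of_le] <;> gcongr <;> linarith

/-- A cell is half-open on the same side as the ranges in `Equidistributed`: `q / Q ∈ (u, v]`
exactly when `⌊u Q⌋ < q ≤ ⌊v Q⌋`. Hence the two sums agree without boundary error. -/
lemma tendsto_gridSum_indicator {w : ℕ → ℕ → ℝ} {c : ℝ} (hw : Equidistributed w c) {K : ℕ}
    {i : ℕ × ℕ} (hi : i ∈ Finset.range K ×ˢ Finset.range K) (U : ℝ) :
    Tendsto (gridSum w ((gridCell K i).indicator fun _ => U)) atTop
      (𝓝 (c * ∫ z in unitSquare, (gridCell K i).indicator (fun _ => U) z)) := by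
  obtain ⟨h1, h2⟩ := Finset.mem_product.1 hi
  rw [Finset.mem_range] at h1 h2
  have hK' : (0 : ℝ) < K := by exact_mod_cast (by omega : 0 < K)
  have hm : MeasurableSet (gridCell K i) := measurableSet_Ioc.prod measurableSet_Ioc
  have hint : ∫ z in unitSquare, (gridCell K i).indicator (fun _ => U) z
      = volume.real (gridCell K i) * U := by
    rw [setIntegral_indicator hm, Set.inter_eq_self_of_subset_right (gridCell_subset hi),
      setIntegral_const, smul_eq_mul]
  have key := (hw ((i.1 : ℝ) / K) ((i.1 + 1) / K) ((i.2 : ℝ) / K) ((i.2 + 1) / K) (by positivity)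
    (by gcongr; linarith) (by positivity) (by gcongr; linarith)).mul_const U
  rw [hint, volume_gridCell, ← mul_assoc]
  refine key.congr' ?_
  filter_upwards [eventually_gt_atTop 0] with Q hQ
  classical
  have hQ' : (0 : ℝ) < Q := by exact_mod_cast hQ
  have hmem : ∀ (l : ℕ) (x : ℕ), x ∈ Finset.Ioc ⌊((l : ℝ) / K) * Q⌋₊ ⌊(((l : ℝ) + 1) / K) * Q⌋₊ ↔
      (x : ℝ) / Q ∈ Set.Ioc ((l : ℝ) / K) ((l + 1) / K) := by
    intro l x
    rw [Finset.mem_Ioc, Nat.floor_lt (by positivity), Nat.le_floor_iff (by positivity), Set.mem_Ioc,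
      lt_div_iff₀ hQ', div_le_iff₀ hQ']
  rw [gridSum, div_mul_eq_mul_div]
  congr 1
  rw [← Finset.sum_product', Finset.sum_mul]
  symm
  rw [← Finset.sum_filter_of_ne (p := fun p : ℕ × ℕ =>
    ((p.1 : ℝ) / Q, (p.2 : ℝ) / Q) ∈ gridCell K i)]
  · refine Finset.sum_congr ?_ ?_
    · ext p
      simp only [Finset.mem_product, Finset.mem_filter, Finset.mem_Icc]
      rw [hmem, hmem]
      refine ⟨fun hp => hp.2, ?_⟩
      · intro hp
        have hu := gridCell_subset hi (show ((p.1 : ℝ) / Q, (p.2 : ℝ) / Q) ∈ gridCell K i from hp)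
        refine ⟨?_, hp⟩
        obtain ⟨⟨a1, a2⟩, a3, a4⟩ := hu
        simp only at a1 a2 a3 a4
        rw [lt_div_iff₀ hQ', zero_mul] at a1 a3
        rw [div_le_one hQ'] at a2 a4
        have a1 : 0 < p.1 := by exact_mod_cast a1
        have a3 : 0 < p.2 := by exact_mod_cast a3
        exact ⟨⟨a1, by exact_mod_cast a2⟩, a3, by exact_mod_cast a4⟩
    · intro p hp
      rw [Finset.mem_product, hmem, hmem] at hp
      rw [Set.indicator_of_mem (show ((p.1 : ℝ) / Q, (p.2 : ℝ) / Q) ∈ gridCell K i from hp)]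
  · intro p _ hne
    by_contra hcon
    rw [Set.indicator_of_notMem hcon, mul_zero] at hne
    exact hne rfl

lemma measurable_upperStep (Φ : ℝ × ℝ → ℝ) (K : ℕ) : Measurable (upperStep Φ K) :=
  Finset.measurable_sum _ fun _ _ =>
    measurable_const.indicator (measurableSet_Ioc.prod measurableSet_Ioc)

lemma tendsto_gridSum_upperStep {w : ℕ → ℕ → ℝ} {c : ℝ} (hw : Equidistributed w c) (K : ℕ)
    (Φ : ℝ × ℝ → ℝ) :
    Tendsto (gridSum w (upperStep Φ K)) atTop
      (𝓝 (c * ∫ z in unitSquare, upperStep Φ K z)) := by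
  have h := tendsto_finsetSum (Finset.range K ×ˢ Finset.range K)
    fun i hi => tendsto_gridSum_indicator hw hi (sSup (Φ '' gridCell K i))
  have e : ∫ z in unitSquare, upperStep Φ K z = ∑ i ∈ Finset.range K ×ˢ Finset.range K,
      ∫ z in unitSquare, (gridCell K i).indicator (fun _ => sSup (Φ '' gridCell K i)) z := by
    unfold upperStep
    refine integral_finsetSum _ fun i hi => ?_
    refine (integrable_indicator_iff (measurableSet_Ioc.prod measurableSet_Ioc)).2 ?_
    refine integrableOn_const ?_
    refine ne_of_lt (lt_of_le_of_lt (Measure.restrict_apply_le _ _) ?_)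
    refine (measure_mono (gridCell_subset hi)).trans_lt ?_
    rw [volume_unitSquare]
    exact ENNReal.one_lt_top
  rw [e, Finset.mul_sum]
  refine h.congr fun Q => ?_
  simp only [gridSum, upperStep]
  rw [← Finset.sum_div, Finset.sum_comm]
  simp only [Finset.mul_sum]

lemma measurableSet_unitSquare : MeasurableSet unitSquare := measurableSet_Ioc.prod measurableSet_Ioc

section

variable {Φ : ℝ × ℝ → ℝ} {M : ℝ}

lemma bddAbove_image_gridCell (hM : ∀ z ∈ unitSquare, |Φ z| ≤ M) {K : ℕ} {i : ℕ × ℕ}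
    (hi : i ∈ Finset.range K ×ˢ Finset.range K) : BddAbove (Φ '' gridCell K i) := by
  refine ⟨M, ?_⟩
  rintro _ ⟨z, hz, rfl⟩
  exact (abs_le.1 (hM z (gridCell_subset hi hz))).2

lemma le_upperStep (hM : ∀ z ∈ unitSquare, |Φ z| ≤ M) {K : ℕ} (hK : 0 < K) {z : ℝ × ℝ}
    (hz : z ∈ unitSquare) : Φ z ≤ upperStep Φ K z := by
  obtain ⟨i, hi, hzi⟩ := exists_gridCell hK hz
  rw [upperStep_eq hi hzi]
  exact le_csSup (bddAbove_image_gridCell hM hi) ⟨z, hzi, rfl⟩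

lemma upperStep_le (hM : ∀ z ∈ unitSquare, |Φ z| ≤ M) {K : ℕ} (hK : 0 < K) {z : ℝ × ℝ}
    (hz : z ∈ unitSquare) : upperStep Φ K z ≤ M := by
  obtain ⟨i, hi, hzi⟩ := exists_gridCell hK hz
  rw [upperStep_eq hi hzi]
  refine csSup_le ⟨_, z, hzi, rfl⟩ ?_
  rintro _ ⟨z', hz', rfl⟩
  exact (abs_le.1 (hM z' (gridCell_subset hi hz'))).2

lemma tendsto_upperStep (hM : ∀ z ∈ unitSquare, |Φ z| ≤ M) {z : ℝ × ℝ}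
    (hz : z ∈ unitSquare) (hc : ContinuousAt Φ z) :
    Tendsto (fun K => upperStep Φ K z) atTop (𝓝 (Φ z)) := by
  rw [Metric.tendsto_atTop]
  intro ε hε
  obtain ⟨δ, hδ, hδ'⟩ := Metric.continuousAt_iff.1 hc (ε / 2) (by linarith)
  obtain ⟨N, hN⟩ := exists_nat_gt (1 / δ)
  refine ⟨N + 1, fun K hK => ?_⟩
  have hK0 : 0 < K := by omega
  have hK' : (0 : ℝ) < K := by exact_mod_cast hK0
  have hKδ : 1 / (K : ℝ) < δ := by
    rw [div_lt_iff₀ hK']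
    rw [div_lt_iff₀ hδ] at hN
    have : (N : ℝ) + 1 ≤ K := by exact_mod_cast hK
    nlinarith
  obtain ⟨i, hi, hzi⟩ := exists_gridCell hK0 hz
  have h1 := le_upperStep hM hK0 hz
  have h2 : upperStep Φ K z ≤ Φ z + ε / 2 := by
    rw [upperStep_eq hi hzi]
    refine csSup_le ⟨_, z, hzi, rfl⟩ ?_
    rintro _ ⟨z', hz', rfl⟩
    have hd : dist z' z < δ := by
      have w : ∀ l : ℕ, ((l : ℝ) + 1) / K = l / K + 1 / K := by intro l; ring
      rw [Prod.dist_eq, max_lt_iff, Real.dist_eq, Real.dist_eq, abs_lt, abs_lt]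
      obtain ⟨⟨a1, a2⟩, a3, a4⟩ := hz'
      obtain ⟨⟨b1, b2⟩, b3, b4⟩ := hzi
      rw [w] at a2 a4 b2 b4
      refine ⟨⟨?_, ?_⟩, ?_, ?_⟩ <;> linarith
    have := hδ' hd
    rw [Real.dist_eq, abs_lt] at this
    linarith [this.2]
  rw [Real.dist_eq, abs_lt]
  constructor <;> linarith

/-- The upper steps converge at every continuity point, and dominated convergence does the rest. The
index `K + 1` avoids the empty grid. -/
lemma tendsto_integral_upperStep (hM : ∀ z ∈ unitSquare, |Φ z| ≤ M)
    (hc : ∀ᵐ z, z ∈ unitSquare → ContinuousAt Φ z) :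
    Tendsto (fun K => ∫ z in unitSquare, upperStep Φ (K + 1) z) atTop
      (𝓝 (∫ z in unitSquare, Φ z)) := by
  have : IsFiniteMeasure (volume.restrict unitSquare) :=
    ⟨by rw [Measure.restrict_apply_univ, volume_unitSquare]; exact ENNReal.one_lt_top⟩
  refine tendsto_integral_of_dominated_convergence (fun _ => M)
    (fun K => (measurable_upperStep Φ _).aestronglyMeasurable) (integrable_const M) ?_ ?_
  · intro K
    filter_upwards [ae_restrict_mem measurableSet_unitSquare] with z hz
    rw [Real.norm_eq_abs, abs_le]
    exact ⟨(abs_le.1 (hM z hz)).1.trans (le_upperStep hM K.succ_pos hz),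
      upperStep_le hM K.succ_pos hz⟩
  · rw [ae_restrict_iff' measurableSet_unitSquare]
    filter_upwards [hc] with z hz hz'
    exact (tendsto_upperStep hM hz' (hz hz')).comp (tendsto_add_atTop_nat 1)

/-- Nonnegative weights make the weighted sum monotone in the function, so `Φ` may be replaced by an
upper step function whose integral is close. -/
lemma eventually_gridSum_le {w : ℕ → ℕ → ℝ} {c : ℝ} (hw : Equidistributed w c)
    (hw0 : ∀ q q', 0 ≤ w q q') (hM : ∀ z ∈ unitSquare, |Φ z| ≤ M)
    (hc : ∀ᵐ z, z ∈ unitSquare → ContinuousAt Φ z) {ε : ℝ} (hε : 0 < ε) :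
    ∀ᶠ Q in atTop, gridSum w Φ Q ≤ c * (∫ z in unitSquare, Φ z) + ε := by
  have h1 := (tendsto_integral_upperStep hM hc).const_mul c
  obtain ⟨K, hK⟩ := (h1.eventually (gt_mem_nhds (show c * (∫ z in unitSquare, Φ z)
    < c * (∫ z in unitSquare, Φ z) + ε / 2 by linarith))).exists
  have h2 := tendsto_gridSum_upperStep hw (K + 1) Φ
  filter_upwards [h2.eventually (gt_mem_nhds hK |>.mono fun x hx => hx), eventually_gt_atTop 0]
    with Q hQ hQ0
  have hQ' : (0 : ℝ) < Q := by exact_mod_cast hQ0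
  have : gridSum w Φ Q ≤ gridSum w (upperStep Φ (K + 1)) Q := by
    unfold gridSum
    gcongr with p hp
    · exact hw0 _ _
    · refine le_upperStep hM K.succ_pos ?_
      obtain ⟨hp1, hp2⟩ := Finset.mem_product.1 hp
      rw [Finset.mem_Icc] at hp1 hp2
      have i1 : (0 : ℝ) < p.1 := by exact_mod_cast hp1.1
      have i2 : (0 : ℝ) < p.2 := by exact_mod_cast hp2.1
      refine ⟨⟨by positivity, ?_⟩, by positivity, ?_⟩
      · simp only; rw [div_le_one hQ']; exact_mod_cast hp1.2
      · simp only; rw [div_le_one hQ']; exact_mod_cast hp2.2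
  linarith

/-- Scaled sums against equidistributed nonnegative weights of a bounded, almost everywhere
continuous function converge to its integral. -/
theorem tendsto_gridSum {w : ℕ → ℕ → ℝ} {c : ℝ} (hw : Equidistributed w c)
    (hw0 : ∀ q q', 0 ≤ w q q') (hM : ∀ z ∈ unitSquare, |Φ z| ≤ M)
    (hc : ∀ᵐ z, z ∈ unitSquare → ContinuousAt Φ z) :
    Tendsto (gridSum w Φ) atTop (𝓝 (c * ∫ z in unitSquare, Φ z)) := by
  rw [Metric.tendsto_atTop']
  intro ε hε
  have h1 := eventually_gridSum_le hw hw0 hM hc (half_pos hε)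
  -- The upper bound for `-Φ` is the lower bound for `Φ`.
  have h2 := eventually_gridSum_le (Φ := -Φ) hw hw0 (M := M) (by simpa using hM)
    (hc.mono fun z hz hz' => (hz hz').neg) (half_pos hε)
  obtain ⟨N, hN⟩ := eventually_atTop.1 (h1.and h2)
  refine ⟨N, fun Q hQ => ?_⟩
  obtain ⟨a1, a2⟩ := hN Q hQ.le
  have e1 : gridSum w (-Φ) Q = -gridSum w Φ Q := by
    simp [gridSum, neg_div]
  have e2 : ∫ z in unitSquare, (-Φ) z = -∫ z in unitSquare, Φ z := by
    simp [integral_neg]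
  rw [e1, e2] at a2
  rw [Real.dist_eq, abs_lt]
  constructor <;> linarith

end

end GapDistribution

/-! ### The density of coprime pairs. -/

namespace GapDistribution

open ArithmeticFunction

lemma sum_moebius_divisors (n : ℕ) :
    ∑ d ∈ n.divisors, ((moebius d : ℤ) : ℝ) = if n = 1 then 1 else 0 := by
  have h := congrArg (fun f : ArithmeticFunction ℤ => f n) moebius_mul_coe_zeta
  simp only [coe_mul_zeta_apply, one_apply] at h
  exact_mod_cast h

/-- The Dirichlet series of the Möbius function at 2 is `1 / ζ(2)`; the term `d = 0` vanishes. -/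
lemma tsum_moebius_div_sq : ∑' d : ℕ, ((moebius d : ℤ) : ℝ) * (1 / (d : ℝ)) * (1 / (d : ℝ))
    = 6 / Real.pi ^ 2 := by
  have h2 : (1 : ℝ) < (2 : ℂ).re := by norm_num
  have h := LSeries_one_mul_Lseries_moebius h2
  rw [LSeries_one_eq_riemannZeta h2, riemannZeta_two] at h
  have e : LSeries (fun n => ((moebius n : ℤ) : ℂ)) 2
      = ((∑' d : ℕ, ((moebius d : ℤ) : ℝ) * (1 / (d : ℝ)) * (1 / (d : ℝ)) : ℝ) : ℂ) := by
    rw [LSeries, Complex.ofReal_tsum]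
    refine tsum_congr fun d => ?_
    rcases eq_or_ne d 0 with rfl | hd
    · simp
    · rw [LSeries.term_of_ne_zero hd]
      have : (d : ℂ) ≠ 0 := by exact_mod_cast hd
      push_cast
      rw [show (2 : ℂ) = ((2 : ℕ) : ℂ) by norm_num, Complex.cpow_natCast]
      field_simp
  rw [e] at h
  have h' : Real.pi ^ 2 / 6 * (∑' d : ℕ, ((moebius d : ℤ) : ℝ) * (1 / (d : ℝ)) * (1 / (d : ℝ))) = 1 := by
    exact_mod_cast h
  have := Real.pi_pos
  field_simp at h' ⊢
  linarith

lemma sum_Ioc_dvd {a b : ℕ} (h : a ≤ b) (d : ℕ) :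
    ∑ q ∈ Finset.Ioc a b, (if d ∣ q then (1 : ℝ) else 0) = ((b / d : ℕ) : ℝ) - ((a / d : ℕ) : ℝ) := by
  have key : ∀ n, ∑ q ∈ Finset.Ioc 0 n, (if d ∣ q then (1 : ℝ) else 0) = ((n / d : ℕ) : ℝ) := by
    intro n
    rw [← Nat.Ioc_filter_dvd_card_eq_div, Finset.card_filter]
    push_cast; rfl
  have := Finset.sum_Ioc_consecutive (fun q => if d ∣ q then (1 : ℝ) else 0) (Nat.zero_le a) h
  rw [key, key] at this
  linarith

/-- Möbius inversion over the common divisors of `q` and `q'`. Only `d ≤ b` contributes; the sum is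
written over all `d` so that dominated convergence applies to growing rectangles. -/
lemma sum_coprime_rectangle {a b c e : ℕ} (hab : a ≤ b) (hce : c ≤ e) :
    ∑ q ∈ Finset.Ioc a b, ∑ q' ∈ Finset.Ioc c e, (if Nat.Coprime q q' then (1 : ℝ) else 0)
      = ∑' d : ℕ, ((moebius d : ℤ) : ℝ) * (((b / d : ℕ) : ℝ) - ((a / d : ℕ) : ℝ))
        * (((e / d : ℕ) : ℝ) - ((c / d : ℕ) : ℝ)) := by
  rw [tsum_eq_sum (s := Finset.range (b + 1))]
  swap
  · intro d hd
    rw [Finset.mem_range] at hd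
    rw [Nat.div_eq_of_lt (by omega : b < d), Nat.div_eq_of_lt (by omega : a < d)]
    simp
  simp only [← sum_Ioc_dvd hab, ← sum_Ioc_dvd hce, mul_assoc, Finset.sum_mul_sum]
  simp only [Finset.mul_sum]
  symm
  rw [Finset.sum_comm]
  refine Finset.sum_congr rfl fun q hq => ?_
  rw [Finset.sum_comm]
  refine Finset.sum_congr rfl fun q' hq' => ?_
  rw [Finset.mem_Ioc] at hq
  have hg : 0 < Nat.gcd q q' := Nat.gcd_pos_of_pos_left _ (by omega)
  rw [show (if Nat.Coprime q q' then (1 : ℝ) else 0) = _ from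
    (sum_moebius_divisors (Nat.gcd q q')).symm]
  have : (Nat.gcd q q').divisors
      = (Finset.range (b + 1)).filter (fun d => d ∣ q ∧ d ∣ q') := by
    ext d
    simp only [Nat.mem_divisors, Finset.mem_filter, Finset.mem_range, Nat.dvd_gcd_iff]
    constructor
    · rintro ⟨⟨h1, h2⟩, -⟩
      exact ⟨by have := Nat.le_of_dvd (by omega) h1; omega, h1, h2⟩
    · rintro ⟨-, h1, h2⟩
      exact ⟨⟨h1, h2⟩, hg.ne'⟩
  rw [this, Finset.sum_filter]
  refine Finset.sum_congr rfl fun d _ => ?_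
  by_cases h1 : d ∣ q <;> by_cases h2 : d ∣ q' <;> simp [h1, h2]

lemma tendsto_floor_div {u : ℝ} (hu : 0 ≤ u) (d : ℕ) :
    Tendsto (fun Q : ℕ => ((⌊u * Q⌋₊ / d : ℕ) : ℝ) / Q) atTop (𝓝 (u * (1 / d))) := by
  have h := (tendsto_nat_floor_mul_div_atTop (a := u * (1 / (d : ℝ))) (by positivity)).comp
    tendsto_natCast_atTop_atTop
  refine h.congr fun Q => ?_
  simp only [Function.comp]
  rw [← Nat.floor_div_natCast]
  congr 3
  ring

lemma floor_div_le {u : ℝ} (hu : 0 ≤ u) (d Q : ℕ) :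
    ((⌊u * Q⌋₊ / d : ℕ) : ℝ) / Q ≤ u * (1 / d) := by
  rcases Nat.eq_zero_or_pos Q with rfl | hQ
  · simp; positivity
  have hQ' : (0 : ℝ) < Q := by exact_mod_cast hQ
  rw [div_le_iff₀ hQ', ← Nat.floor_div_natCast]
  refine (Nat.floor_le (by positivity)).trans (le_of_eq ?_)
  ring

/-- Coprime pairs have density `6 / π²` in every rectangle. -/
theorem equidistributed_coprime :
    Equidistributed (fun q q' => if Nat.Coprime q q' then 1 else 0) (6 / Real.pi ^ 2) := by
  intro u₁ u₂ v₁ v₂ hu₁ hu hv₁ hv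
  have hu₂ := hu₁.trans hu
  have hv₂ := hv₁.trans hv
  have hfl : ∀ {s t : ℝ} (Q : ℕ), s ≤ t → ⌊s * Q⌋₊ ≤ ⌊t * Q⌋₊ := fun Q h =>
    Nat.floor_mono (mul_le_mul_of_nonneg_right h (Nat.cast_nonneg _))
  set f : ℕ → ℕ → ℝ := fun Q d => ((moebius d : ℤ) : ℝ)
    * (((⌊u₂ * Q⌋₊ / d : ℕ) : ℝ) / Q - ((⌊u₁ * Q⌋₊ / d : ℕ) : ℝ) / Q)
    * (((⌊v₂ * Q⌋₊ / d : ℕ) : ℝ) / Q - ((⌊v₁ * Q⌋₊ / d : ℕ) : ℝ) / Q) with hf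
  have hlim : ∑' d : ℕ, ((moebius d : ℤ) : ℝ) * (u₂ * (1 / d) - u₁ * (1 / d))
      * (v₂ * (1 / d) - v₁ * (1 / d)) = 6 / Real.pi ^ 2 * ((u₂ - u₁) * (v₂ - v₁)) := by
    rw [← tsum_moebius_div_sq, ← tsum_mul_right]
    refine tsum_congr fun d => ?_
    ring
  have hbd : ∀ {s t : ℝ} (Q d : ℕ), 0 ≤ s → s ≤ t →
      |((⌊t * Q⌋₊ / d : ℕ) : ℝ) / Q - ((⌊s * Q⌋₊ / d : ℕ) : ℝ) / Q| ≤ t * (1 / d) := by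
    intro s t Q d h0 h
    have h1 : ((⌊s * Q⌋₊ / d : ℕ) : ℝ) / Q ≤ ((⌊t * Q⌋₊ / d : ℕ) : ℝ) / Q := by
      gcongr
    have h2 : (0 : ℝ) ≤ ((⌊s * Q⌋₊ / d : ℕ) : ℝ) / Q := by positivity
    rw [abs_of_nonneg (by linarith)]
    have := floor_div_le (h0.trans h) d Q
    linarith
  have main : Tendsto (fun Q => ∑' d, f Q d) atTop
      (𝓝 (6 / Real.pi ^ 2 * ((u₂ - u₁) * (v₂ - v₁)))) := by
    rw [← hlim]
    -- The scaled count of multiples of `d` is at most the right end point divided by `d`, so the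
    -- terms are dominated by `u₂ v₂ / d²` uniformly in `Q`.
    refine tendsto_tsum_of_dominated_convergence
      (bound := fun d : ℕ => u₂ * v₂ * (1 / (d : ℝ) ^ 2)) ?_ ?_ ?_
    · exact (Real.summable_one_div_nat_pow.2 one_lt_two).mul_left _
    · intro d
      exact (((tendsto_floor_div hu₂ d).sub (tendsto_floor_div hu₁ d)).const_mul _).mul
        ((tendsto_floor_div hv₂ d).sub (tendsto_floor_div hv₁ d))
    · refine Eventually.of_forall fun Q d => ?_
      simp only [hf]
      rw [norm_mul, norm_mul, Real.norm_eq_abs, Real.norm_eq_abs, Real.norm_eq_abs]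
      have h1 : |((moebius d : ℤ) : ℝ)| ≤ 1 := by exact_mod_cast abs_moebius_le_one (n := d)
      have h2 := hbd Q d hu₁ hu
      have h3 := hbd Q d hv₁ hv
      calc _ ≤ 1 * (u₂ * (1 / d)) * (v₂ * (1 / d)) := by gcongr
        _ = _ := by ring
  refine main.congr fun Q => ?_
  rw [sum_coprime_rectangle (hfl Q hu) (hfl Q hv), ← tsum_div_const]
  refine tsum_congr fun d => ?_
  simp only [hf]
  ring

end GapDistribution

/-! ### Second moments of character sums modulo a prime. -/

namespace GapDistribution

section CharacterSums

variable {p : ℕ} [Fact p.Prime] (ψ : AddChar (ZMod p) ℂ)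

/-- The sum of a character over the values of `c / (z (z + 1))`. -/
noncomputable def productSum (c : ZMod p) : ℂ :=
  ∑ z : ZMod p, if z ≠ 0 ∧ z + 1 ≠ 0 then ψ (c * (z * (z + 1))⁻¹) else 0

/-- A character evaluated at `c / z`. -/
noncomputable def inverseChar (c z : ZMod p) : ℂ := if z ≠ 0 then ψ (c * z⁻¹) else 0

variable {ψ}

/-- Orthogonality in `c` leaves `p` times the number of solutions of `z (z + 1) = w (w + 1)`, and
this equation forces `w = z` or `w = -1 - z`. -/
lemma sum_norm_sq_productSum (hψ : ψ.IsPrimitive) :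
    ∑ c : ZMod p, ‖productSum ψ c‖ ^ 2 ≤ 2 * (p : ℝ) ^ 2 := by
  have h1 : ∀ c : ZMod p, ((‖productSum ψ c‖ ^ 2 : ℝ) : ℂ)
      = ∑ z : ZMod p, ∑ w : ZMod p, if (z ≠ 0 ∧ z + 1 ≠ 0) ∧ (w ≠ 0 ∧ w + 1 ≠ 0) then
        ψ (c * ((z * (z + 1))⁻¹ - (w * (w + 1))⁻¹)) else 0 := by
    intro c
    rw [Complex.ofReal_pow, ← Complex.mul_conj']
    unfold productSum
    rw [map_sum, Finset.sum_mul_sum]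
    refine Finset.sum_congr rfl fun z _ => Finset.sum_congr rfl fun w _ => ?_
    split_ifs with h1 h2 h3 h4 h5 h6
    · rw [← AddChar.map_neg_eq_conj, ← AddChar.map_add_eq_mul]
      congr 1; ring
    all_goals first | (exfalso; tauto) | simp
  have h2 : ((∑ c : ZMod p, ‖productSum ψ c‖ ^ 2 : ℝ) : ℂ)
      = ((∑ z : ZMod p, ∑ w : ZMod p, if (z ≠ 0 ∧ z + 1 ≠ 0) ∧ (w ≠ 0 ∧ w + 1 ≠ 0) then
        (if (z * (z + 1))⁻¹ - (w * (w + 1))⁻¹ = 0 then (p : ℝ) else 0) else 0 : ℝ) : ℂ) := by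
    push_cast
    simp only [← Complex.ofReal_pow, h1]
    rw [Finset.sum_comm]
    refine Finset.sum_congr rfl fun z _ => ?_
    rw [Finset.sum_comm]
    refine Finset.sum_congr rfl fun w _ => ?_
    split_ifs with h h'
    · rw [AddChar.sum_mulShift _ hψ, if_pos h', ZMod.card]; simp
    · rw [AddChar.sum_mulShift _ hψ, if_neg h']; simp
    · simp
  rw [Complex.ofReal_inj] at h2
  rw [h2]
  have h3 : ∀ z : ZMod p, (∑ w : ZMod p, if (z ≠ 0 ∧ z + 1 ≠ 0) ∧ (w ≠ 0 ∧ w + 1 ≠ 0) then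
        (if (z * (z + 1))⁻¹ - (w * (w + 1))⁻¹ = 0 then (p : ℝ) else 0) else 0) ≤ 2 * p := by
    intro z
    have hle : ∀ w : ZMod p, (if (z ≠ 0 ∧ z + 1 ≠ 0) ∧ (w ≠ 0 ∧ w + 1 ≠ 0) then
        (if (z * (z + 1))⁻¹ - (w * (w + 1))⁻¹ = 0 then (p : ℝ) else 0) else 0)
        ≤ if w ∈ ({z, -1 - z} : Finset (ZMod p)) then (p : ℝ) else 0 := by
      intro w
      split_ifs with h h' h'' h4
      · exact le_rfl
      · exfalso
        apply h''
        have e := inv_injective (sub_eq_zero.1 h')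
        have : (z - w) * (z + w + 1) = 0 := by linear_combination e
        rcases mul_eq_zero.1 this with h0 | h0
        · simp [sub_eq_zero.1 h0]
        · have : w = -1 - z := by linear_combination h0
          simp [this]
      all_goals first | exact le_rfl | positivity
    refine (Finset.sum_le_sum fun w _ => hle w).trans ?_
    rw [← Finset.sum_filter, Finset.filter_mem_eq_inter, Finset.univ_inter, Finset.sum_const,
      nsmul_eq_mul]
    have : (({z, -1 - z} : Finset (ZMod p)).card : ℝ) ≤ 2 := by
      exact_mod_cast Finset.card_le_two
    gcongr
  refine (Finset.sum_le_sum fun z _ => h3 z).trans ?_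
  rw [Finset.sum_const, Finset.card_univ, ZMod.card, nsmul_eq_mul]
  exact le_of_eq (by ring)

lemma norm_inverseChar_le (c z : ZMod p) : ‖inverseChar ψ c z‖ ≤ 1 := by
  unfold inverseChar
  split_ifs
  · rw [AddChar.norm_apply]
  · simp

/-- Correlations of `inverseChar`. -/
lemma sum_inverseChar_mul_conj {l : ZMod p} (hl : l ≠ 0) (c : ZMod p) :
    ∑ z : ZMod p, inverseChar ψ c (z + l) * (starRingEnd ℂ) (inverseChar ψ c z)
      = productSum ψ (-c * l⁻¹) := by
  unfold productSum
  -- After `z` is scaled by `l`, the difference `c / (z + l) - c / z` becomes `-(c / l) / (z (z +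
  -- 1))`.
  rw [← Equiv.sum_comp (Equiv.mulLeft₀ l hl)]
  refine Finset.sum_congr rfl fun z _ => ?_
  simp only [Equiv.mulLeft₀_apply, inverseChar]
  have e1 : l * z + l = l * (z + 1) := by ring
  rw [e1]
  by_cases h1 : z = 0
  · simp [h1]
  by_cases h2 : z + 1 = 0
  · simp [h2]
  rw [if_pos (mul_ne_zero hl h2), if_pos (mul_ne_zero hl h1), if_pos ⟨h1, h2⟩,
    ← AddChar.map_neg_eq_conj, ← AddChar.map_add_eq_mul]
  congr 1
  field_simp
  ring

/-- Opening the square gives correlations of `inverseChar`. Each of the `j ^ 2` rows has a diagonal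
entry of size at most `p`, and its off-diagonal entries are values of `productSum`, which the second
moment bounds by `2 j p` in total. This saves a factor `j` over the trivial bound `p j ^ 4`, without
any estimate for an individual complete sum. -/
lemma sum_norm_sq_shifts (hψ : ψ.IsPrimitive) {c : ZMod p} (hc : c ≠ 0) {j : ℕ}
    (hj : 1 ≤ j) (hjp : j ^ 2 ≤ p) :
    ∑ z : ZMod p, ‖∑ k ∈ Finset.range (j ^ 2), inverseChar ψ c (z + k)‖ ^ 2
      ≤ 3 * p * (j : ℝ) ^ 3 := by
  set K := Finset.range (j ^ 2) with hK
  have hp0 : (0 : ℝ) ≤ p := Nat.cast_nonneg _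
  have hinj : ∀ k ∈ K, ∀ k' ∈ K, ((k : ℕ) : ZMod p) = k' → k = k' := by
    intro k hk k' hk' h
    rw [hK, Finset.mem_range] at hk hk'
    rw [ZMod.natCast_eq_natCast_iff'] at h
    rwa [Nat.mod_eq_of_lt (by omega), Nat.mod_eq_of_lt (by omega)] at h
  set C : ℕ → ℕ → ℂ := fun k k' =>
    ∑ z : ZMod p, inverseChar ψ c (z + k) * (starRingEnd ℂ) (inverseChar ψ c (z + k')) with hC
  have h1 : ((∑ z : ZMod p, ‖∑ k ∈ K, inverseChar ψ c (z + k)‖ ^ 2 : ℝ) : ℂ)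
      = ∑ k' ∈ K, ∑ k ∈ K, C k k' := by
    push_cast
    simp only [← Complex.mul_conj', map_sum, Finset.sum_mul_sum, hC]
    rw [Finset.sum_comm (s := K) (t := K)]
    rw [Finset.sum_comm]
    refine Finset.sum_congr rfl fun k _ => ?_
    rw [Finset.sum_comm]
  have h2 : ∀ k' ∈ K, ∑ k ∈ K, ‖C k k'‖ ≤ p + 2 * j * p := by
    intro k' hk'
    rw [← Finset.add_sum_erase _ _ hk']
    have d1 : ‖C k' k'‖ ≤ p := by
      refine (norm_sum_le _ _).trans ?_
      refine (Finset.sum_le_sum fun z _ => (?_ : _ ≤ (1 : ℝ))).trans ?_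
      · rw [norm_mul, RCLike.norm_conj]
        exact mul_le_one₀ (norm_inverseChar_le _ _) (norm_nonneg _) (norm_inverseChar_le _ _)
      · simp [ZMod.card]
    have d2 : ∀ k ∈ K.erase k', ‖C k k'‖ = ‖productSum ψ (-c * ((k : ZMod p) - k')⁻¹)‖ := by
      intro k hk
      obtain ⟨hne, hk⟩ := Finset.mem_erase.1 hk
      have hl : (k : ZMod p) - k' ≠ 0 := fun h => hne (hinj k hk k' hk' (sub_eq_zero.1 h))
      rw [← sum_inverseChar_mul_conj hl c, hC]
      simp only
      rw [← Equiv.sum_comp (Equiv.addRight (-(k' : ZMod p)))]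
      congr 1
      refine Finset.sum_congr rfl fun z _ => ?_
      simp only [Equiv.coe_addRight]
      rw [show z + -(k' : ZMod p) + k = z + (k - k') by ring,
        show z + -(k' : ZMod p) + k' = z by ring]
    rw [Finset.sum_congr rfl d2]
    -- Cauchy–Schwarz. For fixed `k'` the arguments `-c / (k - k')` are distinct, so the squares
    -- form part of the complete second moment.
    have d3 : (∑ k ∈ K.erase k', ‖productSum ψ (-c * ((k : ZMod p) - k')⁻¹)‖) ^ 2
        ≤ (j : ℝ) ^ 2 * (2 * (p : ℝ) ^ 2) := by
      refine (sq_sum_le_card_mul_sum_sq).trans ?_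
      have e1 : ((K.erase k').card : ℝ) ≤ (j : ℝ) ^ 2 := by
        have : (K.erase k').card ≤ j ^ 2 := (Finset.card_erase_le).trans (by simp [hK])
        exact_mod_cast this
      have e2 : ∑ k ∈ K.erase k', ‖productSum ψ (-c * ((k : ZMod p) - k')⁻¹)‖ ^ 2
          ≤ ∑ c : ZMod p, ‖productSum ψ c‖ ^ 2 := by
        rw [← Finset.sum_image (f := fun c => ‖productSum ψ c‖ ^ 2)
          (g := fun k : ℕ => -c * ((k : ZMod p) - k')⁻¹)]
        · exact Finset.sum_le_sum_of_subset_of_nonneg (Finset.subset_univ _)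
            fun _ _ _ => by positivity
        · intro k hk l hl e
          have e := inv_injective (mul_left_cancel₀ (neg_ne_zero.2 hc) e)
          exact hinj k (Finset.mem_of_mem_erase hk) l (Finset.mem_of_mem_erase hl)
            (sub_left_injective e)
      exact mul_le_mul e1 (e2.trans (sum_norm_sq_productSum hψ))
        (Finset.sum_nonneg fun _ _ => by positivity) (by positivity)
    have d4 : ∑ k ∈ K.erase k', ‖productSum ψ (-c * ((k : ZMod p) - k')⁻¹)‖ ≤ 2 * j * p := by
      refine abs_le_of_sq_le_sq' ?_ (by positivity) |>.2
      nlinarith [sq_nonneg ((j : ℝ) * p)]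
    linarith
  have h3 : (∑ z : ZMod p, ‖∑ k ∈ K, inverseChar ψ c (z + k)‖ ^ 2)
      ≤ ∑ k' ∈ K, ∑ k ∈ K, ‖C k k'‖ := by
    have h0 : 0 ≤ ∑ z : ZMod p, ‖∑ k ∈ K, inverseChar ψ c (z + k)‖ ^ 2 :=
      Finset.sum_nonneg fun _ _ => by positivity
    rw [← abs_of_nonneg h0, ← Real.norm_eq_abs, ← Complex.norm_real, h1]
    exact (norm_sum_le _ _).trans (Finset.sum_le_sum fun _ _ => norm_sum_le _ _)
  refine h3.trans ((Finset.sum_le_sum h2).trans ?_)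
  rw [Finset.sum_const, hK, Finset.card_range, nsmul_eq_mul]
  have hj' : (1 : ℝ) ≤ j := by exact_mod_cast hj
  push_cast
  nlinarith [mul_nonneg hp0 (sq_nonneg (j : ℝ))]

end CharacterSums

end GapDistribution

/-! ### Short Kloosterman sums and the equidistribution of Farey end points. -/

namespace GapDistribution

/-- The value of the character of frequency `m` at the left end point of a Farey arc. -/
noncomputable def arcPhase (m : ℤ) (q q' : ℕ) : ℂ :=
  if Nat.Coprime q q' then Complex.exp (2 * Real.pi * Complex.I * (m * leftNum q q' / q)) else 0

lemma norm_arcPhase_le (m : ℤ) (q q' : ℕ) : ‖arcPhase m q q'‖ ≤ 1 := by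
  unfold arcPhase
  split_ifs
  · have : (2 * Real.pi * Complex.I * (m * leftNum q q' / q) : ℂ)
        = ((2 * Real.pi * (m * leftNum q q' / q) : ℝ) : ℂ) * Complex.I := by push_cast; ring
    rw [this, Complex.norm_exp_ofReal_mul_I]
  · simp

/-- With `p s + q₁ t = 1` the phase of `m u / (q₁ p)` splits into those of `m s u / q₁` and `m t u /
p`, where `u ≡ -1 / (x + k q₁)`. The first factor does not depend on `k` and becomes `w`; the second
is a character at the inverse of `x / q₁ + k`, with constant `c = -m / q₁²`. -/
lemma arcPhase_shift {p q₁ : ℕ} [Fact p.Prime] (hq₁ : 0 < q₁) (hcop : Nat.Coprime q₁ p)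
    {m : ℤ} (hm : ¬ (p : ℤ) ∣ m) :
    ∃ c : ZMod p, c ≠ 0 ∧ ∀ x : ℕ, ∃ w : ℂ, ‖w‖ ≤ 1 ∧ ∀ k : ℕ,
      arcPhase m (q₁ * p) (x + k * q₁)
        = w * inverseChar ZMod.stdAddChar c (x * (q₁ : ZMod p)⁻¹ + k) := by
  have hp : p.Prime := Fact.out
  have : NeZero q₁ := ⟨hq₁.ne'⟩
  have hr : (q₁ : ZMod p) ≠ 0 := by
    rw [Ne, ZMod.natCast_eq_zero_iff]
    intro h
    exact hp.one_lt.ne' (Nat.Coprime.eq_one_of_dvd hcop.symm h)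
  have hm' : (m : ZMod p) ≠ 0 := by
    rwa [Ne, ZMod.intCast_zmod_eq_zero_iff_dvd]
  have hbez : (p : ℤ) * Nat.gcdB q₁ p + q₁ * Nat.gcdA q₁ p = 1 := by
    have := Nat.gcd_eq_gcd_ab q₁ p
    rw [hcop.gcd_eq_one] at this
    push_cast at this
    linarith
  set s := Nat.gcdB q₁ p
  set t := Nat.gcdA q₁ p
  have ht : (t : ZMod p) = (q₁ : ZMod p)⁻¹ := by
    have := congrArg (Int.cast : ℤ → ZMod p) hbez
    push_cast at this
    rw [CharP.cast_eq_zero, zero_mul, zero_add] at this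
    exact eq_inv_of_mul_eq_one_right this
  refine ⟨-(m * (q₁ : ZMod p)⁻¹ * (q₁ : ZMod p)⁻¹),
    neg_ne_zero.2 (mul_ne_zero (mul_ne_zero hm' (inv_ne_zero hr)) (inv_ne_zero hr)), fun x => ?_⟩
  have hq : 0 < q₁ * p := Nat.mul_pos hq₁ hp.pos
  have hzero : ∀ k : ℕ, (x * (q₁ : ZMod p)⁻¹ + k : ZMod p) = ((x + k * q₁ : ℕ) : ZMod p) * (q₁ : ZMod p)⁻¹ := by
    intro k
    push_cast
    field_simp
  by_cases hx : Nat.Coprime q₁ x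
  swap
  -- If `x` has a factor in common with `q₁`, so has every `x + k q₁`, and all phases vanish.
  · refine ⟨0, by simp, fun k => ?_⟩
    rw [arcPhase, if_neg, zero_mul]
    intro h
    apply hx
    have := (Nat.Coprime.coprime_mul_right h)
    simpa using this
  refine ⟨ZMod.stdAddChar (-(m * s * (x : ZMod q₁)⁻¹) : ZMod q₁), by rw [AddChar.norm_apply],
    fun k => ?_⟩
  have hx1 : Nat.Coprime q₁ (x + k * q₁) := by simpa using hx
  -- When `x` is prime to `q₁`, only `p` can obstruct coprimality, which matches the zero of
  -- `inverseChar`.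
  have hiff : Nat.Coprime (q₁ * p) (x + k * q₁) ↔ (x * (q₁ : ZMod p)⁻¹ + k : ZMod p) ≠ 0 := by
    rw [Nat.coprime_mul_iff_left, hzero, Ne, mul_eq_zero, not_or, ZMod.natCast_eq_zero_iff,
      hp.coprime_iff_not_dvd]
    exact ⟨fun h => ⟨h.2, inv_ne_zero hr⟩, fun h => ⟨hx1, h.1⟩⟩
  unfold arcPhase inverseChar
  by_cases hc : Nat.Coprime (q₁ * p) (x + k * q₁)
  swap
  · rw [if_neg hc, if_neg (fun h => hc (hiff.2 h)), mul_zero]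
  rw [if_pos hc, if_pos (hiff.1 hc)]
  have hdvd := dvd_leftNum_mul hq hc
  set u := leftNum (q₁ * p) (x + k * q₁)
  have hu1 : (u : ZMod q₁) = -(x : ZMod q₁)⁻¹ := by
    have h1 : (q₁ : ℤ) ∣ u * ((x + k * q₁ : ℕ) : ℤ) + 1 :=
      dvd_trans (by push_cast; exact dvd_mul_right _ _) hdvd
    rw [← ZMod.intCast_zmod_eq_zero_iff_dvd] at h1
    push_cast at h1
    rw [ZMod.natCast_self, mul_zero, add_zero] at h1
    have h2 := ZMod.coe_mul_inv_eq_one x hx.symm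
    linear_combination (x : ZMod q₁)⁻¹ * h1 - (u : ZMod q₁) * h2
  have hne : ((x + k * q₁ : ℕ) : ZMod p) ≠ 0 := by
    have := hiff.1 hc
    rw [hzero] at this
    exact left_ne_zero_of_mul this
  have hu2 : (u : ZMod p) = -((x + k * q₁ : ℕ) : ZMod p)⁻¹ := by
    have h1 : (p : ℤ) ∣ u * ((x + k * q₁ : ℕ) : ℤ) + 1 :=
      dvd_trans (by push_cast; exact dvd_mul_left _ _) hdvd
    rw [← ZMod.intCast_zmod_eq_zero_iff_dvd] at h1
    rw [Int.cast_add, Int.cast_mul, Int.cast_natCast, Int.cast_one] at h1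
    have h2 := mul_inv_cancel₀ hne
    linear_combination (((x + k * q₁ : ℕ) : ZMod p))⁻¹ * h1 - (u : ZMod p) * h2
  have e1 : (-(m * s * (x : ZMod q₁)⁻¹) : ZMod q₁) = ((m * s * u : ℤ) : ZMod q₁) := by
    push_cast; rw [hu1]; ring
  have e2 : -(m * (q₁ : ZMod p)⁻¹ * (q₁ : ZMod p)⁻¹) * (x * (q₁ : ZMod p)⁻¹ + k : ZMod p)⁻¹
      = ((m * t * u : ℤ) : ZMod p) := by
    rw [hzero]
    push_cast at hu2 hne ⊢
    rw [hu2, ht, mul_inv, inv_inv]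
    field_simp
  rw [e1, e2, ZMod.stdAddChar_coe, ZMod.stdAddChar_coe, ← Complex.exp_add]
  congr 1
  have hb : (p : ℂ) * s + q₁ * t = 1 := by exact_mod_cast congrArg (Int.cast : ℤ → ℂ) hbez
  have n1 : (q₁ : ℂ) ≠ 0 := by exact_mod_cast hq₁.ne'
  have n2 : (p : ℂ) ≠ 0 := by exact_mod_cast hp.ne_zero
  push_cast
  field_simp
  linear_combination (-(m : ℂ) * u) * hb

/-- An interval meets each residue class modulo `p` at most `(b - a) / p + 1` times. -/
lemma sum_Ioc_cast_le {p : ℕ} [Fact p.Prime] (h : ZMod p → ℝ) (h0 : ∀ z, 0 ≤ h z) (a b : ℕ)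
    (hab : a ≤ b) :
    ∑ x ∈ Finset.Ioc a b, h (x : ZMod p) ≤ (((b : ℝ) - a) / p + 1) * ∑ z, h z := by
  have hp : 0 < p := (Fact.out : p.Prime).pos
  rw [← Finset.sum_fiberwise (Finset.Ioc a b) (fun x : ℕ => (x : ZMod p)), Finset.mul_sum]
  refine Finset.sum_le_sum fun z _ => ?_
  have e : ∑ x ∈ (Finset.Ioc a b).filter (fun x : ℕ => (x : ZMod p) = z), h (x : ZMod p)
      = (((Finset.Ioc a b).filter fun x : ℕ => (x : ZMod p) = z).card : ℝ) * h z := by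
    rw [Finset.sum_congr rfl (g := fun _ => h z), Finset.sum_const, nsmul_eq_mul]
    intro x hx
    rw [(Finset.mem_filter.1 hx).2]
  rw [e]
  refine mul_le_mul_of_nonneg_right ?_ (h0 z)
  have e2 : ((Finset.Ioc a b).filter fun x : ℕ => (x : ZMod p) = z)
      = (Finset.Ioc a b).filter fun x : ℕ => x ≡ z.val [MOD p] := by
    ext x
    simp only [Finset.mem_filter]
    rw [← ZMod.natCast_eq_natCast_iff, ZMod.natCast_zmod_val]
  rw [e2]
  have key := Nat.Ioc_filter_modEq_card a b hp z.val
  have hle : ((((Finset.Ioc a b).filter fun x : ℕ => x ≡ z.val [MOD p]).card : ℤ) : ℚ)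
      ≤ ((b : ℚ) - a) / p + 1 := by
    rw [key]
    push_cast
    have hp' : (0 : ℚ) < p := by exact_mod_cast hp
    have hab' : (a : ℚ) ≤ b := by exact_mod_cast hab
    refine max_le ?_ ?_
    · have h1 := Int.floor_le (((b : ℚ) - z.val) / p)
      have h2 := Int.lt_floor_add_one (((a : ℚ) - z.val) / p)
      have : ((b : ℚ) - a) / p = ((b : ℚ) - z.val) / p - ((a : ℚ) - z.val) / p := by ring
      rw [this]
      linarith
    · have : 0 ≤ ((b : ℚ) - a) / p := div_nonneg (by linarith) hp'.le
      linarith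
  have hreal := (Rat.cast_le (K := ℝ)).2 hle
  push_cast at hreal
  exact hreal

/-- An interval and its translate by `n` differ by two intervals of `n` points. -/
lemma norm_sum_shift_sub_le (f : ℕ → ℂ) (hf : ∀ x, ‖f x‖ ≤ 1) (a b n : ℕ) :
    ‖∑ x ∈ Finset.Ioc a b, f x - ∑ x ∈ Finset.Ioc a b, f (x + n)‖ ≤ 2 * n := by
  rcases le_or_gt b a with hab | hab
  · rw [Finset.Ioc_eq_empty_of_le hab]; simp
  have hsh : ∑ x ∈ Finset.Ioc a b, f (x + n) = ∑ x ∈ Finset.Ioc (a + n) (b + n), f x := by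
    rw [← Finset.image_add_right_Ioc, Finset.sum_image (by simp)]
  have hb : ∀ c e : ℕ, c ≤ e → ‖∑ x ∈ Finset.Ioc c e, f x‖ ≤ (e : ℝ) - c := by
    intro c e hce
    refine (norm_sum_le _ _).trans ((Finset.sum_le_sum fun x _ => hf x).trans ?_)
    simp [Nat.cast_sub hce]
  have h1 := Finset.sum_Ioc_consecutive f (show a ≤ a + n by omega) (show a + n ≤ b + n by omega)
  have h2 := Finset.sum_Ioc_consecutive f hab.le (show b ≤ b + n by omega)
  have h3 := hb a (a + n) (by omega)
  have h4 := hb b (b + n) (by omega)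
  have e : ∑ x ∈ Finset.Ioc a b, f x - ∑ x ∈ Finset.Ioc a b, f (x + n)
      = ∑ x ∈ Finset.Ioc a (a + n), f x - ∑ x ∈ Finset.Ioc b (b + n), f x := by
    rw [hsh]; linear_combination h2 - h1
  rw [e]
  refine (norm_sub_le _ _).trans ?_
  push_cast at h3 h4
  linarith

/-- Short Kloosterman sums to a modulus with a large simple prime factor are small. -/
lemma norm_sum_arcPhase_le {p q₁ : ℕ} (hp : p.Prime) (hq₁ : 0 < q₁) (hcop : Nat.Coprime q₁ p)
    {m : ℤ} (hm : ¬ (p : ℤ) ∣ m) {i : ℕ} (hi : 1 ≤ i) (hip : i ^ 8 ≤ p) {a b : ℕ} (hab : a ≤ b) :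
    ‖∑ x ∈ Finset.Ioc a b, arcPhase m (q₁ * p) x‖
      ≤ 2 * (q₁ * p) / i + 2 * ((b - a) + p) / i := by
  have : Fact p.Prime := ⟨hp⟩
  obtain ⟨c, hc, hw⟩ := arcPhase_shift hq₁ hcop hm
  have hi' : (1 : ℝ) ≤ i := by exact_mod_cast hi
  have hp0 : (0 : ℝ) < p := by exact_mod_cast hp.pos
  have hq0 : (0 : ℝ) < q₁ := by exact_mod_cast hq₁
  -- The number `i ^ 4` of shifts is a balance: moving by up to `i ^ 4 q₁` costs only a multiple of
  -- `q₁ p / i`, since `i ^ 5 ≤ p`, while the moment bound with `j = i ^ 2` saves a factor `i`.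
  set K := Finset.range ((i ^ 2) ^ 2) with hK
  have hKc : (K.card : ℝ) = (i : ℝ) ^ 4 := by
    rw [hK, Finset.card_range]; push_cast; ring
  set S := ∑ x ∈ Finset.Ioc a b, arcPhase m (q₁ * p) x with hS
  set h : ZMod p → ℝ := fun z => ‖∑ k ∈ K, inverseChar ZMod.stdAddChar c (z + k)‖ with hh
  have h1 : ‖(K.card : ℂ) * S - ∑ k ∈ K, ∑ x ∈ Finset.Ioc a b, arcPhase m (q₁ * p) (x + k * q₁)‖
      ≤ (i : ℝ) ^ 4 * (2 * ((i : ℝ) ^ 4 * q₁)) := by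
    have e : (K.card : ℂ) * S = ∑ k ∈ K, S := by rw [Finset.sum_const, nsmul_eq_mul]
    rw [e, ← Finset.sum_sub_distrib]
    refine (norm_sum_le _ _).trans ?_
    rw [← hKc, ← nsmul_eq_mul, ← Finset.sum_const]
    refine Finset.sum_le_sum fun k hk => ?_
    refine (norm_sum_shift_sub_le _ (norm_arcPhase_le m _) a b (k * q₁)).trans ?_
    rw [hK, Finset.mem_range] at hk
    have : (k : ℝ) ≤ K.card := by rw [hK, Finset.card_range]; exact_mod_cast hk.le
    push_cast
    gcongr
  have h2 : ‖∑ k ∈ K, ∑ x ∈ Finset.Ioc a b, arcPhase m (q₁ * p) (x + k * q₁)‖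
      ≤ (((b : ℝ) - a) / p + 1) * ∑ z, h z := by
    rw [Finset.sum_comm]
    refine (norm_sum_le _ _).trans ?_
    have e : ∀ x ∈ Finset.Ioc a b, ‖∑ k ∈ K, arcPhase m (q₁ * p) (x + k * q₁)‖
        ≤ h ((x : ZMod p) * (q₁ : ZMod p)⁻¹) := by
      intro x _
      obtain ⟨w, hw1, hw2⟩ := hw x
      simp only [hw2, hh]
      rw [← Finset.mul_sum, norm_mul]
      exact mul_le_of_le_one_left (norm_nonneg _) hw1
    refine (Finset.sum_le_sum e).trans ?_
    refine (sum_Ioc_cast_le (fun z => h (z * (q₁ : ZMod p)⁻¹)) (fun z => norm_nonneg _) a b hab).trans ?_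
    have hr : (q₁ : ZMod p)⁻¹ ≠ 0 := by
      rw [Ne, inv_eq_zero, ZMod.natCast_eq_zero_iff]
      intro h
      exact hp.one_lt.ne' (Nat.Coprime.eq_one_of_dvd hcop.symm h)
    have := Equiv.sum_comp (Equiv.mulRight₀ _ hr) h
    simp only [Equiv.mulRight₀_apply] at this
    rw [this]
  -- Cauchy–Schwarz over the residues: the square of the sum is at most `p · 3 p i ^ 6`.
  have h3 : ∑ z, h z ≤ 2 * p * (i : ℝ) ^ 3 := by
    have hV := sum_norm_sq_shifts (ZMod.isPrimitive_stdAddChar p) hc (j := i ^ 2)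
      (Nat.one_le_pow _ _ hi) (le_trans (by ring_nf; exact Nat.pow_le_pow_right hi (by norm_num)) hip)
    have hcs : (∑ z, h z) ^ 2 ≤ p * ∑ z, h z ^ 2 := by
      have := sq_sum_le_card_mul_sum_sq (s := (Finset.univ : Finset (ZMod p))) (f := h)
      rwa [Finset.card_univ, ZMod.card] at this
    refine (abs_le_of_sq_le_sq' ?_ (by positivity)).2
    refine hcs.trans ((mul_le_mul_of_nonneg_left hV hp0.le).trans ?_)
    push_cast
    have : 0 ≤ (p : ℝ) ^ 2 * (i : ℝ) ^ 6 := by positivity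
    nlinarith
  have hba : (0 : ℝ) ≤ (b : ℝ) - a := by
    have : (a : ℝ) ≤ b := by exact_mod_cast hab
    linarith
  have h4 : (i : ℝ) ^ 4 * ‖S‖ ≤ (i : ℝ) ^ 4 * (2 * ((i : ℝ) ^ 4 * q₁))
      + (((b : ℝ) - a) / p + 1) * (2 * p * (i : ℝ) ^ 3) := by
    have e : (i : ℝ) ^ 4 * ‖S‖ = ‖(K.card : ℂ) * S‖ := by
      rw [norm_mul, Complex.norm_natCast, hKc]
    rw [e]
    have := norm_sub_norm_le ((K.card : ℂ) * S)
      (∑ k ∈ K, ∑ x ∈ Finset.Ioc a b, arcPhase m (q₁ * p) (x + k * q₁))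
    have h5 : (((b : ℝ) - a) / p + 1) * ∑ z, h z
        ≤ (((b : ℝ) - a) / p + 1) * (2 * p * (i : ℝ) ^ 3) := by gcongr
    linarith
  have hip' : (i : ℝ) ^ 8 ≤ p := by exact_mod_cast hip
  have h6 : (i : ℝ) ^ 4 * q₁ ≤ q₁ * p / i := by
    rw [le_div_iff₀ (by linarith)]
    have : (i : ℝ) ^ 5 ≤ p := (pow_le_pow_right₀ hi' (by norm_num)).trans hip'
    nlinarith
  have h7 : (((b : ℝ) - a) / p + 1) * (2 * p * (i : ℝ) ^ 3)
      = (i : ℝ) ^ 4 * (2 * ((b - a) + p) / i) := by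
    field_simp
  have h8 : (i : ℝ) ^ 4 * ‖S‖ ≤ (i : ℝ) ^ 4 * (2 * (q₁ * p) / i + 2 * ((b - a) + p) / i) := by
    rw [mul_add, ← h7]
    refine h4.trans (add_le_add ?_ le_rfl)
    have : 2 * ((i : ℝ) ^ 4 * q₁) ≤ 2 * (q₁ * p) / i := by
      rw [mul_div_assoc]; linarith
    gcongr
  exact le_of_mul_le_mul_left h8 (by positivity)

end GapDistribution

namespace GapDistribution

/-- All prime factors of `q` beyond `P` are multiple. -/
def FullBeyond (P q : ℕ) : Prop := ∀ p : ℕ, p.Prime → P < p → p ∣ q → p ^ 2 ∣ q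

/-- Write `q = t² s` with `s` squarefree, and put `c = gcd(s, t)`, `s = c r`, `t = c d`. A prime
beyond `P` dividing `r` would also divide `t`, hence `c`, hence `s` twice. So `r` is a squarefree
product of primes up to `P` and divides the primorial. -/
lemma FullBeyond.exists_eq {P q : ℕ} (hq : 0 < q) (h : FullBeyond P q) :
    ∃ r c d : ℕ, r ≤ primorial P ∧ q = r * c ^ 3 * d ^ 2 := by
  obtain ⟨s, t, hst, hs⟩ := Nat.sq_mul_squarefree q
  have hs0 : s ≠ 0 := hs.ne_zero
  have ht0 : t ≠ 0 := by rintro rfl; simp at hst; omega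
  set c := Nat.gcd s t with hc
  obtain ⟨r, hr⟩ := Nat.gcd_dvd_left s t
  obtain ⟨d, hd⟩ := Nat.gcd_dvd_right s t
  refine ⟨r, c, d, ?_, ?_⟩
  · have hrsq : Squarefree r := hs.squarefree_of_dvd ⟨c, by rw [mul_comm]; exact hr⟩
    refine Nat.le_of_dvd (primorial_pos P) ?_
    rw [← Nat.prod_primeFactors_of_squarefree hrsq, primorial]
    refine Finset.prod_dvd_prod_of_subset _ _ _ fun p hp => ?_
    have hpp := Nat.prime_of_mem_primeFactors hp
    have hpr := Nat.dvd_of_mem_primeFactors hp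
    simp only [Finset.mem_filter, Finset.mem_range]
    refine ⟨?_, hpp⟩
    by_contra hcon
    have hps : p ∣ s := hr ▸ dvd_mul_of_dvd_right hpr _
    have hpq : p ^ 2 ∣ q := h p hpp (by omega) (hst ▸ dvd_mul_of_dvd_right hps _)
    have hpt : p ∣ t := by
      by_contra hnt
      rw [← hst] at hpq
      have hcop : Nat.Coprime (p ^ 2) (t ^ 2) :=
        Nat.Coprime.pow 2 2 ((Nat.Prime.coprime_iff_not_dvd hpp).2 hnt)
      have hdv : p ^ 2 ∣ s := hcop.dvd_of_dvd_mul_left hpq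
      rw [sq] at hdv
      exact hpp.one_lt.ne' (Nat.isUnit_iff.1 (hs p hdv))
    have hpc : p ∣ c := Nat.dvd_gcd hps hpt
    have : p * p ∣ s := by rw [hr]; exact mul_dvd_mul hpc hpr
    exact hpp.one_lt.ne' (Nat.isUnit_iff.1 (hs p this))
  · rw [← hst]
    have : ∀ c' : ℕ, s = c' * r → t = c' * d → t ^ 2 * s = r * c' ^ 3 * d ^ 2 := by
      intro c' h1 h2
      rw [h1, h2]; ring
    exact this c hr hd

open Classical in
-- Such a number up to `N` is determined by a bounded `r`, some `c ≤ N ^ (1/3)` and some `d ≤ N ^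
-- (1/2)`, which leaves `O(N ^ (5/6))` possibilities. The constant `C` takes care of small `N`.
lemma card_fullBeyond_le (P : ℕ) {ε : ℝ} (hε : 0 < ε) :
    ∃ C : ℝ, ∀ N : ℕ, (((Finset.Ioc 0 N).filter (FullBeyond P)).card : ℝ) ≤ ε * N + C := by
  set R : ℝ := ((primorial P : ℕ) : ℝ) with hR
  have hR0 : 0 ≤ R := Nat.cast_nonneg _
  -- Beyond `x₀` the count `4 (R + 1) x ^ 5` is below `ε x ^ 6`.
  set x₀ : ℝ := 8 * (R + 1) / ε + 1 with hx₀
  have hx₀1 : 1 ≤ x₀ := by rw [hx₀]; have : 0 ≤ 8 * (R + 1) / ε := by positivity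
                           linarith
  refine ⟨x₀ ^ 6, fun N => ?_⟩
  have htriv : (((Finset.Ioc 0 N).filter (FullBeyond P)).card : ℝ) ≤ N := by
    have := Finset.card_filter_le (Finset.Ioc 0 N) (FullBeyond P)
    simp only [Nat.card_Ioc, tsub_zero] at this
    exact_mod_cast this
  rcases le_or_gt (N : ℝ) (x₀ ^ 6) with hN | hN
  · have : 0 ≤ ε * N := by positivity
    linarith
  -- The sixth root of `N` makes both ranges integral powers: `c ≤ x ^ 2` and `d ≤ x ^ 3`.
  set x : ℝ := (N : ℝ) ^ ((6 : ℝ)⁻¹) with hx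
  have hN0 : (0 : ℝ) ≤ N := Nat.cast_nonneg _
  have hx0 : 0 ≤ x := Real.rpow_nonneg hN0 _
  have hx6 : x ^ 6 = N := by
    rw [hx, ← Real.rpow_natCast, ← Real.rpow_mul hN0]; norm_num
  have hxx : x₀ < x := by
    rw [← hx6] at hN
    exact lt_of_pow_lt_pow_left₀ 6 hx0 hN
  have hx1 : 1 ≤ x := by linarith
  have hsub : (Finset.Ioc 0 N).filter (FullBeyond P) ⊆
      (Finset.range (primorial P + 1) ×ˢ Finset.range (⌊x ^ 2⌋₊ + 1) ×ˢ
        Finset.range (⌊x ^ 3⌋₊ + 1)).image (fun v => v.1 * v.2.1 ^ 3 * v.2.2 ^ 2) := by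
    intro q hq
    obtain ⟨hq1, hq2⟩ := Finset.mem_filter.1 hq
    rw [Finset.mem_Ioc] at hq1
    obtain ⟨r, c, d, hr, hqe⟩ := hq2.exists_eq hq1.1
    have hr1 : 1 ≤ r := Nat.one_le_iff_ne_zero.2 (by rintro rfl; simp at hqe; omega)
    have hc1 : 1 ≤ c := Nat.one_le_iff_ne_zero.2 (by rintro rfl; simp at hqe; omega)
    have hd1 : 1 ≤ d := Nat.one_le_iff_ne_zero.2 (by rintro rfl; simp at hqe; omega)
    have hc3 : c ^ 3 ≤ N := by
      have : c ^ 3 * 1 ≤ c ^ 3 * (r * d ^ 2) :=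
        Nat.mul_le_mul_left _ (Nat.mul_pos hr1 (pow_pos hd1 2))
      nlinarith
    have hd2 : d ^ 2 ≤ N := by
      have : d ^ 2 * 1 ≤ d ^ 2 * (r * c ^ 3) :=
        Nat.mul_le_mul_left _ (Nat.mul_pos hr1 (pow_pos hc1 3))
      nlinarith
    have hc' : (c : ℝ) ≤ x ^ 2 := by
      have : (c : ℝ) ^ 3 ≤ (x ^ 2) ^ 3 := by
        rw [← pow_mul, hx6]; exact_mod_cast hc3
      exact le_of_pow_le_pow_left₀ (by norm_num) (by positivity) this
    have hd' : (d : ℝ) ≤ x ^ 3 := by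
      have : (d : ℝ) ^ 2 ≤ (x ^ 3) ^ 2 := by
        rw [← pow_mul, hx6]; exact_mod_cast hd2
      exact le_of_pow_le_pow_left₀ (by norm_num) (by positivity) this
    refine Finset.mem_image.2 ⟨(r, c, d), ?_, hqe.symm⟩
    simp only [Finset.mem_product, Finset.mem_range]
    exact ⟨by omega, Nat.lt_succ_of_le (Nat.le_floor hc'), Nat.lt_succ_of_le (Nat.le_floor hd')⟩
  have hcard := (Finset.card_le_card hsub).trans Finset.card_image_le
  rw [Finset.card_product, Finset.card_product, Finset.card_range, Finset.card_range,
    Finset.card_range] at hcard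
  have hcard' : (((Finset.Ioc 0 N).filter (FullBeyond P)).card : ℝ)
      ≤ (R + 1) * ((⌊x ^ 2⌋₊ + 1) * (⌊x ^ 3⌋₊ + 1)) := by
    rw [hR]; exact_mod_cast hcard
  have f1 : (⌊x ^ 2⌋₊ : ℝ) + 1 ≤ 2 * x ^ 2 := by
    have := Nat.floor_le (show 0 ≤ x ^ 2 by positivity)
    nlinarith
  have f2 : (⌊x ^ 3⌋₊ : ℝ) + 1 ≤ 2 * x ^ 3 := by
    have := Nat.floor_le (show 0 ≤ x ^ 3 by positivity)
    have : 1 ≤ x ^ 3 := one_le_pow₀ hx1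
    linarith
  have f3 : (R + 1) * ((⌊x ^ 2⌋₊ + 1) * (⌊x ^ 3⌋₊ + 1)) ≤ (R + 1) * ((2 * x ^ 2) * (2 * x ^ 3)) := by
    gcongr
  have f4 : 8 * (R + 1) ≤ ε * x := by
    have : 8 * (R + 1) / ε ≤ x := by linarith
    rw [div_le_iff₀ hε] at this
    linarith
  have f5 : (R + 1) * ((2 * x ^ 2) * (2 * x ^ 3)) ≤ ε * N := by
    rw [← hx6]
    have : 0 ≤ x ^ 5 := by positivity
    nlinarith
  have : 0 ≤ x₀ ^ 6 := by positivity
  linarith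

lemma norm_sum_Ioc_arcPhase_le_length (m : ℤ) (q c e : ℕ) :
    ‖∑ x ∈ Finset.Ioc c e, arcPhase m q x‖ ≤ e := by
  refine (norm_sum_le _ _).trans ((Finset.sum_le_sum fun x _ => norm_arcPhase_le m q x).trans ?_)
  simp only [Finset.sum_const, Nat.card_Ioc, nsmul_eq_mul, mul_one]
  exact_mod_cast Nat.sub_le e c

/-- If `q` has a simple prime factor beyond `P`, the inner sum is bounded by `norm_sum_arcPhase_le`;
the remaining `q` are rare and are bounded trivially. The choice of `P` ensures that this prime is
at least `i ^ 8` and does not divide `m`. -/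
lemma norm_sum_rectangle_arcPhase_le {m : ℤ} (hm : m ≠ 0) {ε : ℝ} (hε : 0 < ε) :
    ∃ C : ℝ, ∀ a b c e : ℕ, c ≤ e →
      ‖∑ q ∈ Finset.Ioc a b, ∑ q' ∈ Finset.Ioc c e, arcPhase m q q'‖
        ≤ ε * (b + e) ^ 2 + C * e := by
  classical
  obtain ⟨i, hi⟩ := exists_nat_gt (8 / ε)
  have hi0 : (0 : ℝ) < i := lt_trans (by positivity) hi
  have hi1 : 1 ≤ i := by exact_mod_cast hi0
  set P := max (i ^ 8) m.natAbs with hP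
  obtain ⟨C, hC⟩ := card_fullBeyond_le P (half_pos hε)
  refine ⟨C, fun a b c e hce => ?_⟩
  have hi4 : 4 / (i : ℝ) ≤ ε / 2 := by
    rw [div_le_iff₀ hi0]; rw [div_lt_iff₀ hε] at hi; linarith
  have hgood : ∀ q ∈ Finset.Ioc a b, ‖∑ q' ∈ Finset.Ioc c e, arcPhase m q q'‖
      ≤ ε / 2 * (b + e) + if FullBeyond P q then (e : ℝ) else 0 := by
    intro q hq
    rw [Finset.mem_Ioc] at hq
    split_ifs with hF
    · refine (norm_sum_Ioc_arcPhase_le_length m q c e).trans ?_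
      have : 0 ≤ ε / 2 * ((b : ℝ) + e) := by positivity
      linarith
    · rw [add_zero]
      unfold FullBeyond at hF
      push Not at hF
      obtain ⟨p, hp, hPp, ⟨q₁, rfl⟩, hp2⟩ := hF
      have hq₁ : 0 < q₁ := Nat.pos_of_ne_zero (by rintro rfl; simp at hq)
      have hcop : Nat.Coprime q₁ p := by
        rw [Nat.coprime_comm, hp.coprime_iff_not_dvd]
        intro hd
        exact hp2 (by rw [sq]; exact mul_dvd_mul_left p hd)
      have hmp : ¬ (p : ℤ) ∣ m := by
        intro hd
        have := Int.natAbs_dvd_natAbs.2 hd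
        rw [Int.natAbs_natCast] at this
        have := Nat.le_of_dvd (Int.natAbs_pos.2 hm) this
        have := le_max_right (i ^ 8) m.natAbs
        omega
      have hip : i ^ 8 ≤ p := by
        have := le_max_left (i ^ 8) m.natAbs
        omega
      have key := norm_sum_arcPhase_le hp hq₁ hcop hmp hi1 hip hce
      rw [mul_comm p q₁]
      refine key.trans ?_
      have hqb : (q₁ : ℝ) * p ≤ b := by
        have := hq.2; rw [mul_comm] at this; exact_mod_cast this
      have hpb : (p : ℝ) ≤ b := by
        have : p * 1 ≤ p * q₁ := Nat.mul_le_mul_left _ hq₁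
        exact_mod_cast (show p ≤ b by omega)
      have hc0 : (0 : ℝ) ≤ c := Nat.cast_nonneg _
      have he0 : (0 : ℝ) ≤ e := Nat.cast_nonneg _
      have hb0 : (0 : ℝ) ≤ b := Nat.cast_nonneg _
      calc 2 * ((q₁ : ℝ) * p) / i + 2 * ((e - c) + p) / i
          = (2 * ((q₁ : ℝ) * p) + 2 * ((e - c) + p)) / i := by ring
        _ ≤ (4 * (b + e)) / i := by gcongr; linarith
        _ = 4 / i * (b + e) := by ring
        _ ≤ ε / 2 * (b + e) := by gcongr
  have hb0 : (0 : ℝ) ≤ b := Nat.cast_nonneg _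
  have he0 : (0 : ℝ) ≤ e := Nat.cast_nonneg _
  refine (norm_sum_le _ _).trans ((Finset.sum_le_sum hgood).trans ?_)
  rw [Finset.sum_add_distrib, Finset.sum_const, nsmul_eq_mul, Nat.card_Ioc, ← Finset.sum_filter,
    Finset.sum_const, nsmul_eq_mul]
  have h1 : (((Finset.Ioc a b).filter (FullBeyond P)).card : ℝ) ≤ ε / 2 * b + C := by
    refine le_trans ?_ (hC b)
    exact_mod_cast Finset.card_le_card (Finset.filter_subset_filter _
      (Finset.Ioc_subset_Ioc_left (Nat.zero_le a)))
  have h2 : ((b - a : ℕ) : ℝ) ≤ b := by exact_mod_cast Nat.sub_le b a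
  have h3 : ((b - a : ℕ) : ℝ) * (ε / 2 * (b + e)) ≤ b * (ε / 2 * (b + e)) := by gcongr
  have h4 := mul_le_mul_of_nonneg_right h1 he0
  nlinarith [mul_nonneg hb0 he0, mul_nonneg he0 he0]

/-- The left end points of the Farey arcs with denominators in a rectangle are uniformly
distributed: their nontrivial character sums are negligible. -/
lemma tendsto_sum_arcPhase {m : ℤ} (hm : m ≠ 0) {u₁ u₂ v₁ v₂ : ℝ} (hu₂ : 0 ≤ u₂) (hv : v₁ ≤ v₂)
    (hv₂ : 0 ≤ v₂) :
    Tendsto (fun Q : ℕ => (∑ q ∈ Finset.Ioc ⌊u₁ * Q⌋₊ ⌊u₂ * Q⌋₊,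
      ∑ q' ∈ Finset.Ioc ⌊v₁ * Q⌋₊ ⌊v₂ * Q⌋₊, arcPhase m q q') / (Q : ℂ) ^ 2) atTop (𝓝 0) := by
  rw [Metric.tendsto_atTop']
  intro ε hε
  set M := (u₂ + v₂) ^ 2 + 1 with hM
  have hM0 : 0 < M := by positivity
  obtain ⟨C, hC⟩ := norm_sum_rectangle_arcPhase_le hm (show 0 < ε / (2 * M) by positivity)
  obtain ⟨N, hN⟩ := exists_nat_gt (2 * |C| * v₂ / ε)
  refine ⟨N, fun Q hQ => ?_⟩
  have hQ0 : (0 : ℝ) < Q := by exact_mod_cast lt_of_le_of_lt (Nat.zero_le N) hQ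
  have hQN : 2 * |C| * v₂ < ε * Q := by
    have : (N : ℝ) < Q := by exact_mod_cast hQ
    have := hN.trans this
    rw [div_lt_iff₀ hε] at this
    linarith
  rw [dist_zero_right, norm_div, norm_pow, Complex.norm_natCast, div_lt_iff₀ (by positivity)]
  have hfl : ⌊v₁ * Q⌋₊ ≤ ⌊v₂ * Q⌋₊ := Nat.floor_mono (mul_le_mul_of_nonneg_right hv hQ0.le)
  refine (hC _ _ _ _ hfl).trans_lt ?_
  have f1 := Nat.floor_le (mul_nonneg hu₂ hQ0.le)
  have f2 := Nat.floor_le (mul_nonneg hv₂ hQ0.le)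
  have g1 : ε / (2 * M) * ((⌊u₂ * Q⌋₊ : ℝ) + ⌊v₂ * Q⌋₊) ^ 2 ≤ ε / 2 * (Q : ℝ) ^ 2 := by
    have : ((⌊u₂ * Q⌋₊ : ℝ) + ⌊v₂ * Q⌋₊) ^ 2 ≤ M * (Q : ℝ) ^ 2 := by
      have : ((⌊u₂ * Q⌋₊ : ℝ) + ⌊v₂ * Q⌋₊) ^ 2 ≤ (u₂ * Q + v₂ * Q) ^ 2 := by gcongr
      refine this.trans ?_
      rw [hM]; nlinarith [sq_nonneg (Q : ℝ)]
    calc _ ≤ ε / (2 * M) * (M * (Q : ℝ) ^ 2) := by gcongr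
      _ = _ := by field_simp
  have g2 : C * (⌊v₂ * Q⌋₊ : ℝ) ≤ |C| * (v₂ * Q) := by
    have h0 : (0 : ℝ) ≤ ⌊v₂ * Q⌋₊ := Nat.cast_nonneg _
    calc C * (⌊v₂ * Q⌋₊ : ℝ) ≤ |C| * (⌊v₂ * Q⌋₊ : ℝ) := by gcongr; exact le_abs_self C
      _ ≤ _ := by gcongr
  nlinarith

/-- A continuous function evaluated at the left end points of the Farey arcs. -/
noncomputable def arcWeight (χ : ℝ → ℝ) (q q' : ℕ) : ℝ :=
  if Nat.Coprime q q' then χ ((leftNum q q' : ℝ) / q) else 0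

lemma arcPhase_eq (m : ℤ) (q q' : ℕ) : arcPhase m q q'
    = (arcWeight (fun α => Real.cos (2 * Real.pi * m * α)) q q' : ℂ)
      + (arcWeight (fun α => Real.sin (2 * Real.pi * m * α)) q q' : ℂ) * Complex.I := by
  unfold arcPhase arcWeight
  split_ifs
  · have : (2 * Real.pi * Complex.I * (m * leftNum q q' / q) : ℂ)
        = ((2 * Real.pi * m * (leftNum q q' / q) : ℝ) : ℂ) * Complex.I := by push_cast; ring
    rw [this, Complex.exp_mul_I, Complex.ofReal_cos, Complex.ofReal_sin]
  · simp

lemma equidistributed_arcWeight_cos {m : ℤ} (hm : m ≠ 0) :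
    Equidistributed (arcWeight fun α => Real.cos (2 * Real.pi * m * α)) 0 ∧
    Equidistributed (arcWeight fun α => Real.sin (2 * Real.pi * m * α)) 0 := by
  constructor
  all_goals
    intro u₁ u₂ v₁ v₂ hu₁ hu hv₁ hv
    have h := tendsto_sum_arcPhase hm (u₁ := u₁) (hu₁.trans hu) hv (hv₁.trans hv)
    rw [zero_mul]
  · have h' := (Complex.continuous_re.tendsto 0).comp h
    refine h'.congr fun Q => ?_
    simp only [Function.comp, arcPhase_eq, ← Complex.ofReal_natCast, ← Complex.ofReal_pow,
      Complex.div_ofReal_re, Complex.re_sum, Complex.add_re, Complex.ofReal_re, Complex.mul_re,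
      Complex.I_re, Complex.I_im, Complex.ofReal_im]
    simp
  · have h' := (Complex.continuous_im.tendsto 0).comp h
    refine h'.congr fun Q => ?_
    simp only [Function.comp, arcPhase_eq, ← Complex.ofReal_natCast, ← Complex.ofReal_pow,
      Complex.div_ofReal_im, Complex.im_sum, Complex.add_im, Complex.ofReal_re, Complex.mul_im,
      Complex.I_re, Complex.I_im, Complex.ofReal_im]
    simp

lemma equidistributed_arcWeight_one :
    Equidistributed (arcWeight fun _ => 1) (6 / Real.pi ^ 2) := equidistributed_coprime

/-- Adding 1 to a cosine or sine makes the weights nonnegative, as the comparison with step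
functions demands. The density stays that of the coprime pairs. -/
lemma equidistributed_arcWeight_one_add {χ : ℝ → ℝ} (h : Equidistributed (arcWeight χ) 0) :
    Equidistributed (arcWeight fun α => 1 + χ α) (6 / Real.pi ^ 2) := by
  intro u₁ u₂ v₁ v₂ hu₁ hu hv₁ hv
  have := (equidistributed_arcWeight_one u₁ u₂ v₁ v₂ hu₁ hu hv₁ hv).add
    (h u₁ u₂ v₁ v₂ hu₁ hu hv₁ hv)
  rw [zero_mul, add_zero] at this
  refine this.congr fun Q => ?_
  rw [← add_div, ← Finset.sum_add_distrib]
  congr 1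
  refine Finset.sum_congr rfl fun q _ => ?_
  rw [← Finset.sum_add_distrib]
  refine Finset.sum_congr rfl fun q' _ => ?_
  unfold arcWeight
  split_ifs <;> simp

end GapDistribution

/-! ### The limiting density on the Farey triangle. -/

namespace GapDistribution

open MeasureTheory

/-- The average of the pair frequency over an arc, in terms of the scaled denominators. -/
noncomputable def meanFreq (a b : ℝ) (z : ℝ × ℝ) : ℝ :=
  ∫ t in (0 : ℝ)..1, pairFreq a b z.1 z.2 (t / z.2) ((1 - t) / z.1)

/-- The Farey triangle. -/
def fareyTriangle : Set (ℝ × ℝ) := {z | z ∈ unitSquare ∧ 1 < z.1 + z.2}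

/-- The limiting density of pairs of gaps over the Farey triangle. -/
noncomputable def arcDensity (a b : ℝ) (z : ℝ × ℝ) : ℝ := meanFreq a b z / (z.1 * z.2)

lemma continuousAt_bothLE {a b : ℝ} {X : Type*} [TopologicalSpace X] {u v : X → ℝ} {z : X}
    (hu : ContinuousAt u z) (hv : ContinuousAt v z) (ha : u z ≠ a) (hb : v z ≠ b) :
    ContinuousAt (fun z => bothLE a b (u z) (v z)) z := by
  by_cases h : a ≤ u z ∧ b ≤ v z
  · have h1 : a < u z := lt_of_le_of_ne h.1 ha.symm
    have h2 : b < v z := lt_of_le_of_ne h.2 hb.symm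
    refine (continuousAt_const (y := (1 : ℝ))).congr ?_
    filter_upwards [hu.eventually (lt_mem_nhds h1), hv.eventually (lt_mem_nhds h2)] with w i1 i2
    rw [bothLE, if_pos ⟨i1.le, i2.le⟩]
  · refine (continuousAt_const (y := (0 : ℝ))).congr ?_
    rw [not_and_or, not_le, not_le] at h
    rcases h with h | h
    · filter_upwards [hu.eventually (gt_mem_nhds h)] with w i1
      rw [bothLE, if_neg fun i => absurd i.1 (not_le.2 i1)]
    · filter_upwards [hv.eventually (gt_mem_nhds h)] with w i1
      rw [bothLE, if_neg fun i => absurd i.2 (not_le.2 i1)]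

lemma meanFreq_nonneg (a b : ℝ) {z : ℝ × ℝ} (hz : z ∈ unitSquare) : 0 ≤ meanFreq a b z :=
  intervalIntegral.integral_nonneg zero_le_one fun _ _ => pairFreq_nonneg a b hz.1.2 hz.2.2 _ _

lemma meanFreq_le (a b : ℝ) {z : ℝ × ℝ} (hz : z ∈ unitSquare) : meanFreq a b z ≤ 9 := by
  have h := intervalIntegral.norm_integral_le_of_norm_le_const (a := (0 : ℝ)) (b := 1) (C := 9)
    (f := fun t => pairFreq a b z.1 z.2 (t / z.2) ((1 - t) / z.1)) fun t _ => by
      rw [Real.norm_eq_abs]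
      exact abs_pairFreq_le a b hz.1.1.le hz.2.1.le hz.1.2 hz.2.2 _ _
  rw [Real.norm_eq_abs, sub_zero, abs_one, mul_one] at h
  exact (abs_le.1 h).2

/-- The integrand is discontinuous at `z` only for the finitely many `t` at which `A`, `B` or `A +
B` equals a threshold; `z.1 ≠ z.2` ensures that `A + B` really varies with `t`. Dominated
convergence applies off these `t`. -/
lemma continuousAt_meanFreq (a b : ℝ) {z : ℝ × ℝ} (h1 : z.1 ∈ Set.Ioo (0 : ℝ) 1)
    (h2 : z.2 ∈ Set.Ioo (0 : ℝ) 1) (hne : z.1 ≠ z.2) : ContinuousAt (meanFreq a b) z := by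
  unfold meanFreq
  have hnb : ∀ᶠ w : ℝ × ℝ in 𝓝 z, w.1 ∈ Set.Ioo (0 : ℝ) 1 ∧ w.2 ∈ Set.Ioo (0 : ℝ) 1 :=
    (continuousAt_fst.eventually (isOpen_Ioo.mem_nhds h1)).and
      (continuousAt_snd.eventually (isOpen_Ioo.mem_nhds h2))
  refine intervalIntegral.continuousAt_of_dominated_interval (bound := fun _ => 9) ?_ ?_ ?_ ?_
  · refine Eventually.of_forall fun w => ?_
    exact (measurable_pairFreq a b measurable_const measurable_const (by fun_prop)
      (by fun_prop)).aestronglyMeasurable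
  · filter_upwards [hnb] with w hw
    refine Eventually.of_forall fun t _ => ?_
    rw [Real.norm_eq_abs]
    exact abs_pairFreq_le a b hw.1.1.le hw.2.1.le hw.1.2.le hw.2.2.le _ _
  · exact intervalIntegrable_const
  · have p1 : z.1 ≠ 0 := h1.1.ne'
    have p2 : z.2 ≠ 0 := h2.1.ne'
    have hd : z.1 - z.2 ≠ 0 := sub_ne_zero.2 hne
    have hfin : ({a * z.2, b * z.2, 1 - a * z.1, 1 - b * z.1, z.2 * (a * z.1 - 1) / (z.1 - z.2),
      z.2 * (b * z.1 - 1) / (z.1 - z.2)} : Set ℝ).Countable := Set.Finite.countable (Set.toFinite _)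
    filter_upwards [hfin.ae_notMem volume] with t ht _
    simp only [Set.mem_insert_iff, Set.mem_singleton_iff, not_or] at ht
    obtain ⟨t1, t2, t3, t4, t5, t6⟩ := ht
    have cA : ContinuousAt (fun w : ℝ × ℝ => t / w.2) z :=
      continuousAt_const.div continuousAt_snd p2
    have cB : ContinuousAt (fun w : ℝ × ℝ => (1 - t) / w.1) z :=
      continuousAt_const.div continuousAt_fst p1
    have cC := cA.add cB
    have nA : ∀ c, t ≠ c * z.2 → t / z.2 ≠ c := by
      rintro c hc rfl; exact hc (by field_simp)
    have nB : ∀ c, t ≠ 1 - c * z.1 → (1 - t) / z.1 ≠ c := by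
      rintro c hc rfl; exact hc (by field_simp; ring)
    have nC : ∀ c, t ≠ z.2 * (c * z.1 - 1) / (z.1 - z.2) → t / z.2 + (1 - t) / z.1 ≠ c := by
      rintro c hc rfl
      apply hc
      rw [eq_div_iff hd]
      field_simp
      ring
    have m1 := continuousAt_bothLE cA cA (nA _ t1) (nA _ t2)
    have m2 := continuousAt_bothLE cA cB (nA _ t1) (nB _ t4)
    have m3 := continuousAt_bothLE cB cA (nB _ t3) (nA _ t2)
    have m4 := continuousAt_bothLE cB cB (nB _ t3) (nB _ t4)
    have m5 := continuousAt_bothLE cA cC (nA _ t1) (nC _ t6)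
    have m6 := continuousAt_bothLE cB cC (nB _ t3) (nC _ t6)
    have m7 := continuousAt_bothLE cC cA (nC _ t5) (nA _ t2)
    have m8 := continuousAt_bothLE cC cB (nC _ t5) (nB _ t4)
    have m9 := continuousAt_bothLE cC cC (nC _ t5) (nC _ t6)
    have f1 : ContinuousAt (fun w : ℝ × ℝ => freqSame w.1) z := by unfold freqSame; fun_prop
    have f2 : ContinuousAt (fun w : ℝ × ℝ => freqSame w.2) z := by unfold freqSame; fun_prop
    have f3 : ContinuousAt (fun w : ℝ × ℝ => freqMixed w.1 w.2) z := by unfold freqMixed; fun_prop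
    have f4 : ContinuousAt (fun w : ℝ × ℝ => freqSum w.1 w.2) z := by unfold freqSum; fun_prop
    have f5 : ContinuousAt (fun w : ℝ × ℝ => freqSum w.2 w.1) z := by unfold freqSum; fun_prop
    have f6 : ContinuousAt (fun w : ℝ × ℝ => freqSumSum w.1 w.2) z := by
      unfold freqSumSum; fun_prop
    unfold pairFreq
    exact (((((f1.mul m1).add (f2.mul m4)).add (f3.mul (m2.add m3))).add
      (f4.mul (m5.add m7))).add (f5.mul (m6.add m8))).add (f6.mul m9)

lemma measurableSet_fareyTriangle : MeasurableSet fareyTriangle :=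
  measurableSet_unitSquare.inter (measurableSet_lt measurable_const (measurable_fst.add measurable_snd))

/-- The exceptional sets are lines, hence null. They carry all possible discontinuities of the
truncated density. -/
lemma ae_generic (δ : ℝ) : ∀ᵐ z : ℝ × ℝ, z.1 ≠ 1 ∧ z.2 ≠ 1 ∧ z.1 ≠ δ ∧ z.2 ≠ δ ∧
    z.1 + z.2 ≠ 1 ∧ z.1 ≠ z.2 := by
  have key : ∀ f : ℝ → ℝ, Measurable f → ∀ᵐ z : ℝ × ℝ, z.2 ≠ f z.1 := by
    intro f hf
    rw [Measure.volume_eq_prod]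
    have hm : MeasurableSet {z : ℝ × ℝ | ¬ (z.2 ≠ f z.1)} := by
      simp only [not_not]
      exact measurableSet_eq_fun measurable_snd (hf.comp measurable_fst)
    rw [ae_iff, Measure.measure_prod_null hm]
    refine Eventually.of_forall fun x => ?_
    have : Prod.mk x ⁻¹' {z : ℝ × ℝ | ¬ (z.2 ≠ f z.1)} = {f x} := by ext y; simp
    change volume (Prod.mk x ⁻¹' {z : ℝ × ℝ | ¬ (z.2 ≠ f z.1)}) = 0
    rw [this]; simp
  have key' : ∀ c : ℝ, ∀ᵐ z : ℝ × ℝ, z.1 ≠ c := by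
    intro c
    rw [Measure.volume_eq_prod]
    have : ∀ᵐ x : ℝ, x ≠ c := by simp [ae_iff]
    exact Measure.quasiMeasurePreserving_fst.ae this
  filter_upwards [key' 1, key (fun _ => 1) measurable_const, key' δ,
    key (fun _ => δ) measurable_const, key (fun x => 1 - x) (by fun_prop),
    key (fun x => x) measurable_id] with z h1 h2 h3 h4 h5 h6
  exact ⟨h1, h2, h3, h4, fun h => h5 (by linarith), fun h => h6 h.symm⟩

/-- The part of the Farey triangle away from its two acute corners. -/
def truncTriangle (δ : ℝ) : Set (ℝ × ℝ) := {z | z ∈ fareyTriangle ∧ δ < z.1 ∧ δ < z.2}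

lemma measurableSet_truncTriangle (δ : ℝ) : MeasurableSet (truncTriangle δ) :=
  measurableSet_fareyTriangle.inter ((measurableSet_lt measurable_const measurable_fst).inter
    (measurableSet_lt measurable_const measurable_snd))

lemma ae_continuousAt_trunc (a b δ : ℝ) : ∀ᵐ z : ℝ × ℝ, z ∈ unitSquare →
    ContinuousAt ((truncTriangle δ).indicator (arcDensity a b)) z := by
  filter_upwards [ae_generic δ] with z hz hsq
  obtain ⟨g1, g2, g3, g4, g5, g6⟩ := hz
  have h1 : z.1 ∈ Set.Ioo (0 : ℝ) 1 := ⟨hsq.1.1, lt_of_le_of_ne hsq.1.2 g1⟩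
  have h2 : z.2 ∈ Set.Ioo (0 : ℝ) 1 := ⟨hsq.2.1, lt_of_le_of_ne hsq.2.2 g2⟩
  have hnb : ∀ᶠ w : ℝ × ℝ in 𝓝 z, w ∈ unitSquare := by
    filter_upwards [continuousAt_fst.eventually (isOpen_Ioo.mem_nhds h1),
      continuousAt_snd.eventually (isOpen_Ioo.mem_nhds h2)] with w i1 i2
    exact ⟨Set.Ioo_subset_Ioc_self i1, Set.Ioo_subset_Ioc_self i2⟩
  have c1 : ContinuousAt (fun w : ℝ × ℝ => w.1) z := continuousAt_fst
  have c2 : ContinuousAt (fun w : ℝ × ℝ => w.2) z := continuousAt_snd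
  have c3 : ContinuousAt (fun w : ℝ × ℝ => w.1 + w.2) z := c1.add c2
  by_cases hT : z ∈ truncTriangle δ
  · obtain ⟨⟨-, t1⟩, t2, t3⟩ := hT
    have hc : ContinuousAt (arcDensity a b) z :=
      (continuousAt_meanFreq a b h1 h2 g6).div (c1.mul c2) (mul_pos h1.1 h2.1).ne'
    refine hc.congr ?_
    filter_upwards [hnb, c1.eventually (lt_mem_nhds t2), c2.eventually (lt_mem_nhds t3),
      c3.eventually (lt_mem_nhds t1)] with w w1 w2 w3 w4
    rw [Set.indicator_of_mem (show w ∈ truncTriangle δ from ⟨⟨w1, w4⟩, w2, w3⟩)]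
  · refine (continuousAt_const (y := (0 : ℝ))).congr ?_
    have : z.1 + z.2 < 1 ∨ z.1 < δ ∨ z.2 < δ := by
      by_contra hcon
      push Not at hcon
      exact hT ⟨⟨hsq, lt_of_le_of_ne hcon.1 g5.symm⟩, lt_of_le_of_ne hcon.2.1 g3.symm,
        lt_of_le_of_ne hcon.2.2 g4.symm⟩
    rcases this with h | h | h
    · filter_upwards [c3.eventually (gt_mem_nhds h)] with w hw
      rw [Set.indicator_of_notMem fun i => absurd i.1.2 (not_lt.2 hw.le)]
    · filter_upwards [c1.eventually (gt_mem_nhds h)] with w hw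
      rw [Set.indicator_of_notMem fun i => absurd i.2.1 (not_lt.2 hw.le)]
    · filter_upwards [c2.eventually (gt_mem_nhds h)] with w hw
      rw [Set.indicator_of_notMem fun i => absurd i.2.2 (not_lt.2 hw.le)]

/-- The factor `1 / (x y)` is unbounded at the acute corners of the triangle, which is why both
coordinates are kept above `δ`. -/
lemma abs_trunc_le (a b : ℝ) {δ : ℝ} (hδ : 0 < δ) {z : ℝ × ℝ} (hz : z ∈ unitSquare) :
    |(truncTriangle δ).indicator (arcDensity a b) z| ≤ 9 / (δ * δ) := by
  by_cases hT : z ∈ truncTriangle δ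
  · rw [Set.indicator_of_mem hT, arcDensity, abs_of_nonneg
      (div_nonneg (meanFreq_nonneg a b hz) (mul_pos hz.1.1 hz.2.1).le)]
    have := meanFreq_le a b hz
    have h1 := hT.2.1
    have h2 := hT.2.2
    have h3 := hz.1.1.le
    exact div_le_div₀ (by norm_num) this (by positivity) (mul_le_mul h1.le h2.le hδ.le h3)
  · rw [Set.indicator_of_notMem hT, abs_zero]
    positivity

/-- `(π² / 6)` times the limiting joint distribution of consecutive gaps. -/
noncomputable def limitIntegral (a b : ℝ) : ENNReal :=
  ∫⁻ z in fareyTriangle, ENNReal.ofReal (arcDensity a b z)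

lemma tendsto_gridSum_trunc {χ : ℝ → ℝ} {c : ℝ} (hw : Equidistributed (arcWeight χ) c)
    (h0 : ∀ x, 0 ≤ χ x) (a b : ℝ) {δ : ℝ} (hδ : 0 < δ) :
    Tendsto (gridSum (arcWeight χ) ((truncTriangle δ).indicator (arcDensity a b))) atTop
      (𝓝 (c * ∫ z in unitSquare, (truncTriangle δ).indicator (arcDensity a b) z)) := by
  refine tendsto_gridSum hw (fun q q' => ?_) (fun z hz => abs_trunc_le a b hδ hz)
    (ae_continuousAt_trunc a b δ)
  unfold arcWeight
  split_ifs
  · exact h0 _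
  · exact le_rfl

end GapDistribution

/-! ### Passage to the limit against a Lipschitz weight. -/

namespace GapDistribution

open MeasureTheory

/-- The summands are the lengths of the arcs, which tile the unit interval up to a null set. -/
lemma sum_inv_fareyPairs {Q : ℕ} (hQ : 1 ≤ Q) :
    ∑ p ∈ fareyPairs Q, 1 / ((p.1 : ℝ) * p.2) = 1 := by
  have h := (integral_eq_sum_fareyArc hQ (fun _ => (1 : ℝ)) fun p _ =>
    (integrableOn_const (by simp [fareyArc]))).2
  rw [intervalIntegral.integral_const, sub_zero, one_smul] at h
  refine Eq.trans (Finset.sum_congr rfl fun p hp => ?_) h.symm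
  have := right_sub_left hp
  rw [setIntegral_const, smul_eq_mul, mul_one, fareyArc, Measure.real, Real.volume_Ioo, this,
    add_sub_cancel_left, ENNReal.toReal_ofReal (by positivity)]

/-- A given `q` admits at most `q` values of `q'`, all at least `Q / 2`, so it contributes at most
`2 / Q`; there are at most `δ Q` such `q`. -/
lemma sum_fareyPairs_le_of_small {Q : ℕ} {δ : ℝ} (hQ : 1 ≤ Q) (hδ0 : 0 < δ) (hδ : δ ≤ 1 / 2) :
    ∑ p ∈ (fareyPairs Q).filter (fun p => (p.1 : ℝ) ≤ δ * Q), 1 / ((p.1 : ℝ) * p.2) ≤ 2 * δ := by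
  have hQ' : (0 : ℝ) < Q := by exact_mod_cast hQ
  have hsub : (fareyPairs Q).filter (fun p => (p.1 : ℝ) ≤ δ * Q) ⊆
      ((Finset.Icc 1 ⌊δ * Q⌋₊).sigma (fun q => Finset.Ioc (Q - q) Q)).map
        (Equiv.sigmaEquivProd ℕ ℕ).toEmbedding := by
    intro p hp
    obtain ⟨h, h'⟩ := Finset.mem_filter.1 hp
    obtain ⟨⟨h1, h2⟩, ⟨h3, h4⟩, h5, h6⟩ := mem_fareyPairs.1 h
    simp only [Finset.mem_map_equiv, Equiv.sigmaEquivProd_symm_apply, Finset.mem_sigma,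
      Finset.mem_Icc, Finset.mem_Ioc]
    exact ⟨⟨h1, Nat.le_floor h'⟩, by omega, h4⟩
  refine (Finset.sum_le_sum_of_subset_of_nonneg hsub fun _ _ _ => by positivity).trans ?_
  rw [Finset.sum_map, Finset.sum_sigma]
  have hrow : ∀ q ∈ Finset.Icc 1 ⌊δ * Q⌋₊, ∑ q' ∈ Finset.Ioc (Q - q) Q,
      1 / ((q : ℝ) * q') ≤ 2 / Q := by
    intro q hq
    obtain ⟨h1, h2⟩ := Finset.mem_Icc.1 hq
    have hq0 : (0 : ℝ) < q := by exact_mod_cast h1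
    have h3 : (q : ℝ) ≤ δ * Q := (Nat.le_floor_iff (by positivity)).1 h2
    have h4 : (q : ℝ) ≤ Q / 2 := h3.trans (by nlinarith)
    have h5 : q ≤ Q := by exact_mod_cast h4.trans (by linarith : (Q : ℝ) / 2 ≤ Q)
    have : ∀ q' ∈ Finset.Ioc (Q - q) Q, 1 / ((q : ℝ) * q') ≤ 1 / (q * (Q / 2)) := by
      intro q' hq'
      have : ((Q - q : ℕ) : ℝ) < q' := by exact_mod_cast (Finset.mem_Ioc.1 hq').1
      rw [Nat.cast_sub h5] at this
      have : (Q : ℝ) / 2 ≤ q' := by linarith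
      gcongr
    refine (Finset.sum_le_sum this).trans ?_
    rw [Finset.sum_const, Nat.card_Ioc, Nat.sub_sub_self h5, nsmul_eq_mul]
    apply le_of_eq
    field_simp
  refine (Finset.sum_le_sum hrow).trans ?_
  rw [Finset.sum_const, Nat.card_Icc, Nat.add_sub_cancel, nsmul_eq_mul, mul_div_assoc',
    div_le_iff₀ hQ']
  have := Nat.floor_le (show 0 ≤ δ * Q by positivity)
  linarith

lemma sum_fareyPairs_le_of_small_right {Q : ℕ} {δ : ℝ} (hQ : 1 ≤ Q) (hδ0 : 0 < δ)
    (hδ : δ ≤ 1 / 2) :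
    ∑ p ∈ (fareyPairs Q).filter (fun p => (p.2 : ℝ) ≤ δ * Q), 1 / ((p.1 : ℝ) * p.2) ≤ 2 * δ := by
  refine le_trans (le_of_eq ?_) (sum_fareyPairs_le_of_small hQ hδ0 hδ)
  refine Finset.sum_nbij' Prod.swap Prod.swap ?_ ?_ (by simp) (by simp) (by simp [mul_comm])
  all_goals
    intro p hp
    simp only [Finset.mem_filter, mem_fareyPairs, Prod.fst_swap, Prod.snd_swap] at hp ⊢
    obtain ⟨⟨h1, h2, h3, h4⟩, h5⟩ := hp
    exact ⟨⟨h2, h1, by omega, h4.symm⟩, h5⟩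

lemma pairFreq_scaled_mem {Q : ℕ} {p : ℕ × ℕ} (hp : p ∈ fareyPairs Q) :
    ((p.1 : ℝ) / Q, (p.2 : ℝ) / Q) ∈ fareyTriangle := by
  obtain ⟨⟨h1, h2⟩, ⟨h3, h4⟩, h5, h6⟩ := mem_fareyPairs.1 hp
  have hQ : (0 : ℝ) < Q := by exact_mod_cast lt_of_lt_of_le h1 h2
  have p1 : (0 : ℝ) < p.1 := by exact_mod_cast h1
  have p2 : (0 : ℝ) < p.2 := by exact_mod_cast h3
  refine ⟨⟨⟨by positivity, ?_⟩, by positivity, ?_⟩, ?_⟩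
  · rw [div_le_one hQ]; exact_mod_cast h2
  · rw [div_le_one hQ]; exact_mod_cast h4
  · change 1 < (p.1 : ℝ) / Q + p.2 / Q
    rw [← add_div, one_lt_div hQ]; exact_mod_cast h5

/-- An arc has length at most `1 / Q`, so a Lipschitz weight may be frozen at its left end point. -/
lemma abs_arcIntegral_sub_le {Q : ℕ} {p : ℕ × ℕ} (hp : p ∈ fareyPairs Q) (a b : ℝ) {χ : ℝ → ℝ}
    {L : NNReal} (hχ : LipschitzWith L χ) :
    |arcIntegral a b χ Q p - meanFreq a b ((p.1 : ℝ) / Q, (p.2 : ℝ) / Q)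
      * χ ((leftNum p.1 p.2 : ℝ) / p.1)| ≤ 9 * L / Q := by
  have hT := pairFreq_scaled_mem hp
  obtain ⟨⟨h1, h2⟩, ⟨h3, h4⟩, h5, h6⟩ := mem_fareyPairs.1 hp
  have hQ : (0 : ℝ) < Q := by exact_mod_cast lt_of_lt_of_le h1 h2
  have p1 : (0 : ℝ) < p.1 := by exact_mod_cast h1
  have p2 : (0 : ℝ) < p.2 := by exact_mod_cast h3
  -- For positive integers `q q' ≥ q + q' - 1 ≥ Q`.
  have hpp : (Q : ℝ) ≤ p.1 * p.2 := by
    have : Q ≤ p.1 * p.2 := by nlinarith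
    exact_mod_cast this
  have hm : Measurable fun t : ℝ => pairFreq a b ((p.1 : ℝ) / Q) (p.2 / Q) (t / (p.2 / Q))
      ((1 - t) / (p.1 / Q)) :=
    measurable_pairFreq a b measurable_const measurable_const (by fun_prop) (by fun_prop)
  have hb : ∀ t : ℝ, |pairFreq a b ((p.1 : ℝ) / Q) (p.2 / Q) (t / (p.2 / Q))
      ((1 - t) / (p.1 / Q))| ≤ 9 := fun t =>
    abs_pairFreq_le a b hT.1.1.1.le hT.1.2.1.le hT.1.1.2 hT.1.2.2 _ _
  have hi : IntervalIntegrable (fun t : ℝ => pairFreq a b ((p.1 : ℝ) / Q) (p.2 / Q)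
      (t / (p.2 / Q)) ((1 - t) / (p.1 / Q))) volume 0 1 :=
    (intervalIntegrable_const (c := (9 : ℝ))).mono_fun hm.aestronglyMeasurable
      (Eventually.of_forall fun t => by
        simpa [Real.norm_eq_abs] using hb t)
  have hc : Continuous fun t : ℝ => χ ((leftNum p.1 p.2 : ℝ) / p.1 + t / (p.1 * p.2)) :=
    hχ.continuous.comp (by fun_prop)
  unfold arcIntegral meanFreq
  rw [← intervalIntegral.integral_mul_const, ← intervalIntegral.integral_sub
    (hi.mul_continuousOn hc.continuousOn) (hi.mul_const _)]
  have := intervalIntegral.norm_integral_le_of_norm_le_const (a := (0 : ℝ)) (b := 1)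
    (C := 9 * L / Q) (f := fun t => pairFreq a b ((p.1 : ℝ) / Q) (p.2 / Q)
      (t / (p.2 / Q)) ((1 - t) / (p.1 / Q)) * χ ((leftNum p.1 p.2 : ℝ) / p.1 + t / (p.1 * p.2))
      - pairFreq a b ((p.1 : ℝ) / Q) (p.2 / Q)
      (t / (p.2 / Q)) ((1 - t) / (p.1 / Q)) * χ ((leftNum p.1 p.2 : ℝ) / p.1)) ?_
  · rwa [Real.norm_eq_abs, sub_zero, abs_one, mul_one] at this
  · intro t ht
    rw [Set.uIoc_of_le zero_le_one] at ht
    rw [← mul_sub, Real.norm_eq_abs, abs_mul]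
    have hd : |χ ((leftNum p.1 p.2 : ℝ) / p.1 + t / (p.1 * p.2))
        - χ ((leftNum p.1 p.2 : ℝ) / p.1)| ≤ L * (1 / Q) := by
      have := hχ.dist_le_mul ((leftNum p.1 p.2 : ℝ) / p.1 + t / (p.1 * p.2))
        ((leftNum p.1 p.2 : ℝ) / p.1)
      rw [Real.dist_eq, Real.dist_eq, add_sub_cancel_left] at this
      refine this.trans (mul_le_mul_of_nonneg_left ?_ L.2)
      rw [abs_of_nonneg (div_nonneg ht.1.le (by positivity))]
      exact div_le_div₀ zero_le_one ht.2 hQ hpp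
    have e : (9 : ℝ) * (L * (1 / Q)) = 9 * L / Q := by ring
    exact e ▸ mul_le_mul (hb t) hd (abs_nonneg _) (by norm_num)

/-- Only the arcs with both denominators larger than `δ Q` matter. -/
lemma gridSum_trunc_eq {Q : ℕ} (hQ : 1 ≤ Q) (a b δ : ℝ) (χ : ℝ → ℝ) :
    gridSum (arcWeight χ) ((truncTriangle δ).indicator (arcDensity a b)) Q
      = ∑ p ∈ (fareyPairs Q).filter (fun p => δ * Q < p.1 ∧ δ * Q < p.2), 1 / ((p.1 : ℝ) * p.2)
        * (meanFreq a b ((p.1 : ℝ) / Q, (p.2 : ℝ) / Q) * χ ((leftNum p.1 p.2 : ℝ) / p.1)) := by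
  have hQ' : (0 : ℝ) < Q := by exact_mod_cast hQ
  unfold gridSum
  rw [Finset.sum_div, Finset.sum_filter, fareyPairs, Finset.sum_filter]
  refine Finset.sum_congr rfl fun p hp => ?_
  obtain ⟨hp1, hp2⟩ := Finset.mem_product.1 hp
  have h1 := (Finset.mem_Icc.1 hp1).1
  have h3 := (Finset.mem_Icc.1 hp2).1
  have p1 : (0 : ℝ) < p.1 := by exact_mod_cast h1
  have p2 : (0 : ℝ) < p.2 := by exact_mod_cast h3
  by_cases hf : Q < p.1 + p.2 ∧ Nat.Coprime p.1 p.2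
  · rw [if_pos hf]
    have hmem : p ∈ fareyPairs Q := Finset.mem_filter.2 ⟨hp, hf⟩
    have hT := pairFreq_scaled_mem hmem
    by_cases hδ : δ * Q < p.1 ∧ δ * Q < p.2
    · have : ((p.1 : ℝ) / Q, (p.2 : ℝ) / Q) ∈ truncTriangle δ :=
        ⟨hT, (lt_div_iff₀ hQ').2 hδ.1, (lt_div_iff₀ hQ').2 hδ.2⟩
      rw [if_pos hδ, Set.indicator_of_mem this, arcWeight, if_pos hf.2, arcDensity]
      simp only
      field_simp
    · have : ((p.1 : ℝ) / Q, (p.2 : ℝ) / Q) ∉ truncTriangle δ := fun i =>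
        hδ ⟨(lt_div_iff₀ hQ').1 i.2.1, (lt_div_iff₀ hQ').1 i.2.2⟩
      rw [if_neg hδ, Set.indicator_of_notMem this, mul_zero, zero_div]
  · rw [if_neg hf]
    by_cases hco : Nat.Coprime p.1 p.2
    · have : ((p.1 : ℝ) / Q, (p.2 : ℝ) / Q) ∉ truncTriangle δ := fun i => by
        have := i.1.2
        change 1 < (p.1 : ℝ) / Q + p.2 / Q at this
        rw [← add_div, one_lt_div hQ'] at this
        exact hf ⟨by exact_mod_cast this, hco⟩
      rw [Set.indicator_of_notMem this, mul_zero, zero_div]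
    · rw [arcWeight, if_neg hco, zero_mul, zero_div]

/-- The constant is `9 · 2`, from the bounds on `meanFreq` and `χ`, against total arc length 1.
Since it does not depend on `δ`, it will also give the finiteness of `limitIntegral`. -/
lemma abs_gridSum_trunc_le {Q : ℕ} (hQ : 1 ≤ Q) (a b δ : ℝ) {χ : ℝ → ℝ} (h0 : ∀ x, 0 ≤ χ x)
    (h2 : ∀ x, χ x ≤ 2) :
    gridSum (arcWeight χ) ((truncTriangle δ).indicator (arcDensity a b)) Q ≤ 18 := by
  rw [gridSum_trunc_eq hQ]
  calc _ ≤ ∑ p ∈ (fareyPairs Q).filter (fun p => δ * Q < p.1 ∧ δ * Q < p.2),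
        1 / ((p.1 : ℝ) * p.2) * 18 := by
        refine Finset.sum_le_sum fun p hp => mul_le_mul_of_nonneg_left ?_ (by positivity)
        have hz := (pairFreq_scaled_mem (Finset.mem_filter.1 hp).1).1
        have := mul_le_mul (meanFreq_le a b hz) (h2 ((leftNum p.1 p.2 : ℝ) / p.1)) (h0 _)
          (by norm_num)
        linarith
    _ ≤ ∑ p ∈ fareyPairs Q, 1 / ((p.1 : ℝ) * p.2) * 18 :=
        Finset.sum_le_sum_of_subset_of_nonneg (Finset.filter_subset _ _)
          fun _ _ _ => by positivity
    _ = 18 := by rw [← Finset.sum_mul, sum_inv_fareyPairs hQ, one_mul]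

/-- Freezing the weight costs `9 L / Q`. The arcs with a denominator at most `δ Q` have total length
at most `4 δ`, with an integrand bounded by 18. -/
lemma abs_integral_sub_gridSum_le {Q : ℕ} (hQ : 1 ≤ Q) (a b : ℝ) {δ : ℝ} (hδ0 : 0 < δ)
    (hδ : δ ≤ 1 / 2) {χ : ℝ → ℝ} {L : NNReal} (hχ : LipschitzWith L χ) (h0 : ∀ x, 0 ≤ χ x)
    (h2 : ∀ x, χ x ≤ 2) :
    |(∫ α in (0 : ℝ)..1, (pairCount Q a b α : ℝ) / Q * χ α)
      - gridSum (arcWeight χ) ((truncTriangle δ).indicator (arcDensity a b)) Q|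
      ≤ 9 * L / Q + 72 * δ := by
  rw [(integral_pairCount hQ a b hχ.continuous).2, gridSum_trunc_eq hQ]
  set M : ℕ × ℕ → ℝ := fun p => 1 / ((p.1 : ℝ) * p.2)
        * (meanFreq a b ((p.1 : ℝ) / Q, (p.2 : ℝ) / Q) * χ ((leftNum p.1 p.2 : ℝ) / p.1)) with hM
  have hMle : ∀ p ∈ fareyPairs Q, |M p| ≤ 1 / ((p.1 : ℝ) * p.2) * 18 := by
    intro p hp
    have hz := (pairFreq_scaled_mem hp).1
    have h3 := meanFreq_nonneg a b hz
    have := mul_le_mul (meanFreq_le a b hz) (h2 ((leftNum p.1 p.2 : ℝ) / p.1)) (h0 _)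
          (by norm_num)
    rw [hM, abs_of_nonneg (mul_nonneg (by positivity) (mul_nonneg h3 (h0 _)))]
    exact mul_le_mul_of_nonneg_left (by linarith) (by positivity)
  have e1 : |∑ p ∈ fareyPairs Q, 1 / ((p.1 : ℝ) * p.2) * arcIntegral a b χ Q p
      - ∑ p ∈ fareyPairs Q, M p| ≤ 9 * L / Q := by
    rw [← Finset.sum_sub_distrib]
    refine (Finset.abs_sum_le_sum_abs _ _).trans ?_
    calc _ ≤ ∑ p ∈ fareyPairs Q, 1 / ((p.1 : ℝ) * p.2) * (9 * L / Q) := by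
          refine Finset.sum_le_sum fun p hp => ?_
          rw [hM, ← mul_sub, abs_mul, abs_of_nonneg (by positivity : (0 : ℝ) ≤ 1 / (p.1 * p.2))]
          exact mul_le_mul_of_nonneg_left (abs_arcIntegral_sub_le hp a b hχ) (by positivity)
      _ = 9 * L / Q := by rw [← Finset.sum_mul, sum_inv_fareyPairs hQ, one_mul]
  have e2 : |∑ p ∈ fareyPairs Q, M p
      - ∑ p ∈ (fareyPairs Q).filter (fun p => δ * Q < p.1 ∧ δ * Q < p.2), M p| ≤ 72 * δ := by
    rw [← Finset.sum_filter_add_sum_filter_not (fareyPairs Q)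
      (fun p => δ * Q < p.1 ∧ δ * Q < p.2), add_sub_cancel_left]
    refine (Finset.abs_sum_le_sum_abs _ _).trans ?_
    have hs : (fareyPairs Q).filter (fun p => ¬ (δ * Q < p.1 ∧ δ * Q < p.2)) =
        (fareyPairs Q).filter (fun p => (p.1 : ℝ) ≤ δ * Q)
          ∪ (fareyPairs Q).filter (fun p => (p.2 : ℝ) ≤ δ * Q) := by
      rw [← Finset.filter_or]
      refine Finset.filter_congr fun p _ => ?_
      rw [not_and_or, not_lt, not_lt]
    rw [hs]
    have hun : ∀ s t : Finset (ℕ × ℕ), ∀ f : ℕ × ℕ → ℝ, (∀ p, 0 ≤ f p) →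
        ∑ p ∈ s ∪ t, f p ≤ ∑ p ∈ s, f p + ∑ p ∈ t, f p := by
      intro s t f hf
      rw [← Finset.sum_union_inter]
      exact le_add_of_nonneg_right (Finset.sum_nonneg fun p _ => hf p)
    refine (hun _ _ _ fun _ => abs_nonneg _).trans ?_
    have b1 : ∑ p ∈ (fareyPairs Q).filter (fun p => (p.1 : ℝ) ≤ δ * Q), |M p| ≤ 36 * δ := by
      refine (Finset.sum_le_sum fun p hp => hMle p (Finset.mem_filter.1 hp).1).trans ?_
      rw [← Finset.sum_mul]
      linarith [sum_fareyPairs_le_of_small hQ hδ0 hδ]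
    have b2 : ∑ p ∈ (fareyPairs Q).filter (fun p => (p.2 : ℝ) ≤ δ * Q), |M p| ≤ 36 * δ := by
      refine (Finset.sum_le_sum fun p hp => hMle p (Finset.mem_filter.1 hp).1).trans ?_
      rw [← Finset.sum_mul]
      linarith [sum_fareyPairs_le_of_small_right hQ hδ0 hδ]
    linarith
  exact (abs_sub_le _ _ _).trans (add_le_add e1 e2)

lemma arcDensity_nonneg (a b : ℝ) {z : ℝ × ℝ} (hz : z ∈ unitSquare) : 0 ≤ arcDensity a b z :=
  div_nonneg (meanFreq_nonneg a b hz) (mul_pos hz.1.1 hz.2.1).le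

lemma measurable_arcDensity (a b : ℝ) : Measurable (arcDensity a b) := by
  refine Measurable.div ?_ (by fun_prop)
  unfold meanFreq
  simp only [intervalIntegral.integral_of_le zero_le_one]
  have : Measurable (Function.uncurry fun (z : ℝ × ℝ) (t : ℝ) =>
      pairFreq a b z.1 z.2 (t / z.2) ((1 - t) / z.1)) :=
    measurable_pairFreq a b (by fun_prop) (by fun_prop) (by fun_prop) (by fun_prop)
  exact (this.stronglyMeasurable.integral_prod_right).measurable

lemma integral_trunc_eq (a b δ : ℝ) :
    ∫ z in unitSquare, (truncTriangle δ).indicator (arcDensity a b) z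
      = (∫⁻ z in truncTriangle δ, ENNReal.ofReal (arcDensity a b z)).toReal := by
  have hsub : truncTriangle δ ⊆ unitSquare := fun z hz => hz.1.1
  rw [setIntegral_indicator (measurableSet_truncTriangle δ),
    Set.inter_eq_right.2 hsub, integral_eq_lintegral_of_nonneg_ae]
  · filter_upwards [ae_restrict_mem (measurableSet_truncTriangle δ)] with z hz
    exact arcDensity_nonneg a b (hsub hz)
  · exact (measurable_arcDensity a b).aestronglyMeasurable

lemma lintegral_trunc_ne_top (a b : ℝ) {δ : ℝ} (hδ : 0 < δ) :
    ∫⁻ z in truncTriangle δ, ENNReal.ofReal (arcDensity a b z) ≠ ⊤ := by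
  have hsub : truncTriangle δ ⊆ unitSquare := fun z hz => hz.1.1
  have h1 : ∫⁻ z in truncTriangle δ, ENNReal.ofReal (arcDensity a b z)
      ≤ ∫⁻ _ in truncTriangle δ, ENNReal.ofReal (9 / (δ * δ)) := by
    refine setLIntegral_mono measurable_const fun z hz => ENNReal.ofReal_le_ofReal ?_
    have := (le_abs_self _).trans (abs_trunc_le a b hδ (hsub hz))
    rwa [Set.indicator_of_mem hz] at this
  rw [setLIntegral_const] at h1
  refine ne_top_of_le_ne_top (ENNReal.mul_ne_top ENNReal.ofReal_ne_top ?_) h1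
  exact ne_top_of_le_ne_top (by rw [volume_unitSquare]; simp) (measure_mono hsub)

lemma tendsto_lintegral_trunc (a b : ℝ) :
    Tendsto (fun n : ℕ => ∫⁻ z in truncTriangle (1 / ((n : ℝ) + 2)),
      ENNReal.ofReal (arcDensity a b z)) atTop (𝓝 (limitIntegral a b)) := by
  have hU : fareyTriangle = ⋃ n : ℕ, truncTriangle (1 / ((n : ℝ) + 2)) := by
    ext z
    simp only [Set.mem_iUnion]
    refine ⟨fun hz => ?_, fun ⟨n, hn⟩ => hn.1⟩
    obtain ⟨n, hn⟩ := exists_nat_one_div_lt (lt_min hz.1.1.1 hz.1.2.1)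
    refine ⟨n, hz, ?_⟩
    have : 1 / ((n : ℝ) + 2) ≤ 1 / (n + 1) := by gcongr; norm_num
    exact ⟨(this.trans_lt hn).trans_le (min_le_left _ _),
      (this.trans_lt hn).trans_le (min_le_right _ _)⟩
  have hmono : Monotone fun n : ℕ => truncTriangle (1 / ((n : ℝ) + 2)) := by
    intro n m hnm z hz
    have : 1 / ((m : ℝ) + 2) ≤ 1 / (n + 2) := by gcongr
    exact ⟨hz.1, this.trans_lt hz.2.1, this.trans_lt hz.2.2⟩
  rw [limitIntegral, hU, setLIntegral_iUnion_of_directed _ hmono.directed_le]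
  refine tendsto_atTop_iSup fun n m hnm => lintegral_mono_set (hmono hnm)

/-- The mean value of the pair count against a weight. -/
lemma tendsto_integral_pairCount {χ : ℝ → ℝ} {L : NNReal} (hχ : LipschitzWith L χ)
    (h0 : ∀ x, 0 ≤ χ x) (h2 : ∀ x, χ x ≤ 2) (hw : Equidistributed (arcWeight χ) (6 / Real.pi ^ 2))
    (a b : ℝ) :
    limitIntegral a b ≠ ⊤ ∧
    Tendsto (fun Q : ℕ => ∫ α in (0 : ℝ)..1, (pairCount Q a b α : ℝ) / Q * χ α) atTop
      (𝓝 (6 / Real.pi ^ 2 * (limitIntegral a b).toReal)) := by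
  have hπ : 0 < 6 / Real.pi ^ 2 := by positivity
  set d : ℕ → ℝ := fun n => 1 / ((n : ℝ) + 2) with hd
  have hd0 : ∀ n, 0 < d n := fun n => by positivity
  have hd1 : ∀ n, d n ≤ 1 / 2 := fun n => by
    rw [hd]
    exact one_div_le_one_div_of_le (by norm_num) (by linarith [n.cast_nonneg (α := ℝ)])
  have hv : ∀ n, Tendsto
      (gridSum (arcWeight χ) ((truncTriangle (d n)).indicator (arcDensity a b))) atTop
      (𝓝 (6 / Real.pi ^ 2 * (∫⁻ z in truncTriangle (d n),
        ENNReal.ofReal (arcDensity a b z)).toReal)) := fun n => by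
    rw [← integral_trunc_eq a b (d n)]
    exact tendsto_gridSum_trunc hw h0 a b (hd0 n)
  have hlim := tendsto_lintegral_trunc a b
  have hfin : limitIntegral a b ≠ ⊤ := by
    have : limitIntegral a b ≤ ENNReal.ofReal (18 / (6 / Real.pi ^ 2)) := by
      refine le_of_tendsto hlim (Eventually.of_forall fun n => ?_)
      rw [ENNReal.le_ofReal_iff_toReal_le (lintegral_trunc_ne_top a b (hd0 n)) (by positivity),
        le_div_iff₀ hπ, mul_comm]
      refine le_of_tendsto (hv n) ?_
      filter_upwards [eventually_ge_atTop 1] with Q hQ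
      exact abs_gridSum_trunc_le hQ a b _ h0 h2
    exact ne_top_of_le_ne_top ENNReal.ofReal_ne_top this
  refine ⟨hfin, ?_⟩
  have hlim' : Tendsto (fun n : ℕ => 6 / Real.pi ^ 2 * (∫⁻ z in truncTriangle (d n),
      ENNReal.ofReal (arcDensity a b z)).toReal) atTop
      (𝓝 (6 / Real.pi ^ 2 * (limitIntegral a b).toReal)) :=
    ((ENNReal.tendsto_toReal hfin).comp hlim).const_mul _
  have hdlim : Tendsto d atTop (𝓝 0) := by
    have := tendsto_const_div_atTop_nhds_zero_nat (1 : ℝ)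
    have := (tendsto_add_atTop_iff_nat 2).2 this
    simpa [hd] using this
  rw [Metric.tendsto_atTop]
  intro ε hε
  -- The truncation is fixed first, with `72 δ < ε / 4`; only then is `Q` taken large.
  have ev := (hdlim.eventually (gt_mem_nhds (show 0 < ε / 400 by positivity))).and
    (Metric.tendsto_nhds.1 hlim' (ε / 4) (by positivity))
  obtain ⟨n, hn1, hn2⟩ := ev.exists
  have hLlim : Tendsto (fun Q : ℕ => 9 * (L : ℝ) / Q) atTop (𝓝 0) :=
    tendsto_const_div_atTop_nhds_zero_nat _
  obtain ⟨N, hN⟩ := eventually_atTop.1 (((eventually_ge_atTop 1).and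
    (hLlim.eventually (gt_mem_nhds (show 0 < ε / 4 by positivity)))).and
    (Metric.tendsto_nhds.1 (hv n) (ε / 4) (by positivity)))
  refine ⟨N, fun Q hQ => ?_⟩
  obtain ⟨⟨q1, q2⟩, q3⟩ := hN Q hQ
  have q4 := abs_integral_sub_gridSum_le q1 a b (hd0 n) (hd1 n) hχ h0 h2
  rw [Real.dist_eq] at *
  rw [abs_le] at q4
  rw [abs_lt] at *
  constructor <;> linarith [q4.1, q4.2, q3.1, q3.2, hn2.1, hn2.2]

end GapDistribution

/-! ### Weyl's criterion and the limit on arbitrary intervals. -/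

namespace GapDistribution

open MeasureTheory

/-- A sequence of uniformly bounded nonnegative densities on the circle whose Fourier
coefficients converge to those of the constant `c`. -/
structure WeylSequence (f : ℕ → ℝ → ℝ) (c : ℝ) : Prop where
  nonneg : ∀ n x, 0 ≤ f n x
  le_one : ∀ n x, f n x ≤ 1
  integrable : ∀ n, IntervalIntegrable (f n) volume 0 1
  periodic : ∀ n, Function.Periodic (f n) 1
  tendsto_mean : Tendsto (fun n => ∫ x in (0 : ℝ)..1, f n x) atTop (𝓝 c)
  tendsto_cos : ∀ m : ℤ, m ≠ 0 →
    Tendsto (fun n => ∫ x in (0 : ℝ)..1, f n x * Real.cos (2 * Real.pi * m * x)) atTop (𝓝 0)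
  tendsto_sin : ∀ m : ℤ, m ≠ 0 →
    Tendsto (fun n => ∫ x in (0 : ℝ)..1, f n x * Real.sin (2 * Real.pi * m * x)) atTop (𝓝 0)

namespace WeylSequence

variable {f : ℕ → ℝ → ℝ} {c : ℝ}

lemma continuous_lift (h : C(AddCircle (1 : ℝ), ℂ)) :
    Continuous fun x : ℝ => h (x : AddCircle (1 : ℝ)) :=
  h.continuous.comp (AddCircle.continuous_mk' 1)

lemma integrable_mul (hf : WeylSequence f c) (n : ℕ) {g : ℝ → ℂ} (hg : Continuous g) :
    IntervalIntegrable (fun x => (f n x : ℂ) * g x) volume 0 1 := by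
  have : IntervalIntegrable (fun x => (f n x : ℂ)) volume 0 1 := by
    have := hf.integrable n
    rw [intervalIntegrable_iff] at this ⊢
    exact this.ofReal
  exact this.mul_continuousOn hg.continuousOn

lemma tendsto_fourier (hf : WeylSequence f c) (m : ℤ) :
    Tendsto (fun n => ∫ x in (0 : ℝ)..1, (f n x : ℂ) * fourier m (x : AddCircle (1 : ℝ))) atTop
      (𝓝 (c * ∫ x in (0 : ℝ)..1, fourier m (x : AddCircle (1 : ℝ)))) := by
  have : Fact ((0 : ℝ) < 1) := ⟨one_pos⟩
  have hval : ∀ x : ℝ, fourier m (x : AddCircle (1 : ℝ))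
      = (Real.cos (2 * Real.pi * m * x) : ℂ) + (Real.sin (2 * Real.pi * m * x) : ℂ) * Complex.I := by
    intro x
    rw [fourier_coe_apply, Complex.ofReal_cos, Complex.ofReal_sin, ← Complex.exp_mul_I]
    congr 1
    push_cast
    ring
  by_cases hm : m = 0
  · subst hm
    simp only [fourier_zero, mul_one, intervalIntegral.integral_const, sub_zero, one_smul]
    have := (Complex.continuous_ofReal.tendsto _).comp hf.tendsto_mean
    refine this.congr fun n => ?_
    simp only [Function.comp_apply]
    rw [intervalIntegral.integral_ofReal]
  · have hz : ∫ x in (0 : ℝ)..1, fourier m (x : AddCircle (1 : ℝ)) = (0 : ℂ) := by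
      have hne : (2 * Real.pi * Complex.I * m : ℂ) ≠ 0 := by
        simp [hm, Real.pi_ne_zero]
      have : ∀ x : ℝ, fourier m (x : AddCircle (1 : ℝ)) = Complex.exp (2 * Real.pi * Complex.I * m * x) := by
        intro x; rw [fourier_coe_apply]; simp
      simp only [this]
      rw [integral_exp_mul_complex hne]
      have e : Complex.exp (2 * Real.pi * Complex.I * m * (1 : ℝ)) = 1 := by
        rw [Complex.exp_eq_one_iff]; exact ⟨m, by push_cast; ring⟩
      rw [e]; simp
    rw [hz, mul_zero]
    have h1 := (Complex.continuous_ofReal.tendsto _).comp (hf.tendsto_cos m hm)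
    have h2 := (Complex.continuous_ofReal.tendsto _).comp (hf.tendsto_sin m hm)
    have h3 := h1.add (h2.mul_const Complex.I)
    simp only [Complex.ofReal_zero, zero_mul, add_zero] at h3
    refine h3.congr fun n => ?_
    simp only [hval]
    change ((∫ x in (0 : ℝ)..1, f n x * Real.cos (2 * Real.pi * m * x) : ℝ) : ℂ)
      + ((∫ x in (0 : ℝ)..1, f n x * Real.sin (2 * Real.pi * m * x) : ℝ) : ℂ) * Complex.I = _
    rw [← intervalIntegral.integral_ofReal, ← intervalIntegral.integral_ofReal,
      ← intervalIntegral.integral_mul_const, ← intervalIntegral.integral_add]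
    · refine intervalIntegral.integral_congr fun x _ => ?_
      push_cast
      ring
    · have := hf.integrable_mul n (g := fun x => (Real.cos (2 * Real.pi * m * x) : ℂ)) (by fun_prop)
      simpa using this
    · have := (hf.integrable_mul n (g := fun x => (Real.sin (2 * Real.pi * m * x) : ℂ))
        (by fun_prop)).mul_const Complex.I
      simpa only [Complex.ofReal_mul] using this

lemma norm_integral_mul_sub_le (hf : WeylSequence f c) (n : ℕ) (g h : C(AddCircle (1 : ℝ), ℂ)) :
    ‖(∫ x in (0 : ℝ)..1, (f n x : ℂ) * g x) - ∫ x in (0 : ℝ)..1, (f n x : ℂ) * h x‖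
      ≤ ‖g - h‖ := by
  rw [← intervalIntegral.integral_sub (hf.integrable_mul n (continuous_lift g))
    (hf.integrable_mul n (continuous_lift h))]
  have := intervalIntegral.norm_integral_le_of_norm_le_const (a := (0 : ℝ)) (b := 1)
    (C := ‖g - h‖) (f := fun x => (f n x : ℂ) * g x - (f n x : ℂ) * h x) ?_
  · simpa using this
  · intro x _
    rw [← mul_sub, norm_mul, Complex.norm_real, Real.norm_of_nonneg (hf.nonneg n x)]
    calc _ ≤ 1 * ‖g - h‖ := mul_le_mul (hf.le_one n x) ((g - h).norm_coe_le_norm x)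
          (norm_nonneg _) zero_le_one
      _ = _ := one_mul _

/-- Trigonometric polynomials are dense in the continuous functions, and both the integrals against
`f n` and the limit functional are 1-Lipschitz in the sup norm, uniformly in `n`. -/
lemma tendsto_continuous (hf : WeylSequence f c) (h : C(AddCircle (1 : ℝ), ℂ)) :
    Tendsto (fun n => ∫ x in (0 : ℝ)..1, (f n x : ℂ) * h x) atTop
      (𝓝 (c * ∫ x in (0 : ℝ)..1, h x)) := by
  have hfact : Fact ((0 : ℝ) < 1) := ⟨one_pos⟩
  have hspan : ∀ g ∈ Submodule.span ℂ (Set.range (fourier (T := (1 : ℝ)))),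
      Tendsto (fun n => ∫ x in (0 : ℝ)..1, (f n x : ℂ) * g x) atTop
      (𝓝 (c * ∫ x in (0 : ℝ)..1, g x)) := by
    intro g hg
    induction hg using Submodule.span_induction with
    | mem g hg =>
      obtain ⟨m, rfl⟩ := hg
      exact hf.tendsto_fourier m
    | zero => simp
    | add g₁ g₂ _ _ i₁ i₂ =>
      have e1 : ∫ x in (0 : ℝ)..1, (g₁ + g₂) x = (∫ x in (0 : ℝ)..1, g₁ x) + ∫ x in (0 : ℝ)..1, g₂ x :=
        intervalIntegral.integral_add ((continuous_lift g₁).intervalIntegrable _ _)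
          ((continuous_lift g₂).intervalIntegrable _ _)
      rw [e1, mul_add]
      refine (i₁.add i₂).congr fun n => ?_
      rw [← intervalIntegral.integral_add (hf.integrable_mul n (continuous_lift g₁))
        (hf.integrable_mul n (continuous_lift g₂))]
      exact intervalIntegral.integral_congr fun x _ => by simp [mul_add]
    | smul r g _ i =>
      have e1 : ∫ x in (0 : ℝ)..1, (r • g) x = r * ∫ x in (0 : ℝ)..1, g x := by
        rw [← intervalIntegral.integral_const_mul]; rfl
      rw [e1, mul_left_comm]
      refine (i.const_mul r).congr fun n => ?_
      rw [← intervalIntegral.integral_const_mul]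
      exact intervalIntegral.integral_congr fun x _ => by
        simp only [ContinuousMap.smul_apply, smul_eq_mul]; ring
  have hmem : h ∈ (Submodule.span ℂ (Set.range (fourier (T := (1 : ℝ))))).topologicalClosure := by
    rw [span_fourier_closure_eq_top]; trivial
  rw [← SetLike.mem_coe, Submodule.topologicalClosure_coe] at hmem
  have hc : ‖(c : ℂ)‖ ≤ 1 := by
    have h1 : ∀ n, ∫ x in (0 : ℝ)..1, f n x ≤ 1 := fun n => by
      have := intervalIntegral.integral_mono_on zero_le_one (hf.integrable n)
        (intervalIntegrable_const (c := (1 : ℝ))) fun x _ => hf.le_one n x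
      simpa using this
    have h0 : ∀ n, 0 ≤ ∫ x in (0 : ℝ)..1, f n x := fun n =>
      intervalIntegral.integral_nonneg zero_le_one fun x _ => hf.nonneg n x
    rw [Complex.norm_real, Real.norm_of_nonneg (ge_of_tendsto' hf.tendsto_mean h0)]
    exact le_of_tendsto' hf.tendsto_mean h1
  rw [Metric.tendsto_atTop]
  intro ε hε
  obtain ⟨g, hg, hgh⟩ := Metric.mem_closure_iff.1 hmem (ε / 4) (by positivity)
  obtain ⟨N, hN⟩ := Metric.tendsto_atTop.1 (hspan g hg) (ε / 4) (by positivity)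
  refine ⟨N, fun n hn => ?_⟩
  have d1 := hf.norm_integral_mul_sub_le n h g
  have d2 := hN n hn
  have d3 : ‖(c * ∫ x in (0 : ℝ)..1, g x) - c * ∫ x in (0 : ℝ)..1, h x‖ ≤ ‖h - g‖ := by
    rw [← mul_sub, ← intervalIntegral.integral_sub ((continuous_lift g).intervalIntegrable _ _)
      ((continuous_lift h).intervalIntegrable _ _), norm_mul]
    have := intervalIntegral.norm_integral_le_of_norm_le_const (a := (0 : ℝ)) (b := 1)
      (C := ‖h - g‖) (f := fun x => g (x : AddCircle (1 : ℝ)) - h x) fun x _ => by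
        rw [norm_sub_rev]; exact (h - g).norm_coe_le_norm x
    rw [sub_zero, abs_one, mul_one] at this
    calc _ ≤ 1 * ‖h - g‖ := mul_le_mul hc this (norm_nonneg _) zero_le_one
      _ = _ := one_mul _
  rw [dist_eq_norm] at *
  calc ‖(∫ x in (0 : ℝ)..1, (f n x : ℂ) * h x) - c * ∫ x in (0 : ℝ)..1, h x‖
      = ‖((∫ x in (0 : ℝ)..1, (f n x : ℂ) * h x) - ∫ x in (0 : ℝ)..1, (f n x : ℂ) * g x)
        + ((∫ x in (0 : ℝ)..1, (f n x : ℂ) * g x) - c * ∫ x in (0 : ℝ)..1, g x)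
        + ((c * ∫ x in (0 : ℝ)..1, g x) - c * ∫ x in (0 : ℝ)..1, h x)‖ := by congr 1; ring
    _ ≤ _ := norm_add₃_le
    _ < ε := by linarith

lemma intervalIntegrable (hf : WeylSequence f c) (n : ℕ) (u v : ℝ) :
    IntervalIntegrable (f n) volume u v :=
  (hf.periodic n).intervalIntegrable₀ one_ne_zero (hf.integrable n) u v

/-- Thickened indicators are continuous majorants of the indicator of a closed arc and decrease to
it. As `f` is nonnegative, they bound the integral from above. -/
lemma eventually_integral_le (hf : WeylSequence f c) {u v : ℝ} (hu : 0 ≤ u) (huv : u ≤ v)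
    (hv : v ≤ 1) {ε : ℝ} (hε : 0 < ε) :
    ∀ᶠ n in atTop, ∫ x in u..v, f n x ≤ c * (v - u) + ε := by
  set E : Set (AddCircle (1 : ℝ)) := (fun x : ℝ => (x : AddCircle (1 : ℝ))) '' Set.Icc u v with hE
  have hEc : IsClosed E := (isCompact_Icc.image (AddCircle.continuous_mk' 1)).isClosed
  have hd0 : ∀ k : ℕ, (0 : ℝ) < 1 / (k + 1) := fun k => by positivity
  set g : ℕ → AddCircle (1 : ℝ) → ℝ := fun k z => (thickenedIndicator (hd0 k) E z : ℝ) with hg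
  have hgc : ∀ k, Continuous (g k) := fun k =>
    NNReal.continuous_coe.comp (thickenedIndicator (hd0 k) E).continuous
  have hg0 : ∀ k z, 0 ≤ g k z := fun k z => NNReal.coe_nonneg _
  have hg1 : ∀ k z, g k z ≤ 1 := fun k z =>
    NNReal.coe_le_one.2 (thickenedIndicator_le_one (hd0 k) E z)
  have hgE : ∀ k, ∀ x ∈ Set.Icc u v, g k (x : AddCircle (1 : ℝ)) = 1 := fun k x hx => by
    have := thickenedIndicator_one (hd0 k) E (Set.mem_image_of_mem _ hx)
    simp only [hg]
    rw [this]; rfl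
  have hlim : Tendsto (fun k => ∫ x in (0 : ℝ)..1, g k (x : AddCircle (1 : ℝ))) atTop
      (𝓝 (∫ x in (0 : ℝ)..1, (Set.Icc u v).indicator (fun _ => (1 : ℝ)) x)) := by
    have hp := thickenedIndicator_tendsto_indicator_closure hd0
      tendsto_one_div_add_atTop_nhds_zero_nat E
    rw [hEc.closure_eq, tendsto_pi_nhds] at hp
    refine intervalIntegral.tendsto_integral_filter_of_dominated_convergence (fun _ => (1 : ℝ))
      (Eventually.of_forall fun k => ?_) (Eventually.of_forall fun k => ?_)
      intervalIntegrable_const ?_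
    · exact ((hgc k).comp (AddCircle.continuous_mk' 1)).aestronglyMeasurable
    · refine Eventually.of_forall fun x _ => ?_
      rw [Real.norm_of_nonneg (hg0 k _)]; exact hg1 k _
    -- The point 1 is set aside because the circle identifies it with 0, which may lie in the arc
    -- when 1 does not lie in `[u, v]`.
    · have hne : ∀ᵐ x : ℝ, x ≠ 1 := by simp [ae_iff]
      filter_upwards [hne] with x hx1 hx
      rw [Set.uIoc_of_le zero_le_one] at hx
      have hmem : (x : AddCircle (1 : ℝ)) ∈ E ↔ x ∈ Set.Icc u v := by
        constructor
        · rintro ⟨r, hr, he⟩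
          have he' : ((r - x : ℝ) : AddCircle (1 : ℝ)) = 0 := by
            rw [AddCircle.coe_sub, sub_eq_zero]; exact he
          obtain ⟨k, hk⟩ := (AddCircle.coe_eq_zero_iff (1 : ℝ)).1 he'
          rw [zsmul_eq_mul, mul_one] at hk
          have hx2 : x < 1 := lt_of_le_of_ne hx.2 hx1
          have k1 : ((-1 : ℤ) : ℝ) < k := by push_cast; linarith [hr.1]
          have k2 : (k : ℝ) < ((1 : ℤ) : ℝ) := by push_cast; linarith [hr.2, hx.1]
          have : k = 0 := by
            have := Int.cast_lt.1 k1
            have := Int.cast_lt.1 k2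
            omega
          rw [this, Int.cast_zero] at hk
          rwa [show x = r by linarith]
        · exact fun h => Set.mem_image_of_mem _ h
      have := (NNReal.continuous_coe.tendsto _).comp (hp (x : AddCircle (1 : ℝ)))
      refine Tendsto.congr (fun _ => rfl) (Eq.subst (motive := fun r => Tendsto _ atTop (𝓝 r)) ?_ this)
      by_cases hi : x ∈ Set.Icc u v
      · rw [Set.indicator_of_mem hi, Set.indicator_of_mem (hmem.2 hi)]; simp
      · rw [Set.indicator_of_notMem hi, Set.indicator_of_notMem (fun h => hi (hmem.1 h))]; simp
  have hval : ∫ x in (0 : ℝ)..1, (Set.Icc u v).indicator (fun _ => (1 : ℝ)) x = v - u := by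
    rw [intervalIntegral.integral_of_le zero_le_one, ← integral_Icc_eq_integral_Ioc,
      setIntegral_indicator measurableSet_Icc, Set.inter_eq_right.2 (Set.Icc_subset_Icc hu hv)]
    simp [huv]
  rw [hval] at hlim
  have hlim2 := hlim.const_mul c
  obtain ⟨k, hk⟩ := (hlim2.eventually
    (gt_mem_nhds (show c * (v - u) < c * (v - u) + ε / 2 by linarith))).exists
  set h : C(AddCircle (1 : ℝ), ℂ) := ⟨fun z => (g k z : ℂ), by
    exact Complex.continuous_ofReal.comp (hgc k)⟩ with hh
  have ht := hf.tendsto_continuous h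
  have hre : Tendsto (fun n => ∫ x in (0 : ℝ)..1, f n x * g k (x : AddCircle (1 : ℝ))) atTop
      (𝓝 (c * ∫ x in (0 : ℝ)..1, g k (x : AddCircle (1 : ℝ)))) := by
    have := (Complex.continuous_re.tendsto _).comp ht
    have e1 : ∀ F : ℝ → ℝ, (∫ x in (0 : ℝ)..1, (F x : ℂ)) = ((∫ x in (0 : ℝ)..1, F x : ℝ) : ℂ) :=
      fun F => intervalIntegral.integral_ofReal
    have e2 : ((c : ℂ) * ∫ x in (0 : ℝ)..1, h x).re = c * ∫ x in (0 : ℝ)..1, g k (x : AddCircle (1 : ℝ)) := by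
      simp only [hh, ContinuousMap.coe_mk]
      rw [e1, ← Complex.ofReal_mul, Complex.ofReal_re]
    rw [e2] at this
    refine this.congr fun n => ?_
    change (∫ x in (0 : ℝ)..1, (f n x : ℂ) * (g k (x : AddCircle (1 : ℝ)) : ℂ)).re = _
    simp only [← Complex.ofReal_mul]
    rw [e1, Complex.ofReal_re]
  filter_upwards [hre.eventually (gt_mem_nhds (hk.trans (by linarith :
    c * (v - u) + ε / 2 < c * (v - u) + ε)))] with n hn
  refine le_trans ?_ hn.le
  have hint : IntervalIntegrable (fun x => f n x * g k (x : AddCircle (1 : ℝ))) volume 0 1 :=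
    (hf.integrable n).mul_continuousOn ((hgc k).comp (AddCircle.continuous_mk' 1)).continuousOn
  calc ∫ x in u..v, f n x = ∫ x in u..v, f n x * g k (x : AddCircle (1 : ℝ)) := by
        refine intervalIntegral.integral_congr fun x hx => ?_
        rw [Set.uIcc_of_le huv] at hx
        rw [hgE k x hx, mul_one]
    _ ≤ _ := by
        refine intervalIntegral.integral_mono_interval hu huv hv ?_ hint
        exact Eventually.of_forall fun x => mul_nonneg (hf.nonneg n x) (hg0 k _)

/-- The lower bound follows from the upper bound on `[s, 1]` and the convergence of the total mass.
-/
lemma tendsto_integral_of_mem (hf : WeylSequence f c) {s : ℝ} (hs0 : 0 ≤ s) (hs1 : s ≤ 1) :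
    Tendsto (fun n => ∫ x in (0 : ℝ)..s, f n x) atTop (𝓝 (c * s)) := by
  rw [Metric.tendsto_nhds]
  intro ε hε
  filter_upwards [hf.eventually_integral_le le_rfl hs0 hs1 (half_pos hε),
    hf.eventually_integral_le hs0 hs1 le_rfl (half_pos (half_pos hε)),
    hf.tendsto_mean.eventually (lt_mem_nhds (show c - ε / 4 < c by linarith))] with n h1 h2 h3
  have h4 := intervalIntegral.integral_add_adjacent_intervals (hf.intervalIntegrable n 0 s)
    (hf.intervalIntegrable n s 1)
  rw [Real.dist_eq, abs_lt]
  constructor <;> nlinarith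

/-- By periodicity the integral from 0 to `s` consists of `⌊s⌋` full periods and a part over the
fractional part of `s`. -/
lemma tendsto_integral (hf : WeylSequence f c) (u v : ℝ) :
    Tendsto (fun n => ∫ x in u..v, f n x) atTop (𝓝 (c * (v - u))) := by
  have key : ∀ s : ℝ, Tendsto (fun n => ∫ x in (0 : ℝ)..s, f n x) atTop (𝓝 (c * s)) := by
    intro s
    have h1 := hf.tendsto_integral_of_mem (Int.fract_nonneg s) (Int.fract_lt_one s).le
    have h2 := (hf.tendsto_mean.const_mul (⌊s⌋ : ℝ)).add h1
    have e : (⌊s⌋ : ℝ) * c + c * Int.fract s = c * s := by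
      linear_combination c * Int.floor_add_fract s
    rw [e] at h2
    refine h2.congr fun n => ?_
    rw [← intervalIntegral.integral_add_adjacent_intervals (hf.intervalIntegrable n 0 (⌊s⌋ : ℝ))
      (hf.intervalIntegrable n (⌊s⌋ : ℝ) s)]
    congr 1
    · have := (hf.periodic n).intervalIntegral_add_zsmul_eq ⌊s⌋ 0 fun a b =>
        hf.intervalIntegrable n a b
      simp only [zsmul_eq_mul, mul_one, zero_add] at this
      rw [this]
    · have hper : ∀ x, f n (x + (⌊s⌋ : ℝ)) = f n x := fun x => by
        simpa using (hf.periodic n).int_mul ⌊s⌋ x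
      have := intervalIntegral.integral_comp_add_right (a := 0) (b := Int.fract s) (f n) (⌊s⌋ : ℝ)
      rw [zero_add, Int.fract_add_floor] at this
      rw [← this]
      simp only [hper]
  have := (key v).sub (key u)
  rw [← mul_sub] at this
  refine this.congr fun n => ?_
  exact intervalIntegral.integral_interval_sub_left (hf.intervalIntegrable n _ _)
    (hf.intervalIntegrable n _ _)

end WeylSequence

lemma pairCount_le (Q : ℕ) (a b α : ℝ) : pairCount Q a b α ≤ Q := by
  unfold pairCount
  exact (Finset.card_le_univ _).trans (by simp)

lemma pairCount_add_one (Q : ℕ) (a b α : ℝ) : pairCount Q a b (α + 1) = pairCount Q a b α := by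
  have h : ∀ n : ℕ, Int.fract ((n : ℝ) * (α + 1)) = Int.fract ((n : ℝ) * α) := fun n => by
    rw [mul_add, mul_one, Int.fract_add_natCast]
  have hs : sigma Q (α + 1) = sigma Q α := by
    unfold sigma; simp only [h]
  have hp : point Q (α + 1) = point Q α := by
    funext i; unfold point; rw [hs, h]
  unfold pairCount gap
  rw [hp]

lemma lipschitzWith_cos_mul (r : ℝ) : LipschitzWith ⟨|r|, abs_nonneg r⟩
    fun x : ℝ => 1 + Real.cos (r * x) := by
  refine LipschitzWith.of_dist_le_mul fun x y => ?_
  rw [Real.dist_eq, Real.dist_eq, add_sub_add_left_eq_sub]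
  have := Real.lipschitzWith_cos.dist_le_mul (r * x) (r * y)
  rw [Real.dist_eq, Real.dist_eq, ← mul_sub, abs_mul] at this
  rw [NNReal.coe_one, one_mul] at this
  exact this

lemma lipschitzWith_sin_mul (r : ℝ) : LipschitzWith ⟨|r|, abs_nonneg r⟩
    fun x : ℝ => 1 + Real.sin (r * x) := by
  refine LipschitzWith.of_dist_le_mul fun x y => ?_
  rw [Real.dist_eq, Real.dist_eq, add_sub_add_left_eq_sub]
  have := Real.lipschitzWith_sin.dist_le_mul (r * x) (r * y)
  rw [Real.dist_eq, Real.dist_eq, ← mul_sub, abs_mul] at this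
  rw [NNReal.coe_one, one_mul] at this
  exact this

lemma limitIntegral_ne_top (a b : ℝ) : limitIntegral a b ≠ ⊤ :=
  (tendsto_integral_pairCount (LipschitzWith.const' (1 : ℝ) : LipschitzWith 0 _)
    (fun _ => zero_le_one) (fun _ => one_le_two) equidistributed_arcWeight_one a b).1

lemma intervalIntegrable_pairCount (Q : ℕ) (a b : ℝ) :
    IntervalIntegrable (fun α => (pairCount Q a b α : ℝ) / Q) volume 0 1 := by
  rcases Nat.eq_zero_or_pos Q with rfl | hQ
  · simp
  · simpa using (integral_pairCount hQ a b (χ := fun _ => 1) continuous_const).1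

/-- A nontrivial Fourier coefficient is the difference of the means against `1 + cos` or `1 + sin`
and against 1, and all these means have the same limit. -/
lemma weylSequence_pairCount (a b : ℝ) :
    WeylSequence (fun Q α => (pairCount Q a b α : ℝ) / Q)
      (6 / Real.pi ^ 2 * (limitIntegral a b).toReal) := by
  have hone := (tendsto_integral_pairCount (LipschitzWith.const' (1 : ℝ) : LipschitzWith 0 _)
    (fun _ => zero_le_one) (fun _ => one_le_two) equidistributed_arcWeight_one a b).2
  simp only [mul_one] at hone
  have split : ∀ χ : ℝ → ℝ, Continuous χ →
      Tendsto (fun Q : ℕ => ∫ α in (0 : ℝ)..1, (pairCount Q a b α : ℝ) / Q * (1 + χ α)) atTop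
        (𝓝 (6 / Real.pi ^ 2 * (limitIntegral a b).toReal)) →
      Tendsto (fun Q : ℕ => ∫ α in (0 : ℝ)..1, (pairCount Q a b α : ℝ) / Q * χ α) atTop (𝓝 0) := by
    intro χ hχ h
    have := h.sub hone
    rw [sub_self] at this
    refine this.congr fun Q => ?_
    have hi := intervalIntegrable_pairCount Q a b
    have hi2 := hi.mul_continuousOn hχ.continuousOn
    simp only [mul_add, mul_one]
    rw [intervalIntegral.integral_add hi hi2, add_sub_cancel_left]
  refine ⟨fun Q α => by positivity, fun Q α => ?_, fun Q => intervalIntegrable_pairCount Q a b,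
    fun Q α => by simp only [pairCount_add_one], hone, fun m hm => ?_, fun m hm => ?_⟩
  · exact div_le_one_of_le₀ (by exact_mod_cast pairCount_le Q a b α) (Nat.cast_nonneg _)
  · refine split _ (by fun_prop) (tendsto_integral_pairCount (lipschitzWith_cos_mul _) (fun x => ?_)
      (fun x => ?_) (equidistributed_arcWeight_one_add (equidistributed_arcWeight_cos hm).1) a b).2
    · linarith [Real.neg_one_le_cos (2 * Real.pi * m * x)]
    · linarith [Real.cos_le_one (2 * Real.pi * m * x)]
  · refine split _ (by fun_prop) (tendsto_integral_pairCount (lipschitzWith_sin_mul _) (fun x => ?_)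
      (fun x => ?_) (equidistributed_arcWeight_one_add (equidistributed_arcWeight_cos hm).2) a b).2
    · linarith [Real.neg_one_le_sin (2 * Real.pi * m * x)]
    · linarith [Real.sin_le_one (2 * Real.pi * m * x)]

/-- The averages over any interval converge to the normalized integral over the Farey triangle. -/
theorem tendsto_pairAverage (a b β : ℝ) {η : ℝ} (hη : 0 < η) :
    Tendsto (fun Q : ℕ => pairAverage β η a b Q) atTop
      (𝓝 (6 / Real.pi ^ 2 * (limitIntegral a b).toReal)) := by
  have := ((weylSequence_pairCount a b).tendsto_integral β (β + η)).const_mul (1 / η)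
  rw [add_sub_cancel_left] at this
  have e : 1 / η * (6 / Real.pi ^ 2 * (limitIntegral a b).toReal * η)
      = 6 / Real.pi ^ 2 * (limitIntegral a b).toReal := by field_simp
  rw [e] at this
  exact this

lemma gap_nonneg {Q : ℕ} (α : ℝ) (i : Fin Q) : 0 ≤ gap Q α i := by
  unfold gap
  split_ifs with h
  · rw [sub_nonneg]
    exact Tuple.monotone_sort (fun n : Fin Q => Int.fract (((n : ℕ) : ℝ) * α))
      (show i ≤ ⟨(i : ℕ) + 1, h⟩ from Nat.le_succ _)
  · rw [sub_nonneg]; exact (Int.fract_lt_one _).le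

/-- With zero thresholds every pair is counted, so the averages equal 1, and comparison with their
limit evaluates the integral. -/
lemma limitIntegral_zero_zero : limitIntegral 0 0 = ENNReal.ofReal (Real.pi ^ 2 / 6) := by
  have h1 := tendsto_pairAverage 0 0 0 one_pos
  have h2 : Tendsto (fun Q : ℕ => pairAverage 0 1 0 0 Q) atTop (𝓝 1) := by
    refine tendsto_const_nhds.congr' ?_
    filter_upwards [eventually_ge_atTop 1] with Q hQ
    have hQ' : (Q : ℝ) ≠ 0 := by positivity
    have : ∀ α, pairCount Q 0 0 α = Q := fun α => by
      unfold pairCount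
      simp [gap_nonneg]
    simp [pairAverage, this, hQ']
  have h3 := tendsto_nhds_unique h1 h2
  have h4 : (limitIntegral 0 0).toReal = Real.pi ^ 2 / 6 := by
    have : Real.pi ≠ 0 := Real.pi_ne_zero
    field_simp at h3 ⊢
    linarith
  rw [← h4, ENNReal.ofReal_toReal (limitIntegral_ne_top 0 0)]

lemma limitIntegral_comm (a b : ℝ) : limitIntegral a b = limitIntegral b a := by
  have hb : ∀ u v, bothLE a b u v = bothLE b a v u := fun u v => by
    unfold bothLE; simp only [and_comm]
  have : arcDensity a b = arcDensity b a := by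
    funext z
    unfold arcDensity meanFreq
    congr 1
    refine intervalIntegral.integral_congr fun t _ => ?_
    simp only [pairFreq, hb]
    ring
  rw [limitIntegral, limitIntegral, this]

end GapDistribution

/-! ### Reduction to a joint density of consecutive gaps. -/

namespace GapDistribution

open MeasureTheory

lemma lintegral_comp_affine {c : ℝ} (hc : c ≠ 0) (d : ℝ) {f : ℝ → ENNReal} (hf : Measurable f) :
    ∫⁻ t, f t = ENNReal.ofReal |c| * ∫⁻ s, f (c * s + d) := by
  have h1 : ∫⁻ t, f t = ∫⁻ t, f (t + d) := (lintegral_add_right_eq_self f d).symm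
  rw [h1]
  conv_lhs => rw [← Real.smul_map_volume_mul_left hc]
  rw [lintegral_smul_measure, lintegral_map (by fun_prop) (by fun_prop), smul_eq_mul]

lemma lintegral_Ioo_one_sub {f : ℝ → ENNReal} (hf : Measurable f) :
    ∫⁻ t in Set.Ioo (0 : ℝ) 1, f (1 - t) = ∫⁻ t in Set.Ioo (0 : ℝ) 1, f t := by
  rw [← lintegral_indicator measurableSet_Ioo, ← lintegral_indicator measurableSet_Ioo,
    lintegral_comp_affine (c := -1) (by norm_num) 1 (hf.indicator measurableSet_Ioo)]
  rw [abs_neg, abs_one, ENNReal.ofReal_one, one_mul]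
  refine lintegral_congr fun t => ?_
  have e : -1 * t + 1 = 1 - t := by ring
  rw [e]
  by_cases h : t ∈ Set.Ioo (0 : ℝ) 1
  · rw [Set.indicator_of_mem h, Set.indicator_of_mem (show 1 - t ∈ Set.Ioo (0 : ℝ) 1 from
      ⟨by linarith [h.2], by linarith [h.1]⟩)]
  · rw [Set.indicator_of_notMem h, Set.indicator_of_notMem]
    exact fun i => h ⟨by linarith [i.2], by linarith [i.1]⟩

lemma mem_fareyTriangle {x y : ℝ} : (x, y) ∈ fareyTriangle ↔
    (0 < x ∧ x ≤ 1) ∧ (0 < y ∧ y ≤ 1) ∧ 1 < x + y := by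
  simp only [fareyTriangle, unitSquare, Set.mem_ofPred_eq, Set.mem_prod, Set.mem_Ioc, and_assoc]

lemma lintegral_fareyTriangle_swap {f : ℝ × ℝ → ENNReal} :
    ∫⁻ z in fareyTriangle, f z.swap = ∫⁻ z in fareyTriangle, f z := by
  have hp : MeasurePreserving (Prod.swap : ℝ × ℝ → ℝ × ℝ) volume volume :=
    Measure.measurePreserving_swap
  have := hp.setLIntegral_comp_preimage_emb MeasurableEquiv.prodComm.measurableEmbedding f
    fareyTriangle
  rw [← this]
  congr 2
  ext ⟨x, y⟩
  rw [Set.mem_preimage, Prod.swap_prod_mk, mem_fareyTriangle, mem_fareyTriangle]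
  constructor <;> rintro ⟨h1, h2, h3⟩ <;> exact ⟨h2, h1, by linarith⟩

/-- The unnormalized limit as an integral over the triangle and the position within the arc. -/
lemma limitIntegral_eq (a b : ℝ) : limitIntegral a b = ∫⁻ z in fareyTriangle,
    ∫⁻ t in Set.Ioo (0 : ℝ) 1,
      ENNReal.ofReal (pairFreq a b z.1 z.2 (t / z.2) ((1 - t) / z.1) / (z.1 * z.2)) := by
  refine setLIntegral_congr_fun measurableSet_fareyTriangle fun z hz => ?_
  obtain ⟨⟨⟨hx0, hx1⟩, hy0, hy1⟩, -⟩ := hz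
  have hm : Measurable fun t : ℝ => pairFreq a b z.1 z.2 (t / z.2) ((1 - t) / z.1) / (z.1 * z.2) :=
    (measurable_pairFreq a b measurable_const measurable_const (by fun_prop)
      (by fun_prop)).div_const _
  have hxy : 0 < z.1 * z.2 := mul_pos hx0 hy0
  simp only [arcDensity, meanFreq]
  rw [← intervalIntegral.integral_div, intervalIntegral.integral_of_le zero_le_one,
    integral_Ioc_eq_integral_Ioo, ofReal_integral_eq_lintegral_ofReal]
  · refine (integrable_const (9 / (z.1 * z.2))).mono hm.aestronglyMeasurable
      (Eventually.of_forall fun t => ?_)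
    rw [Real.norm_eq_abs, Real.norm_eq_abs, abs_div, abs_of_pos hxy,
      abs_of_pos (show 0 < 9 / (z.1 * z.2) by positivity)]
    exact div_le_div_of_nonneg_right (abs_pairFreq_le a b hx0.le hy0.le hx1 hy1 _ _) hxy.le
  · exact Eventually.of_forall fun t => div_nonneg (pairFreq_nonneg a b hx1 hy1 _ _) hxy.le

/-- The contribution of the pairs whose second gap is of type `A` and shorter than `b`. -/
noncomputable def shortFreq (a b x y A B : ℝ) : ℝ :=
  freqMixed x y * (if a ≤ B ∧ A < b then 1 else 0)
    + freqSum x y * (if a ≤ A + B ∧ A < b then 1 else 0)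

lemma bothLE_zero_eq {v : ℝ} (hv : 0 ≤ v) (a b u : ℝ) :
    bothLE a 0 u v = bothLE a b u v + if a ≤ u ∧ v < b then 1 else 0 := by
  unfold bothLE
  by_cases h1 : a ≤ u <;> by_cases h2 : v < b
  · simp [h1, h2, hv]
  · simp [h1, h2, hv, not_lt.1 h2]
  · simp [h1]
  · simp [h1]

/-- A pair admitted for `(a, 0)` but not for `(a, b)` has a second gap below `b ≤ a`, hence strictly
shorter than the first. This leaves `(B, A)`, `(A + B, A)` and their mirror images. -/
lemma pairFreq_zero_eq {a b A B : ℝ} (hab : b ≤ a) (hA : 0 ≤ A) (hB : 0 ≤ B)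
    (x y : ℝ) : pairFreq a 0 x y A B
      = pairFreq a b x y A B + (shortFreq a b x y A B + shortFreq a b y x B A) := by
  have z : ∀ u v : ℝ, u ≤ v → (if a ≤ u ∧ v < b then (1 : ℝ) else 0) = 0 := fun u v h =>
    if_neg fun i => by linarith [i.1, i.2]
  have hm : freqMixed y x = freqMixed x y := min_comm _ _
  unfold pairFreq shortFreq
  rw [bothLE_zero_eq hA a b A, bothLE_zero_eq hB a b B, bothLE_zero_eq hB a b A,
    bothLE_zero_eq hA a b B, bothLE_zero_eq (add_nonneg hA hB) a b A,
    bothLE_zero_eq hA a b (A + B), bothLE_zero_eq (add_nonneg hA hB) a b B,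
    bothLE_zero_eq hB a b (A + B), bothLE_zero_eq (add_nonneg hA hB) a b (A + B),
    z A A le_rfl, z B B le_rfl, z A (A + B) (by linarith), z B (A + B) (by linarith),
    z (A + B) (A + B) le_rfl, hm, add_comm B A]
  ring

lemma shortFreq_nonneg (a b : ℝ) {x y : ℝ} (hx : x ≤ 1) (hy : y ≤ 1) (A B : ℝ) :
    0 ≤ shortFreq a b x y A B := by
  unfold shortFreq
  refine add_nonneg (mul_nonneg (freqMixed_nonneg hx hy) ?_) (mul_nonneg (freqSum_nonneg _ _) ?_)
  all_goals split_ifs <;> norm_num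

lemma measurable_freqMixed : Measurable fun z : ℝ × ℝ => freqMixed z.1 z.2 := by
  unfold freqMixed; fun_prop

lemma measurable_freqSum : Measurable fun z : ℝ × ℝ => freqSum z.1 z.2 := by
  unfold freqSum; fun_prop

lemma measurable_shortFreq {X : Type*} [MeasurableSpace X] {x y A B : X → ℝ} (a b : ℝ)
    (hx : Measurable x) (hy : Measurable y) (hA : Measurable A) (hB : Measurable B) :
    Measurable fun z => shortFreq a b (x z) (y z) (A z) (B z) := by
  unfold shortFreq
  have h1 : Measurable fun z => freqMixed (x z) (y z) := measurable_freqMixed.comp (hx.prodMk hy)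
  have h2 : Measurable fun z => freqSum (x z) (y z) := measurable_freqSum.comp (hx.prodMk hy)
  refine (h1.mul (Measurable.ite ?_ measurable_const measurable_const)).add
    (h2.mul (Measurable.ite ?_ measurable_const measurable_const))
  · exact (measurableSet_le measurable_const hB).inter (measurableSet_lt hA measurable_const)
  · exact (measurableSet_le measurable_const (hA.add hB)).inter
      (measurableSet_lt hA measurable_const)

/-- The reflection `x ↔ y`, `t ↔ 1 - t` interchanges the contributions with short gap `A` and short
gap `B`, whence the factor 2. -/
lemma limitIntegral_zero_eq_add {a b : ℝ} (hab : b ≤ a) :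
    limitIntegral a 0 = limitIntegral a b + 2 * ∫⁻ z in fareyTriangle,
      ∫⁻ t in Set.Ioo (0 : ℝ) 1,
        ENNReal.ofReal (shortFreq a b z.1 z.2 (t / z.2) ((1 - t) / z.1) / (z.1 * z.2)) := by
  set F : (ℝ × ℝ) × ℝ → ENNReal := fun w =>
    ENNReal.ofReal (pairFreq a b w.1.1 w.1.2 (w.2 / w.1.2) ((1 - w.2) / w.1.1) / (w.1.1 * w.1.2))
    with hF
  set E : (ℝ × ℝ) × ℝ → ENNReal := fun w =>
    ENNReal.ofReal (shortFreq a b w.1.1 w.1.2 (w.2 / w.1.2) ((1 - w.2) / w.1.1) / (w.1.1 * w.1.2))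
    with hE
  have mF : Measurable F := ((measurable_pairFreq a b (by fun_prop) (by fun_prop) (by fun_prop)
    (by fun_prop)).div (by fun_prop)).ennreal_ofReal
  have mE : Measurable E := ((measurable_shortFreq a b (by fun_prop) (by fun_prop) (by fun_prop)
    (by fun_prop)).div (by fun_prop)).ennreal_ofReal
  have key : ∀ z ∈ fareyTriangle, ∫⁻ t in Set.Ioo (0 : ℝ) 1,
      ENNReal.ofReal (pairFreq a 0 z.1 z.2 (t / z.2) ((1 - t) / z.1) / (z.1 * z.2))
      = (∫⁻ t in Set.Ioo (0 : ℝ) 1, F (z, t)) + ((∫⁻ t in Set.Ioo (0 : ℝ) 1, E (z, t))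
        + ∫⁻ t in Set.Ioo (0 : ℝ) 1, E (z.swap, t)) := by
    intro z hz
    obtain ⟨⟨⟨hx0, hx1⟩, hy0, hy1⟩, -⟩ := hz
    have hxy : 0 < z.1 * z.2 := mul_pos hx0 hy0
    rw [← lintegral_Ioo_one_sub (f := fun t => E (z.swap, t)) (by fun_prop),
      ← lintegral_add_left (by fun_prop), ← lintegral_add_left (by fun_prop)]
    refine setLIntegral_congr_fun measurableSet_Ioo fun t ht => ?_
    have hA : 0 ≤ t / z.2 := div_nonneg ht.1.le hy0.le
    have hB : 0 ≤ (1 - t) / z.1 := div_nonneg (by linarith [ht.2]) hx0.le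
    have n1 := shortFreq_nonneg a b hx1 hy1 (t / z.2) ((1 - t) / z.1)
    have n2 := shortFreq_nonneg a b hy1 hx1 ((1 - t) / z.1) (t / z.2)
    have n0 := pairFreq_nonneg a b hx1 hy1 (t / z.2) ((1 - t) / z.1)
    simp only [hF, hE, Prod.fst_swap, Prod.snd_swap, sub_sub_cancel]
    rw [pairFreq_zero_eq hab hA hB, mul_comm z.2 z.1, add_div, add_div,
      ENNReal.ofReal_add (div_nonneg n0 hxy.le) (add_nonneg (div_nonneg n1 hxy.le)
        (div_nonneg n2 hxy.le)), ENNReal.ofReal_add (div_nonneg n1 hxy.le) (div_nonneg n2 hxy.le)]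
  rw [limitIntegral_eq, limitIntegral_eq, setLIntegral_congr_fun measurableSet_fareyTriangle key,
    lintegral_add_left (mF.lintegral_prod_right'), lintegral_add_left (mE.lintegral_prod_right'),
    lintegral_fareyTriangle_swap (f := fun z => ∫⁻ t in Set.Ioo (0 : ℝ) 1, E (z, t)), two_mul]

/-- Twice this function along a line gives the joint density of two consecutive gaps. -/
noncomputable def tent (x h : ℝ) : ℝ :=
  if x + h ≤ 1 then max 0 (min h (h + 2 * x - 1)) else max 0 (min (1 - x) (1 - h))

/-- The two indicators have disjoint supports, since the first needs `x + h > 1` and the second `x +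
h ≤ 1`. The other constraints of the triangle hold wherever the branch of `tent` is positive. -/
lemma indicator_freqMixed_add (x h : ℝ) :
    fareyTriangle.indicator (fun z => ENNReal.ofReal (freqMixed z.1 z.2)) (x, h)
      + fareyTriangle.indicator (fun z => ENNReal.ofReal (freqSum z.1 z.2)) (x, h + x)
      = ENNReal.ofReal (tent x h) := by
  unfold tent
  split_ifs with hs
  · rw [Set.indicator_of_notMem (fun i => by
      have := (mem_fareyTriangle.1 i).2.2; linarith), zero_add]
    have e : freqSum x (h + x) = max 0 (min h (h + 2 * x - 1)) := by
      unfold freqSum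
      congr 1
      rcases le_total x (1 - x) with i | i
      · rw [max_eq_right i, min_eq_right (by linarith)]; ring
      · rw [max_eq_left i, min_eq_left (by linarith)]; ring
    by_cases hT : (x, h + x) ∈ fareyTriangle
    · rw [Set.indicator_of_mem hT]
      simp only [e]
    · rw [Set.indicator_of_notMem hT, eq_comm, ENNReal.ofReal_eq_zero]
      refine max_le le_rfl ?_
      by_contra hc
      obtain ⟨c1, c2⟩ := lt_min_iff.1 (not_le.1 hc)
      exact hT (mem_fareyTriangle.2 ⟨⟨by linarith, by linarith⟩, ⟨by linarith, by linarith⟩,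
        by linarith⟩)
  · rw [Set.indicator_of_notMem (a := (x, h + x)) (fun i => by
      have := (mem_fareyTriangle.1 i).2.1.2; linarith), add_zero]
    by_cases hT : (x, h) ∈ fareyTriangle
    · have := mem_fareyTriangle.1 hT
      rw [Set.indicator_of_mem hT, max_eq_right]
      · rfl
      · exact le_min (by linarith [this.1.2]) (by linarith [this.2.1.2])
    · rw [Set.indicator_of_notMem hT, eq_comm, ENNReal.ofReal_eq_zero]
      refine max_le le_rfl ?_
      by_contra hc
      obtain ⟨c1, c2⟩ := lt_min_iff.1 (not_le.1 hc)
      exact hT (mem_fareyTriangle.2 ⟨⟨by linarith, by linarith⟩, ⟨by linarith, by linarith⟩,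
        by linarith⟩)

/-- The joint density of two consecutive gaps, for the second one not the longer one. -/
noncomputable def jointDensity (a b : ℝ) : ENNReal :=
  2 * (ENNReal.ofReal (1 / b) * ∫⁻ x, ENNReal.ofReal (tent x ((1 - a * x) / b)))

/-- For fixed `x` the variable `y` is exchanged for the length `A = c + (1 - b y) / x` of the first
gap, and the Jacobian `x / b` cancels the weight `1 / x`. With a second gap of length `b`, the case
`c = 0` is a first gap of the other basic type and `c = b` is one of sum type. -/
lemma lintegral_line_subst {W : ℝ × ℝ → ENNReal} (hW : Measurable W)
    (hpos : ∀ x y, x ≤ 0 → W (x, y) = 0) {b : ℝ} (hb : 0 < b) (a c : ℝ) :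
    ∫⁻ z, W z * ENNReal.ofReal (1 / z.1) * (if a ≤ c + (1 - b * z.2) / z.1 then 1 else 0)
      = ∫⁻ A in Set.Ici a, ENNReal.ofReal (1 / b) * ∫⁻ x, W (x, (1 - (A - c) * x) / b) := by
  have hite : Measurable fun z : ℝ × ℝ =>
      if a ≤ c + (1 - b * z.2) / z.1 then (1 : ENNReal) else 0 :=
    Measurable.ite (measurableSet_le measurable_const (by fun_prop)) measurable_const
      measurable_const
  have hinv : Measurable fun z : ℝ × ℝ => ENNReal.ofReal (1 / z.1) := by fun_prop
  have hall : Measurable fun z : ℝ × ℝ => W z * ENNReal.ofReal (1 / z.1)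
      * (if a ≤ c + (1 - b * z.2) / z.1 then 1 else 0) := (hW.mul hinv).mul hite
  rw [Measure.volume_eq_prod, lintegral_prod _ hall.aemeasurable]
  have step : ∀ x : ℝ, ∫⁻ y, W (x, y) * ENNReal.ofReal (1 / x)
      * (if a ≤ c + (1 - b * y) / x then 1 else 0)
      = ∫⁻ A in Set.Ici a, ENNReal.ofReal (1 / b) * W (x, (1 - (A - c) * x) / b) := by
    intro x
    rcases le_or_gt x 0 with hx | hx
    · simp [hpos x _ hx]
    · have hm : Measurable fun y => W (x, y) * ENNReal.ofReal (1 / x)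
          * (if a ≤ c + (1 - b * y) / x then 1 else 0) :=
        ((hW.mul hinv).mul hite).comp measurable_prodMk_left
      rw [lintegral_comp_affine (c := -(x / b)) (by
        have := div_pos hx hb
        linarith [this] |> fun (h : -(x / b) < 0) => h.ne) ((1 + c * x) / b) hm,
        abs_neg, abs_of_pos (div_pos hx hb), ← lintegral_indicator measurableSet_Ici,
        ← lintegral_const_mul' _ _ ENNReal.ofReal_ne_top]
      refine lintegral_congr fun A => ?_
      have e1 : -(x / b) * A + (1 + c * x) / b = (1 - (A - c) * x) / b := by ring
      have e2 : c + (1 - b * ((1 - (A - c) * x) / b)) / x = A := by field_simp; ring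
      rw [e1, e2]
      by_cases hA : a ≤ A
      · rw [if_pos hA, mul_one, Set.indicator_of_mem (show A ∈ Set.Ici a from hA), mul_comm (W _),
          ← mul_assoc, ← ENNReal.ofReal_mul (div_pos hx hb).le]
        congr 2
        field_simp
      · rw [if_neg hA, mul_zero, mul_zero,
          Set.indicator_of_notMem (show A ∉ Set.Ici a from hA)]
  simp only [step]
  have hm2 : Measurable (Function.uncurry fun (x A : ℝ) =>
      ENNReal.ofReal (1 / b) * W (x, (1 - (A - c) * x) / b)) :=
    (hW.comp (by fun_prop)).const_mul _
  rw [lintegral_lintegral_swap hm2.aemeasurable]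
  refine lintegral_congr fun A => ?_
  rw [lintegral_const_mul' _ _ ENNReal.ofReal_ne_top]

/-- The density in `b` of `limitIntegral a 0 - limitIntegral a b`. -/
noncomputable def marginal (a b : ℝ) : ENNReal := ∫⁻ A in Set.Ioi a, jointDensity A b

/-- The frequency of the pairs with second gap equal to `b` in terms of the triangle. -/
noncomputable def crossFreq (a b x y : ℝ) : ℝ :=
  freqMixed x y * (if a ≤ (1 - b * y) / x then 1 else 0)
    + freqSum x y * (if a ≤ b + (1 - b * y) / x then 1 else 0)

/-- After the substitution the two kinds of pairs live at `(x, h)` and `(x, h + x)` with the same `h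
= (1 - A x) / b`, so they merge into `tent`. -/
lemma two_mul_lintegral_crossFreq (a : ℝ) {b : ℝ} (hb : 0 < b) :
    2 * ∫⁻ z in fareyTriangle, ENNReal.ofReal (crossFreq a b z.1 z.2 / z.1) = marginal a b := by
  set W₁ : ℝ × ℝ → ENNReal :=
    fareyTriangle.indicator fun z => ENNReal.ofReal (freqMixed z.1 z.2) with hW₁
  set W₂ : ℝ × ℝ → ENNReal :=
    fareyTriangle.indicator fun z => ENNReal.ofReal (freqSum z.1 z.2) with hW₂
  have m₁ : Measurable W₁ := measurable_freqMixed.ennreal_ofReal.indicator measurableSet_fareyTriangle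
  have m₂ : Measurable W₂ := measurable_freqSum.ennreal_ofReal.indicator measurableSet_fareyTriangle
  have p₁ : ∀ x y, x ≤ 0 → W₁ (x, y) = 0 := fun x y hx =>
    Set.indicator_of_notMem (fun i => absurd (mem_fareyTriangle.1 i).1.1 (not_lt.2 hx)) _
  have p₂ : ∀ x y, x ≤ 0 → W₂ (x, y) = 0 := fun x y hx =>
    Set.indicator_of_notMem (fun i => absurd (mem_fareyTriangle.1 i).1.1 (not_lt.2 hx)) _
  have hsplit : ∫⁻ z in fareyTriangle, ENNReal.ofReal (crossFreq a b z.1 z.2 / z.1)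
      = (∫⁻ z, W₁ z * ENNReal.ofReal (1 / z.1) * (if a ≤ 0 + (1 - b * z.2) / z.1 then 1 else 0))
        + ∫⁻ z, W₂ z * ENNReal.ofReal (1 / z.1)
          * (if a ≤ b + (1 - b * z.2) / z.1 then 1 else 0) := by
    rw [← lintegral_add_left, ← lintegral_indicator measurableSet_fareyTriangle]
    · refine lintegral_congr fun z => ?_
      by_cases hz : z ∈ fareyTriangle
      · obtain ⟨⟨⟨hx0, hx1⟩, hy0, hy1⟩, -⟩ := id hz
        have n1 := freqMixed_nonneg hx1 hy1
        have n2 := freqSum_nonneg z.1 z.2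
        rw [hW₁, hW₂, Set.indicator_of_mem hz, Set.indicator_of_mem hz, Set.indicator_of_mem hz,
          ← ENNReal.ofReal_mul n1, ← ENNReal.ofReal_mul n2, crossFreq, add_div, zero_add,
          ENNReal.ofReal_add]
        · congr 1
          · split_ifs <;> simp [div_eq_mul_inv]
          · split_ifs <;> simp [div_eq_mul_inv]
        · exact div_nonneg (mul_nonneg n1 (by split_ifs <;> norm_num)) hx0.le
        · exact div_nonneg (mul_nonneg n2 (by split_ifs <;> norm_num)) hx0.le
      · rw [hW₁, hW₂, Set.indicator_of_notMem hz, Set.indicator_of_notMem hz,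
          Set.indicator_of_notMem hz]
        simp only [zero_mul, add_zero]
    · exact (m₁.mul (by fun_prop)).mul (Measurable.ite (measurableSet_le measurable_const
        (by fun_prop)) measurable_const measurable_const)
  have q₁ : Measurable fun w : ℝ × ℝ => W₁ (w.2, (1 - w.1 * w.2) / b) := m₁.comp (by fun_prop)
  have q₁' : ∀ A : ℝ, Measurable fun x : ℝ => W₁ (x, (1 - A * x) / b) := fun A =>
    m₁.comp (by fun_prop)
  rw [hsplit, lintegral_line_subst m₁ p₁ hb, lintegral_line_subst m₂ p₂ hb,
    ← lintegral_add_left, marginal, restrict_Ioi_eq_restrict_Ici,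
    ← lintegral_const_mul' _ _ (by norm_num)]
  · refine lintegral_congr fun A => ?_
    rw [jointDensity, ← mul_add, sub_zero, ← lintegral_add_left (q₁' A)]
    congr 2
    refine lintegral_congr fun x => ?_
    rw [← indicator_freqMixed_add]
    congr 3
    field_simp
    ring
  · simp only [sub_zero]
    exact (q₁.lintegral_prod_right').const_mul _

lemma measurable_crossFreq (a : ℝ) :
    Measurable fun w : (ℝ × ℝ) × ℝ => ENNReal.ofReal (crossFreq a w.2 w.1.1 w.1.2 / w.1.1) := by
  unfold crossFreq
  have h1 : Measurable fun w : (ℝ × ℝ) × ℝ => freqMixed w.1.1 w.1.2 :=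
    measurable_freqMixed.comp measurable_fst
  have h2 : Measurable fun w : (ℝ × ℝ) × ℝ => freqSum w.1.1 w.1.2 :=
    measurable_freqSum.comp measurable_fst
  refine (Measurable.div ?_ (by fun_prop)).ennreal_ofReal
  exact (h1.mul (Measurable.ite (measurableSet_le measurable_const (by fun_prop)) measurable_const
      measurable_const)).add
    (h2.mul (Measurable.ite (measurableSet_le measurable_const (by fun_prop)) measurable_const
      measurable_const))

/-- The substitution `t = y s` makes the length `s` of the second gap the variable. The constraint
`t < 1` may be dropped: for `y s ≥ 1` the other gap has nonpositive length, and `s < b ≤ a` makes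
both conditions fail. -/
lemma lintegral_shortFreq {a b x y : ℝ} (hab : b ≤ a) (hx : 0 < x) (hy : 0 < y) :
    ∫⁻ t in Set.Ioo (0 : ℝ) 1, ENNReal.ofReal (shortFreq a b x y (t / y) ((1 - t) / x) / (x * y))
      = ∫⁻ s in Set.Ioo (0 : ℝ) b, ENNReal.ofReal (crossFreq a s x y / x) := by
  have hm : Measurable fun t : ℝ =>
      ENNReal.ofReal (shortFreq a b x y (t / y) ((1 - t) / x) / (x * y)) :=
    ((measurable_shortFreq a b measurable_const measurable_const (by fun_prop)
      (by fun_prop)).div_const _).ennreal_ofReal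
  rw [← lintegral_indicator measurableSet_Ioo, ← lintegral_indicator measurableSet_Ioo,
    lintegral_comp_affine hy.ne' 0 (hm.indicator measurableSet_Ioo), abs_of_pos hy,
    ← lintegral_const_mul' _ _ ENNReal.ofReal_ne_top]
  refine lintegral_congr fun s => ?_
  rw [add_zero]
  have e1 : y * s / y = s := by field_simp
  have hzero : ¬ s < b → shortFreq a b x y s ((1 - y * s) / x) = 0 := fun h => by
    simp [shortFreq, h]
  have hpos : s < b → shortFreq a b x y s ((1 - y * s) / x) = crossFreq a s x y := fun h => by
    simp [shortFreq, crossFreq, h, mul_comm y s]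
  by_cases h1 : y * s ∈ Set.Ioo (0 : ℝ) 1
  · have hs0 : 0 < s := pos_of_mul_pos_right h1.1 hy.le
    rw [Set.indicator_of_mem h1, e1]
    by_cases h2 : s < b
    · rw [Set.indicator_of_mem (show s ∈ Set.Ioo (0 : ℝ) b from ⟨hs0, h2⟩), hpos h2,
        ← ENNReal.ofReal_mul hy.le]
      congr 1
      field_simp
    · rw [Set.indicator_of_notMem (fun i : s ∈ Set.Ioo (0 : ℝ) b => h2 i.2), hzero h2]
      simp
  · rw [Set.indicator_of_notMem h1, mul_zero]
    by_cases h2 : s ∈ Set.Ioo (0 : ℝ) b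
    · have h3 : 1 ≤ y * s := not_lt.1 fun i => h1 ⟨mul_pos hy h2.1, i⟩
      have h4 : (1 - s * y) / x ≤ 0 := div_nonpos_of_nonpos_of_nonneg (by linarith) hx.le
      have h5 : s < a := h2.2.trans_le hab
      rw [Set.indicator_of_mem h2, crossFreq, if_neg (by linarith [h2.1]), if_neg (by linarith)]
      simp
    · rw [Set.indicator_of_notMem h2]

/-- The limit with the second bound removed is recovered by integrating the marginal. -/
lemma limitIntegral_zero_eq {a b : ℝ} (hab : b ≤ a) :
    limitIntegral a 0 = limitIntegral a b + ∫⁻ s in Set.Ioo 0 b, marginal a s := by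
  rw [limitIntegral_zero_eq_add hab]
  congr 1
  have h1 : ∫⁻ z in fareyTriangle, ∫⁻ t in Set.Ioo (0 : ℝ) 1,
        ENNReal.ofReal (shortFreq a b z.1 z.2 (t / z.2) ((1 - t) / z.1) / (z.1 * z.2))
      = ∫⁻ z in fareyTriangle, ∫⁻ s in Set.Ioo (0 : ℝ) b,
        ENNReal.ofReal (crossFreq a s z.1 z.2 / z.1) :=
    setLIntegral_congr_fun measurableSet_fareyTriangle fun z hz =>
      lintegral_shortFreq hab hz.1.1.1 hz.1.2.1
  rw [h1, lintegral_lintegral_swap (measurable_crossFreq a).aemeasurable,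
    ← lintegral_const_mul' _ _ (by norm_num)]
  exact setLIntegral_congr_fun measurableSet_Ioo fun s hs => two_mul_lintegral_crossFreq a hs.1

end GapDistribution

/-! ### The joint density region by region. -/

namespace GapDistribution

open MeasureTheory

lemma lintegral_Ioo_add {x₀ x₁ x₂ : ℝ} (h₁ : x₀ ≤ x₁) (h₂ : x₁ ≤ x₂) (f : ℝ → ENNReal) :
    ∫⁻ x in Set.Ioo x₀ x₂, f x = (∫⁻ x in Set.Ioo x₀ x₁, f x) + ∫⁻ x in Set.Ioo x₁ x₂, f x := by
  rw [setLIntegral_congr (Ioo_ae_eq_Ioc (a := x₀) (b := x₂)),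
    setLIntegral_congr (Ioo_ae_eq_Ioc (a := x₀) (b := x₁)),
    setLIntegral_congr (Ioo_ae_eq_Ioc (a := x₁) (b := x₂)),
    ← lintegral_union measurableSet_Ioc (Set.Ioc_disjoint_Ioc_of_le le_rfl),
    Set.Ioc_union_Ioc_eq_Ioc h₁ h₂]

/-- The trapezoidal rule is exact for linear functions, and nonnegativity at the end points
suffices. -/
lemma lintegral_Ioo_linear {x₀ x₁ p q : ℝ} (hx : x₀ ≤ x₁) (h₀ : 0 ≤ p + q * x₀)
    (h₁ : 0 ≤ p + q * x₁) {f : ℝ → ℝ} (hf : ∀ x ∈ Set.Ioo x₀ x₁, f x = p + q * x) :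
    ∫⁻ x in Set.Ioo x₀ x₁, ENNReal.ofReal (f x)
      = ENNReal.ofReal (((p + q * x₀) + (p + q * x₁)) * (x₁ - x₀) / 2) := by
  have e : ∫ x in x₀..x₁, (p + q * x) = ((p + q * x₀) + (p + q * x₁)) * (x₁ - x₀) / 2 := by
    rw [intervalIntegral.integral_add (by simp) (Continuous.intervalIntegrable (by fun_prop) _ _),
      intervalIntegral.integral_const, intervalIntegral.integral_const_mul, integral_id, smul_eq_mul]
    ring
  rw [← e, intervalIntegral.integral_of_le hx, ofReal_integral_eq_lintegral_ofReal,
    ← restrict_Ioo_eq_restrict_Ioc]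
  · exact setLIntegral_congr_fun measurableSet_Ioo fun x hx => by simp only [hf x hx]
  · exact (Continuous.integrableOn_Icc (by fun_prop)).mono_set Set.Ioc_subset_Icc_self
  · filter_upwards [ae_restrict_mem measurableSet_Ioc] with x hx'
    rcases eq_or_lt_of_le hx with rfl | hlt
    · simp at hx'
    · have : 0 ≤ (p + q * x) * (x₁ - x₀) := by
        have : (p + q * x) * (x₁ - x₀) = (p + q * x₀) * (x₁ - x) + (p + q * x₁) * (x - x₀) := by
          ring
        rw [this]
        exact add_nonneg (mul_nonneg h₀ (by linarith [hx'.2])) (mul_nonneg h₁ (by linarith [hx'.1]))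
      exact nonneg_of_mul_nonneg_left this (by linarith)

lemma lintegral_eq_Ioo_of_nonpos {x₀ x₁ : ℝ} {f : ℝ → ℝ} (h₀ : ∀ x, x < x₀ → f x ≤ 0)
    (h₁ : ∀ x, x₁ < x → f x ≤ 0) :
    ∫⁻ x, ENNReal.ofReal (f x) = ∫⁻ x in Set.Ioo x₀ x₁, ENNReal.ofReal (f x) := by
  rw [setLIntegral_congr Ioo_ae_eq_Icc, ← lintegral_indicator measurableSet_Icc]
  refine lintegral_congr fun x => ?_
  by_cases h : x ∈ Set.Icc x₀ x₁
  · rw [Set.indicator_of_mem h]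
  · rw [Set.indicator_of_notMem h, ENNReal.ofReal_eq_zero]
    by_cases i : x < x₀
    · exact h₀ x i
    · exact h₁ x (not_le.1 fun j => h ⟨not_lt.1 i, j⟩)

section Line

variable {a b x : ℝ}

lemma add_line_le_one (hb : 0 < b) : x + (1 - a * x) / b ≤ 1 ↔ 1 - b ≤ (a - b) * x := by
  rw [← le_sub_iff_add_le', div_le_iff₀ hb]
  constructor <;> intro h <;> linarith

/-- On the line `a x + b h = 1` the function `tent` has four linear branches. For `x + h ≤ 1` they
are `h + 2 x - 1` and `h`, separated by `x = 1 / 2`; for `x + h > 1` they are `1 - h` and `1 - x`,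
separated by `x = h`. This lemma and the next three give them in that order. -/
lemma tent_line_left (hb : 0 < b) (h₁ : (a - 2 * b) * x ≤ 1 - b) (h₂ : x ≤ 1 / 2)
    (h₃ : 1 - b ≤ (a - b) * x) : tent x ((1 - a * x) / b) = (1 - b) / b + (2 - a / b) * x := by
  have e : (1 - a * x) / b + 2 * x - 1 = (1 - b) / b + (2 - a / b) * x := by field_simp; ring
  have e' : (1 - b) / b + (2 - a / b) * x = (1 - b - (a - 2 * b) * x) / b := by field_simp; ring
  rw [tent, if_pos ((add_line_le_one hb).2 h₃), min_eq_right (by linarith), e, max_eq_right]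
  rw [e']
  exact div_nonneg (by linarith) hb.le

lemma tent_line_bottom (hb : 0 < b) (h₁ : a * x ≤ 1) (h₂ : 1 / 2 ≤ x)
    (h₃ : 1 - b ≤ (a - b) * x) : tent x ((1 - a * x) / b) = 1 / b + (-a / b) * x := by
  rw [tent, if_pos ((add_line_le_one hb).2 h₃), min_eq_left (by linarith), max_eq_right]
  · ring
  · exact div_nonneg (by linarith) hb.le

lemma tent_line_top (hb : 0 < b) (h₁ : (a - b) * x < 1 - b) (h₂ : (a + b) * x ≤ 1)
    (h₃ : 1 - b ≤ a * x) : tent x ((1 - a * x) / b) = -(1 - b) / b + (a / b) * x := by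
  have e : 1 - (1 - a * x) / b = -(1 - b) / b + (a / b) * x := by field_simp; ring
  have e' : -(1 - b) / b + (a / b) * x = (a * x - (1 - b)) / b := by field_simp; ring
  rw [tent, if_neg (fun h => absurd ((add_line_le_one hb).1 h) (not_le.2 h₁)), min_eq_right, e,
    max_eq_right]
  · rw [e']
    exact div_nonneg (by linarith) hb.le
  · rw [sub_le_sub_iff_left, le_div_iff₀ hb]; linarith

lemma tent_line_right (hb : 0 < b) (h₁ : (a - b) * x < 1 - b) (h₂ : 1 ≤ (a + b) * x)
    (h₃ : x ≤ 1) : tent x ((1 - a * x) / b) = 1 + (-1) * x := by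
  rw [tent, if_neg (fun h => absurd ((add_line_le_one hb).1 h) (not_le.2 h₁)), min_eq_left,
    max_eq_right (by linarith)]
  · ring
  · rw [sub_le_sub_iff_left, div_le_iff₀ hb]; linarith

lemma tent_nonpos {x h : ℝ} (H : h ≤ 0 ∨ 1 ≤ x ∨ 1 ≤ h ∨ h + 2 * x ≤ 1 ∨ x ≤ 0) : tent x h ≤ 0 := by
  unfold tent
  split_ifs with hs
  · refine max_le le_rfl ?_
    rcases H with H | H | H | H | H
    · exact (min_le_left _ _).trans H
    · exact (min_le_left _ _).trans (by linarith)
    · exact (min_le_right _ _).trans (by linarith)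
    · exact (min_le_right _ _).trans (by linarith)
    · exact (min_le_right _ _).trans (by linarith)
  · refine max_le le_rfl ?_
    rcases H with H | H | H | H | H
    · exact (min_le_left _ _).trans (by linarith)
    · exact (min_le_left _ _).trans (by linarith)
    · exact (min_le_right _ _).trans (by linarith)
    · exact (min_le_right _ _).trans (by linarith)
    · exact (min_le_right _ _).trans (by linarith)

lemma tent_line_nonpos (hb : 0 < b) (H : 1 ≤ a * x ∨ 1 ≤ x ∨ a * x ≤ 1 - b ∨
    1 - b ≤ (a - 2 * b) * x ∨ x ≤ 0) : tent x ((1 - a * x) / b) ≤ 0 := by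
  refine tent_nonpos ?_
  rcases H with H | H | H | H | H
  · exact Or.inl (div_nonpos_of_nonpos_of_nonneg (by linarith) hb.le)
  · exact Or.inr (Or.inl H)
  · exact Or.inr (Or.inr (Or.inl ((one_le_div hb).2 (by linarith))))
  · refine Or.inr (Or.inr (Or.inr (Or.inl ?_)))
    rw [← le_sub_iff_add_le, div_le_iff₀ hb]; linarith
  · exact Or.inr (Or.inr (Or.inr (Or.inr H)))

end Line

lemma jointDensity_eq_of_lintegral {a b v : ℝ} (hb : 0 < b)
    (h : ∫⁻ x, ENNReal.ofReal (tent x ((1 - a * x) / b)) = ENNReal.ofReal v) :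
    jointDensity a b = ENNReal.ofReal (2 / b * v) := by
  rw [jointDensity, h, ← ENNReal.ofReal_mul (by positivity), show (2 : ENNReal) = ENNReal.ofReal 2 by
    simp, ← ENNReal.ofReal_mul (by norm_num)]
  congr 1
  ring

lemma jointDensity_eq_zero {a b : ℝ} (ha : 2 ≤ a) (hb : 1 ≤ b) : jointDensity a b = 0 := by
  have hb0 : 0 < b := by linarith
  have : ∀ x, ENNReal.ofReal (tent x ((1 - a * x) / b)) = 0 := by
    intro x
    rw [ENNReal.ofReal_eq_zero]
    apply tent_line_nonpos hb0
    by_contra hc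
    push Not at hc
    obtain ⟨h1, h2, h3, h4, h5⟩ := hc
    nlinarith [mul_nonneg h5.le (sub_nonneg.2 ha), mul_nonneg (sub_nonneg.2 hb) (sub_nonneg.2 h1.le)]
  rw [jointDensity]
  simp [this]

/-- The line meets the support from `h = 1` to `h + 2 x = 1`, with a single break at `x + h = 1`;
all of this lies in `x ≤ 1 / 2`. The integral is the area of a triangle. -/
lemma jointDensity_of_two_le {a b : ℝ} (hb : 0 < b) (hb1 : b < 1) (ha : 2 ≤ a) :
    jointDensity a b = ENNReal.ofReal (2 * (1 - b) ^ 2 / (a * (a - b) * (a - 2 * b))) := by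
  have h0 : 0 < a := by linarith
  have h1 : 0 < a - b := by linarith
  have h2 : 0 < a - 2 * b := by linarith
  have h2' : a - b * 2 ≠ 0 := by linarith [h2] |> fun (h : 0 < a - b * 2) => h.ne'
  have h3 : 0 < 1 - b := by linarith
  have l1 : (1 - b) / a ≤ (1 - b) / (a - b) := div_le_div_of_nonneg_left h3.le h1 (by linarith)
  have l2 : (1 - b) / (a - b) ≤ (1 - b) / (a - 2 * b) :=
    div_le_div_of_nonneg_left h3.le h2 (by linarith)
  have key : ∫⁻ x, ENNReal.ofReal (tent x ((1 - a * x) / b))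
      = ENNReal.ofReal ((1 - b) ^ 2 * b / (a * (a - b) * (a - 2 * b))) := by
    rw [lintegral_eq_Ioo_of_nonpos (x₀ := (1 - b) / a) (x₁ := (1 - b) / (a - 2 * b)),
      lintegral_Ioo_add l1 l2, lintegral_Ioo_linear l1 (p := -(1 - b) / b) (q := a / b),
      lintegral_Ioo_linear l2 (p := (1 - b) / b) (q := 2 - a / b), ← ENNReal.ofReal_add]
    · congr 1; field_simp; ring
    · have e : (-(1 - b) / b + a / b * ((1 - b) / a) + (-(1 - b) / b + a / b * ((1 - b) / (a - b))))
        * ((1 - b) / (a - b) - (1 - b) / a) / 2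
        = ((1 - b) / (a - b)) * ((1 - b) / (a - b) - (1 - b) / a) / 2 := by field_simp; ring
      rw [e]
      exact div_nonneg (mul_nonneg (by positivity) (by linarith)) (by norm_num)
    · have e : ((1 - b) / b + (2 - a / b) * ((1 - b) / (a - b))
          + ((1 - b) / b + (2 - a / b) * ((1 - b) / (a - 2 * b))))
        * ((1 - b) / (a - 2 * b) - (1 - b) / (a - b)) / 2
        = ((1 - b) / (a - b)) * ((1 - b) / (a - 2 * b) - (1 - b) / (a - b)) / 2 := by
        field_simp; ring
      rw [e]
      exact div_nonneg (mul_nonneg (by positivity) (by linarith)) (by norm_num)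
    · have : (1 - b) / b + (2 - a / b) * ((1 - b) / (a - b)) = (1 - b) / (a - b) := by
        field_simp; ring
      rw [this]; positivity
    · have : (1 - b) / b + (2 - a / b) * ((1 - b) / (a - 2 * b)) = 0 := by field_simp; ring
      rw [this]
    · intro x hx
      have i1 := (div_lt_iff₀' h1).1 hx.1
      have i2 := (lt_div_iff₀' h2).1 hx.2
      refine tent_line_left hb i2.le ?_ i1.le
      by_contra hc
      nlinarith
    · have : -(1 - b) / b + a / b * ((1 - b) / a) = 0 := by field_simp; ring
      rw [this]
    · have : -(1 - b) / b + a / b * ((1 - b) / (a - b)) = (1 - b) / (a - b) := by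
        field_simp; ring
      rw [this]; positivity
    · intro x hx
      have i1 := (div_lt_iff₀' h0).1 hx.1
      have i2 := (lt_div_iff₀' h1).1 hx.2
      refine tent_line_top hb i2 ?_ i1.le
      refine le_of_mul_le_mul_left ?_ h1
      nlinarith
    · intro x hx
      have i1 := (lt_div_iff₀' h0).1 hx
      exact tent_line_nonpos hb (Or.inr (Or.inr (Or.inl i1.le)))
    · intro x hx
      have i1 := (div_lt_iff₀' h2).1 hx
      exact tent_line_nonpos hb (Or.inr (Or.inr (Or.inr (Or.inl i1.le))))
  rw [jointDensity_eq_of_lintegral hb key]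
  congr 1
  field_simp

/-- The support is entered at `h + 2 x = 1` and left at `h = 0`, always with `x + h ≤ 1`; the break
is at `x = 1 / 2`. -/
lemma jointDensity_of_one_lt {a b : ℝ} (hb : 1 < b) (ha1 : 1 ≤ a) (ha : a < 2) :
    jointDensity a b = ENNReal.ofReal ((2 - a) ^ 2 / (2 * a * b * (2 * b - a))) := by
  have hb0 : 0 < b := by linarith
  have h0 : 0 < a := by linarith
  have h1 : 0 < 2 - a := by linarith
  have h2 : 0 < 2 * b - a := by linarith
  have h2' : b * 2 - a ≠ 0 := by linarith [h2] |> fun (h : 0 < b * 2 - a) => h.ne'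
  have l1 : (b - 1) / (2 * b - a) ≤ 1 / 2 := by
    rw [div_le_div_iff₀ h2 (by norm_num)]; linarith
  have l2 : 1 / 2 ≤ 1 / a := one_div_le_one_div_of_le h0 ha.le
  have key : ∫⁻ x, ENNReal.ofReal (tent x ((1 - a * x) / b))
      = ENNReal.ofReal ((2 - a) ^ 2 / (4 * a * (2 * b - a))) := by
    have v1 : (1 - b) / b + (2 - a / b) * ((b - 1) / (2 * b - a)) = 0 := by field_simp; ring
    have v2 : (1 - b) / b + (2 - a / b) * (1 / 2) = (2 - a) / (2 * b) := by field_simp; ring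
    have v3 : 1 / b + -a / b * (1 / 2) = (2 - a) / (2 * b) := by field_simp; ring
    have v4 : 1 / b + -a / b * (1 / a) = 0 := by field_simp; ring
    have hv : 0 ≤ (2 - a) / (2 * b) := by positivity
    rw [lintegral_eq_Ioo_of_nonpos (x₀ := (b - 1) / (2 * b - a)) (x₁ := 1 / a),
      lintegral_Ioo_add l1 l2, lintegral_Ioo_linear l1 (p := (1 - b) / b) (q := 2 - a / b),
      lintegral_Ioo_linear l2 (p := 1 / b) (q := -a / b), v1, v2, v3, v4, ← ENNReal.ofReal_add]
    · congr 1; field_simp; ring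
    · exact div_nonneg (mul_nonneg (by linarith) (by linarith)) (by norm_num)
    · exact div_nonneg (mul_nonneg (by linarith) (by linarith)) (by norm_num)
    · rw [v3]; exact hv
    · rw [v4]
    · intro x hx
      have i2 := (lt_div_iff₀' h0).1 hx.2
      refine tent_line_bottom hb0 i2.le hx.1.le ?_
      have := hx.1
      rcases le_total b a with h | h
      · nlinarith
      · refine le_of_mul_le_mul_left ?_ h0
        nlinarith
    · rw [v1]
    · rw [v2]; exact hv
    · intro x hx
      have i1 := (div_lt_iff₀' h2).1 hx.1
      refine tent_line_left hb0 (by linarith) hx.2.le ?_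
      have := hx.2
      have hx0 : 0 < x := lt_of_le_of_lt (by apply div_nonneg <;> linarith) hx.1
      nlinarith
    · intro x hx
      have i1 := (lt_div_iff₀' h2).1 hx
      exact tent_line_nonpos hb0 (Or.inr (Or.inr (Or.inr (Or.inl (by linarith)))))
    · intro x hx
      have i1 := (div_lt_iff₀' h0).1 hx
      exact tent_line_nonpos hb0 (Or.inl i1.le)
  rw [jointDensity_eq_of_lintegral hb0 key]
  congr 1
  field_simp
  ring

/-- The support is entered at `h = 1` and left at `x = 1`, always with `x + h > 1` inside; the break
is at `x = h`. -/
lemma jointDensity_of_le_one {a b : ℝ} (hb : 0 < b) (hb1 : b < 1) (ha : 0 < a) (ha1 : a ≤ 1)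
    (hab : 1 ≤ a + b) :
    jointDensity a b = ENNReal.ofReal ((a + b - 1) ^ 2 / (a * b * (a + b))) := by
  have h0 : 0 < a + b := by linarith
  have l1 : (1 - b) / a ≤ 1 / (a + b) := by
    rw [div_le_div_iff₀ ha h0]; nlinarith
  have l2 : 1 / (a + b) ≤ 1 := by rw [div_le_one h0]; exact hab
  have key : ∫⁻ x, ENNReal.ofReal (tent x ((1 - a * x) / b))
      = ENNReal.ofReal ((a + b - 1) ^ 2 / (2 * a * (a + b))) := by
    have v1 : -(1 - b) / b + a / b * ((1 - b) / a) = 0 := by field_simp; ring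
    have v2 : -(1 - b) / b + a / b * (1 / (a + b)) = (a + b - 1) / (a + b) := by field_simp; ring
    have v3 : 1 + -1 * (1 / (a + b)) = (a + b - 1) / (a + b) := by field_simp; ring
    have v4 : 1 + -1 * (1 : ℝ) = 0 := by ring
    have hv : 0 ≤ (a + b - 1) / (a + b) := div_nonneg (by linarith) h0.le
    rw [lintegral_eq_Ioo_of_nonpos (x₀ := (1 - b) / a) (x₁ := 1),
      lintegral_Ioo_add l1 l2, lintegral_Ioo_linear l1 (p := -(1 - b) / b) (q := a / b),
      lintegral_Ioo_linear l2 (p := 1) (q := -1), v1, v2, v3, v4, ← ENNReal.ofReal_add]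
    · congr 1; field_simp; ring
    · exact div_nonneg (mul_nonneg (by linarith) (by linarith)) (by norm_num)
    · exact div_nonneg (mul_nonneg (by linarith) (by linarith)) (by norm_num)
    · rw [v3]; exact hv
    · rw [v4]
    · intro x hx
      have i1 := (div_lt_iff₀' h0).1 hx.1
      refine tent_line_right hb ?_ i1.le hx.2.le
      have := hx.2
      have : 0 < x := lt_trans (by positivity) hx.1
      rcases le_total b a with h | h <;> nlinarith
    · rw [v1]
    · rw [v2]; exact hv
    · intro x hx
      have i1 := (div_lt_iff₀' ha).1 hx.1
      have i2 := (lt_div_iff₀' h0).1 hx.2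
      have hx0 : 0 < x := lt_of_le_of_lt (by apply div_nonneg <;> linarith) hx.1
      refine tent_line_top hb ?_ i2.le i1.le
      rcases le_total b a with h | h
      · refine lt_of_mul_lt_mul_left ?_ h0.le
        nlinarith
      · nlinarith
    · intro x hx
      have i1 := (lt_div_iff₀' ha).1 hx
      exact tent_line_nonpos hb (Or.inr (Or.inr (Or.inl i1.le)))
    · intro x hx
      exact tent_line_nonpos hb (Or.inr (Or.inl hx.le))
  rw [jointDensity_eq_of_lintegral hb key]
  congr 1
  field_simp

/-- Three pieces from `h = 1` to `h = 0`, with breaks at `x = h` and then at `x + h = 1`. -/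
lemma jointDensity_of_add_le_two {a b : ℝ} (hb : 0 < b) (hb1 : b < 1) (ha : 1 ≤ a)
    (hab : a + b ≤ 2) :
    jointDensity a b = ENNReal.ofReal ((a + b - 1) ^ 2 / (a * b * (a + b))
      - (a - 1) ^ 2 / (a * b * (a - b))) := by
  have ha0 : 0 < a := by linarith
  have h0 : 0 < a + b := by linarith
  have h1 : 0 < a - b := by linarith
  have l1 : (1 - b) / a ≤ 1 / (a + b) := by
    rw [div_le_div_iff₀ ha0 h0]; nlinarith
  have l2 : 1 / (a + b) ≤ (1 - b) / (a - b) := by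
    rw [div_le_div_iff₀ h0 h1]; nlinarith
  have l3 : (1 - b) / (a - b) ≤ 1 / a := by
    rw [div_le_div_iff₀ h1 ha0]; nlinarith
  have key : ∫⁻ x, ENNReal.ofReal (tent x ((1 - a * x) / b))
      = ENNReal.ofReal (((a + b - 1) ^ 2 / (a * (a + b))
      - (a - 1) ^ 2 / (a * (a - b))) / 2) := by
    have v1 : -(1 - b) / b + a / b * ((1 - b) / a) = 0 := by field_simp; ring
    have v2 : -(1 - b) / b + a / b * (1 / (a + b)) = (a + b - 1) / (a + b) := by field_simp; ring
    have v3 : 1 + -1 * (1 / (a + b)) = (a + b - 1) / (a + b) := by field_simp; ring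
    have v4 : 1 + -1 * ((1 - b) / (a - b)) = (a - 1) / (a - b) := by field_simp; ring
    have v5 : 1 / b + -a / b * ((1 - b) / (a - b)) = (a - 1) / (a - b) := by field_simp; ring
    have v6 : 1 / b + -a / b * (1 / a) = 0 := by field_simp; ring
    have hv : 0 ≤ (a + b - 1) / (a + b) := div_nonneg (by linarith) h0.le
    have hw : 0 ≤ (a - 1) / (a - b) := div_nonneg (by linarith) h1.le
    rw [lintegral_eq_Ioo_of_nonpos (x₀ := (1 - b) / a) (x₁ := 1 / a),
      lintegral_Ioo_add l1 (l2.trans l3), lintegral_Ioo_add l2 l3,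
      lintegral_Ioo_linear l1 (p := -(1 - b) / b) (q := a / b),
      lintegral_Ioo_linear l2 (p := 1) (q := -1), lintegral_Ioo_linear l3 (p := 1 / b) (q := -a / b),
      v1, v2, v3, v4, v5, v6, ← ENNReal.ofReal_add, ← ENNReal.ofReal_add]
    · congr 1; field_simp; ring
    · exact div_nonneg (mul_nonneg (by linarith) (by linarith)) (by norm_num)
    · refine add_nonneg ?_ ?_
      · exact div_nonneg (mul_nonneg (by linarith) (by linarith)) (by norm_num)
      · exact div_nonneg (mul_nonneg (by linarith) (by linarith)) (by norm_num)
    · exact div_nonneg (mul_nonneg (by linarith) (by linarith)) (by norm_num)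
    · exact div_nonneg (mul_nonneg (by linarith) (by linarith)) (by norm_num)
    · rw [v5]; exact hw
    · rw [v6]
    · intro x hx
      have i1 := (div_lt_iff₀' h1).1 hx.1
      have i2 := (lt_div_iff₀' ha0).1 hx.2
      refine tent_line_bottom hb i2.le ?_ i1.le
      nlinarith
    · rw [v3]; exact hv
    · rw [v4]; exact hw
    · intro x hx
      have i1 := (div_lt_iff₀' h0).1 hx.1
      have i2 := (lt_div_iff₀' h1).1 hx.2
      refine tent_line_right hb i2 i1.le ?_
      nlinarith
    · rw [v1]
    · rw [v2]; exact hv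
    · intro x hx
      have i1 := (div_lt_iff₀' ha0).1 hx.1
      have i2 := (lt_div_iff₀' h0).1 hx.2
      refine tent_line_top hb ?_ i2.le i1.le
      exact (lt_div_iff₀' h1).1 (hx.2.trans_le l2)
    · intro x hx
      have i1 := (lt_div_iff₀' ha0).1 hx
      exact tent_line_nonpos hb (Or.inr (Or.inr (Or.inl i1.le)))
    · intro x hx
      have i1 := (div_lt_iff₀' ha0).1 hx
      exact tent_line_nonpos hb (Or.inl i1.le)
  rw [jointDensity_eq_of_lintegral hb key]
  congr 1
  field_simp

/-- Three pieces from `h = 1` to `h = 0`. Now the line reaches `x + h = 1` no later than `x = 1 /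
2`, and these two are the breaks. -/
lemma jointDensity_of_two_le_add {a b : ℝ} (hb : 0 < b) (hb1 : b < 1) (ha : a < 2)
    (hab : 2 ≤ a + b) :
    jointDensity a b = ENNReal.ofReal (1 / (2 * a)
      - (a + b - 2) ^ 2 / (2 * a * b * (a - b))) := by
  have ha0 : 0 < a := by linarith
  have h1 : 0 < a - b := by linarith
  have h3 : 0 < 1 - b := by linarith
  have l1 : (1 - b) / a ≤ (1 - b) / (a - b) := div_le_div_of_nonneg_left h3.le h1 (by linarith)
  have l2 : (1 - b) / (a - b) ≤ 1 / 2 := by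
    rw [div_le_div_iff₀ h1 (by norm_num)]; linarith
  have l3 : 1 / 2 ≤ 1 / a := one_div_le_one_div_of_le ha0 ha.le
  have key : ∫⁻ x, ENNReal.ofReal (tent x ((1 - a * x) / b))
      = ENNReal.ofReal (b * (1 / (2 * a) - (a + b - 2) ^ 2 / (2 * a * b * (a - b))) / 2) := by
    have v1 : -(1 - b) / b + a / b * ((1 - b) / a) = 0 := by field_simp; ring
    have v2 : -(1 - b) / b + a / b * ((1 - b) / (a - b)) = (1 - b) / (a - b) := by field_simp; ring
    have v3 : (1 - b) / b + (2 - a / b) * ((1 - b) / (a - b)) = (1 - b) / (a - b) := by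
      field_simp; ring
    have v4 : (1 - b) / b + (2 - a / b) * (1 / 2) = (2 - a) / (2 * b) := by field_simp; ring
    have v5 : 1 / b + -a / b * (1 / 2) = (2 - a) / (2 * b) := by field_simp; ring
    have v6 : 1 / b + -a / b * (1 / a) = 0 := by field_simp; ring
    have hv : 0 ≤ (1 - b) / (a - b) := by positivity
    have hw : 0 ≤ (2 - a) / (2 * b) := div_nonneg (by linarith) (by linarith)
    rw [lintegral_eq_Ioo_of_nonpos (x₀ := (1 - b) / a) (x₁ := 1 / a),
      lintegral_Ioo_add l1 (l2.trans l3), lintegral_Ioo_add l2 l3,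
      lintegral_Ioo_linear l1 (p := -(1 - b) / b) (q := a / b),
      lintegral_Ioo_linear l2 (p := (1 - b) / b) (q := 2 - a / b),
      lintegral_Ioo_linear l3 (p := 1 / b) (q := -a / b),
      v1, v2, v3, v4, v5, v6, ← ENNReal.ofReal_add, ← ENNReal.ofReal_add]
    · congr 1; field_simp; ring
    · exact div_nonneg (mul_nonneg (by linarith) (by linarith)) (by norm_num)
    · refine add_nonneg ?_ ?_
      · exact div_nonneg (mul_nonneg (by linarith) (by linarith)) (by norm_num)
      · exact div_nonneg (mul_nonneg (by linarith) (by linarith)) (by norm_num)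
    · exact div_nonneg (mul_nonneg (by linarith) (by linarith)) (by norm_num)
    · exact div_nonneg (mul_nonneg (by linarith) (by linarith)) (by norm_num)
    · rw [v5]; exact hw
    · rw [v6]
    · intro x hx
      have i1 := (div_lt_iff₀' h1).1 (l2.trans_lt hx.1)
      have i2 := (lt_div_iff₀' ha0).1 hx.2
      exact tent_line_bottom hb i2.le hx.1.le i1.le
    · rw [v3]; exact hv
    · rw [v4]; exact hw
    · intro x hx
      have i1 := (div_lt_iff₀' h1).1 hx.1
      refine tent_line_left hb ?_ hx.2.le i1.le
      have := hx.2
      have hx0 : 0 < x := lt_of_le_of_lt hv hx.1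
      nlinarith
    · rw [v1]
    · rw [v2]; exact hv
    · intro x hx
      have i1 := (div_lt_iff₀' ha0).1 hx.1
      have i2 := (lt_div_iff₀' h1).1 hx.2
      refine tent_line_top hb i2 ?_ i1.le
      refine le_of_mul_le_mul_left ?_ h1
      nlinarith
    · intro x hx
      have i1 := (lt_div_iff₀' ha0).1 hx
      exact tent_line_nonpos hb (Or.inr (Or.inr (Or.inl i1.le)))
    · intro x hx
      have i1 := (div_lt_iff₀' ha0).1 hx
      exact tent_line_nonpos hb (Or.inl i1.le)
  rw [jointDensity_eq_of_lintegral hb key]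
  congr 1
  field_simp

end GapDistribution

/-! ### The density of a single gap. -/

namespace GapDistribution

open MeasureTheory

/-- A nonnegative derivative of a continuous function is integrable. The inequality is recorded
because it supplies the sign of closed forms inside `ENNReal.ofReal`. -/
lemma lintegral_deriv_eq_sub {F f : ℝ → ℝ} {a b : ℝ} (hab : a ≤ b)
    (hc : ContinuousOn F (Set.Icc a b)) (hd : ∀ x ∈ Set.Ioo a b, HasDerivAt F (f x) x)
    (h0 : ∀ x ∈ Set.Ioo a b, 0 ≤ f x) :
    F a ≤ F b ∧ ∫⁻ x in Set.Ioo a b, ENNReal.ofReal (f x) = ENNReal.ofReal (F b - F a) := by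
  have hi := intervalIntegral.integrableOn_deriv_of_nonneg hc hd h0
  have h0' : 0 ≤ᵐ[volume.restrict (Set.Ioo a b)] f := by
    filter_upwards [ae_restrict_mem measurableSet_Ioo] with x hx using h0 x hx
  rw [← sub_nonneg, ← intervalIntegral.integral_eq_sub_of_hasDerivAt_of_le hab hc hd
    ((intervalIntegrable_iff_integrableOn_Ioc_of_le hab).2 hi),
    intervalIntegral.integral_of_le hab, integral_Ioc_eq_integral_Ioo,
    ofReal_integral_eq_lintegral_ofReal (hi.mono_set Set.Ioo_subset_Ioc_self) h0']
  exact ⟨integral_nonneg_of_ae h0', rfl⟩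

/-- The density of the gap lengths. -/
noncomputable def gapDensity (A : ℝ) : ENNReal :=
  2 * (∫⁻ z in fareyTriangle, ENNReal.ofReal ((1 - z.1) / z.1)
    * (Set.Ioo (0 : ℝ) 1).indicator 1 (z.2 * A))
  + ∫⁻ z in fareyTriangle, ENNReal.ofReal ((z.1 + z.2 - 1) / |z.1 - z.2|)
    * (Set.Ioo (0 : ℝ) 1).indicator 1 (z.1 * z.2 / (z.1 - z.2) * A + -z.2 / (z.1 - z.2))

/-- Summing over the type of the second gap leaves the proportions `1 - x`, `1 - y` and `x + y - 1`
of the gaps `A`, `B` and `A + B`. -/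
lemma pairFreq_zero {a x y A B : ℝ} (hx : x ≤ 1) (hy : y ≤ 1) (hxy : 1 < x + y) (hA : 0 ≤ A)
    (hB : 0 ≤ B) : pairFreq a 0 x y A B = (1 - x) * (if a ≤ A then 1 else 0)
      + (1 - y) * (if a ≤ B then 1 else 0) + (x + y - 1) * (if a ≤ A + B then 1 else 0) := by
  have e : ∀ u v : ℝ, 0 ≤ v → bothLE a 0 u v = if a ≤ u then 1 else 0 := fun u v hv => by
    simp [bothLE, hv]
  have hs : ∀ {x y : ℝ}, x ≤ 1 → y ≤ 1 → 1 < x + y →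
      freqSame x + freqMixed x y + freqSum x y = 1 - x := by
    intro x y hx hy hxy
    unfold freqSame freqMixed freqSum
    rcases le_total x y with h1 | h1 <;> rcases le_total (1 / 2) x with h2 | h2
    · rw [max_eq_left (by linarith), min_eq_right (by linarith), max_eq_left (a := x) (by linarith),
        max_eq_right (by linarith)]; ring
    · rw [max_eq_right (by linarith), min_eq_right (by linarith),
        max_eq_right (a := x) (by linarith), max_eq_right (by linarith)]; ring
    · rw [max_eq_left (by linarith), min_eq_left (by linarith), max_eq_left (a := x) (by linarith),
        max_eq_left (by linarith)]; ring
    · linarith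
  have hc : freqSum x y + freqSum y x + freqSumSum x y = x + y - 1 := by
    unfold freqSum freqSumSum
    rcases le_total x y with h1 | h1
    · rw [min_eq_left h1, max_eq_left (a := y) (by linarith), max_eq_left (a := (0 : ℝ)) (b := x - y)
        (by linarith)]
      rcases le_total (1 / 2) x with h2 | h2
      · rw [max_eq_left (a := x) (by linarith), max_eq_right (by linarith),
          max_eq_right (by linarith)]; ring
      · rw [max_eq_right (a := x) (by linarith), max_eq_right (by linarith),
          max_eq_left (by linarith)]; ring
    · rw [min_eq_right h1, max_eq_left (a := x) (by linarith), max_eq_left (a := (0 : ℝ))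
        (b := y - x) (by linarith)]
      rcases le_total (1 / 2) y with h2 | h2
      · rw [max_eq_left (a := y) (by linarith), max_eq_right (by linarith),
          max_eq_right (by linarith)]; ring
      · rw [max_eq_right (a := y) (by linarith), max_eq_right (by linarith),
          max_eq_left (by linarith)]; ring
  have hm : freqMixed y x = freqMixed x y := min_comm _ _
  have h1 := hs hx hy hxy
  have h2 := hs hy hx (by linarith)
  unfold pairFreq
  rw [e _ _ hA, e _ _ hB, e _ _ hB, e _ _ hA, e _ _ (add_nonneg hA hB), e _ _ hA,
    e _ _ (add_nonneg hA hB), e _ _ hB, e _ _ (add_nonneg hA hB)]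
  rw [hm] at h2
  linear_combination (if a ≤ A then (1 : ℝ) else 0) * h1 + (if a ≤ B then (1 : ℝ) else 0) * h2
    + (if a ≤ A + B then (1 : ℝ) else 0) * hc

lemma measurable_ofReal_band {φ : ℝ → ℝ} (hφ : Measurable φ) (k a a' : ℝ) : Measurable fun t : ℝ =>
    ENNReal.ofReal (k * (if a ≤ φ t ∧ φ t < a' then 1 else 0)) := by
  refine (measurable_const.mul (Measurable.ite ?_ measurable_const measurable_const)).ennreal_ofReal
  exact (measurableSet_le measurable_const hφ).inter (measurableSet_lt hφ measurable_const)

lemma lintegral_Ioo_ofReal_mul_affine {c d k a a' : ℝ} (hc : c ≠ 0) {φ : ℝ → ℝ}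
    (hφ : Measurable φ) (hφ' : ∀ A, φ (c * A + d) = A) :
    ∫⁻ t in Set.Ioo (0 : ℝ) 1, ENNReal.ofReal (k * (if a ≤ φ t ∧ φ t < a' then 1 else 0))
      = ∫⁻ A in Set.Ico a a', ENNReal.ofReal (k * |c|)
        * (Set.Ioo (0 : ℝ) 1).indicator 1 (c * A + d) := by
  have hm := measurable_ofReal_band hφ k a a'
  rw [← lintegral_indicator measurableSet_Ioo, ← lintegral_indicator measurableSet_Ico,
    lintegral_comp_affine hc d (hm.indicator measurableSet_Ioo),
    ← lintegral_const_mul' _ _ ENNReal.ofReal_ne_top]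
  refine lintegral_congr fun A => ?_
  by_cases h1 : c * A + d ∈ Set.Ioo (0 : ℝ) 1 <;> by_cases h2 : A ∈ Set.Ico a a'
  · rw [Set.indicator_of_mem h1, Set.indicator_of_mem h2, Set.indicator_of_mem h1, hφ',
      if_pos (show a ≤ A ∧ A < a' from h2), ← ENNReal.ofReal_mul (abs_nonneg _), Pi.one_apply, mul_one, mul_one, mul_comm]
  · rw [Set.indicator_of_mem h1, Set.indicator_of_notMem h2, hφ',
      if_neg (show ¬ (a ≤ A ∧ A < a') from h2)]
    simp
  · rw [Set.indicator_of_notMem h1, Set.indicator_of_mem h2, Set.indicator_of_notMem h1]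
    simp
  · rw [Set.indicator_of_notMem h1, Set.indicator_of_notMem h2]
    simp

lemma measurable_gapDensity_left : Measurable fun w : (ℝ × ℝ) × ℝ =>
    ENNReal.ofReal ((1 - w.1.1) / w.1.1)
      * (Set.Ioo (0 : ℝ) 1).indicator (1 : ℝ → ENNReal) (w.1.2 * w.2) := by
  refine Measurable.mul (by fun_prop) ?_
  exact (measurable_one.indicator measurableSet_Ioo).comp (by fun_prop)

lemma measurable_gapDensity_right : Measurable fun w : (ℝ × ℝ) × ℝ =>
    ENNReal.ofReal ((w.1.1 + w.1.2 - 1) / |w.1.1 - w.1.2|) * (Set.Ioo (0 : ℝ) 1).indicator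
      (1 : ℝ → ENNReal) (w.1.1 * w.1.2 / (w.1.1 - w.1.2) * w.2 + -w.1.2 / (w.1.1 - w.1.2)) := by
  refine Measurable.mul (by fun_prop) ?_
  exact (measurable_one.indicator measurableSet_Ioo).comp (by fun_prop)

lemma ite_le_eq_add {a a' u : ℝ} (h : a ≤ a') : (if a ≤ u then (1 : ℝ) else 0)
    = (if a' ≤ u then 1 else 0) + if a ≤ u ∧ u < a' then 1 else 0 := by
  by_cases h1 : a' ≤ u
  · simp [h1, h.trans h1, not_lt.2 h1]
  · simp [h1, not_le.1 h1]

/-- The distribution of a single gap is recovered from its density. -/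
lemma limitIntegral_eq_add_gapDensity {a a' : ℝ} (haa : a ≤ a') :
    limitIntegral a 0 = limitIntegral a' 0 + ∫⁻ A in Set.Ico a a', gapDensity A := by
  set U : ℝ × ℝ → ENNReal := fun z => ∫⁻ A in Set.Ico a a', ENNReal.ofReal ((1 - z.1) / z.1)
    * (Set.Ioo (0 : ℝ) 1).indicator 1 (z.2 * A) with hU
  set V : ℝ × ℝ → ENNReal := fun z => ∫⁻ A in Set.Ico a a',
    ENNReal.ofReal ((z.1 + z.2 - 1) / |z.1 - z.2|)
    * (Set.Ioo (0 : ℝ) 1).indicator 1 (z.1 * z.2 / (z.1 - z.2) * A + -z.2 / (z.1 - z.2)) with hV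
  have mU : Measurable U := measurable_gapDensity_left.lintegral_prod_right'
  have mV : Measurable V := measurable_gapDensity_right.lintegral_prod_right'
  have mP : Measurable fun z : ℝ × ℝ => ∫⁻ t in Set.Ioo (0 : ℝ) 1, ENNReal.ofReal
      (pairFreq a' 0 z.1 z.2 (t / z.2) ((1 - t) / z.1) / (z.1 * z.2)) := by
    have : Measurable fun w : (ℝ × ℝ) × ℝ => ENNReal.ofReal
      (pairFreq a' 0 w.1.1 w.1.2 (w.2 / w.1.2) ((1 - w.2) / w.1.1) / (w.1.1 * w.1.2)) :=
      ((measurable_pairFreq a' 0 (by fun_prop) (by fun_prop) (by fun_prop)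
        (by fun_prop)).div (by fun_prop)).ennreal_ofReal
    exact this.lintegral_prod_right'
  have key : ∀ᵐ z ∂(volume.restrict fareyTriangle), ∫⁻ t in Set.Ioo (0 : ℝ) 1,
      ENNReal.ofReal (pairFreq a 0 z.1 z.2 (t / z.2) ((1 - t) / z.1) / (z.1 * z.2))
      = (∫⁻ t in Set.Ioo (0 : ℝ) 1,
        ENNReal.ofReal (pairFreq a' 0 z.1 z.2 (t / z.2) ((1 - t) / z.1) / (z.1 * z.2)))
        + (U z + (U z.swap + V z)) := by
    filter_upwards [ae_restrict_mem measurableSet_fareyTriangle,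
      ae_restrict_of_ae (ae_generic 0)] with z hz hg
    obtain ⟨⟨⟨hx0, hx1⟩, hy0, hy1⟩, hxy⟩ := hz
    have hne : z.1 - z.2 ≠ 0 := sub_ne_zero.2 hg.2.2.2.2.2
    have hpos : 0 < z.1 * z.2 := mul_pos hx0 hy0
    have k1 : 0 ≤ (1 - z.1) / (z.1 * z.2) := div_nonneg (by linarith) hpos.le
    have k2 : 0 ≤ (1 - z.2) / (z.1 * z.2) := div_nonneg (by linarith) hpos.le
    have k3 : 0 ≤ (z.1 + z.2 - 1) / (z.1 * z.2) := div_nonneg (by linarith) hpos.le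
    have i1 : ∫⁻ t in Set.Ioo (0 : ℝ) 1, ENNReal.ofReal ((1 - z.1) / (z.1 * z.2)
        * (if a ≤ t / z.2 ∧ t / z.2 < a' then 1 else 0)) = U z := by
      rw [lintegral_Ioo_ofReal_mul_affine (c := z.2) (d := 0) hy0.ne' (by fun_prop)
        (fun A => by field_simp; ring), hU]
      refine lintegral_congr fun A => ?_
      rw [abs_of_pos hy0, add_zero]
      congr 2
      field_simp
    have i2 : ∫⁻ t in Set.Ioo (0 : ℝ) 1, ENNReal.ofReal ((1 - z.2) / (z.1 * z.2)
        * (if a ≤ (1 - t) / z.1 ∧ (1 - t) / z.1 < a' then 1 else 0)) = U z.swap := by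
      rw [← lintegral_Ioo_one_sub]
      · simp only [sub_sub_cancel]
        rw [lintegral_Ioo_ofReal_mul_affine (c := z.1) (d := 0) hx0.ne' (by fun_prop)
          (fun A => by field_simp; ring), hU]
        refine lintegral_congr fun A => ?_
        rw [abs_of_pos hx0, add_zero, Prod.fst_swap, Prod.snd_swap]
        congr 2
        field_simp
      · exact measurable_ofReal_band (by fun_prop) _ _ _
    have i3 : ∫⁻ t in Set.Ioo (0 : ℝ) 1, ENNReal.ofReal ((z.1 + z.2 - 1) / (z.1 * z.2)
        * (if a ≤ t / z.2 + (1 - t) / z.1 ∧ t / z.2 + (1 - t) / z.1 < a' then 1 else 0)) = V z := by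
      rw [lintegral_Ioo_ofReal_mul_affine (c := z.1 * z.2 / (z.1 - z.2)) (d := -z.2 / (z.1 - z.2))
        (div_ne_zero hpos.ne' hne) (by fun_prop) (fun A => by field_simp; ring), hV]
      refine lintegral_congr fun A => ?_
      congr 2
      rw [abs_div, abs_of_pos hpos]
      have : |z.1 - z.2| ≠ 0 := abs_ne_zero.2 hne
      field_simp
    rw [← i1, ← i2, ← i3, ← lintegral_add_right, ← lintegral_add_right, ← lintegral_add_right]
    · refine setLIntegral_congr_fun measurableSet_Ioo fun t ht => ?_
      have hA : 0 ≤ t / z.2 := div_nonneg ht.1.le hy0.le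
      have hB : 0 ≤ (1 - t) / z.1 := div_nonneg (by linarith [ht.2]) hx0.le
      rw [← ENNReal.ofReal_add, ← ENNReal.ofReal_add, ← ENNReal.ofReal_add,
        pairFreq_zero hx1 hy1 hxy hA hB, pairFreq_zero hx1 hy1 hxy hA hB,
        ite_le_eq_add (u := t / z.2) haa, ite_le_eq_add (u := (1 - t) / z.1) haa,
        ite_le_eq_add (u := t / z.2 + (1 - t) / z.1) haa]
      · congr 1; ring
      · exact div_nonneg (pairFreq_nonneg _ _ hx1 hy1 _ _) hpos.le
      · refine add_nonneg (mul_nonneg k1 ?_) (add_nonneg (mul_nonneg k2 ?_) (mul_nonneg k3 ?_))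
        all_goals split_ifs <;> norm_num
      · exact mul_nonneg k1 (by split_ifs <;> norm_num)
      · refine add_nonneg (mul_nonneg k2 ?_) (mul_nonneg k3 ?_)
        all_goals split_ifs <;> norm_num
      · exact mul_nonneg k2 (by split_ifs <;> norm_num)
      · exact mul_nonneg k3 (by split_ifs <;> norm_num)
    · exact (measurable_ofReal_band (by fun_prop) _ _ _).add
        ((measurable_ofReal_band (by fun_prop) _ _ _).add
          (measurable_ofReal_band (by fun_prop) _ _ _))
    · exact (measurable_ofReal_band (by fun_prop) _ _ _).add
        (measurable_ofReal_band (by fun_prop) _ _ _)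
    · exact measurable_ofReal_band (by fun_prop) _ _ _
  rw [limitIntegral_eq, limitIntegral_eq, lintegral_congr_ae key, lintegral_add_left mP,
    lintegral_add_left mU, lintegral_add_right _ mV, lintegral_fareyTriangle_swap (f := U)]
  congr 1
  have e1 : ∫⁻ z in fareyTriangle, U z = ∫⁻ A in Set.Ico a a', ∫⁻ z in fareyTriangle,
      ENNReal.ofReal ((1 - z.1) / z.1) * (Set.Ioo (0 : ℝ) 1).indicator 1 (z.2 * A) :=
    lintegral_lintegral_swap measurable_gapDensity_left.aemeasurable
  have e2 : ∫⁻ z in fareyTriangle, V z = ∫⁻ A in Set.Ico a a', ∫⁻ z in fareyTriangle,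
      ENNReal.ofReal ((z.1 + z.2 - 1) / |z.1 - z.2|)
      * (Set.Ioo (0 : ℝ) 1).indicator 1 (z.1 * z.2 / (z.1 - z.2) * A + -z.2 / (z.1 - z.2)) :=
    lintegral_lintegral_swap measurable_gapDensity_right.aemeasurable
  have m1 : Measurable fun A : ℝ => ∫⁻ z in fareyTriangle, ENNReal.ofReal ((1 - z.1) / z.1)
      * (Set.Ioo (0 : ℝ) 1).indicator 1 (z.2 * A) :=
    (measurable_gapDensity_left.comp measurable_swap).lintegral_prod_right'
  rw [← add_assoc, ← two_mul, e1, e2, ← lintegral_const_mul' _ _ (by norm_num),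
    ← lintegral_add_left (m1.const_mul 2)]
  rfl

lemma lintegral_fareyTriangle {f : ℝ × ℝ → ENNReal} (hf : Measurable f) :
    ∫⁻ z in fareyTriangle, f z
      = ∫⁻ x in Set.Ioo (0 : ℝ) 1, ∫⁻ y in Set.Ioo (1 - x) 1, f (x, y) := by
  rw [← lintegral_indicator measurableSet_fareyTriangle, Measure.volume_eq_prod,
    lintegral_prod _ (hf.indicator measurableSet_fareyTriangle).aemeasurable,
    setLIntegral_congr Ioo_ae_eq_Ioc, ← lintegral_indicator measurableSet_Ioc]
  refine lintegral_congr fun x => ?_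
  by_cases hx : x ∈ Set.Ioc (0 : ℝ) 1
  · rw [Set.indicator_of_mem hx, setLIntegral_congr Ioo_ae_eq_Ioc,
      ← lintegral_indicator measurableSet_Ioc]
    refine lintegral_congr fun y => ?_
    by_cases hy : y ∈ Set.Ioc (1 - x) 1
    · rw [Set.indicator_of_mem hy, Set.indicator_of_mem]
      exact mem_fareyTriangle.2 ⟨hx, ⟨by linarith [hy.1, hx.2], hy.2⟩, by linarith [hy.1]⟩
    · rw [Set.indicator_of_notMem hy, Set.indicator_of_notMem]
      exact fun i => hy ⟨by linarith [(mem_fareyTriangle.1 i).2.2], (mem_fareyTriangle.1 i).2.1.2⟩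
  · rw [Set.indicator_of_notMem hx]
    have : ∀ y, fareyTriangle.indicator f (x, y) = 0 := fun y =>
      Set.indicator_of_notMem (fun i => hx (mem_fareyTriangle.1 i).1) _
    simp [this]

/-- A gap of sum type has length `t / y + (1 - t) / x ≥ 1` and does not contribute, while for the
basic types the constraint `y A < 1` is automatic. What remains is twice the integral of `(1 - x) /
x` over the triangle. -/
lemma gapDensity_of_lt_one {A : ℝ} (h0 : 0 < A) (h1 : A < 1) : gapDensity A = 1 := by
  have e1 : ∫⁻ z in fareyTriangle, ENNReal.ofReal ((1 - z.1) / z.1)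
      * (Set.Ioo (0 : ℝ) 1).indicator 1 (z.2 * A)
      = ∫⁻ z in fareyTriangle, ENNReal.ofReal ((1 - z.1) / z.1) := by
    refine setLIntegral_congr_fun measurableSet_fareyTriangle fun z hz => ?_
    rw [Set.indicator_of_mem, Pi.one_apply, mul_one]
    exact ⟨mul_pos hz.1.2.1 h0, by nlinarith [hz.1.2.1, hz.1.2.2]⟩
  have e2 : ∫⁻ z in fareyTriangle, ENNReal.ofReal ((z.1 + z.2 - 1) / |z.1 - z.2|)
      * (Set.Ioo (0 : ℝ) 1).indicator 1 (z.1 * z.2 / (z.1 - z.2) * A + -z.2 / (z.1 - z.2)) = 0 := by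
    rw [← lintegral_zero]
    refine setLIntegral_congr_fun measurableSet_fareyTriangle fun z hz => ?_
    obtain ⟨⟨⟨hx0, hx1⟩, hy0, hy1⟩, hxy⟩ := hz
    by_cases hne : z.1 - z.2 = 0
    · simp [hne]
    · rw [Set.indicator_of_notMem, mul_zero]
      rintro ⟨i1, i2⟩
      set t := z.1 * z.2 / (z.1 - z.2) * A + -z.2 / (z.1 - z.2) with ht
      have hA : A = t / z.2 + (1 - t) / z.1 := by
        rw [ht]; field_simp; ring
      have j1 : t ≤ t / z.2 := le_div_self i1.le hy0 hy1
      have j2 : 1 - t ≤ (1 - t) / z.1 := le_div_self (by linarith) hx0 hx1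
      linarith
  have e3 : ∫⁻ z in fareyTriangle, ENNReal.ofReal ((1 - z.1) / z.1) = ENNReal.ofReal (1 / 2) := by
    rw [lintegral_fareyTriangle (f := fun z => ENNReal.ofReal ((1 - z.1) / z.1)) (by fun_prop)]
    have : ∀ x ∈ Set.Ioo (0 : ℝ) 1, ∫⁻ _ in Set.Ioo (1 - x) 1, ENNReal.ofReal ((1 - x) / x)
        = ENNReal.ofReal (1 - x) := by
      intro x hx
      rw [setLIntegral_const, Real.volume_Ioo, ← ENNReal.ofReal_mul
        (div_nonneg (by linarith [hx.2]) hx.1.le)]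
      congr 1
      have := hx.1.ne'
      field_simp
      ring
    rw [setLIntegral_congr_fun measurableSet_Ioo this, lintegral_Ioo_linear zero_le_one (p := 1)
      (q := -1) (by norm_num) (by norm_num) (fun x _ => by ring)]
    norm_num
  rw [gapDensity, e1, e2, e3, add_zero, show (2 : ENNReal) = ENNReal.ofReal 2 by simp,
    ← ENNReal.ofReal_mul (by norm_num)]
  norm_num

lemma limitIntegral_zero_of_le_one {a : ℝ} (h0 : 0 ≤ a) (h1 : a ≤ 1) :
    limitIntegral a 0 = ENNReal.ofReal (Real.pi ^ 2 / 6 - a) := by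
  have h := limitIntegral_eq_add_gapDensity h0
  have e : ∫⁻ A in Set.Ico 0 a, gapDensity A = ENNReal.ofReal a := by
    rw [← setLIntegral_congr Ioo_ae_eq_Ico, setLIntegral_congr_fun measurableSet_Ioo
      (g := fun _ => 1) fun A hA => gapDensity_of_lt_one hA.1 (hA.2.trans_le h1)]
    simp
  rw [limitIntegral_zero_zero, e] at h
  have h' := congrArg ENNReal.toReal h
  rw [ENNReal.toReal_add (limitIntegral_ne_top _ _) ENNReal.ofReal_ne_top,
    ENNReal.toReal_ofReal (by positivity), ENNReal.toReal_ofReal h0] at h'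
  rw [h', add_sub_cancel_right, ENNReal.ofReal_toReal (limitIntegral_ne_top _ _)]

end GapDistribution

/-! ### The single gap density between 1 and 2. -/

namespace GapDistribution

open MeasureTheory

/-- The density of the gap lengths between `1` and `2`. -/
noncomputable def gapDensityFormula (A : ℝ) : ℝ :=
  1 / A + 2 * (A - 1) ^ 2 / A ^ 2 * (Real.log (A - 1) - Real.log A)
    - (2 - A) ^ 2 / (2 * A ^ 2) * (Real.log (2 - A) - Real.log A)

/-- Here `u` is the inverse gap length, and the constraint reads `y < u`. The admissible `y` form
the interval from `1 - x` to `u`, which is empty unless `x > 1 - u`. -/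
lemma lintegral_gapDensity_left {u : ℝ} (h0 : 0 < u) (h1 : u < 1) :
    0 ≤ (1 - u) * Real.log (1 - u) + u - u ^ 2 / 2 ∧
    ∫⁻ z in fareyTriangle, ENNReal.ofReal ((1 - z.1) / z.1)
      * (Set.Ioo (0 : ℝ) 1).indicator 1 (z.2 * u⁻¹)
      = ENNReal.ofReal ((1 - u) * Real.log (1 - u) + u - u ^ 2 / 2) := by
  rw [lintegral_fareyTriangle (f := fun z => ENNReal.ofReal ((1 - z.1) / z.1)
    * (Set.Ioo (0 : ℝ) 1).indicator 1 (z.2 * u⁻¹)) (measurable_gapDensity_left.comp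
      (measurable_id.prodMk measurable_const))]
  have hin : ∀ x ∈ Set.Ioo (0 : ℝ) 1, ∫⁻ y in Set.Ioo (1 - x) 1, ENNReal.ofReal ((1 - x) / x)
      * (Set.Ioo (0 : ℝ) 1).indicator 1 (y * u⁻¹)
      = ENNReal.ofReal ((1 - x) * (x - (1 - u)) / x) := by
    intro x hx
    have e : ∀ y ∈ Set.Ioo (1 - x) 1, ENNReal.ofReal ((1 - x) / x)
      * (Set.Ioo (0 : ℝ) 1).indicator (1 : ℝ → ENNReal) (y * u⁻¹)
      = (Set.Iio u).indicator (fun _ => ENNReal.ofReal ((1 - x) / x)) y := by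
      intro y hy
      have hy0 : 0 < y := by linarith [hy.1, hx.2]
      by_cases h : y < u
      · rw [Set.indicator_of_mem, Set.indicator_of_mem (show y ∈ Set.Iio u from h), Pi.one_apply,
          mul_one]
        exact ⟨by positivity, by rw [← div_eq_mul_inv, div_lt_one h0]; exact h⟩
      · rw [Set.indicator_of_notMem, Set.indicator_of_notMem (show y ∉ Set.Iio u from h), mul_zero]
        rintro ⟨-, i⟩
        rw [← div_eq_mul_inv, div_lt_one h0] at i
        exact h i
    rw [setLIntegral_congr_fun measurableSet_Ioo e, lintegral_indicator measurableSet_Iio,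
      Measure.restrict_restrict measurableSet_Iio, setLIntegral_const, Set.inter_comm,
      Set.Ioo_inter_Iio, min_eq_right h1.le, Real.volume_Ioo, ← ENNReal.ofReal_mul
        (div_nonneg (by linarith [hx.2]) hx.1.le)]
    congr 1
    ring
  have hzero : ∫⁻ x in Set.Ioo 0 (1 - u), ENNReal.ofReal ((1 - x) * (x - (1 - u)) / x) = 0 := by
    rw [← lintegral_zero]
    refine setLIntegral_congr_fun measurableSet_Ioo fun x hx => ?_
    rw [ENNReal.ofReal_eq_zero]
    exact div_nonpos_of_nonpos_of_nonneg (mul_nonpos_of_nonneg_of_nonpos (by linarith [hx.2])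
      (by linarith [hx.2])) hx.1.le
  rw [setLIntegral_congr_fun measurableSet_Ioo hin, lintegral_Ioo_add (x₁ := 1 - u) (by linarith)
    (by linarith), hzero, zero_add]
  have := lintegral_deriv_eq_sub (f := fun x => (1 - x) * (x - (1 - u)) / x)
    (F := fun x => -(1 - u) * Real.log x + (2 - u) * x - x ^ 2 / 2) (a := 1 - u) (b := 1)
    (by linarith) ?_ ?_ ?_
  · simp only [Real.log_one] at this
    rw [this.2]
    constructor
    · linarith [this.1]
    · congr 1; ring
  · have : ∀ x ∈ Set.Icc (1 - u) 1, x ≠ 0 := fun x hx => by linarith [hx.1] |> fun (h : 0 < x) => h.ne'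
    fun_prop (disch := assumption)
  · intro x hx
    have hx0 : x ≠ 0 := by linarith [hx.1] |> fun (h : 0 < x) => h.ne'
    have := (((Real.hasDerivAt_log hx0).const_mul (-(1 - u))).add ((hasDerivAt_id x).const_mul
      (2 - u))).sub (((hasDerivAt_id x).pow 2).div_const 2)
    refine this.congr_deriv ?_
    simp only [id]
    field_simp
    ring
  · intro x hx
    exact div_nonneg (mul_nonneg (by linarith [hx.2]) (by linarith [hx.1])) (by linarith [hx.1])

/-- Half of the sum part of the density of gap lengths. -/
noncomputable def sumGapKernel (u : ℝ) (z : ℝ × ℝ) : ENNReal :=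
  if z.1 < u ∧ u < z.2 then ENNReal.ofReal ((z.1 + z.2 - 1) / (z.2 - z.1)) else 0

lemma measurable_sumGapKernel (u : ℝ) : Measurable (sumGapKernel u) := by
  unfold sumGapKernel
  refine Measurable.ite ?_ (by fun_prop) measurable_const
  exact (measurableSet_lt measurable_fst measurable_const).inter
    (measurableSet_lt measurable_const measurable_snd)

/-- As `t` runs through `(0, 1)`, the sum `t / y + (1 - t) / x` runs between `1 / x` and `1 / y`. So
the value `1 / u` is attained exactly when `u` lies strictly between `x` and `y`, and the two orders
are mirror images. -/
lemma lintegral_gapDensity_right {u : ℝ} (h0 : 0 < u) :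
    ∫⁻ z in fareyTriangle, ENNReal.ofReal ((z.1 + z.2 - 1) / |z.1 - z.2|)
      * (Set.Ioo (0 : ℝ) 1).indicator 1 (z.1 * z.2 / (z.1 - z.2) * u⁻¹ + -z.2 / (z.1 - z.2))
      = 2 * ∫⁻ z in fareyTriangle, sumGapKernel u z := by
  have key : ∀ᵐ z ∂(volume.restrict fareyTriangle), ENNReal.ofReal ((z.1 + z.2 - 1) / |z.1 - z.2|)
      * (Set.Ioo (0 : ℝ) 1).indicator 1 (z.1 * z.2 / (z.1 - z.2) * u⁻¹ + -z.2 / (z.1 - z.2))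
      = sumGapKernel u z + sumGapKernel u z.swap := by
    filter_upwards [ae_restrict_mem measurableSet_fareyTriangle,
      ae_restrict_of_ae (ae_generic 0)] with z hz hg
    obtain ⟨⟨⟨hx0, hx1⟩, hy0, hy1⟩, hxy⟩ := hz
    have hne : z.1 ≠ z.2 := hg.2.2.2.2.2
    have hne' : z.1 - z.2 ≠ 0 := sub_ne_zero.2 hne
    have e1 : z.1 * z.2 / (z.1 - z.2) * u⁻¹ + -z.2 / (z.1 - z.2)
        = z.2 * (u - z.1) / (u * (z.2 - z.1)) := by
      have : z.2 - z.1 ≠ 0 := sub_ne_zero.2 hne.symm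
      field_simp
      ring
    rw [e1]
    simp only [sumGapKernel, Prod.fst_swap, Prod.snd_swap]
    rcases lt_or_gt_of_ne hne with h | h
    · have hp : 0 < z.2 - z.1 := by linarith
      rw [if_neg (c := z.2 < u ∧ u < z.1) fun i => by linarith [i.1, i.2], add_zero,
        abs_of_neg (by linarith), neg_sub]
      by_cases i : z.1 < u ∧ u < z.2
      · rw [if_pos i, Set.indicator_of_mem, Pi.one_apply, mul_one]
        constructor
        · exact div_pos (mul_pos hy0 (by linarith [i.1])) (mul_pos h0 hp)
        · rw [div_lt_one (mul_pos h0 hp)]; nlinarith [i.2]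
      · rw [if_neg i, Set.indicator_of_notMem, mul_zero]
        rintro ⟨j1, j2⟩
        rw [div_lt_one (mul_pos h0 hp)] at j2
        have j3 := (div_pos_iff_of_pos_right (mul_pos h0 hp)).1 j1
        have j4 := pos_of_mul_pos_right j3 hy0.le
        exact i ⟨by linarith, by nlinarith⟩
    · have hp : 0 < z.1 - z.2 := by linarith
      rw [if_neg (c := z.1 < u ∧ u < z.2) fun i => by linarith [i.1, i.2], zero_add,
        abs_of_pos hp, show z.2 * (u - z.1) / (u * (z.2 - z.1)) = z.2 * (z.1 - u) / (u * (z.1 - z.2))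
          by rw [← neg_div_neg_eq]; congr 1 <;> ring, add_comm z.2 z.1]
      by_cases i : z.2 < u ∧ u < z.1
      · rw [if_pos i, Set.indicator_of_mem, Pi.one_apply, mul_one]
        constructor
        · exact div_pos (mul_pos hy0 (by linarith [i.2])) (mul_pos h0 hp)
        · rw [div_lt_one (mul_pos h0 hp)]; nlinarith [i.1]
      · rw [if_neg i, Set.indicator_of_notMem, mul_zero]
        rintro ⟨j1, j2⟩
        rw [div_lt_one (mul_pos h0 hp)] at j2
        have j3 := (div_pos_iff_of_pos_right (mul_pos h0 hp)).1 j1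
        have j4 := pos_of_mul_pos_right j3 hy0.le
        exact i ⟨by nlinarith, by linarith⟩
  rw [lintegral_congr_ae key, lintegral_add_left (measurable_sumGapKernel u),
    lintegral_fareyTriangle_swap (f := sumGapKernel u), two_mul]

lemma lintegral_sumGapKernel_right {u y : ℝ} (hu : 1 / 2 < u) (hu1 : u < 1) (hy : u < y) :
    ∫⁻ x in Set.Ioo (1 - y) 1, sumGapKernel u (x, y) = ENNReal.ofReal
      (-(y - (1 - u)) + (2 * y - 1) * (Real.log (2 * y - 1) - Real.log (y - u))) := by
  have hzero : ∫⁻ x in Set.Ioo u 1, sumGapKernel u (x, y) = 0 := by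
    rw [← lintegral_zero]
    refine setLIntegral_congr_fun measurableSet_Ioo fun x hx => ?_
    exact if_neg fun i => by linarith [i.1, hx.1]
  have e : ∀ x ∈ Set.Ioo (1 - y) u, sumGapKernel u (x, y)
      = ENNReal.ofReal ((x + y - 1) / (y - x)) := fun x hx => if_pos ⟨hx.2, hy⟩
  rw [lintegral_Ioo_add (x₁ := u) (by linarith) hu1.le, hzero, add_zero,
    setLIntegral_congr_fun measurableSet_Ioo e, (lintegral_deriv_eq_sub
      (F := fun x => -x - (2 * y - 1) * Real.log (y - x)) (by linarith) ?_ ?_ ?_).2]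
  · congr 1
    rw [show y - (1 - y) = 2 * y - 1 by ring]
    ring
  · have : ∀ x ∈ Set.Icc (1 - y) u, y - x ≠ 0 := fun x hx => by
      linarith [hx.2] |> fun (h : 0 < y - x) => h.ne'
    fun_prop (disch := assumption)
  · intro x hx
    have hx0 : y - x ≠ 0 := by linarith [hx.2] |> fun (h : 0 < y - x) => h.ne'
    have := (hasDerivAt_id x).neg.sub ((((hasDerivAt_id x).const_sub y).log hx0).const_mul
      (2 * y - 1))
    refine this.congr_deriv ?_
    simp only [id]
    field_simp
    ring
  · intro x hx
    exact div_nonneg (by linarith [hx.1]) (by linarith [hx.2])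

lemma lintegral_sumGapKernel {u : ℝ} (hu : 1 / 2 < u) (hu1 : u < 1) :
    0 ≤ -(u * (1 - u)) / 2 - u * (1 - u) * Real.log (1 - u)
      - (2 * u - 1) ^ 2 / 4 * Real.log (2 * u - 1) ∧
    ∫⁻ z in fareyTriangle, sumGapKernel u z = ENNReal.ofReal (-(u * (1 - u)) / 2
      - u * (1 - u) * Real.log (1 - u) - (2 * u - 1) ^ 2 / 4 * Real.log (2 * u - 1)) := by
  rw [← lintegral_fareyTriangle_swap, lintegral_fareyTriangle
    (f := fun z => sumGapKernel u z.swap) ((measurable_sumGapKernel u).comp measurable_swap)]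
  have hzero : ∫⁻ y in Set.Ioo 0 u, ∫⁻ x in Set.Ioo (1 - y) 1, sumGapKernel u (Prod.swap (y, x))
      = 0 := by
    rw [← lintegral_zero]
    refine setLIntegral_congr_fun measurableSet_Ioo fun y hy => ?_
    have : ∀ x, sumGapKernel u (Prod.swap (y, x)) = 0 := fun x =>
      if_neg fun i => by
        have := i.2
        simp only [Prod.swap_prod_mk] at this
        linarith [hy.2]
    simp only [this, lintegral_zero]
  have hin : ∀ y ∈ Set.Ioo u 1, ∫⁻ x in Set.Ioo (1 - y) 1, sumGapKernel u (Prod.swap (y, x))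
      = _ := fun y hy => lintegral_sumGapKernel_right hu hu1 hy.1
  rw [lintegral_Ioo_add (x₁ := u) (by linarith) hu1.le, hzero, zero_add,
    setLIntegral_congr_fun measurableSet_Ioo hin]
  -- In the primitive the singular logarithm occurs only as `(y - u) log (y - u)`, which is
  -- continuous at the end point `y = u`.
  have := lintegral_deriv_eq_sub (f := fun y => -(y - (1 - u)) + (2 * y - 1)
      * (Real.log (2 * y - 1) - Real.log (y - u))) (F := fun y => -(y - (1 - u)) ^ 2 / 2
      + ((2 * y - 1) ^ 2 / 4 * Real.log (2 * y - 1) - (2 * y - 1) ^ 2 / 8)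
      - ((y - u) * ((y - u) * Real.log (y - u)) - (y - u) ^ 2 / 2
        + (2 * u - 1) * ((y - u) * Real.log (y - u) - (y - u)))) hu1.le ?_ ?_ ?_
  · have e : (2 : ℝ) * 1 - 1 = 1 := by norm_num
    simp only [e, Real.log_one, sub_self, Real.log_zero] at this
    rw [this.2]
    constructor
    · linarith [this.1]
    · congr 1; ring
  · have h1 : ∀ y ∈ Set.Icc u 1, 2 * y - 1 ≠ 0 := fun y hy => by
      linarith [hy.1] |> fun (h : 0 < 2 * y - 1) => h.ne'
    have h2 : Continuous fun y : ℝ => (y - u) * Real.log (y - u) :=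
      Real.continuous_mul_log.comp (by fun_prop : Continuous fun y : ℝ => y - u)
    have h3 : ContinuousOn (fun y : ℝ => (y - u) * Real.log (y - u)) (Set.Icc u 1) :=
      h2.continuousOn
    have h4 : ContinuousOn (fun y : ℝ => Real.log (2 * y - 1)) (Set.Icc u 1) := by
      fun_prop (disch := assumption)
    fun_prop
  · intro y hy
    have h1 : 2 * y - 1 ≠ 0 := by linarith [hy.1] |> fun (h : 0 < 2 * y - 1) => h.ne'
    have h2 : y - u ≠ 0 := by linarith [hy.1] |> fun (h : 0 < y - u) => h.ne'
    have d1 : HasDerivAt (fun y : ℝ => 2 * y - 1) 2 y := by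
      simpa using ((hasDerivAt_id y).const_mul 2).sub_const 1
    have d2 : HasDerivAt (fun y : ℝ => y - u) 1 y := (hasDerivAt_id y).sub_const u
    have d3 : HasDerivAt (fun y : ℝ => y - (1 - u)) 1 y := (hasDerivAt_id y).sub_const _
    have l1 := d1.log h1
    have l2 := d2.mul (d2.log h2)
    have := (((d3.pow 2).neg.div_const 2).add ((((d1.pow 2).div_const 4).mul l1).sub
      ((d1.pow 2).div_const 8))).sub (((d2.mul l2).sub ((d2.pow 2).div_const 2)).add
        ((l2.sub d2).const_mul (2 * u - 1)))
    refine this.congr_deriv ?_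
    simp only [Pi.pow_apply, Pi.mul_apply]
    field_simp
    ring
  · intro y hy
    have h1 : 0 < 2 * y - 1 := by linarith [hy.1]
    have h2 : 0 < y - u := by linarith [hy.1]
    -- Nonnegativity is the inequality `1 - 1 / w ≤ log w` at `w = (2 y - 1) / (y - u)`.
    have := Real.one_sub_inv_le_log_of_pos (div_pos h1 h2)
    rw [Real.log_div h1.ne' h2.ne', inv_div] at this
    have := mul_le_mul_of_nonneg_left this h1.le
    have e : (2 * y - 1) * (1 - (y - u) / (2 * y - 1)) = y - (1 - u) := by field_simp; ring
    linarith

lemma gapDensity_eq_formula {A : ℝ} (h1 : 1 < A) (h2 : A < 2) :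
    0 ≤ gapDensityFormula A ∧ gapDensity A = ENNReal.ofReal (gapDensityFormula A) := by
  have h0 : 0 < A := by linarith
  have u0 : 0 < A⁻¹ := by positivity
  have u1 : A⁻¹ < 1 := inv_lt_one_of_one_lt₀ h1
  have u2 : 1 / 2 < A⁻¹ := by rw [← one_div]; exact one_div_lt_one_div_of_lt h0 h2
  obtain ⟨n1, e1⟩ := lintegral_gapDensity_left u0 u1
  obtain ⟨n2, e2⟩ := lintegral_sumGapKernel u2 u1
  have e3 := lintegral_gapDensity_right u0
  rw [inv_inv] at e1 e3
  have t2 : (2 : ENNReal) = ENNReal.ofReal 2 := by simp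
  have l1 : Real.log (1 - A⁻¹) = Real.log (A - 1) - Real.log A := by
    rw [← Real.log_div (by linarith |> fun (h : 0 < A - 1) => h.ne') h0.ne']
    congr 1; field_simp
  have l2 : Real.log (2 * A⁻¹ - 1) = Real.log (2 - A) - Real.log A := by
    rw [← Real.log_div (by linarith |> fun (h : 0 < 2 - A) => h.ne') h0.ne']
    congr 1; field_simp
  have e : gapDensityFormula A
      = 2 * ((1 - A⁻¹) * Real.log (1 - A⁻¹) + A⁻¹ - A⁻¹ ^ 2 / 2)
        + 2 * (-(A⁻¹ * (1 - A⁻¹)) / 2 - A⁻¹ * (1 - A⁻¹) * Real.log (1 - A⁻¹)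
          - (2 * A⁻¹ - 1) ^ 2 / 4 * Real.log (2 * A⁻¹ - 1)) := by
    rw [l1, l2, gapDensityFormula]
    field_simp
    ring
  rw [e]
  refine ⟨by linarith, ?_⟩
  rw [gapDensity, e1, e3, e2, t2, ← ENNReal.ofReal_mul (by norm_num),
    ← ENNReal.ofReal_mul (by norm_num),
    ← ENNReal.ofReal_add (by linarith) (by linarith)]

end GapDistribution

/-! ### The marginals in closed form. -/

namespace GapDistribution

open MeasureTheory

lemma marginal_eq_add {a a' : ℝ} (h : a ≤ a') (b : ℝ) :
    marginal a b = marginal a' b + ∫⁻ A in Set.Ioo a a', jointDensity A b := by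
  rw [marginal, marginal, setLIntegral_congr Ioo_ae_eq_Ioc, add_comm,
    ← lintegral_union measurableSet_Ioi
      (Set.disjoint_left.2 fun x hx hx' => absurd hx.2 (not_le.2 hx')),
    Set.Ioc_union_Ioi_eq_Ioi h]

/-- On the triangle `a x + b y ≤ a + b ≤ 1`, so both threshold conditions hold, and the two
frequencies add up to `min x (1 - x)`. -/
lemma marginal_of_add_le_one {a b : ℝ} (ha : 0 ≤ a) (hb : 0 < b) (hab : a + b ≤ 1) :
    marginal a b = ENNReal.ofReal (1 / 2) := by
  have e : ∀ z ∈ fareyTriangle, ENNReal.ofReal (crossFreq a b z.1 z.2 / z.1)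
      = ENNReal.ofReal (min z.1 (1 - z.1) / z.1) := by
    rintro z ⟨⟨⟨hx0, hx1⟩, hy0, hy1⟩, hxy⟩
    have i1 : a ≤ (1 - b * z.2) / z.1 := by
      rw [le_div_iff₀ hx0]; nlinarith
    have i2 : a ≤ b + (1 - b * z.2) / z.1 := by linarith
    rw [crossFreq, if_pos i1, if_pos i2, mul_one, mul_one]
    congr 2
    unfold freqMixed freqSum
    rcases le_total z.1 (1 / 2) with h | h
    · rw [max_eq_right (a := z.1) (by linarith), min_eq_left (a := z.1) (by linarith),
        min_eq_right (by linarith), max_eq_right (by linarith)]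
      ring
    · rw [max_eq_left (a := z.1) (by linarith), min_eq_right (a := z.1) (by linarith)]
      rcases le_total z.1 z.2 with h' | h'
      · rw [min_eq_right (by linarith), max_eq_right (by linarith)]; ring
      · rw [min_eq_left (by linarith), max_eq_left (by linarith)]; ring
  rw [← two_mul_lintegral_crossFreq a hb, setLIntegral_congr_fun measurableSet_fareyTriangle e,
    lintegral_fareyTriangle (f := fun z => ENNReal.ofReal (min z.1 (1 - z.1) / z.1))
      (by fun_prop)]
  have hin : ∀ x ∈ Set.Ioo (0 : ℝ) 1, ∫⁻ _ in Set.Ioo (1 - x) 1, ENNReal.ofReal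
      (min x (1 - x) / x) = ENNReal.ofReal (min x (1 - x)) := by
    intro x hx
    have h0 : 0 ≤ min x (1 - x) := le_min hx.1.le (by linarith [hx.2])
    rw [setLIntegral_const, Real.volume_Ioo, ← ENNReal.ofReal_mul (div_nonneg h0 hx.1.le)]
    congr 1
    have := hx.1.ne'
    field_simp
    ring
  rw [setLIntegral_congr_fun measurableSet_Ioo hin,
    lintegral_Ioo_add (x₁ := 1 / 2) (by norm_num) (by norm_num),
    lintegral_Ioo_linear (p := 0) (q := 1) (by norm_num) (by norm_num) (by norm_num),
    lintegral_Ioo_linear (p := 1) (q := -1) (by norm_num) (by norm_num) (by norm_num),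
    ← ENNReal.ofReal_add (by norm_num) (by norm_num), show (2 : ENNReal) = ENNReal.ofReal 2 by simp,
    ← ENNReal.ofReal_mul (by norm_num)]
  · norm_num
  · intro x hx
    rw [min_eq_right (by linarith [hx.1])]; ring
  · intro x hx
    rw [min_eq_left (by linarith [hx.2])]; ring

/-- The marginal for `a ≤ 1 ≤ a + b`. -/
noncomputable def marginalB (a b : ℝ) : ℝ :=
  1 / 2 - 1 / b * ((a + b - 1) + (1 - b) ^ 2 / b * (Real.log a - Real.log (1 - b))
    - 1 / b * Real.log (a + b))

/-- The value `1 / 2` on the line `a + b = 1` minus the integral of the joint density from `1 - b`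
to `a`. -/
lemma marginal_of_le_one {a b : ℝ} (hb : 0 < b) (hb1 : b < 1) (ha1 : a ≤ 1) (hab : 1 ≤ a + b) :
    0 ≤ marginalB a b ∧ marginal a b = ENNReal.ofReal (marginalB a b) := by
  have ha : 0 < a := by linarith
  have h := marginal_eq_add (show 1 - b ≤ a by linarith) b
  rw [marginal_of_add_le_one (by linarith) hb (by linarith)] at h
  have e : ∫⁻ A in Set.Ioo (1 - b) a, jointDensity A b = ∫⁻ A in Set.Ioo (1 - b) a,
      ENNReal.ofReal ((A + b - 1) ^ 2 / (A * b * (A + b))) :=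
    setLIntegral_congr_fun measurableSet_Ioo fun A hA =>
      jointDensity_of_le_one hb hb1 (by linarith [hA.1]) (by linarith [hA.2]) (by linarith [hA.1])
  have hF := lintegral_deriv_eq_sub (f := fun A => (A + b - 1) ^ 2 / (A * b * (A + b)))
    (F := fun A => 1 / b * (A + (1 - b) ^ 2 / b * Real.log A - 1 / b * Real.log (A + b)))
    (show 1 - b ≤ a by linarith) ?_ ?_ ?_
  · rw [e, hF.2] at h
    have hfin : marginal a b ≠ ⊤ := fun i => by rw [i, top_add] at h; exact ENNReal.ofReal_ne_top h
    have h' := congrArg ENNReal.toReal h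
    rw [ENNReal.toReal_add hfin ENNReal.ofReal_ne_top, ENNReal.toReal_ofReal (by norm_num),
      ENNReal.toReal_ofReal (by linarith [hF.1])] at h'
    have e2 : (marginal a b).toReal = marginalB a b := by
      rw [marginalB]
      simp only [sub_add_cancel, Real.log_one] at h'
      linear_combination -h'
    exact ⟨e2 ▸ ENNReal.toReal_nonneg, by rw [← e2, ENNReal.ofReal_toReal hfin]⟩
  · have h1 : ∀ A ∈ Set.Icc (1 - b) a, A ≠ 0 := fun A hA =>
      (show 0 < A by linarith [hA.1]).ne'
    have h2 : ∀ A ∈ Set.Icc (1 - b) a, A + b ≠ 0 := fun A hA =>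
      (show 0 < A + b by linarith [hA.1]).ne'
    fun_prop (disch := assumption)
  · intro A hA
    have h1 : A ≠ 0 := (show 0 < A by linarith [hA.1]).ne'
    have h2 : A + b ≠ 0 := (show 0 < A + b by linarith [hA.1]).ne'
    have := (((hasDerivAt_id A).add ((Real.hasDerivAt_log h1).const_mul ((1 - b) ^ 2 / b))).sub
      ((((hasDerivAt_id A).add_const b).log h2).const_mul (1 / b))).const_mul (1 / b)
    refine this.congr_deriv ?_
    simp only [id]
    field_simp
    ring
  · intro A hA
    have : 0 < A := by linarith [hA.1]
    positivity

/-- The marginal for `2 ≤ a` and `b < 1`. -/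
noncomputable def marginalF (a b : ℝ) : ℝ :=
  (1 - b) ^ 2 / b ^ 2 * (2 * Real.log (a - b) - Real.log a - Real.log (a - 2 * b))

/-- The function `-marginalF` is an antiderivative of the joint density in the first variable.
Written in `log (1 - b / A)` and `log (1 - 2 b / A)`, it visibly vanishes at infinity. -/
lemma marginal_of_two_le {a b : ℝ} (hb : 0 < b) (hb1 : b < 1) (ha : 2 ≤ a) :
    0 ≤ marginalF a b ∧ marginal a b = ENNReal.ofReal (marginalF a b) := by
  have e : marginal a b = ∫⁻ A in Set.Ioi a,
      ENNReal.ofReal (2 * (1 - b) ^ 2 / (A * (A - b) * (A - 2 * b))) :=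
    setLIntegral_congr_fun measurableSet_Ioi fun A hA => by
      rw [Set.mem_Ioi] at hA
      exact jointDensity_of_two_le hb hb1 (by linarith)
  have hlim : Tendsto (fun A => -marginalF A b) atTop (𝓝 0) := by
    have h1 : Tendsto (fun A : ℝ => b / A) atTop (𝓝 0) := tendsto_const_nhds.div_atTop tendsto_id
    have h2 : Tendsto (fun A : ℝ => 2 * Real.log (1 - b / A) - Real.log (1 - 2 * (b / A))) atTop
        (𝓝 (2 * Real.log (1 - 0) - Real.log (1 - 2 * 0))) :=
      (((h1.const_sub 1).log (by norm_num)).const_mul 2).sub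
        (((h1.const_mul 2).const_sub 1).log (by norm_num))
    have h3 := (h2.const_mul ((1 - b) ^ 2 / b ^ 2)).neg
    simp only [sub_zero, mul_zero, Real.log_one, neg_zero] at h3
    refine h3.congr' ?_
    filter_upwards [eventually_ge_atTop 2] with A hA
    have p0 : A ≠ 0 := (show 0 < A by linarith).ne'
    have p1 : A - b ≠ 0 := (show 0 < A - b by linarith).ne'
    have p2 : A - 2 * b ≠ 0 := (show 0 < A - 2 * b by linarith).ne'
    rw [marginalF, show 1 - b / A = (A - b) / A by field_simp,
      show 1 - 2 * (b / A) = (A - 2 * b) / A by field_simp, Real.log_div p1 p0, Real.log_div p2 p0]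
    ring
  have hd : ∀ A ∈ Set.Ici a, HasDerivAt (fun A => -marginalF A b)
      (2 * (1 - b) ^ 2 / (A * (A - b) * (A - 2 * b))) A := by
    intro A hA
    rw [Set.mem_Ici] at hA
    have p0 : A ≠ 0 := (show 0 < A by linarith).ne'
    have p1 : A - b ≠ 0 := (show 0 < A - b by linarith).ne'
    have p2 : A - 2 * b ≠ 0 := (show 0 < A - 2 * b by linarith).ne'
    have p2' : A - b * 2 ≠ 0 := (show 0 < A - b * 2 by linarith).ne'
    have := (((((((hasDerivAt_id A).sub_const b).log p1).const_mul 2).sub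
      (Real.hasDerivAt_log p0)).sub (((hasDerivAt_id A).sub_const (2 * b)).log p2)).const_mul
        ((1 - b) ^ 2 / b ^ 2)).neg
    refine this.congr_deriv ?_
    simp only [id]
    field_simp
    ring
  have hpos : ∀ A ∈ Set.Ioi a, 0 ≤ 2 * (1 - b) ^ 2 / (A * (A - b) * (A - 2 * b)) := by
    intro A hA
    rw [Set.mem_Ioi] at hA
    have p0 : 0 < A := by linarith
    have p1 : 0 < A - b := by linarith
    have p2 : 0 < A - 2 * b := by linarith
    positivity
  have hi := integral_Ioi_of_hasDerivAt_of_nonneg' hd hpos hlim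
  have hint := integrableOn_Ioi_deriv_of_nonneg' hd hpos hlim
  have h0 : 0 ≤ᵐ[volume.restrict (Set.Ioi a)]
      fun A => 2 * (1 - b) ^ 2 / (A * (A - b) * (A - 2 * b)) := by
    filter_upwards [ae_restrict_mem measurableSet_Ioi] with A hA using hpos A hA
  rw [zero_sub, neg_neg] at hi
  rw [e, ← ofReal_integral_eq_lintegral_ofReal hint h0, hi]
  exact ⟨hi ▸ integral_nonneg_of_ae h0, rfl⟩

/-- An antiderivative in `a` of the joint density for `a ≤ 2 ≤ a + b`. -/
noncomputable def marginalPrimitive (a b : ℝ) : ℝ :=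
  1 / 2 * Real.log a - 1 / (2 * b) * (a - (2 - b) ^ 2 / b * Real.log a
    + 4 * (1 - b) ^ 2 / b * Real.log (a - b))

/-- The marginal for `a ≤ 2 ≤ a + b` and `b < 1`. -/
noncomputable def marginalD (a b : ℝ) : ℝ :=
  marginalF 2 b + (marginalPrimitive 2 b - marginalPrimitive a b)

lemma marginal_of_two_le_add {a b : ℝ} (hb : 0 < b) (hb1 : b < 1) (ha : a ≤ 2) (hab : 2 ≤ a + b) :
    0 ≤ marginalD a b ∧ marginal a b = ENNReal.ofReal (marginalD a b) := by
  obtain ⟨h1, h2⟩ := marginal_of_two_le hb hb1 le_rfl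
  have e : ∫⁻ A in Set.Ioo a 2, jointDensity A b = ∫⁻ A in Set.Ioo a 2,
      ENNReal.ofReal (1 / (2 * A) - (A + b - 2) ^ 2 / (2 * A * b * (A - b))) :=
    setLIntegral_congr_fun measurableSet_Ioo fun A hA =>
      jointDensity_of_two_le_add hb hb1 hA.2 (by linarith [hA.1])
  have hF := lintegral_deriv_eq_sub
    (f := fun A => 1 / (2 * A) - (A + b - 2) ^ 2 / (2 * A * b * (A - b)))
    (F := fun A => marginalPrimitive A b) ha ?_ ?_ ?_
  · rw [marginal_eq_add ha, h2, e, hF.2, ← ENNReal.ofReal_add h1 (by linarith [hF.1])]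
    exact ⟨add_nonneg h1 (by linarith [hF.1]), rfl⟩
  · have h1 : ∀ A ∈ Set.Icc a 2, A ≠ 0 := fun A hA => (show 0 < A by linarith [hA.1]).ne'
    have h2 : ∀ A ∈ Set.Icc a 2, A - b ≠ 0 := fun A hA =>
      (show 0 < A - b by linarith [hA.1]).ne'
    unfold marginalPrimitive
    fun_prop (disch := assumption)
  · intro A hA
    have h1 : A ≠ 0 := (show 0 < A by linarith [hA.1]).ne'
    have h2 : A - b ≠ 0 := (show 0 < A - b by linarith [hA.1]).ne'
    have := ((Real.hasDerivAt_log h1).const_mul (1 / 2)).sub ((((hasDerivAt_id A).sub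
      ((Real.hasDerivAt_log h1).const_mul ((2 - b) ^ 2 / b))).add
      ((((hasDerivAt_id A).sub_const b).log h2).const_mul (4 * (1 - b) ^ 2 / b))).const_mul
        (1 / (2 * b)))
    refine this.congr_deriv ?_
    simp only [id]
    field_simp
    ring
  · intro A hA
    have p0 : 0 < A := by linarith [hA.1]
    have p1 : 0 < A - b := by linarith [hA.1]
    rw [sub_nonneg, div_le_div_iff₀ (by positivity) (by positivity)]
    -- The nonnegative number `A + b - 2` is at most `b` and at most `A - b`.
    have : (A + b - 2) ^ 2 ≤ b * (A - b) := by nlinarith [hA.1, hA.2]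
    nlinarith

/-- The marginal for `1 ≤ a ≤ 2` and `1 < b`. -/
noncomputable def marginalE (a b : ℝ) : ℝ :=
  1 / (2 * b) * (-(2 - a) + 2 / b * (Real.log 2 - Real.log a)
    - 2 * (1 - b) ^ 2 / b * (Real.log (2 * b - 2) - Real.log (2 * b - a)))

/-- The joint density vanishes beyond length 2, so only the integral from `a` to 2 remains. -/
lemma marginal_of_one_lt {a b : ℝ} (hb : 1 < b) (ha1 : 1 ≤ a) (ha : a ≤ 2) :
    0 ≤ marginalE a b ∧ marginal a b = ENNReal.ofReal (marginalE a b) := by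
  have h2 : marginal 2 b = 0 := by
    rw [marginal, ← lintegral_zero]
    exact setLIntegral_congr_fun measurableSet_Ioi fun A hA =>
      jointDensity_eq_zero (le_of_lt hA) hb.le
  have e : ∫⁻ A in Set.Ioo a 2, jointDensity A b = ∫⁻ A in Set.Ioo a 2,
      ENNReal.ofReal ((2 - A) ^ 2 / (2 * A * b * (2 * b - A))) :=
    setLIntegral_congr_fun measurableSet_Ioo fun A hA =>
      jointDensity_of_one_lt hb (by linarith [hA.1]) hA.2
  have hb0 : 0 < b := by linarith
  have hF := lintegral_deriv_eq_sub
    (f := fun A => (2 - A) ^ 2 / (2 * A * b * (2 * b - A)))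
    (F := fun A => 1 / (2 * b) * (-A + 2 / b * Real.log A
      - 2 * (1 - b) ^ 2 / b * Real.log (2 * b - A))) ha ?_ ?_ ?_
  · have e2 : marginalE a b = 1 / (2 * b) * (-2 + 2 / b * Real.log 2
      - 2 * (1 - b) ^ 2 / b * Real.log (2 * b - 2)) - 1 / (2 * b) * (-a + 2 / b * Real.log a
      - 2 * (1 - b) ^ 2 / b * Real.log (2 * b - a)) := by rw [marginalE]; ring
    rw [marginal_eq_add ha, h2, e, hF.2, zero_add, e2]
    exact ⟨by linarith [hF.1], rfl⟩
  · have h1 : ∀ A ∈ Set.Icc a 2, A ≠ 0 := fun A hA => (show 0 < A by linarith [hA.1]).ne'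
    have h2 : ∀ A ∈ Set.Icc a 2, 2 * b - A ≠ 0 := fun A hA =>
      (show 0 < 2 * b - A by linarith [hA.2]).ne'
    fun_prop (disch := assumption)
  · intro A hA
    have h1 : A ≠ 0 := (show 0 < A by linarith [hA.1]).ne'
    have h2 : 2 * b - A ≠ 0 := (show 0 < 2 * b - A by linarith [hA.2]).ne'
    have h2' : b * 2 - A ≠ 0 := (show 0 < b * 2 - A by linarith [hA.2]).ne'
    have := (((hasDerivAt_id A).neg.add ((Real.hasDerivAt_log h1).const_mul (2 / b))).sub
      ((((hasDerivAt_id A).const_sub (2 * b)).log h2).const_mul (2 * (1 - b) ^ 2 / b))).const_mul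
        (1 / (2 * b))
    refine this.congr_deriv ?_
    simp only [id]
    field_simp
    ring
  · intro A hA
    have p0 : 0 < A := by linarith [hA.1]
    have p1 : 0 < 2 * b - A := by linarith [hA.2]
    positivity

end GapDistribution

/-! ### The dilogarithm: derivative, reflection formula, special values. -/

namespace GapDistribution

open MeasureTheory

lemma summable_li₂_bound : Summable fun n : ℕ => 1 / ((n : ℝ) + 1) ^ 2 := by
  have := (summable_nat_add_iff 1).2 (Real.summable_one_div_nat_pow.2 one_lt_two)
  simpa using this

lemma continuousOn_li₂ : ContinuousOn Li₂ (Set.Icc (-1) 1) := by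
  unfold Li₂
  refine continuousOn_tsum (fun n => by fun_prop) summable_li₂_bound fun n x hx => ?_
  rw [Real.norm_eq_abs, abs_div, abs_pow, abs_of_pos (show (0 : ℝ) < ((n : ℝ) + 1) ^ 2 by positivity)]
  gcongr
  exact pow_le_one₀ (abs_nonneg _) (abs_le.2 hx)

lemma li₂_zero : Li₂ 0 = 0 := by
  unfold Li₂; simp

lemma li₂_one : Li₂ 1 = Real.pi ^ 2 / 6 := by
  have h := (hasSum_nat_add_iff' 1).2 hasSum_zeta_two
  unfold Li₂
  refine HasSum.tsum_eq ?_
  simpa using h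

/-- Termwise differentiation in a disc of radius `r < 1` containing `z`; the result is the
logarithmic series. -/
lemma hasDerivAt_li₂ {z : ℝ} (h0 : z ≠ 0) (h1 : |z| < 1) :
    HasDerivAt Li₂ (-Real.log (1 - z) / z) z := by
  obtain ⟨r, hr, hr1⟩ := exists_between h1
  have hr0 : 0 < r := (abs_nonneg z).trans_lt hr
  have hsum : Summable fun n : ℕ => r ^ n := summable_geometric_of_lt_one hr0.le hr1
  have key := hasDerivAt_tsum_of_isPreconnected (𝕜 := ℝ)
    (g := fun (n : ℕ) (y : ℝ) => y ^ (n + 1) / ((n : ℝ) + 1) ^ 2)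
    (g' := fun (n : ℕ) (y : ℝ) => y ^ n / ((n : ℝ) + 1)) (t := Metric.ball 0 r) (y₀ := 0) (y := z)
    hsum Metric.isOpen_ball (convex_ball 0 r).isPreconnected (fun n y _ => ?_) (fun n y hy => ?_)
    (Metric.mem_ball_self hr0) ?_ (by simpa using hr)
  · have e : ∑' n : ℕ, z ^ n / ((n : ℝ) + 1) = -Real.log (1 - z) / z := by
      rw [eq_div_iff h0, ← tsum_mul_right, ← (Real.hasSum_pow_div_log_of_abs_lt_one h1).tsum_eq]
      exact tsum_congr fun n => by ring
    rw [← e]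
    exact key
  · have := (hasDerivAt_pow (n + 1) y).div_const (((n : ℝ) + 1) ^ 2)
    refine this.congr_deriv ?_
    have : (n : ℝ) + 1 ≠ 0 := by positivity
    push_cast
    field_simp
  · have hy' : |y| ≤ r := by simpa using (Metric.mem_ball.1 hy).le
    rw [Real.norm_eq_abs, abs_div, abs_pow, abs_of_pos (show (0 : ℝ) < (n : ℝ) + 1 by positivity)]
    calc |y| ^ n / ((n : ℝ) + 1) ≤ |y| ^ n / 1 :=
          div_le_div_of_nonneg_left (by positivity) one_pos (by linarith [n.cast_nonneg (α := ℝ)])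
      _ ≤ r ^ n := by rw [div_one]; exact pow_le_pow_left₀ (abs_nonneg _) hy' n
  · simp

lemma hasDerivAt_li₂_comp {u : ℝ → ℝ} {u' x : ℝ} (hu : HasDerivAt u u' x) (h0 : 0 < u x)
    (h1 : u x < 1) : HasDerivAt (fun y => Li₂ (u y)) (-Real.log (1 - u x) * (u' / u x)) x := by
  have := (hasDerivAt_li₂ h0.ne' (abs_lt.2 ⟨by linarith, h1⟩)).comp x hu
  refine this.congr_deriv ?_
  ring

lemma continuousOn_li₂_comp {u : ℝ → ℝ} {s : Set ℝ} (hu : ContinuousOn u s)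
    (h0 : ∀ x ∈ s, 0 ≤ u x) (h1 : ∀ x ∈ s, u x ≤ 1) : ContinuousOn (fun y => Li₂ (u y)) s :=
  continuousOn_li₂.comp hu fun x hx => ⟨by linarith [h0 x hx], h1 x hx⟩

/-- Near 0 one has `|log (1 - x)| ≤ 2 x`, and `x log x` tends to 0. -/
lemma tendsto_log_mul_log_one_sub :
    Tendsto (fun x : ℝ => Real.log x * Real.log (1 - x)) (𝓝[>] 0) (𝓝 0) := by
  have h1 : Tendsto (fun x : ℝ => Real.log x * x) (𝓝[>] 0) (𝓝 0) := by
    simpa using tendsto_log_mul_rpow_nhdsGT_zero one_pos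
  have h2 := (h1.const_mul 2).abs
  rw [mul_zero, abs_zero] at h2
  refine squeeze_zero_norm' ?_ h2
  filter_upwards [Ioo_mem_nhdsGT (show (0 : ℝ) < 1 / 2 by norm_num)] with x hx
  rw [Real.norm_eq_abs, abs_mul, abs_mul, abs_mul, abs_of_pos (show (0 : ℝ) < 2 by norm_num),
    abs_of_pos hx.1]
  have hl : |Real.log (1 - x)| ≤ 2 * x := by
    have h3 : Real.log (1 - x) ≤ 0 := Real.log_nonpos (by linarith [hx.2]) (by linarith [hx.1])
    have h4 := Real.one_sub_inv_le_log_of_pos (show 0 < 1 - x by linarith [hx.2])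
    rw [abs_of_nonpos h3]
    have h5 : (1 - x)⁻¹ ≤ 1 + 2 * x := by
      rw [inv_le_iff_one_le_mul₀ (by linarith [hx.2])]
      nlinarith [hx.1, hx.2]
    linarith
  calc _ ≤ |Real.log x| * (2 * x) := mul_le_mul_of_nonneg_left hl (abs_nonneg _)
    _ = _ := by ring

/-- The difference of the two sides has derivative 0 on `(0, 1)`, and the constant is read off as
`x` tends to 0. -/
lemma li₂_add_li₂_one_sub {x : ℝ} (h0 : 0 < x) (h1 : x < 1) :
    Li₂ x + Li₂ (1 - x) = Real.pi ^ 2 / 6 - Real.log x * Real.log (1 - x) := by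
  set g : ℝ → ℝ := fun x => Li₂ x + Li₂ (1 - x) + Real.log x * Real.log (1 - x) with hg
  have hd : ∀ y ∈ Set.Ioo (0 : ℝ) 1, HasDerivAt g 0 y := by
    intro y hy
    have p0 : y ≠ 0 := hy.1.ne'
    have p1 : 1 - y ≠ 0 := (sub_pos.2 hy.2).ne'
    have d1 := hasDerivAt_li₂_comp (hasDerivAt_id y) hy.1 hy.2
    have d0 : HasDerivAt (fun y : ℝ => 1 - y) (-1) y := by
      simpa using (hasDerivAt_id y).const_sub 1
    have d2 := hasDerivAt_li₂_comp d0 (sub_pos.2 hy.2) (by linarith [hy.1])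
    refine ((d1.add d2).add ((Real.hasDerivAt_log p0).mul (d0.log p1))).congr_deriv ?_
    simp only [id, sub_sub_cancel]
    field_simp
    ring
  have hconst : ∀ y ∈ Set.Ioo (0 : ℝ) 1, g y = g x := fun y hy =>
    isOpen_Ioo.is_const_of_deriv_eq_zero isPreconnected_Ioo
      (fun z hz => (hd z hz).differentiableAt.differentiableWithinAt)
      (fun z hz => (hd z hz).deriv) hy ⟨h0, h1⟩
  have hI : Set.Ioo (0 : ℝ) 1 ∈ 𝓝[>] (0 : ℝ) := Ioo_mem_nhdsGT one_pos
  have hle : 𝓝[>] (0 : ℝ) ≤ 𝓝[Set.Icc 0 1] 0 := by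
    rw [← nhdsWithin_Ioo_eq_nhdsGT (zero_lt_one (α := ℝ))]
    exact nhdsWithin_mono _ Set.Ioo_subset_Icc_self
  have c1 : ContinuousOn (fun y : ℝ => Li₂ y) (Set.Icc 0 1) :=
    continuousOn_li₂_comp continuousOn_id (fun y hy => hy.1) fun y hy => hy.2
  have c2 : ContinuousOn (fun y : ℝ => Li₂ (1 - y)) (Set.Icc 0 1) :=
    continuousOn_li₂_comp (by fun_prop) (fun y hy => sub_nonneg.2 hy.2)
      fun y hy => by linarith [hy.1]
  have t1 := ((c1.add c2) 0 (by simp)).mono_left hle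
  have t2 := t1.add tendsto_log_mul_log_one_sub
  rw [show ((fun y : ℝ => Li₂ y) + fun y => Li₂ (1 - y)) 0 = Real.pi ^ 2 / 6 by
    simp [li₂_zero, li₂_one], add_zero] at t2
  have t3 : Tendsto g (𝓝[>] 0) (𝓝 (g x)) :=
    tendsto_const_nhds.congr' (by filter_upwards [hI] with y hy using (hconst y hy).symm)
  have := tendsto_nhds_unique t3 t2
  rw [hg] at this
  linarith [this]

lemma li₂_one_half : Li₂ (1 / 2) = Real.pi ^ 2 / 12 - Real.log 2 ^ 2 / 2 := by
  have h := li₂_add_li₂_one_sub (x := 1 / 2) (by norm_num) (by norm_num)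
  rw [show (1 : ℝ) - 1 / 2 = 1 / 2 by norm_num, one_div, Real.log_inv] at h
  rw [one_div]
  linarith

end GapDistribution

/-! ### From the densities to the limit value; region A. -/

namespace GapDistribution

open MeasureTheory

/-- The limiting number of pairs, normalised so that its value at `(0, 0)` is `π² / 6`. -/
noncomputable def limitValue (a b : ℝ) : ℝ := (limitIntegral a b).toReal

lemma limitIntegral_eq_add_marginal {a p q : ℝ} (h0 : 0 ≤ p) (hpq : p ≤ q) (hq : q ≤ a) :
    limitIntegral a p = limitIntegral a q + ∫⁻ s in Set.Ioo p q, marginal a s := by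
  have h1 := limitIntegral_zero_eq (hpq.trans hq)
  have h2 := limitIntegral_zero_eq hq
  rw [h1, lintegral_Ioo_add h0 hpq (fun s => marginal a s), add_comm (∫⁻ s in Set.Ioo 0 p, marginal a s), ← add_assoc] at h2
  refine (ENNReal.add_left_inj ?_).1 h2
  intro h
  rw [h, add_top] at h1
  exact limitIntegral_ne_top _ _ h1

/-- The device for regions A, B, D, E and F: at fixed `a`, a function of the second threshold with
derivative minus the marginal differs from the limit value by a constant. -/
lemma limitValue_sub_eq_of_hasDerivAt {a p q : ℝ} {F κ : ℝ → ℝ} (h0 : 0 ≤ p) (hpq : p ≤ q)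
    (hq : q ≤ a) (hm : ∀ s ∈ Set.Ioo p q, 0 ≤ κ s ∧ marginal a s = ENNReal.ofReal (κ s))
    (hc : ContinuousOn F (Set.Icc p q)) (hd : ∀ s ∈ Set.Ioo p q, HasDerivAt F (-κ s) s) :
    limitValue a p - F p = limitValue a q - F q := by
  have h := limitIntegral_eq_add_marginal h0 hpq hq
  rw [setLIntegral_congr_fun measurableSet_Ioo fun s hs => (hm s hs).2] at h
  obtain ⟨h1, h2⟩ := lintegral_deriv_eq_sub (F := fun s => -F s) hpq hc.neg
    (fun s hs => (hd s hs).neg.congr_deriv (neg_neg _)) fun s hs => (hm s hs).1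
  rw [h2] at h
  have h' := congrArg ENNReal.toReal h
  rw [ENNReal.toReal_add (limitIntegral_ne_top _ _) ENNReal.ofReal_ne_top,
    ENNReal.toReal_ofReal (by linarith)] at h'
  unfold limitValue
  linarith

lemma limitValue_of_add_le_one {a b : ℝ} (hb : 0 ≤ b) (hba : b ≤ a) (hab : a + b ≤ 1) :
    limitValue a b = formulaA a b := by
  have h := limitValue_sub_eq_of_hasDerivAt (a := a) (F := fun s => -(s / 2)) (κ := fun _ => 1 / 2)
    le_rfl hb hba (fun s hs => ⟨by norm_num, marginal_of_add_le_one (hb.trans hba) hs.1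
      (by linarith [hs.2])⟩) (by fun_prop)
    fun s _ => (((hasDerivAt_id s).div_const 2).neg).congr_deriv (by norm_num)
  have h0 : limitValue a 0 = Real.pi ^ 2 / 6 - a := by
    rw [limitValue, limitIntegral_zero_of_le_one (by linarith) (by linarith),
      ENNReal.toReal_ofReal]
    nlinarith [Real.pi_gt_three]
  rw [formulaA]
  linarith

lemma limitValue_anti {a a' b : ℝ} (h : a ≤ a') : limitValue a' b ≤ limitValue a b := by
  have key := le_of_tendsto_of_tendsto' (tendsto_pairAverage a' b 0 one_pos)
    (tendsto_pairAverage a b 0 one_pos) fun Q => ?_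
  · exact le_of_mul_le_mul_left key (by positivity)
  · unfold pairAverage
    rw [zero_add]
    refine mul_le_mul_of_nonneg_left (intervalIntegral.integral_mono_on zero_le_one
      (intervalIntegrable_pairCount Q a' b) (intervalIntegrable_pairCount Q a b) fun α _ => ?_)
      (by norm_num)
    refine div_le_div_of_nonneg_right (Nat.cast_le.2 (Finset.card_le_card fun i hi => ?_))
      (Nat.cast_nonneg _)
    rw [Finset.mem_filter] at hi ⊢
    exact ⟨hi.1, (div_le_div_of_nonneg_right h (Nat.cast_nonneg _)).trans hi.2.1, hi.2.2⟩

/-- Lowering the first threshold from 1 to `a` adds at most the pairs with first gap in `[a, 1)`,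
where the gap density is 1. Together with monotonicity this gives left continuity at `a = 1`. -/
lemma limitValue_le_add {a b : ℝ} (ha : 0 < a) (ha1 : a ≤ 1) (hba : b ≤ a) :
    limitValue a b ≤ limitValue 1 b + (1 - a) := by
  have h1 := limitIntegral_zero_eq hba
  have h2 := limitIntegral_zero_eq (hba.trans ha1)
  have h3 := limitIntegral_eq_add_gapDensity ha1
  have e : ∫⁻ A in Set.Ico a 1, gapDensity A = ENNReal.ofReal (1 - a) := by
    rw [setLIntegral_congr_fun measurableSet_Ico (g := fun _ => 1)
      fun A hA => gapDensity_of_lt_one (ha.trans_le hA.1) hA.2, setLIntegral_one, Real.volume_Ico]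
  have hm : ∫⁻ s in Set.Ioo 0 b, marginal 1 s ≤ ∫⁻ s in Set.Ioo 0 b, marginal a s :=
    lintegral_mono fun s => by rw [marginal_eq_add ha1]; exact le_self_add
  rw [h1, h2, e] at h3
  have hfin : ∫⁻ s in Set.Ioo 0 b, marginal 1 s ≠ ⊤ := by
    intro h; rw [h, add_top] at h2; exact limitIntegral_ne_top _ _ h2
  have h4 : limitIntegral a b ≤ limitIntegral 1 b + ENNReal.ofReal (1 - a) := by
    refine (ENNReal.add_le_add_iff_right hfin).1 ?_
    calc _ ≤ limitIntegral a b + ∫⁻ s in Set.Ioo 0 b, marginal a s := by gcongr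
      _ = _ := by rw [h3]; ring
  have h5 := ENNReal.toReal_mono (ENNReal.add_ne_top.2
    ⟨limitIntegral_ne_top _ _, ENNReal.ofReal_ne_top⟩) h4
  rwa [ENNReal.toReal_add (limitIntegral_ne_top _ _) ENNReal.ofReal_ne_top,
    ENNReal.toReal_ofReal (by linarith)] at h5

lemma tendsto_limitValue_one {b : ℝ} (hb1 : b < 1) :
    Tendsto (fun a => limitValue a b) (𝓝[<] 1) (𝓝 (limitValue 1 b)) := by
  have h1 : Tendsto (fun a : ℝ => limitValue 1 b + (1 - a)) (𝓝[<] 1) (𝓝 (limitValue 1 b)) := by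
    have : Tendsto (fun a : ℝ => limitValue 1 b + (1 - a)) (𝓝 1) (𝓝 (limitValue 1 b + (1 - 1))) :=
      Continuous.tendsto (by fun_prop) 1
    rw [sub_self, add_zero] at this
    exact this.mono_left nhdsWithin_le_nhds
  refine tendsto_of_tendsto_of_tendsto_of_le_of_le' tendsto_const_nhds h1 ?_ ?_
  · filter_upwards [self_mem_nhdsWithin] with a ha using limitValue_anti (le_of_lt ha)
  · filter_upwards [self_mem_nhdsWithin, Ioo_mem_nhdsLT (max_lt hb1 one_pos)] with a ha hm
    exact limitValue_le_add ((le_max_right _ _).trans_lt hm.1) (le_of_lt ha)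
      ((le_max_left _ _).trans hm.1.le)

/-- The integral over `β ∈ (0, b)` of the joint density at `(a, β)`, for `1 ≤ a`, `a + b ≤ 2`. -/
noncomputable def tailDensity (a b : ℝ) : ℝ :=
  1 / a ^ 2 * (a * b - Real.log ((a + b) / a) + (a - 1) ^ 2 * Real.log ((a - b) / a))

lemma lintegral_jointDensity {a b : ℝ} (hb : 0 < b) (hb1 : b < 1) (ha : 1 ≤ a) (hab : a + b ≤ 2) :
    0 ≤ tailDensity a b ∧ ∫⁻ s in Set.Ioo 0 b, ENNReal.ofReal
      ((a + s - 1) ^ 2 / (a * s * (a + s)) - (a - 1) ^ 2 / (a * s * (a - s)))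
      = ENNReal.ofReal (tailDensity a b) := by
  have a0 : a ≠ 0 := by positivity
  -- The logarithms are normalised by `a` so that the primitive starts at 0.
  have h0 : tailDensity a 0 = 0 := by simp [tailDensity, a0]
  have hF := lintegral_deriv_eq_sub
    (f := fun s => (a + s - 1) ^ 2 / (a * s * (a + s)) - (a - 1) ^ 2 / (a * s * (a - s)))
    (F := fun s => tailDensity a s) hb.le ?_ ?_ ?_
  · simpa [h0] using hF
  · have h1 : ∀ s ∈ Set.Icc 0 b, (a + s) / a ≠ 0 := fun s hs =>
      div_ne_zero (show 0 < a + s by linarith [hs.1]).ne' a0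
    have h2 : ∀ s ∈ Set.Icc 0 b, (a - s) / a ≠ 0 := fun s hs =>
      div_ne_zero (show 0 < a - s by linarith [hs.2]).ne' a0
    unfold tailDensity
    fun_prop (disch := assumption)
  · intro s hs
    have s0 : s ≠ 0 := hs.1.ne'
    have p1 : a + s ≠ 0 := (show 0 < a + s by linarith [hs.1]).ne'
    have p2 : a - s ≠ 0 := (show 0 < a - s by linarith [hs.2]).ne'
    have d1 := (((hasDerivAt_id s).const_add a).div_const a).log (div_ne_zero p1 a0)
    have d2 := (((hasDerivAt_id s).const_sub a).div_const a).log (div_ne_zero p2 a0)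
    have := ((((hasDerivAt_id s).const_mul a).sub d1).add (d2.const_mul ((a - 1) ^ 2))).const_mul
      (1 / a ^ 2)
    refine this.congr_deriv ?_
    simp only [id]
    field_simp
    ring
  · intro s hs
    have p0 : 0 < a + s := by linarith [hs.1]
    have p2 : 0 < a - s := by linarith [hs.2]
    have s0 : 0 < s := hs.1
    -- Over a common denominator the poles at `s = 0` cancel and the sign becomes visible.
    have e : (a + s - 1) ^ 2 / (a * s * (a + s)) - (a - 1) ^ 2 / (a * s * (a - s))
        = ((a - 1) * (2 - s) + s * (1 - s)) / (a * (a + s) * (a - s)) := by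
      field_simp
      ring
    rw [e]
    have q1 := mul_nonneg (sub_nonneg.2 ha) (show 0 ≤ 2 - s by linarith [hs.2])
    have q2 := mul_nonneg s0.le (show 0 ≤ 1 - s by linarith [hs.2])
    have : 0 < a := by linarith
    positivity

/-- `limitIntegral_zero_eq` is compared at the first thresholds 1 and `a`. The limits at `(1, 0)`
and `(a, 0)` differ by the integral of the single gap density, and the marginals by that of the
joint density, whose integral over the second length is `tailDensity`. Everything stays additive
because the values lie in `ENNReal`. -/
lemma limitIntegral_add_gapDensity {a b : ℝ} (hb : 0 < b) (hb1 : b < 1) (ha : 1 ≤ a)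
    (hab : a + b ≤ 2) :
    limitIntegral a b + ∫⁻ A in Set.Ioo 1 a, ENNReal.ofReal (gapDensityFormula A)
      = limitIntegral 1 b + ∫⁻ A in Set.Ioo 1 a, ENNReal.ofReal (tailDensity A b) := by
  have h1 := limitIntegral_zero_eq (a := 1) hb1.le
  have h2 := limitIntegral_zero_eq (a := a) (hb1.le.trans ha)
  have h3 := limitIntegral_eq_add_gapDensity ha
  have e1 : ∫⁻ A in Set.Ico 1 a, gapDensity A
      = ∫⁻ A in Set.Ioo 1 a, ENNReal.ofReal (gapDensityFormula A) := by
    rw [← setLIntegral_congr Ioo_ae_eq_Ico]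
    exact setLIntegral_congr_fun measurableSet_Ioo fun A hA =>
      (gapDensity_eq_formula hA.1 (by linarith [hA.2])).2
  have e2 : ∫⁻ s in Set.Ioo 0 b, marginal 1 s = (∫⁻ s in Set.Ioo 0 b, marginal a s)
      + ∫⁻ A in Set.Ioo 1 a, ENNReal.ofReal (tailDensity A b) := by
    have e3 : ∫⁻ s in Set.Ioo 0 b, marginal 1 s = ∫⁻ s in Set.Ioo 0 b, (marginal a s
        + ∫⁻ A in Set.Ioo 1 a, ENNReal.ofReal
          ((A + s - 1) ^ 2 / (A * s * (A + s)) - (A - 1) ^ 2 / (A * s * (A - s)))) := by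
      refine setLIntegral_congr_fun measurableSet_Ioo fun s hs => ?_
      rw [marginal_eq_add ha]
      congr 1
      exact setLIntegral_congr_fun measurableSet_Ioo fun A hA =>
        jointDensity_of_add_le_two hs.1 (hs.2.trans hb1) hA.1.le (by linarith [hA.2, hs.2])
    have m : Measurable fun s : ℝ => ∫⁻ A in Set.Ioo 1 a, ENNReal.ofReal
        ((A + s - 1) ^ 2 / (A * s * (A + s)) - (A - 1) ^ 2 / (A * s * (A - s))) :=
      Measurable.lintegral_prod_right' (f := fun z : ℝ × ℝ => ENNReal.ofReal
        ((z.2 + z.1 - 1) ^ 2 / (z.2 * z.1 * (z.2 + z.1))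
          - (z.2 - 1) ^ 2 / (z.2 * z.1 * (z.2 - z.1)))) (by fun_prop)
    rw [e3, lintegral_add_right _ m,
      lintegral_lintegral_swap (f := fun s A => ENNReal.ofReal
        ((A + s - 1) ^ 2 / (A * s * (A + s)) - (A - 1) ^ 2 / (A * s * (A - s))))
        (Measurable.aemeasurable (by unfold Function.uncurry; fun_prop))]
    congr 1
    exact setLIntegral_congr_fun measurableSet_Ioo fun A hA =>
      (lintegral_jointDensity hb hb1 hA.1.le (by linarith [hA.2])).2
  rw [h1, h2, e1, e2, add_comm (∫⁻ s in Set.Ioo 0 b, marginal a s), ← add_assoc,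
    add_right_comm (limitIntegral a b)] at h3
  refine ((ENNReal.add_left_inj ?_).1 h3).symm
  intro h
  rw [h, add_top] at h2
  exact limitIntegral_ne_top _ _ h2

/-- The derivative in the first threshold is a difference of two nonnegative densities; each is
integrable because its lower integral is finite. This route into region C needs no closed form of
the marginal there. -/
lemma limitValue_sub_eq_of_hasDerivAt_left {a b : ℝ} {F : ℝ → ℝ} (hb : 0 < b) (hb1 : b < 1)
    (ha : 1 ≤ a) (hab : a + b ≤ 2) (hc : ContinuousOn F (Set.Icc 1 a))
    (hd : ∀ A ∈ Set.Ioo 1 a, HasDerivAt F (tailDensity A b - gapDensityFormula A) A) :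
    limitValue a b - F a = limitValue 1 b - F 1 := by
  have key := limitIntegral_add_gapDensity hb hb1 ha hab
  have m1 : Measurable fun A => gapDensityFormula A := by unfold gapDensityFormula; fun_prop
  have m2 : Measurable fun A => tailDensity A b := by unfold tailDensity; fun_prop
  have f1 : ∫⁻ A in Set.Ioo 1 a, ENNReal.ofReal (gapDensityFormula A) ≠ ⊤ := by
    have h3 := limitIntegral_eq_add_gapDensity ha
    rw [← setLIntegral_congr Ioo_ae_eq_Ico, setLIntegral_congr_fun measurableSet_Ioo fun A hA =>
      (gapDensity_eq_formula hA.1 (by linarith [hA.2])).2] at h3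
    intro h
    rw [h, add_top] at h3
    exact limitIntegral_ne_top _ _ h3
  have f2 : ∫⁻ A in Set.Ioo 1 a, ENNReal.ofReal (tailDensity A b) ≠ ⊤ := by
    intro h
    rw [h, add_top] at key
    exact ENNReal.add_ne_top.2 ⟨limitIntegral_ne_top _ _, f1⟩ key
  have n1 : ∀ᵐ A ∂volume.restrict (Set.Ioo 1 a), 0 ≤ gapDensityFormula A := by
    filter_upwards [ae_restrict_mem measurableSet_Ioo] with A hA
    exact (gapDensity_eq_formula hA.1 (by linarith [hA.2])).1
  have n2 : ∀ᵐ A ∂volume.restrict (Set.Ioo 1 a), 0 ≤ tailDensity A b := by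
    filter_upwards [ae_restrict_mem measurableSet_Ioo] with A hA
    exact (lintegral_jointDensity hb hb1 hA.1.le (by linarith [hA.2])).1
  have i1 : IntegrableOn gapDensityFormula (Set.Ioo 1 a) :=
    (lintegral_ofReal_ne_top_iff_integrable m1.aestronglyMeasurable n1).1 f1
  have i2 : IntegrableOn (fun A => tailDensity A b) (Set.Ioo 1 a) :=
    (lintegral_ofReal_ne_top_iff_integrable m2.aestronglyMeasurable n2).1 f2
  have h := congrArg ENNReal.toReal key
  rw [ENNReal.toReal_add (limitIntegral_ne_top _ _) f1,
    ENNReal.toReal_add (limitIntegral_ne_top _ _) f2, ← integral_eq_lintegral_of_nonneg_ae n1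
    m1.aestronglyMeasurable, ← integral_eq_lintegral_of_nonneg_ae n2 m2.aestronglyMeasurable] at h
  have hint := intervalIntegral.integral_eq_sub_of_hasDerivAt_of_le ha hc hd
    ((intervalIntegrable_iff_integrableOn_Ioo_of_le ha).2 (i2.sub i1))
  rw [intervalIntegral.integral_of_le ha, integral_Ioc_eq_integral_Ioo,
    integral_sub i2 i1] at hint
  unfold limitValue
  linarith

end GapDistribution

/-! ### Regions B and C. -/

namespace GapDistribution

open MeasureTheory

/-- Through `L` the logarithm of `d - n` can be expanded into logarithms of linear factors, so that
derivatives of the closed formulas become polynomials in finitely many logarithms with rational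
coefficients. As `Real.log` ignores signs, `n` and `d` may both be negative. -/
lemma hasDerivAt_li₂_div {n d : ℝ → ℝ} {n' d' x L : ℝ} (hn : HasDerivAt n n' x)
    (hd : HasDerivAt d d' x) (h0 : 0 < n x / d x) (h1 : n x / d x < 1)
    (hL : Real.log (d x) - Real.log (d x - n x) = L) :
    HasDerivAt (fun y => Li₂ (n y / d y)) (L * (n' / n x - d' / d x)) x := by
  have d0 : d x ≠ 0 := fun h => by simp [h] at h0
  have n0 : n x ≠ 0 := fun h => by simp [h] at h0
  have e : 1 - n x / d x = (d x - n x) / d x := by field_simp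
  have dn : d x - n x ≠ 0 := fun h => by
    rw [h, zero_div] at e
    linarith
  have := hasDerivAt_li₂_comp (hn.fun_div hd d0) h0 h1
  refine this.congr_deriv ?_
  rw [e, Real.log_div dn d0, ← hL]
  field_simp
  ring

lemma limitValue_of_lt_one {a b : ℝ} (hba : b ≤ a) (hab : 1 ≤ a + b) (ha : a < 1) :
    limitValue a b = formulaB a b := by
  have a0 : a ≠ 0 := (show 0 < a by linarith).ne'
  have a1 : 1 - a ≠ 0 := (show 0 < 1 - a by linarith).ne'
  have h := limitValue_sub_eq_of_hasDerivAt (a := a) (p := 1 - a) (q := b)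
    (F := fun s => formulaB a s) (κ := fun s => marginalB a s) (by linarith) (by linarith) hba
    (fun s hs => marginal_of_le_one (by linarith [hs.1]) (by linarith [hs.2]) ha.le
      (by linarith [hs.1])) ?_ ?_
  · rw [limitValue_of_add_le_one (by linarith) (by linarith) (by linarith)] at h
    -- On `a + b = 1` every logarithmic term vanishes and the two dilogarithms cancel.
    have e : formulaA a (1 - a) = formulaB a (1 - a) := by
      simp only [formulaA, formulaB, sub_sub_cancel, add_sub_cancel, div_self a0, div_self a1,
        Real.log_one]
      ring
    linarith
  · have h1 : ∀ s ∈ Set.Icc (1 - a) b, s ≠ 0 := fun s hs => (show 0 < s by linarith [hs.1]).ne'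
    have h2 : ∀ s ∈ Set.Icc (1 - a) b, a + s ≠ 0 := fun s hs =>
      (show 0 < a + s by linarith [hs.1]).ne'
    have h3 : ∀ s ∈ Set.Icc (1 - a) b, (1 - a) / s ≠ 0 := fun s hs => div_ne_zero a1 (h1 s hs)
    have h4 : ∀ s ∈ Set.Icc (1 - a) b, (1 - s) / a ≠ 0 := fun s hs =>
      div_ne_zero (show 0 < 1 - s by linarith [hs.2]).ne' a0
    have c : ContinuousOn (fun s => 2 * Li₂ (1 - s)) (Set.Icc (1 - a) b) :=
      (continuousOn_li₂_comp (by fun_prop) (fun s hs => by linarith [hs.2])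
        (fun s hs => by linarith [hs.1])).const_mul 2
    unfold formulaB
    exact ((((ContinuousOn.add (by fun_prop) c).add (by fun_prop (disch := assumption))).add
      (by fun_prop (disch := assumption))).add (by fun_prop (disch := assumption)))
  · intro s hs
    have s0 : s ≠ 0 := (show 0 < s by linarith [hs.1]).ne'
    have p1 : 1 - s ≠ 0 := (show 0 < 1 - s by linarith [hs.2]).ne'
    have p2 : a + s ≠ 0 := (show 0 < a + s by linarith [hs.1]).ne'
    have i := hasDerivAt_id' s
    have l0 := Real.hasDerivAt_log s0
    have l1 := (i.const_add a).log p2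
    have l2 := ((hasDerivAt_const s (1 - a)).fun_div i s0).log (div_ne_zero a1 s0)
    have l3 := ((i.const_sub 1).div_const a).log (div_ne_zero p1 a0)
    have l4 := hasDerivAt_li₂_comp (i.const_sub 1) (by linarith [hs.2]) (by linarith [hs.1])
    unfold formulaB
    apply HasDerivAt.congr_deriv
    · repeat' first
        | exact hasDerivAt_const _ _
        | exact i | exact l0 | exact l1 | exact l2 | exact l3 | exact l4
        | exact HasDerivAt.fun_div (hasDerivAt_const _ _) i s0
        | apply HasDerivAt.fun_add
        | apply HasDerivAt.fun_sub
        | apply HasDerivAt.const_mul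
        | apply HasDerivAt.div_const
        | apply HasDerivAt.fun_mul
        | apply HasDerivAt.fun_neg
    · rw [marginalB, Real.log_div p1 a0, sub_sub_cancel]
      field_simp
      ring


lemma log_sub_comm (x y : ℝ) : Real.log (x - y) = Real.log (y - x) := by
  rw [← Real.log_neg_eq_log, neg_sub]

/-- Region B is settled only for `a < 1`, and both sides are left continuous at 1. In the formula
the factor `1 / A - A` absorbs the singularity of `log (1 - A)`, and `log 0 = 0` gives the correct
value at the end point. -/
lemma limitValue_one {b : ℝ} (hb : 0 < b) (hb1 : b < 1) : limitValue 1 b = formulaB 1 b := by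
  set m := max b (1 - b) with hm
  have m0 : 0 < m := hb.trans_le (le_max_left _ _)
  have m1 : m < 1 := max_lt hb1 (by linarith)
  have b1 : 1 - b ≠ 0 := (sub_pos.2 hb1).ne'
  have hc : ContinuousOn (fun A => formulaB A b) (Set.Icc m 1) := by
    have h1 : ∀ A ∈ Set.Icc m 1, A ≠ 0 := fun A hA => (m0.trans_le hA.1).ne'
    have h2 : ∀ A ∈ Set.Icc m 1, A + b ≠ 0 := fun A hA =>
      (show 0 < A + b by linarith [m0.trans_le hA.1]).ne'
    have h3 : ∀ A ∈ Set.Icc m 1, (1 - b) / A ≠ 0 := fun A hA => div_ne_zero b1 (h1 A hA)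
    have c1 : ContinuousOn (fun A => Li₂ A) (Set.Icc m 1) :=
      continuousOn_li₂_comp (by fun_prop) (fun A hA => (m0.trans_le hA.1).le) fun A hA => hA.2
    have c2 : ContinuousOn (fun A : ℝ => (1 / A - A) * Real.log ((1 - A) / b)) (Set.Icc m 1) := by
      have c3 : Continuous fun A : ℝ => (1 - A) * Real.log (1 - A) :=
        Real.continuous_mul_log.comp (by fun_prop : Continuous fun A : ℝ => 1 - A)
      have : ContinuousOn (fun A : ℝ => (1 + A) / A * ((1 - A) * Real.log (1 - A)
        - (1 - A) * Real.log b)) (Set.Icc m 1) := by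
        refine ContinuousOn.mul (by fun_prop (disch := assumption)) ?_
        exact c3.continuousOn.sub (by fun_prop)
      refine this.congr fun A hA => ?_
      have := h1 A hA
      rcases eq_or_ne A 1 with rfl | h
      · simp
      · beta_reduce
        rw [Real.log_div (sub_ne_zero.2 h.symm) hb.ne']
        field_simp
        ring
    unfold formulaB
    fun_prop (disch := assumption)
  have h := (hc 1 ⟨m1.le, le_rfl⟩).mono_left
    (show 𝓝[<] (1 : ℝ) ≤ 𝓝[Set.Icc m 1] 1 by
      rw [← nhdsWithin_Ioo_eq_nhdsLT m1]; exact nhdsWithin_mono _ Set.Ioo_subset_Icc_self)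
  refine tendsto_nhds_unique ((tendsto_limitValue_one hb1).congr' ?_) h
  filter_upwards [Ioo_mem_nhdsLT m1] with A hA
  exact limitValue_of_lt_one ((le_max_left _ _).trans hA.1.le)
    (by linarith [(le_max_right b (1 - b)).trans_lt hA.1]) hA.2

/-- At `a = 1` the dilogarithms of region C specialise to arguments 1, `1 / 2` and `b`, and the
reflection formula exchanges `b` and `1 - b`. -/
lemma formulaB_one {b : ℝ} (hb : 0 < b) (hb1 : b < 1) : formulaB 1 b = formulaC 1 b := by
  have h := li₂_add_li₂_one_sub hb hb1
  have d : (b - 1) / (b - 1) = 1 := div_self (sub_neg.2 hb1).ne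
  rw [formulaB, formulaC]
  simp only [sub_self, zero_div, Real.log_zero, mul_zero, div_one, one_mul, d, li₂_one,
    li₂_one_half, Real.log_one]
  rw [show (2 : ℝ) - 1 = 1 by norm_num, Real.log_one]
  linear_combination 2 * h

/-- Pairing a singular logarithm with its vanishing factor gives continuity up to the boundary of a
region. -/
lemma continuousOn_mul_log_sub {f : ℝ → ℝ} {s : Set ℝ} {c : ℝ} (hf : ContinuousOn f s) :
    ContinuousOn (fun x => f x * ((x - c) * Real.log (x - c))) s :=
  hf.mul (Real.continuous_mul_log.comp (by fun_prop : Continuous fun x : ℝ => x - c)).continuousOn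

lemma continuousOn_formulaC {a b : ℝ} (hb : 0 < b) (hb1 : b < 1) (hab : a + b ≤ 2) :
    ContinuousOn (fun A => formulaC A b) (Set.Icc 1 a) := by
  have b1 : 1 - b ≠ 0 := (sub_pos.2 hb1).ne'
  have h1 : ∀ A ∈ Set.Icc 1 a, A ≠ 0 := fun A hA => (show 0 < A by linarith [hA.1]).ne'
  have h2 : ∀ A ∈ Set.Icc 1 a, A + b ≠ 0 := fun A hA => (show 0 < A + b by linarith [hA.1]).ne'
  have h3 : ∀ A ∈ Set.Icc 1 a, A - b ≠ 0 := fun A hA => (show 0 < A - b by linarith [hA.1]).ne'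
  have h4 : ∀ A ∈ Set.Icc 1 a, 2 - A ≠ 0 := fun A hA => (show 0 < 2 - A by linarith [hA.2]).ne'
  have h5 : ∀ A ∈ Set.Icc 1 a, b - A ≠ 0 := fun A hA => (show b - A < 0 by linarith [hA.1]).ne
  have c0 : ContinuousOn (fun A : ℝ => (2 / A - 2 * A) * Real.log (A - 1)) (Set.Icc 1 a) := by
    refine (continuousOn_mul_log_sub (f := fun A => -(2 * (1 + A)) / A) (c := 1)
      (by fun_prop (disch := assumption))).congr fun A hA => ?_
    have := h1 A hA
    field_simp
    ring
  have c1 : ContinuousOn (fun A => Li₂ (1 / A)) (Set.Icc 1 a) :=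
    continuousOn_li₂_comp (by fun_prop (disch := assumption))
      (fun A hA => by have : 0 < A := by linarith [hA.1]
                      positivity)
      (fun A hA => (div_le_one (by linarith [hA.1])).2 hA.1)
  have c2 : ContinuousOn (fun A => Li₂ (A / 2)) (Set.Icc 1 a) :=
    continuousOn_li₂_comp (by fun_prop) (fun A hA => by linarith [hA.1])
      (fun A hA => by linarith [hA.2])
  have c3 : ContinuousOn (fun A => Li₂ ((b - 1) / (b - A))) (Set.Icc 1 a) :=
    continuousOn_li₂_comp (by fun_prop (disch := assumption))
      (fun A hA => div_nonneg_of_nonpos (by linarith) (by linarith [hA.1]))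
      (fun A hA => (div_le_one_of_neg (by linarith [hA.1])).2 (by linarith [hA.1]))
  have c4 : ContinuousOn (fun A => Li₂ (A * (b - 1) / (b - A))) (Set.Icc 1 a) :=
    continuousOn_li₂_comp (by fun_prop (disch := assumption))
      (fun A hA => div_nonneg_of_nonpos (by nlinarith [hA.1]) (by linarith [hA.1]))
      (fun A hA => (div_le_one_of_neg (by linarith [hA.1])).2 (by nlinarith [hA.1]))
  unfold formulaC
  fun_prop (disch := assumption)

lemma hasDerivAt_formulaC {A b : ℝ} (hb : 0 < b) (hb1 : b < 1) (hA : 1 < A) (hA2 : A < 2) :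
    HasDerivAt (fun A => formulaC A b) (tailDensity A b - gapDensityFormula A) A := by
  have A1 : 0 < A - 1 := by linarith
  have A2 : 0 < 2 - A := by linarith
  have Apos : 0 < A := by linarith
  have A0 : A ≠ 0 := (show 0 < A by linarith).ne'
  have p1 : A + b ≠ 0 := (show 0 < A + b by linarith).ne'
  have p2 : A - b ≠ 0 := (show 0 < A - b by linarith).ne'
  have p3 : b - A ≠ 0 := (show b - A < 0 by linarith).ne
  have n1 := A1.ne'
  have n2 := A2.ne'
  have i := hasDerivAt_id' A
  have l0 := Real.hasDerivAt_log A0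
  have l1 := (i.sub_const 1).log n1
  have l2 := (i.const_sub 2).log n2
  have l3 := (i.add_const b).log p1
  have l4 := (i.sub_const b).log p2
  have l5 := l0.fun_pow 2
  have i0 : HasDerivAt (fun y : ℝ => y / 2) (1 / 2) A := i.div_const 2
  have d1 := hasDerivAt_li₂_div (hasDerivAt_const A 1) i (one_div_pos.2 Apos)
    ((div_lt_one (by linarith)).2 hA) rfl
  have d2 := hasDerivAt_li₂_div i (hasDerivAt_const A 2) (half_pos Apos) (by linarith) rfl
  have d3 := hasDerivAt_li₂_div (L := Real.log (A - b) - Real.log (A - 1))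
    (hasDerivAt_const A (b - 1)) (i.const_sub b)
    (div_pos_of_neg_of_neg (by linarith) (by linarith))
    ((div_lt_one_of_neg (by linarith)).2 (by linarith))
    (by rw [log_sub_comm b, show b - A - (b - 1) = 1 - A by ring, log_sub_comm 1])
  have d4 := hasDerivAt_li₂_div (L := Real.log (A - b) - (Real.log b + Real.log (A - 1)))
    (i.mul_const (b - 1)) (i.const_sub b)
    (div_pos_of_neg_of_neg (by nlinarith) (by linarith))
    ((div_lt_one_of_neg (by linarith)).2 (by nlinarith))
    (by rw [log_sub_comm b, show b - A - A * (b - 1) = b * (1 - A) by ring,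
      Real.log_mul hb.ne' (by linarith |> fun (h : 1 - A < 0) => h.ne), log_sub_comm 1])
  unfold formulaC
  apply HasDerivAt.congr_deriv
  · repeat' first
      | with_reducible exact hasDerivAt_const _ _
      | with_reducible exact i
      | with_reducible exact l0
      | with_reducible exact l1
      | with_reducible exact l2
      | with_reducible exact l3
      | with_reducible exact l4
      | with_reducible exact l5
      | with_reducible exact i0
      | with_reducible exact d1
      | with_reducible exact d2
      | with_reducible exact d3
      | with_reducible exact d4
      | with_reducible exact HasDerivAt.fun_div (hasDerivAt_const _ _) i A0
      | with_reducible apply HasDerivAt.fun_add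
      | with_reducible apply HasDerivAt.fun_sub
      | with_reducible apply HasDerivAt.const_mul
      | with_reducible apply HasDerivAt.fun_mul
  · rw [tailDensity, gapDensityFormula, Real.log_div p1 A0, Real.log_div p2 A0,
      Real.log_mul two_ne_zero hb.ne']
    have n3 : b - 1 ≠ 0 := (show b - 1 < 0 by linarith).ne
    simp only [Nat.cast_ofNat]
    -- The identity holds coefficient by coefficient in the logarithms, so they may be treated as
    -- independent variables.
    generalize Real.log (A + b) = x1
    generalize Real.log (A - b) = x2
    generalize Real.log (A - 1) = x3
    generalize Real.log (2 - A) = x4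
    generalize Real.log A = x5
    generalize Real.log b = x6
    generalize Real.log (1 - b) = x7
    generalize Real.log 2 = x8
    have e : b - A = -(A - b) := by ring
    rw [e]
    field_simp
    ring

lemma limitValue_of_add_le_two {a b : ℝ} (hb : 0 < b) (ha : 1 < a) (hab : a + b ≤ 2) :
    limitValue a b = formulaC a b := by
  have hb1 : b < 1 := by linarith
  have h := limitValue_sub_eq_of_hasDerivAt_left (F := fun A => formulaC A b) hb hb1 ha.le hab 
    (continuousOn_formulaC hb hb1 hab)
    fun A hA => hasDerivAt_formulaC hb hb1 hA.1 (by linarith [hA.2])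
  rw [limitValue_one hb hb1, formulaB_one hb hb1] at h
  linarith

end GapDistribution

/-! ### Region D. -/

namespace GapDistribution

open MeasureTheory

/-- On `a + b = 2` the dilogarithm arguments collapse to `1 / 2`, `a / 2`, `1 / a`, `2 - a` and `a -
1`; the reflection formula for the last two closes the identity. -/
lemma formulaC_eq_formulaD {a : ℝ} (h1 : 1 < a) (h2 : a < 2) :
    formulaC a (2 - a) = formulaD a (2 - a) := by
  have a0 : a ≠ 0 := (show 0 < a by linarith).ne'
  have a1 : a - 1 ≠ 0 := (sub_pos.2 h1).ne'
  have a2 : 2 - a ≠ 0 := (sub_pos.2 h2).ne'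
  have h := li₂_add_li₂_one_sub (x := 2 - a) (by linarith) (by linarith)
  have l1 : Real.log (a - (2 - a)) = Real.log 2 + Real.log (a - 1) := by
    rw [← Real.log_mul two_ne_zero a1]
    congr 1; ring
  have l2 : Real.log (2 - a + (2 - a)) = Real.log 2 + Real.log (2 - a) := by
    rw [← Real.log_mul two_ne_zero a2]
    congr 1; ring
  have l3 : Real.log (-a + (2 - a) + 2) = Real.log 2 + Real.log (2 - a) := by
    rw [← l2]
    congr 1; ring
  have n1 : 2 - a - a ≠ 0 := (show 2 - a - a < 0 by linarith).ne
  have n2 : a - (2 - a) ≠ 0 := (show 0 < a - (2 - a) by linarith).ne'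
  have e1 : (2 - a - 1) / (2 - a - a) = 1 / 2 := by
    rw [div_eq_iff n1]; ring
  have e2 : a * (2 - a - 1) / (2 - a - a) = a / 2 := by
    rw [div_eq_iff n1]; ring
  have e3 : 2 * (2 - a) / (a * (2 - a + (2 - a))) = 1 / a := by
    rw [← two_mul]; field_simp
  have e4 : (2 - a) / (2 - a + (2 - a)) = 1 / 2 := by
    rw [← two_mul]; field_simp
  have e5 : (2 - a + (2 - a)) / 2 = 2 - a := by ring
  have e6 : (a - a * (2 - a)) / (a - (2 - a)) = a / 2 := by
    rw [div_eq_iff n2]; ring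
  rw [show 1 - (2 - a) = a - 1 by ring] at h
  rw [formulaC, formulaD, e1, e2, e3, e4, e5, e6, l1, l2, l3, Real.log_mul two_ne_zero a2,
    add_sub_cancel, show 1 - (2 - a) = a - 1 by ring, li₂_one_half]
  generalize Real.log (a - 1) = x1 at *
  generalize Real.log (2 - a) = x2 at *
  generalize Real.log a = x3 at *
  generalize Real.log 2 = x4 at *
  have e7 : Li₂ (2 - a) = Real.pi ^ 2 / 6 - x2 * x1 - Li₂ (a - 1) := by linarith
  rw [e7]
  field_simp
  ring

lemma continuousOn_formulaD {a : ℝ} (ha1 : 1 < a) (ha2 : a < 2) :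
    ContinuousOn (fun s => formulaD a s) (Set.Icc (2 - a) 1) := by
  have a0 : a ≠ 0 := (show 0 < a by linarith).ne'
  have h0 : ∀ s ∈ Set.Icc (2 - a) 1, s ≠ 0 := fun s hs => (show 0 < s by linarith [hs.1]).ne'
  have h3 : ∀ s ∈ Set.Icc (2 - a) 1, a - s ≠ 0 := fun s hs => (show 0 < a - s by linarith [hs.2]).ne'
  have h4 : ∀ s ∈ Set.Icc (2 - a) 1, s - a ≠ 0 := fun s hs => (show s - a < 0 by linarith [hs.2]).ne
  have h5 : ∀ s ∈ Set.Icc (2 - a) 1, 2 - a + s ≠ 0 := fun s hs =>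
    (show 0 < 2 - a + s by linarith [hs.1]).ne'
  have h6 : ∀ s ∈ Set.Icc (2 - a) 1, -a + s + 2 ≠ 0 := fun s hs =>
    (show 0 < -a + s + 2 by linarith [hs.1]).ne'
  have h7 : ∀ s ∈ Set.Icc (2 - a) 1, a * (2 - a + s) ≠ 0 := fun s hs => mul_ne_zero a0 (h5 s hs)
  have c0 : ContinuousOn (fun s : ℝ => (s - 1 / s) * Real.log (1 - s)) (Set.Icc (2 - a) 1) := by
    refine (continuousOn_mul_log_sub (f := fun s => (1 + s) / s) (c := 1)
      (by fun_prop (disch := assumption))).congr fun s hs => ?_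
    have := h0 s hs
    rw [log_sub_comm]
    field_simp
    ring
  have c1 : ContinuousOn (fun s => Li₂ (1 - s)) (Set.Icc (2 - a) 1) :=
    continuousOn_li₂_comp (by fun_prop) (fun s hs => by linarith [hs.2])
      (fun s hs => by linarith [hs.1])
  have c2 : ContinuousOn (fun s => Li₂ s) (Set.Icc (2 - a) 1) :=
    continuousOn_li₂_comp (by fun_prop) (fun s hs => by linarith [hs.1])
      (fun s hs => by linarith [hs.2])
  have c3 : ContinuousOn (fun s => Li₂ (2 * s / (a * (2 - a + s)))) (Set.Icc (2 - a) 1) :=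
    continuousOn_li₂_comp (by fun_prop (disch := assumption))
      (fun s hs => div_nonneg (by linarith [hs.1]) (by nlinarith [hs.1]))
      (fun s hs => (div_le_one (by nlinarith [hs.1])).2 (by nlinarith [hs.1, hs.2]))
  have c4 : ContinuousOn (fun s => Li₂ ((s - 1) / (s - a))) (Set.Icc (2 - a) 1) :=
    continuousOn_li₂_comp (by fun_prop (disch := assumption))
      (fun s hs => div_nonneg_of_nonpos (by linarith [hs.2]) (by linarith [hs.2]))
      (fun s hs => (div_le_one_of_neg (by linarith [hs.2])).2 (by linarith))
  have c5 : ContinuousOn (fun s => Li₂ (s / (2 - a + s))) (Set.Icc (2 - a) 1) :=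
    continuousOn_li₂_comp (by fun_prop (disch := assumption))
      (fun s hs => div_nonneg (by linarith [hs.1]) (by linarith [hs.1]))
      (fun s hs => (div_le_one (by linarith [hs.1])).2 (by linarith))
  have c6 : ContinuousOn (fun s => Li₂ ((2 - a + s) / 2)) (Set.Icc (2 - a) 1) :=
    continuousOn_li₂_comp (by fun_prop) (fun s hs => by linarith [hs.1])
      (fun s hs => by linarith [hs.2])
  have c7 : ContinuousOn (fun s => Li₂ ((a - a * s) / (a - s))) (Set.Icc (2 - a) 1) :=
    continuousOn_li₂_comp (by fun_prop (disch := assumption))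
      (fun s hs => div_nonneg (by nlinarith [hs.2]) (by linarith [hs.2]))
      (fun s hs => (div_le_one (by linarith [hs.2])).2 (by nlinarith [hs.1]))
  unfold formulaD
  fun_prop (disch := assumption)

/-- For all dilogarithm arguments `n / d`, the difference `d - n` is a product of factors whose
logarithms already occur. The derivative can therefore be compared with `marginalD` coefficient by
coefficient. -/
lemma hasDerivAt_formulaD {a s : ℝ} (ha1 : 1 < a) (ha2 : a < 2) (hs : 2 - a < s) (hs1 : s < 1) :
    HasDerivAt (fun s => formulaD a s) (-marginalD a s) s := by
  have apos : 0 < a := by linarith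
  have spos : 0 < s := by linarith
  have a0 : a ≠ 0 := apos.ne'
  have s0 : s ≠ 0 := spos.ne'
  have p1 : 0 < a - s := by linarith
  have p2 : 0 < 1 - s := by linarith
  have p3 : 0 < 2 - a + s := by linarith
  have p4 : 0 < 2 - a := by linarith
  have p5 : 0 < a - 1 := by linarith
  have e3 : -a + s + 2 = 2 - a + s := by ring
  have i := hasDerivAt_id' s
  have l0 := Real.hasDerivAt_log s0
  have l1 := (i.const_sub a).log p1.ne'
  have l2 := (i.const_sub 1).log p2.ne'
  have l3 := ((i.const_add (-a)).add_const 2).log (e3.trans_ne p3.ne')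
  have l4 := (i.const_add (2 - a)).log p3.ne'
  have d1 := hasDerivAt_li₂_comp (i.const_sub 1) (by linarith) (by linarith)
  have d2 := hasDerivAt_li₂_comp i spos hs1
  have d3 := hasDerivAt_li₂_div (L := Real.log a + Real.log (2 - a + s)
      - (Real.log (2 - a) + Real.log (a - s)))
    (i.const_mul 2) ((i.const_add (2 - a)).const_mul a) (by positivity)
    ((div_lt_one (by positivity)).2 (by nlinarith))
    (by rw [show a * (2 - a + s) - 2 * s = (2 - a) * (a - s) by ring, Real.log_mul a0 p3.ne',
      Real.log_mul p4.ne' p1.ne'])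
  have d4 := hasDerivAt_li₂_div (L := Real.log (a - s) - Real.log (a - 1))
    (i.sub_const 1) (i.sub_const a) (div_pos_of_neg_of_neg (by linarith) (by linarith))
    ((div_lt_one_of_neg (by linarith)).2 (by linarith))
    (by rw [log_sub_comm s, show s - a - (s - 1) = 1 - a by ring, log_sub_comm 1])
  have d5 := hasDerivAt_li₂_div (L := Real.log (2 - a + s) - Real.log (2 - a))
    i (i.const_add (2 - a)) (by positivity) ((div_lt_one p3).2 (by linarith))
    (by rw [add_sub_cancel_right])
  have d6 := hasDerivAt_li₂_div (L := Real.log 2 - Real.log (a - s))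
    (i.const_add (2 - a)) (hasDerivAt_const s 2) (by positivity)
    ((div_lt_one two_pos).2 (by linarith)) (by rw [show 2 - (2 - a + s) = a - s by ring])
  have d7 := hasDerivAt_li₂_div (L := Real.log (a - s) - (Real.log s + Real.log (a - 1)))
    ((i.const_mul a).const_sub a) (i.const_sub a) (div_pos (by nlinarith) p1)
    ((div_lt_one p1).2 (by nlinarith))
    (by rw [show a - s - (a - a * s) = s * (a - 1) by ring, Real.log_mul s0 p5.ne'])
  unfold formulaD
  apply HasDerivAt.congr_deriv
  · repeat' first
    | with_reducible exact hasDerivAt_const _ _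
    | with_reducible exact i
    | with_reducible exact l0
    | with_reducible exact l1
    | with_reducible exact l2
    | with_reducible exact l3
    | with_reducible exact l4
    | with_reducible exact d1
    | with_reducible exact d2
    | with_reducible exact d3
    | with_reducible exact d4
    | with_reducible exact d5
    | with_reducible exact d6
    | with_reducible exact d7
    | with_reducible exact HasDerivAt.fun_div (hasDerivAt_const _ _) i s0
    | with_reducible apply HasDerivAt.fun_add
    | with_reducible apply HasDerivAt.fun_sub
    | with_reducible apply HasDerivAt.const_mul
    | with_reducible apply HasDerivAt.fun_mul
  · have f1 : Real.log (2 - 2 * s) = Real.log 2 + Real.log (1 - s) := by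
      rw [← Real.log_mul two_ne_zero p2.ne']
      congr 1; ring
    rw [marginalD, marginalF, marginalPrimitive, marginalPrimitive, f1, e3, sub_sub_cancel,
      show s - 1 = -(1 - s) by ring, show s - a = -(a - s) by ring,
      show a - a * s = a * (1 - s) by ring]
    generalize Real.log s = x0
    generalize Real.log (a - s) = x1
    generalize Real.log (1 - s) = x2
    generalize Real.log (2 - a + s) = x3
    generalize Real.log (2 - a) = x4
    generalize Real.log (a - 1) = x5
    generalize Real.log a = x6
    generalize Real.log 2 = x7
    generalize Real.log (2 - s) = x8
    have n1 := p1.ne'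
    have n2 := p2.ne'
    have n3 := p3.ne'
    field_simp
    ring

/-- The constant comes from region C on `a + b = 2`. The line `b = 1` is included since it is the
initial line for region E. -/
lemma limitValue_of_two_le_add {a b : ℝ} (ha1 : 1 < a) (ha2 : a < 2) (hab : 2 ≤ a + b)
    (hb : b ≤ 1) : limitValue a b = formulaD a b := by
  have h := limitValue_sub_eq_of_hasDerivAt (a := a) (p := 2 - a) (q := b)
    (F := fun s => formulaD a s) (κ := fun s => marginalD a s) (by linarith) (by linarith)
    (by linarith) (fun s hs => marginal_of_two_le_add (by linarith [hs.1]) (by linarith [hs.2])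
      ha2.le (by linarith [hs.1]))
    ((continuousOn_formulaD ha1 ha2).mono (Set.Icc_subset_Icc_right hb))
    fun s hs => hasDerivAt_formulaD ha1 ha2 hs.1 (by linarith [hs.2])
  rw [limitValue_of_add_le_two (by linarith) ha1 (by linarith), formulaC_eq_formulaD ha1 ha2] at h
  linarith

end GapDistribution

/-! ### Region E. -/

namespace GapDistribution

open MeasureTheory

/-- At `b = 1` the coefficients of the singular logarithms vanish. The dilogarithm arguments
degenerate to 0, 1, `1 / 2` or to arguments common to both formulas. -/
lemma formulaD_eq_formulaE {a : ℝ} (h1 : 1 < a) (h2 : a < 2) : formulaD a 1 = formulaE a 1 := by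
  have a0 : a ≠ 0 := (show 0 < a by linarith).ne'
  have a1 : a - 1 ≠ 0 := (sub_pos.2 h1).ne'
  have a2 : a - 2 ≠ 0 := (sub_neg.2 h2).ne
  have a3 : 3 - a ≠ 0 := (show 0 < 3 - a by linarith).ne'
  have e1 : (1 : ℝ) / 2 * (3 - a) = (3 - a) / 2 := by ring
  have e2 : (a - 2) / (2 * (a - 2)) = 1 / 2 := by field_simp
  have e3 : (a - 2) / (a * (a - 2)) = 1 / a := by field_simp
  have e4 : -(2 / (a * (a - 3))) = 2 / (a * (3 - a)) := by
    rw [← div_neg]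
    congr 1
    ring
  rw [formulaD, formulaE, show 2 - a + 1 = 3 - a by ring, show -a + 1 + 2 = 3 - a by ring,
    show -a + 1 + 1 = 2 - a by ring, show a - 1 - 2 = a - 3 by ring,
    show a - 1 - 1 = a - 2 by ring]
  simp only [sub_self, zero_div, mul_one, li₂_zero, li₂_one, Real.log_zero, Real.log_one, mul_zero,
    e1, e2, e3, e4, div_self a2, li₂_one_half]
  field_simp
  ring

lemma continuousOn_formulaE {a : ℝ} (ha1 : 1 < a) (ha2 : a < 2) :
    ContinuousOn (fun s => formulaE a s) (Set.Icc 1 a) := by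
  have a0 : a ≠ 0 := (show 0 < a by linarith).ne'
  have h0 : ∀ s ∈ Set.Icc 1 a, s ≠ 0 := fun s hs => 
    (show 0 < s by linarith [hs.1, hs.2]).ne'
  have h1 : ∀ s ∈ Set.Icc 1 a, 2 * s - a ≠ 0 := fun s hs => 
    (show 0 < 2 * s - a by linarith [hs.1, hs.2]).ne'
  have h2 : ∀ s ∈ Set.Icc 1 a, 2 - a + s ≠ 0 := fun s hs => 
    (show 0 < 2 - a + s by linarith [hs.1, hs.2]).ne'
  have h3 : ∀ s ∈ Set.Icc 1 a, -a + s + 1 ≠ 0 := fun s hs => 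
    (show 0 < -a + s + 1 by linarith [hs.1, hs.2]).ne'
  have h4 : ∀ s ∈ Set.Icc 1 a, -a + s + 2 ≠ 0 := fun s hs => 
    (show 0 < -a + s + 2 by linarith [hs.1, hs.2]).ne'
  have h5 : ∀ s ∈ Set.Icc 1 a, a - s - 1 ≠ 0 := fun s hs => 
    (show a - s - 1 < 0 by linarith [hs.1, hs.2]).ne
  have h6 : ∀ s ∈ Set.Icc 1 a, a - s - 2 ≠ 0 := fun s hs => 
    (show a - s - 2 < 0 by linarith [hs.1, hs.2]).ne
  have h7 : ∀ s ∈ Set.Icc 1 a, a - 2 * s ≠ 0 := fun s hs => 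
    (show a - 2 * s < 0 by linarith [hs.1, hs.2]).ne
  have h8 : ∀ s ∈ Set.Icc 1 a, 2 * (a - s - 1) ≠ 0 := fun s hs => mul_ne_zero two_ne_zero (h5 s hs)
  have h9 : ∀ s ∈ Set.Icc 1 a, a * (a - s - 1) ≠ 0 := fun s hs => mul_ne_zero a0 (h5 s hs)
  have h10 : ∀ s ∈ Set.Icc 1 a, a * (a - s - 2) ≠ 0 := fun s hs => mul_ne_zero a0 (h6 s hs)
  have c0 : ContinuousOn (fun s : ℝ => (s - 1 / s) * Real.log (s - 1)) (Set.Icc 1 a) := by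
    refine (continuousOn_mul_log_sub (f := fun s => (1 + s) / s) (c := 1)
      (by fun_prop (disch := assumption))).congr fun s hs => ?_
    have := h0 s hs
    field_simp
    ring
  have c1 : ContinuousOn (fun s => Li₂ ((a - 2 * s) / (2 * (a - s - 1)))) (Set.Icc 1 a) :=
    continuousOn_li₂_comp (by fun_prop (disch := assumption))
      (fun s hs => div_nonneg_of_nonpos (by linarith [hs.1, hs.2]) (by linarith [hs.1, hs.2]))
      (fun s hs => (div_le_one_of_neg (by linarith [hs.1, hs.2])).2 (by linarith [hs.1, hs.2]))
  have c2 : ContinuousOn (fun s => Li₂ ((a - 2 * s) / (a * (a - s - 1)))) (Set.Icc 1 a) :=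
    continuousOn_li₂_comp (by fun_prop (disch := assumption))
      (fun s hs => div_nonneg_of_nonpos (by linarith [hs.1, hs.2]) (by nlinarith [hs.1, hs.2]))
      (fun s hs => (div_le_one_of_neg (by nlinarith [hs.1, hs.2])).2
        (by nlinarith [hs.1, mul_nonneg (sub_pos.2 ha2).le (sub_nonneg.2 hs.2)]))
  have c3 : ContinuousOn (fun s => Li₂ ((a - s - 1) / (a - 2 * s))) (Set.Icc 1 a) :=
    continuousOn_li₂_comp (by fun_prop (disch := assumption))
      (fun s hs => div_nonneg_of_nonpos (by linarith [hs.1, hs.2]) (by linarith [hs.1, hs.2]))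
      (fun s hs => (div_le_one_of_neg (by linarith [hs.1, hs.2])).2 (by linarith [hs.1, hs.2]))
  have c4 : ContinuousOn (fun s => Li₂ (-(2 * s / (a * (a - s - 2))))) (Set.Icc 1 a) :=
    continuousOn_li₂_comp (by fun_prop (disch := assumption))
      (fun s hs => neg_nonneg.2 (div_nonpos_of_nonneg_of_nonpos (by linarith [hs.1, hs.2]) (by nlinarith [hs.1, hs.2])))
      (fun s hs => by
        rw [← neg_div, div_le_one_of_neg (by nlinarith [hs.1, hs.2])]
        nlinarith [mul_nonneg (sub_pos.2 ha2).le (sub_nonneg.2 hs.2)])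
  have c5 : ContinuousOn (fun s => Li₂ ((a - s - 1) * s / (a - 2 * s))) (Set.Icc 1 a) :=
    continuousOn_li₂_comp (by fun_prop (disch := assumption))
      (fun s hs => div_nonneg_of_nonpos (by nlinarith [hs.1, hs.2]) (by linarith [hs.1, hs.2]))
      (fun s hs => (div_le_one_of_neg (by linarith [hs.1, hs.2])).2
        (by nlinarith [mul_nonneg (sub_nonneg.2 hs.1) (sub_nonneg.2 hs.2)]))
  have c6 : ContinuousOn (fun s => Li₂ (s / (-a + s + 2))) (Set.Icc 1 a) :=
    continuousOn_li₂_comp (by fun_prop (disch := assumption))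
      (fun s hs => div_nonneg (by linarith [hs.1, hs.2]) (by linarith [hs.1, hs.2]))
      (fun s hs => (div_le_one (by linarith [hs.1, hs.2])).2 (by linarith [hs.1, hs.2]))
  have c7 : ContinuousOn (fun s => Li₂ (1 / 2 * (-a + s + 2))) (Set.Icc 1 a) :=
    continuousOn_li₂_comp (by fun_prop (disch := assumption))
      (fun s hs => by linarith [hs.1, hs.2])
      (fun s hs => by linarith [hs.1, hs.2])
  unfold formulaE
  fun_prop (disch := assumption)

/-- Several arguments are quotients of two negative forms, such as `(a - s - 1) / (a - 2 s)`. The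
logarithms are first rewritten in terms of positive forms, after which the comparison with
`marginalE` is algebraic. -/
lemma hasDerivAt_formulaE {a s : ℝ} (ha2 : a < 2) (hs : 1 < s) (hs1 : s < a) :
    HasDerivAt (fun s => formulaE a s) (-marginalE a s) s := by
  have apos : 0 < a := by linarith
  have spos : 0 < s := by linarith
  have a0 : a ≠ 0 := apos.ne'
  have s0 : s ≠ 0 := spos.ne'
  have p0 : 0 < 2 * s - a := by linarith
  have p1 : 0 < a - s := by linarith
  have p2 : 0 < s - 1 := by linarith
  have p3 : 0 < 2 - a + s := by linarith
  have p4 : 0 < 2 - a := by linarith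
  have p5 : 0 < -a + s + 1 := by linarith
  have e3 : -a + s + 2 = 2 - a + s := by ring
  have e5 : a - s - 1 = -(-a + s + 1) := by ring
  have e6 : a - s - 2 = -(2 - a + s) := by ring
  have e0 : a - 2 * s = -(2 * s - a) := by ring
  have q0 : a - 2 * s < 0 := by linarith
  have q1 : a - s - 1 < 0 := by linarith
  have i := hasDerivAt_id' s
  have l0 := Real.hasDerivAt_log s0
  have l1 := ((i.const_mul 2).sub_const a).log p0.ne'
  have l2 := (i.sub_const 1).log p2.ne'
  have l3 := ((i.const_add (-a)).add_const 2).log (e3.trans_ne p3.ne')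
  have l4 := (i.const_add (2 - a)).log p3.ne'
  have l5 := ((i.const_add (-a)).add_const 1).log p5.ne'
  have k1 := (i.const_mul 2).const_sub a
  have k2 := (i.const_sub a).sub_const 1
  have k3 := (i.const_sub a).sub_const 2
  have d1 := hasDerivAt_li₂_div (L := Real.log 2 + Real.log (-a + s + 1) - Real.log (2 - a))
    k1 (k2.const_mul 2) (div_pos_of_neg_of_neg q0 (by linarith))
    ((div_lt_one_of_neg (by linarith)).2 (by linarith))
    (by rw [show 2 * (a - s - 1) - (a - 2 * s) = a - 2 by ring, Real.log_mul two_ne_zero q1.ne, e5,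
      Real.log_neg_eq_log, log_sub_comm a])
  have d2 := hasDerivAt_li₂_div (L := Real.log a + Real.log (-a + s + 1)
      - (Real.log (2 - a) + Real.log (a - s)))
    k1 (k2.const_mul a) (div_pos_of_neg_of_neg q0 (by nlinarith))
    ((div_lt_one_of_neg (by nlinarith)).2 (by nlinarith [mul_pos p4 p1]))
    (by rw [show a * (a - s - 1) - (a - 2 * s) = -((2 - a) * (a - s)) by ring,
      Real.log_mul a0 q1.ne, e5, Real.log_neg_eq_log, Real.log_neg_eq_log,
      Real.log_mul p4.ne' p1.ne'])
  have d3 := hasDerivAt_li₂_div (L := Real.log (2 * s - a) - Real.log (s - 1))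
    k2 k1 (div_pos_of_neg_of_neg q1 q0) ((div_lt_one_of_neg q0).2 (by linarith))
    (by rw [log_sub_comm a, show a - 2 * s - (a - s - 1) = 1 - s by ring, log_sub_comm 1])
  have d4 := hasDerivAt_li₂_div (L := Real.log a + Real.log (2 - a + s)
      - (Real.log (2 - a) + Real.log (a - s)))
    ((i.const_mul 2).fun_neg) (k3.const_mul a)
    (div_pos_of_neg_of_neg (by linarith) (by nlinarith))
    ((div_lt_one_of_neg (by nlinarith)).2 (by nlinarith [mul_pos p4 p1]))
    (by rw [show a * (a - s - 2) - -(2 * s) = -((2 - a) * (a - s)) by ring,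
      Real.log_neg_eq_log, Real.log_mul p4.ne' p1.ne', e6, mul_neg, Real.log_neg_eq_log,
      Real.log_mul a0 p3.ne'])
  simp only [neg_div] at d4
  have d5 := hasDerivAt_li₂_div (L := Real.log (2 * s - a) - (Real.log (a - s) + Real.log (s - 1)))
    (k2.fun_mul i) k1 (div_pos_of_neg_of_neg (by nlinarith) q0)
    ((div_lt_one_of_neg q0).2 (by nlinarith [mul_pos p1 p2]))
    (by rw [show a - 2 * s - (a - s - 1) * s = -((a - s) * (s - 1)) by ring, log_sub_comm a,
      Real.log_neg_eq_log, Real.log_mul p1.ne' p2.ne'])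
  have d6 := hasDerivAt_li₂_div (L := Real.log (2 - a + s) - Real.log (2 - a))
    i ((i.const_add (-a)).add_const 2) (div_pos spos (by linarith))
    ((div_lt_one (by linarith)).2 (by linarith)) (by rw [e3, add_sub_cancel_right])
  have d7 := hasDerivAt_li₂_comp (((i.const_add (-a)).add_const 2).const_mul (1 / 2))
    (by linarith) (by linarith)
  unfold formulaE
  apply HasDerivAt.congr_deriv
  · repeat' first
    | with_reducible exact hasDerivAt_const _ _
    | with_reducible exact i
    | with_reducible exact l0
    | with_reducible exact l1
    | with_reducible exact l2
    | with_reducible exact l3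
    | with_reducible exact l4
    | with_reducible exact l5
    | with_reducible exact d1
    | with_reducible exact d2
    | with_reducible exact d3
    | with_reducible exact d4
    | with_reducible exact d5
    | with_reducible exact d6
    | with_reducible exact d7
    | with_reducible exact HasDerivAt.fun_div (hasDerivAt_const _ _) i s0
    | with_reducible apply HasDerivAt.fun_add
    | with_reducible apply HasDerivAt.fun_sub
    | with_reducible apply HasDerivAt.const_mul
    | with_reducible apply HasDerivAt.fun_mul
  · have f1 : Real.log (2 * s - 2) = Real.log 2 + Real.log (s - 1) := by
      rw [← Real.log_mul two_ne_zero p2.ne']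
      congr 1; ring
    have f2 : Real.log (1 - 1 / 2 * (2 - a + s)) = Real.log (a - s) - Real.log 2 := by
      rw [← Real.log_div p1.ne' two_ne_zero]
      congr 1; ring
    rw [marginalE, f1, e3, f2, e5, e6, e0]
    generalize Real.log s = x0
    generalize Real.log (a - s) = x1
    generalize Real.log (s - 1) = x2
    generalize Real.log (2 - a + s) = x3
    generalize Real.log (2 - a) = x4
    generalize Real.log (-a + s + 1) = x5
    generalize Real.log a = x6
    generalize Real.log 2 = x7
    generalize Real.log (2 * s - a) = x8
    have n0 := p0.ne'
    have n1 : s * 2 - a ≠ 0 := by rwa [mul_comm]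
    have n2 := p2.ne'
    have n3 := p3.ne'
    have n5 := p5.ne'
    field_simp
    ring

lemma limitValue_of_one_lt {a b : ℝ} (hb : 1 < b) (hba : b ≤ a) (ha : a < 2) :
    limitValue a b = formulaE a b := by
  have h1 : 1 < a := hb.trans_le hba
  have h := limitValue_sub_eq_of_hasDerivAt (a := a) (p := 1) (q := b)
    (F := fun s => formulaE a s) (κ := fun s => marginalE a s) zero_le_one hb.le hba
    (fun s hs => marginal_of_one_lt hs.1 h1.le ha.le)
    ((continuousOn_formulaE h1 ha).mono (Set.Icc_subset_Icc_right hba))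
    fun s hs => hasDerivAt_formulaE ha hs.1 (by linarith [hs.2])
  rw [limitValue_of_two_le_add h1 ha (by linarith) le_rfl, formulaD_eq_formulaE h1 ha] at h
  linarith

end GapDistribution

/-! ### Region F. -/

namespace GapDistribution

open MeasureTheory

/-- This is the matching with region G: the special values at 0, 1 and `1 / 2` cancel the constants,
and the terms with argument `1 / a` cancel each other. -/
lemma formulaF_one {a : ℝ} (ha : 2 < a) : formulaF a 1 = 0 := by
  have a0 : a ≠ 0 := (show 0 < a by linarith).ne'
  have a2 : a - 2 ≠ 0 := (sub_pos.2 ha).ne'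
  have e2 : (a - 2) / (2 * (a - 2)) = 1 / 2 := by field_simp
  have e3 : (a - 2) / (a * (a - 2)) = 1 / a := by field_simp
  rw [formulaF, show a - 1 - 1 = a - 2 by ring]
  simp only [sub_self, zero_div, mul_one, li₂_zero, li₂_one, Real.log_one, mul_zero, e2, e3,
    div_self a2, li₂_one_half]
  field_simp
  ring

lemma continuousOn_formulaF {a b : ℝ} (ha : 2 < a) (hb : 0 < b) :
    ContinuousOn (fun s => formulaF a s) (Set.Icc b 1) := by
  have a0 : a ≠ 0 := (show 0 < a by linarith).ne'
  have h0 : ∀ s ∈ Set.Icc b 1, s ≠ 0 := fun s hs => 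
    (show 0 < s by linarith [hs.1, hs.2]).ne'
  have h1 : ∀ s ∈ Set.Icc b 1, a - s ≠ 0 := fun s hs => 
    (show 0 < a - s by linarith [hs.1, hs.2]).ne'
  have h2 : ∀ s ∈ Set.Icc b 1, s - a ≠ 0 := fun s hs => 
    (show s - a < 0 by linarith [hs.1, hs.2]).ne
  have h3 : ∀ s ∈ Set.Icc b 1, a - s - 1 ≠ 0 := fun s hs => 
    (show 0 < a - s - 1 by linarith [hs.1, hs.2]).ne'
  have h4 : ∀ s ∈ Set.Icc b 1, a - 2 * s ≠ 0 := fun s hs => 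
    (show 0 < a - 2 * s by linarith [hs.1, hs.2]).ne'
  have h5 : ∀ s ∈ Set.Icc b 1, 2 * (a - s - 1) ≠ 0 := fun s hs => mul_ne_zero two_ne_zero (h3 s hs)
  have h6 : ∀ s ∈ Set.Icc b 1, a * (a - s - 1) ≠ 0 := fun s hs => mul_ne_zero a0 (h3 s hs)
  have c1 : ContinuousOn (fun s => Li₂ (1 - s)) (Set.Icc b 1) :=
    continuousOn_li₂_comp (by fun_prop )
      (fun s hs => by linarith [hs.1, hs.2])
      (fun s hs => by linarith [hs.1, hs.2])
  have c2 : ContinuousOn (fun s => Li₂ (s)) (Set.Icc b 1) :=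
    continuousOn_li₂_comp (by fun_prop )
      (fun s hs => by linarith [hs.1, hs.2])
      (fun s hs => by linarith [hs.1, hs.2])
  have c3 : ContinuousOn (fun s => Li₂ ((a - 2 * s) / (2 * (a - s - 1)))) (Set.Icc b 1) :=
    continuousOn_li₂_comp (by fun_prop (disch := assumption))
      (fun s hs => div_nonneg (by linarith [hs.1, hs.2]) (by linarith [hs.1, hs.2]))
      (fun s hs => (div_le_one (by linarith [hs.1, hs.2])).2 (by linarith [hs.1, hs.2]))
  have c4 : ContinuousOn (fun s => Li₂ ((a - 2 * s) / (a * (a - s - 1)))) (Set.Icc b 1) :=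
    continuousOn_li₂_comp (by fun_prop (disch := assumption))
      (fun s hs => div_nonneg (by linarith [hs.1, hs.2]) (by nlinarith [hs.1, hs.2]))
      (fun s hs => (div_le_one (by nlinarith [hs.1, hs.2])).2
        (by nlinarith [hs.1, hs.2, mul_pos (sub_pos.2 ha) (show 0 < a - s by linarith [hs.2])]))
  have c5 : ContinuousOn (fun s => Li₂ ((a - s - 1) / (a - 2 * s))) (Set.Icc b 1) :=
    continuousOn_li₂_comp (by fun_prop (disch := assumption))
      (fun s hs => div_nonneg (by linarith [hs.1, hs.2]) (by linarith [hs.1, hs.2]))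
      (fun s hs => (div_le_one (by linarith [hs.1, hs.2])).2 (by linarith [hs.1, hs.2]))
  have c6 : ContinuousOn (fun s => Li₂ ((a - s - 1) * s / (a - 2 * s))) (Set.Icc b 1) :=
    continuousOn_li₂_comp (by fun_prop (disch := assumption))
      (fun s hs => div_nonneg
        (mul_nonneg (by linarith [hs.1, hs.2]) (by linarith [hs.1, hs.2])) (by linarith [hs.1, hs.2]))
      (fun s hs => (div_le_one (by linarith [hs.1, hs.2])).2
        (by nlinarith [mul_nonneg (sub_nonneg.2 hs.2) (show 0 ≤ a - s by linarith [hs.2])]))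
  have c7 : ContinuousOn (fun s => Li₂ ((s - 1) / (s - a))) (Set.Icc b 1) :=
    continuousOn_li₂_comp (by fun_prop (disch := assumption))
      (fun s hs => div_nonneg_of_nonpos (by linarith [hs.1, hs.2]) (by linarith [hs.1, hs.2]))
      (fun s hs => (div_le_one_of_neg (by linarith [hs.1, hs.2])).2 (by linarith [hs.1, hs.2]))
  have c8 : ContinuousOn (fun s => Li₂ ((a - a * s) / (a - s))) (Set.Icc b 1) :=
    continuousOn_li₂_comp (by fun_prop (disch := assumption))
      (fun s hs => div_nonneg (by nlinarith [hs.1, hs.2]) (by linarith [hs.1, hs.2]))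
      (fun s hs => (div_le_one (by linarith [hs.1, hs.2])).2 (by nlinarith [hs.1, hs.2]))
  unfold formulaF
  fun_prop (disch := assumption)

lemma hasDerivAt_formulaF {a s : ℝ} (ha : 2 < a) (hs : 0 < s) (hs1 : s < 1) :
    HasDerivAt (fun s => formulaF a s) (-marginalF a s) s := by
  have apos : 0 < a := by linarith
  have a0 : a ≠ 0 := apos.ne'
  have s0 : s ≠ 0 := hs.ne'
  have p0 : 0 < a - 2 * s := by linarith
  have p1 : 0 < a - s := by linarith
  have p2 : 0 < 1 - s := by linarith
  have p3 : 0 < a - s - 1 := by linarith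
  have p4 : 0 < a - 2 := by linarith
  have p5 : 0 < a - 1 := by linarith
  have i := hasDerivAt_id' s
  have k1 := (i.const_mul 2).const_sub a
  have k2 := (i.const_sub a).sub_const 1
  have l0 := Real.hasDerivAt_log s0
  have l1 := (i.const_sub a).log p1.ne'
  have l2 := k1.log p0.ne'
  have l3 := k2.log p3.ne'
  have d1 := hasDerivAt_li₂_comp (i.const_sub 1) (by linarith) (by linarith)
  have d2 := hasDerivAt_li₂_comp i hs hs1
  have d3 := hasDerivAt_li₂_div (L := Real.log 2 + Real.log (a - s - 1) - Real.log (a - 2))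
    k1 (k2.const_mul 2) (by positivity) ((div_lt_one (by positivity)).2 (by linarith))
    (by rw [show 2 * (a - s - 1) - (a - 2 * s) = a - 2 by ring, Real.log_mul two_ne_zero p3.ne'])
  have d4 := hasDerivAt_li₂_div (L := Real.log a + Real.log (a - s - 1)
      - (Real.log (a - 2) + Real.log (a - s)))
    k1 (k2.const_mul a) (by positivity)
    ((div_lt_one (by positivity)).2 (by nlinarith [mul_pos p4 p1]))
    (by rw [show a * (a - s - 1) - (a - 2 * s) = (a - 2) * (a - s) by ring,
      Real.log_mul a0 p3.ne', Real.log_mul p4.ne' p1.ne'])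
  have d5 := hasDerivAt_li₂_div (L := Real.log (a - 2 * s) - Real.log (1 - s))
    k2 k1 (by positivity) ((div_lt_one p0).2 (by linarith))
    (by rw [show a - 2 * s - (a - s - 1) = 1 - s by ring])
  have d6 := hasDerivAt_li₂_div (L := Real.log (a - 2 * s) - (Real.log (a - s) + Real.log (1 - s)))
    (k2.fun_mul i) k1 (by positivity) ((div_lt_one p0).2 (by nlinarith [mul_pos p1 p2]))
    (by rw [show a - 2 * s - (a - s - 1) * s = (a - s) * (1 - s) by ring,
      Real.log_mul p1.ne' p2.ne'])
  have d7 := hasDerivAt_li₂_div (L := Real.log (a - s) - Real.log (a - 1))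
    (i.sub_const 1) (i.sub_const a) (div_pos_of_neg_of_neg (by linarith) (by linarith))
    ((div_lt_one_of_neg (by linarith)).2 (by linarith))
    (by rw [log_sub_comm s, show s - a - (s - 1) = 1 - a by ring, log_sub_comm 1])
  have d8 := hasDerivAt_li₂_div (L := Real.log (a - s) - (Real.log s + Real.log (a - 1)))
    ((i.const_mul a).const_sub a) (i.const_sub a) (div_pos (by nlinarith) p1)
    ((div_lt_one p1).2 (by nlinarith))
    (by rw [show a - s - (a - a * s) = s * (a - 1) by ring, Real.log_mul s0 p5.ne'])
  unfold formulaF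
  apply HasDerivAt.congr_deriv
  · repeat' first
    | with_reducible exact hasDerivAt_const _ _
    | with_reducible exact i
    | with_reducible exact l0
    | with_reducible exact l1
    | with_reducible exact l2
    | with_reducible exact l3
    | with_reducible exact d1
    | with_reducible exact d2
    | with_reducible exact d3
    | with_reducible exact d4
    | with_reducible exact d5
    | with_reducible exact d6
    | with_reducible exact d7
    | with_reducible exact d8
    | with_reducible exact HasDerivAt.fun_div (hasDerivAt_const _ _) i s0
    | with_reducible apply HasDerivAt.fun_add
    | with_reducible apply HasDerivAt.fun_sub
    | with_reducible apply HasDerivAt.const_mul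
    | with_reducible apply HasDerivAt.fun_mul
  · rw [marginalF, sub_sub_cancel, show s - 1 = -(1 - s) by ring,
      show s - a = -(a - s) by ring, show a - a * s = a * (1 - s) by ring]
    generalize Real.log s = x0
    generalize Real.log (a - s) = x1
    generalize Real.log (1 - s) = x2
    generalize Real.log (a - s - 1) = x3
    generalize Real.log (a - 2) = x4
    generalize Real.log (a - 1) = x5
    generalize Real.log a = x6
    generalize Real.log 2 = x7
    generalize Real.log (a - 2 * s) = x8
    have n0 : a - s * 2 ≠ 0 := by rw [mul_comm]; exact p0.ne'
    have n1 := p1.ne'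
    have n2 := p2.ne'
    have n3 := p3.ne'
    field_simp
    ring

/-- The integration runs down from `b = 1`, where the limit value is 0, and not up from a
neighbouring region. -/
lemma limitValue_of_two_lt {a b : ℝ} (hb : 0 < b) (hb1 : b < 1) (ha : 2 < a)
    (h0 : limitValue a 1 = 0) : limitValue a b = formulaF a b := by
  have h := limitValue_sub_eq_of_hasDerivAt (a := a) (p := b) (q := 1)
    (F := fun s => formulaF a s) (κ := fun s => marginalF a s) hb.le hb1.le (by linarith)
    (fun s hs => marginal_of_two_le (by linarith [hs.1]) hs.2 ha.le)
    (continuousOn_formulaF ha hb)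
    fun s hs => hasDerivAt_formulaF ha (by linarith [hs.1]) hs.2
  rw [h0, formulaF_one ha] at h
  linarith

end GapDistribution

/-! ### Region G. -/

namespace GapDistribution

open MeasureTheory

lemma mul_bothLE_eq_zero {a b u v w : ℝ} (h : a ≤ u → b ≤ v → w = 0) : w * bothLE a b u v = 0 := by
  unfold bothLE
  split_ifs with i
  · rw [h i.1 i.2, zero_mul]
  · rw [mul_zero]

/-- If `A = t / y ≥ 2` then `y < 1 / 2`, which annihilates `freqSame x` and `freqSum x y`. In the
last case a positive `freqSum x y` needs `x < y`; with `t ≥ y` and `A + B ≥ 2` one gets `2 x y ≤ t x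
+ (1 - t) y ≤ y (1 - y + x)`, hence `x + y ≤ 1`. -/
lemma freqSum_mul_bothLE_eq_zero {a b x y t : ℝ} (hb : 1 ≤ b) (ha : 2 ≤ a) (hx : 0 < x)
    (hy : 0 < y) (hxy : 1 < x + y) (ht1 : t < 1) :
    freqSame x * bothLE a b (t / y) (t / y) = 0 ∧
      freqSum x y * bothLE a b (t / y) (t / y + (1 - t) / x) = 0 ∧
      freqSum x y * bothLE a b (t / y + (1 - t) / x) (t / y) = 0 := by
  have hA : a ≤ t / y → y < 1 / 2 := fun h => by
    have := (le_div_iff₀ hy).1 (ha.trans h)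
    linarith
  refine ⟨mul_bothLE_eq_zero fun h _ => max_eq_left (by linarith [hA h]),
    mul_bothLE_eq_zero fun h _ => max_eq_left ?_, mul_bothLE_eq_zero fun h h' => max_eq_left ?_⟩
  · linarith [hA h, le_max_left x (1 - x), le_max_right x (1 - x)]
  · by_contra hc
    have h1 : x < y := by linarith [le_max_left x (1 - x)]
    have h2 := (le_div_iff₀ hy).1 (hb.trans h')
    have h3 := ha.trans h
    rw [div_add_div _ _ hy.ne' hx.ne', le_div_iff₀ (by positivity)] at h3
    nlinarith [mul_nonneg (sub_nonneg.2 h2) (sub_pos.2 h1).le, mul_pos hy (sub_pos.2 hxy)]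

/-- For mixed pairs, `A ≥ 2` and `B ≥ 1` would give `2 y + x ≤ 1`, and similarly with the roles
exchanged. For two sums, `A + B ≤ 1 / min x y` forces `min x y ≤ 1 / 2`, where `freqSumSum`
vanishes. -/
lemma pairFreq_eq_zero {a b x y t : ℝ} (hb : 1 ≤ b) (ha : 2 ≤ a) (hx : 0 < x) (hy : 0 < y)
    (hxy : 1 < x + y) (ht0 : 0 < t) (ht1 : t < 1) :
    pairFreq a b x y (t / y) ((1 - t) / x) = 0 := by
  obtain ⟨h1, h2, h3⟩ := freqSum_mul_bothLE_eq_zero hb ha hx hy hxy ht1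
  obtain ⟨k1, k2, k3⟩ := freqSum_mul_bothLE_eq_zero (t := 1 - t) hb ha hy hx
    (by linarith) (by linarith)
  rw [sub_sub_cancel, add_comm] at k2 k3
  have m1 : freqMixed x y * bothLE a b (t / y) ((1 - t) / x) = 0 :=
    mul_bothLE_eq_zero fun h h' => by
      have := (le_div_iff₀ hy).1 (ha.trans h)
      have := (le_div_iff₀ hx).1 (hb.trans h')
      linarith
  have m2 : freqMixed x y * bothLE a b ((1 - t) / x) (t / y) = 0 :=
    mul_bothLE_eq_zero fun h h' => by
      have := (le_div_iff₀ hx).1 (ha.trans h)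
      have := (le_div_iff₀ hy).1 (hb.trans h')
      linarith
  have s : freqSumSum x y * bothLE a b (t / y + (1 - t) / x) (t / y + (1 - t) / x) = 0 :=
    mul_bothLE_eq_zero fun h _ => max_eq_left <| by
      have h3 := ha.trans h
      rw [div_add_div _ _ hy.ne' hx.ne', le_div_iff₀ (by positivity)] at h3
      rcases le_total x y with i | i
      · rw [min_eq_left i]
        by_contra hc
        nlinarith [mul_nonneg ht0.le (sub_nonneg.2 i)]
      · rw [min_eq_right i]
        by_contra hc
        nlinarith [mul_nonneg (sub_pos.2 ht1).le (sub_nonneg.2 i)]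
  simp only [pairFreq, mul_add, h1, h2, h3, k1, k2, k3, m1, m2, s, add_zero]

lemma limitValue_eq_zero {a b : ℝ} (hb : 1 ≤ b) (ha : 2 ≤ a) : limitValue a b = 0 := by
  have : limitIntegral a b = 0 := by
    rw [limitIntegral_eq, ← lintegral_zero]
    refine setLIntegral_congr_fun measurableSet_fareyTriangle fun z hz => ?_
    rw [← lintegral_zero]
    refine setLIntegral_congr_fun measurableSet_Ioo fun t ht => ?_
    obtain ⟨⟨⟨hx0, hx1⟩, hy0, hy1⟩, hxy⟩ := hz
    rw [pairFreq_eq_zero hb ha hx0 hy0 hxy ht.1 ht.2, zero_div, ENNReal.ofReal_zero]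
  rw [limitValue, this, ENNReal.toReal_zero]

end GapDistribution

/-! ### Assembly of the regions. -/

theorem theorem3 :
    ∃ g₂ : ℝ → ℝ → ℝ,
      -- `g₂` is the limiting joint distribution of two consecutive gaps, on every interval
      (∀ l₁ l₂ : ℝ, 0 ≤ l₁ → 0 ≤ l₂ → ∀ β η : ℝ, 0 < η →
        Tendsto (fun Q : ℕ => GapDistribution.pairAverage β η l₁ l₂ Q) atTop (𝓝 (g₂ l₁ l₂))) ∧
      -- symmetry
      (∀ l₁ l₂ : ℝ, 0 ≤ l₁ → 0 ≤ l₂ → g₂ l₁ l₂ = g₂ l₂ l₁) ∧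
      -- region `A`
      (∀ l₁ l₂ : ℝ, 0 ≤ l₂ → l₂ ≤ l₁ → l₁ + l₂ ≤ 1 →
        Real.pi ^ 2 / 6 * g₂ l₁ l₂ = GapDistribution.formulaA l₁ l₂) ∧
      -- region `B`
      (∀ l₁ l₂ : ℝ, l₂ ≤ l₁ → 1 ≤ l₁ + l₂ → l₁ < 1 →
        Real.pi ^ 2 / 6 * g₂ l₁ l₂ = GapDistribution.formulaB l₁ l₂) ∧
      -- region `C`
      (∀ l₁ l₂ : ℝ, 0 < l₂ → 1 < l₁ → l₁ + l₂ ≤ 2 →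
        Real.pi ^ 2 / 6 * g₂ l₁ l₂ = GapDistribution.formulaC l₁ l₂) ∧
      -- region `D`
      (∀ l₁ l₂ : ℝ, l₁ < 2 → l₂ < 1 → 2 ≤ l₁ + l₂ →
        Real.pi ^ 2 / 6 * g₂ l₁ l₂ = GapDistribution.formulaD l₁ l₂) ∧
      -- region `E`
      (∀ l₁ l₂ : ℝ, 1 < l₂ → l₂ ≤ l₁ → l₁ < 2 →
        Real.pi ^ 2 / 6 * g₂ l₁ l₂ = GapDistribution.formulaE l₁ l₂) ∧
      -- region `F`
      (∀ l₁ l₂ : ℝ, 0 < l₂ → l₂ < 1 → 2 < l₁ →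
        Real.pi ^ 2 / 6 * g₂ l₁ l₂ = GapDistribution.formulaF l₁ l₂) ∧
      -- region `G`
      (∀ l₁ l₂ : ℝ, 1 ≤ l₂ → l₂ ≤ l₁ → 2 ≤ l₁ →
        Real.pi ^ 2 / 6 * g₂ l₁ l₂ = 0) ∧
      -- the piecewise linear part
      (∀ l₁ l₂ : ℝ, 0 ≤ l₁ → 0 ≤ l₂ → l₁ + l₂ < 1 →
        g₂ l₁ l₂ = 1 - 6 / Real.pi ^ 2 * max l₁ l₂ - 3 / Real.pi ^ 2 * min l₁ l₂) := by
  have e : ∀ x : ℝ, Real.pi ^ 2 / 6 * (6 / Real.pi ^ 2 * x) = x := fun x => by field_simp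
  have symm : ∀ a b : ℝ, GapDistribution.limitValue a b = GapDistribution.limitValue b a :=
    fun a b => by
      rw [GapDistribution.limitValue, GapDistribution.limitIntegral_comm,
        GapDistribution.limitValue]
  have linear : ∀ a b : ℝ, 0 ≤ b → b ≤ a → a + b < 1 →
      6 / Real.pi ^ 2 * GapDistribution.limitValue a b
        = 1 - 6 / Real.pi ^ 2 * a - 3 / Real.pi ^ 2 * b := fun a b hb hba hab => by
    rw [GapDistribution.limitValue_of_add_le_one hb hba hab.le, GapDistribution.formulaA]
    field_simp
    ring
  refine ⟨fun a b => 6 / Real.pi ^ 2 * GapDistribution.limitValue a b,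
    fun a b _ _ β η hη => GapDistribution.tendsto_pairAverage a b β hη,
    fun a b _ _ => congrArg (6 / Real.pi ^ 2 * ·) (symm a b), fun a b hb hba hab => ?_, fun a b hba hab ha => ?_,
    fun a b hb ha hab => ?_, fun a b ha hb hab => ?_, fun a b hb hba ha => ?_,
    fun a b hb hb1 ha => ?_, fun a b hb _ ha => ?_, fun a b ha hb hab => ?_⟩
  · rw [e, GapDistribution.limitValue_of_add_le_one hb hba hab]
  · rw [e, GapDistribution.limitValue_of_lt_one hba hab ha]
  · rw [e, GapDistribution.limitValue_of_add_le_two hb ha hab]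
  · rw [e, GapDistribution.limitValue_of_two_le_add (by linarith) ha hab hb.le]
  · rw [e, GapDistribution.limitValue_of_one_lt hb hba ha]
  · rw [e, GapDistribution.limitValue_of_two_lt hb hb1 ha
      (GapDistribution.limitValue_eq_zero le_rfl ha.le)]
  · rw [e, GapDistribution.limitValue_eq_zero hb ha]
  · rcases le_total b a with h | h
    · rw [max_eq_left h, min_eq_right h]
      exact linear a b hb h hab
    · rw [max_eq_right h, min_eq_left h]
      exact (congrArg (6 / Real.pi ^ 2 * ·) (symm a b)).trans (linear b a ha h (by linarith))
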